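/- Identify $\mathbb{R}^2$ with $\mathbb{C}$, write $w=w_1+iw_2$, $w^*=w_1-iw_2$, $w^\perp=iw$, and let $\cdot$ be the Euclidean scalar product. Let $\ell,\delta,T>0$ and $\mathbb{T}=\mathbb{R}/\ell\mathbb{Z}\cong[-\ell/2,\ell/2]$. Let $c\in C^{1,\delta}(\mathbb{T})$ with $c\ge 0$, and $z\in C^1([0,T];C^{1,\delta}(\mathbb{T};\mathbb{R}^2))$ such that $z^\circ:=z|_{t=0}\in C^{2,\delta}(\mathbb{T};\mathbb{R}^2)$ is clockwise oriented and parametrized by arc length. Put $\tau=\partial_\alpha z^\circ$ and, for $\lambda\in[-1,1]$, $$z_\lambda(t,\alpha)=z(t,\alpha)-\lambda\, t\,c(\alpha)\,\tau(\alpha)^\perp,\qquad z_\pm=z_{\pm1}.$$ Assume the equi-angle and equi-chord-arc conditions $$\inf_{\alpha\in\mathbb{T},\,\lambda\in[-1,1],\,t\in[0,T]}\frac{\partial_\alpha z_\lambda(t,\alpha)}{|\partial_\alpha z_\lambda(t,\alpha)|}\cdot\tau(\alpha)>0,\qquad \sup_{\alpha,\beta\in[-\ell/2,\ell/2],\,\lambda,\mu\in[-1,1],\,t\in[0,T]}\frac{\sqrt{\beta^2+((\lambda-\mu)tc(\alpha))^2}}{|z_\lambda(t,\alpha)-z_\mu(t,\alpha-\beta)|}<\infty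 .$$ Let $\Omega_+(t)$ be the interior domain of $z_+(t)$, $\Omega_-(t)$ the exterior domain of $z_-(t)$, and $\Omega_{\mathrm{mix}}(t)=\{z_\lambda(t,\alpha): tc(\alpha)>0,\ \lambda\in(-1,1)\}$ (empty for $t=0$). Let $\gamma$ be an $\mathbb{R}^2$-valued function that is continuous on $\{(t,x):0\le t\le T,\ x\in\Omega_{\mathrm{mix}}(t)\}$ and such that, for every $0<t\le T$, $\gamma(t)\in C^1(\Omega_{\mathrm{mix}}(t))$ and the limits $\gamma_a(t,\alpha)=\lim_{\Omega_{\mathrm{mix}}(t)\ni x\to z_a(t,\alpha)}\gamma(t,x)$, $a=\pm$, exist and are continuous in $\alpha$ on $\{c(\alpha)>0\}$. Define $$\bar\rho(t)=1_{\Omega_+(t)}-1_{\Omega_-(t)},\qquad \bar v(t,x)^*=-\frac1{2\pi i}\sum_{b=\pm}\int_{\mathbb{T}}\frac{(\partial_\alpha z_b(t,\beta))_2}{x-z_b(t,\beta)}\,d\beta,\qquad \bar m=\bar\rho\bar v-(1-\bar\rho^2)\left(\gamma+\tfrac i2\right),$$ $$B_{a,b}(t,\alpha)=\frac1{2\pi}\int_{\mathbb{T}}\left(\frac1{z_a(t,\alpha)-z_b(t,\beta)}\right)_1\left(\partial_\alpha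 z_a(t,\alpha)-\partial_\alpha z_b(t,\beta)\right)d\beta,\qquad B_a=\sum_{b=\pm}B_{a,b},\qquad B=\tfrac12\sum_{a=\pm}B_a .$$ The triplet $(\bar\rho,\bar v,\bar m)$ is called a subsolution to IPM on $[0,T]$ (with zones $\Omega_\pm,\Omega_{\mathrm{mix}}$), starting from $\rho^\circ$, where $\rho^\circ=1$ inside $z^\circ$ and $\rho^\circ=-1$ outside $z^\circ$, if: $(\bar\rho,\bar v,\bar m)\in C([0,T];L^\infty_{w^*}(\mathbb{R}^2;[-1,1]\times\mathbb{R}^2\times\mathbb{R}^2))$; for every $\phi\in C^1_c(\mathbb{R}^3)$ and $0<t\le T$, $$\int_0^t\!\!\int_{\mathbb{R}^2}(\bar\rho\,\partial_t\phi+\bar m\cdot\nabla\phi)\,dx\,ds=\int_{\mathbb{R}^2}\bar\rho(t)\phi(t)\,dx-\int_{\mathbb{R}^2}\rho^\circ\phi(0)\,dx,$$ $$\int_0^t\!\!\int_{\mathbb{R}^2}\bar v\cdot\nabla\phi\,dx\,ds=0,\qquad \int_0^t\!\!\int_{\mathbb{R}^2}(\bar v+\bar\rho\, i)\cdot\nabla^\perp\phi\,dx\,ds=0;$$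 for every $0<t\le T$ the sets $\Omega_+(t),\Omega_-(t),\Omega_{\mathrm{mix}}(t)$ are open, pairwise disjoint and cover $\mathbb{R}^2$ up to a null set, with $\bar\rho=\pm1$ and $\bar m=\bar\rho\bar v$ on $\Omega_\pm(t)$ and $|2(\bar m-\bar\rho\bar v)+(1-\bar\rho^2)i|<1-\bar\rho^2$ on $\Omega_{\mathrm{mix}}(t)$; and $\sup_{0\le t\le T}\|\bar v(t)\|_{L^\infty}<\infty$. Then $(\bar\rho,\bar v,\bar m)$ is a subsolution to IPM if and only if both of the following hold. 1. For all $(t,\alpha)\in[0,T]\times\mathbb{T}$, $$(\partial_tz-B)\cdot\partial_\alpha z^\perp=0\ \text{ where } tc(\alpha)=0,\qquad \left(\partial_tz_a-B_a-a\left(\gamma_a+\tfrac i2\right)\right)\cdot\partial_\alpha z_a^\perp=0\ \text{ where } tc(\alpha)>0,\ a=\pm .$$ 2. For every $0<t\le T$, $\nabla\cdot\gamma(t)=0$ and $|\gamma(t)|<\tfrac12$ on $\Omega_{\mathrm{mix}}(t)$. -/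

import Mathlib

open Set Filter Topology MeasureTheory
open scoped NNReal ENNReal

noncomputable section

namespace IPM

/-! The plane is identified with `ℂ`: `w ^ ⊥ = I * w`, and `inner ℝ v w` is the Euclidean
scalar product `v.re * w.re + v.im * w.im`. The circle of length `ℓ` is represented by
`ℓ`-periodic functions on `ℝ`, with fundamental domain `[-ℓ/2, ℓ/2]`. -/

/-! ### Hölder spaces on the circle -/

section Holder

variable {E : Type} [NormedAddCommGroup E] [NormedSpace ℝ E]

/-- `f ∈ C^{1,δ}` on the circle of length `ℓ`. -/
def MemC1Holder (ℓ : ℝ) (δ : ℝ≥0) (f : ℝ → E) : Prop :=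
  Function.Periodic f ℓ ∧ ContDiff ℝ 1 f ∧ MemHolder δ (deriv f)

/-- `f ∈ C^{2,δ}` on the circle of length `ℓ`. -/
def MemC2Holder (ℓ : ℝ) (δ : ℝ≥0) (f : ℝ → E) : Prop :=
  Function.Periodic f ℓ ∧ ContDiff ℝ 2 f ∧ MemHolder δ (deriv (deriv f))

/-- The `C^{1,δ}` norm `max (sup |f|, sup |f'|) + |f'|_{C^δ}` of a `C^1` function. -/
def c1HolderNorm (δ : ℝ≥0) (f : ℝ → E) : ℝ≥0∞ :=
  max (⨆ α, ‖f α‖ₑ) (⨆ α, ‖deriv f α‖ₑ) + eHolderNorm δ (deriv f)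

/-- The time derivative on `[0,T]` (one-sided at the end points). -/
def timeDeriv (T : ℝ) (z : ℝ → ℝ → E) (t α : ℝ) : E :=
  derivWithin (fun s => z s α) (Icc 0 T) t

/-- `z ∈ C^1([0,T]; C^{1,δ})`: the difference quotients in time converge to the time derivative
in the norm of `C^{1,δ}`, and the time derivative is continuous with values in `C^{1,δ}`. -/
structure C1InTime (ℓ : ℝ) (δ : ℝ≥0) (T : ℝ) (z : ℝ → ℝ → E) : Prop where
  mem : ∀ t ∈ Icc 0 T, MemC1Holder ℓ δ (z t)
  mem_deriv : ∀ t ∈ Icc 0 T, MemC1Holder ℓ δ (timeDeriv T z t)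
  differentiable : ∀ t ∈ Icc 0 T,
    Tendsto (fun s => c1HolderNorm δ
      (fun α => (s - t)⁻¹ • (z s α - z t α) - timeDeriv T z t α))
      (𝓝[Icc 0 T \ {t}] t) (𝓝 0)
  continuous_deriv : ∀ t ∈ Icc 0 T,
    Tendsto (fun s => c1HolderNorm δ (fun α => timeDeriv T z s α - timeDeriv T z t α))
      (𝓝[Icc 0 T] t) (𝓝 0)

end Holder

/-! ### Closed curves -/

/-- The interior domain of a closed curve with image `Γ`: the points off `Γ` lying in a bounded
connected component of the complement. -/
def interiorDomain (Γ : Set ℂ) : Set ℂ :=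
  {x | x ∉ Γ ∧ Bornology.IsBounded (connectedComponentIn Γᶜ x)}

/-- The exterior domain of a closed curve with image `Γ`: the points off `Γ` lying in an
unbounded connected component of the complement. -/
def exteriorDomain (Γ : Set ℂ) : Set ℂ :=
  {x | x ∉ Γ ∧ ¬ Bornology.IsBounded (connectedComponentIn Γᶜ x)}

/-- The (counterclockwise) winding number of the `ℓ`-periodic curve `w` around `x`. -/
def windingNumber (ℓ : ℝ) (w : ℝ → ℂ) (x : ℂ) : ℂ :=
  (2 * Real.pi * Complex.I)⁻¹ * ∫ β in (-(ℓ / 2))..(ℓ / 2), deriv w β / (w β - x)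

/-- The closed curve `w` is clockwise oriented. -/
def Clockwise (ℓ : ℝ) (w : ℝ → ℂ) : Prop :=
  ∀ x ∈ interiorDomain (range w), windingNumber ℓ w x = -1

/-! ### The mixing zone

`c` is the growth rate, `z t α` the pseudo-interface, `z 0` the initial interface, which is
parametrized by arc length, so that its unit tangent is `deriv (z 0)`. The signs `±` are the real
numbers `1` and `-1`. -/

/-- `z_λ(t,α) = z(t,α) - λ t c(α) τ(α)^⊥` with `τ = ∂_α z(0,·)`. -/
def zLam (c : ℝ → ℝ) (z : ℝ → ℝ → ℂ) (lam t α : ℝ) : ℂ :=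
  z t α - ((lam * t * c α : ℝ) : ℂ) * (Complex.I * deriv (z 0) α)

/-- `Ω_+(t)`, the interior domain of `z_+(t)`. -/
def OmegaPlus (c : ℝ → ℝ) (z : ℝ → ℝ → ℂ) (t : ℝ) : Set ℂ :=
  interiorDomain (range (zLam c z 1 t))

/-- `Ω_-(t)`, the exterior domain of `z_-(t)`. -/
def OmegaMinus (c : ℝ → ℝ) (z : ℝ → ℝ → ℂ) (t : ℝ) : Set ℂ :=
  exteriorDomain (range (zLam c z (-1) t))

/-- `Ω_mix(t)`; it is empty at `t = 0`. -/
def OmegaMix (c : ℝ → ℝ) (z : ℝ → ℝ → ℂ) (t : ℝ) : Set ℂ :=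
  {x | ∃ α lam : ℝ, 0 < t * c α ∧ lam ∈ Ioo (-1 : ℝ) 1 ∧ x = zLam c z lam t α}

/-- The angle between the curves `z_λ` and `τ` is controlled uniformly:
`inf (∂_α z_λ / |∂_α z_λ|) · τ > 0`. -/
def EquiAngle (T : ℝ) (c : ℝ → ℝ) (z : ℝ → ℝ → ℂ) : Prop :=
  ∃ A : ℝ, 0 < A ∧ ∀ t ∈ Icc 0 T, ∀ lam ∈ Icc (-1 : ℝ) 1, ∀ α : ℝ,
    A ≤ inner ℝ ((‖deriv (zLam c z lam t) α‖⁻¹ : ℝ) • deriv (zLam c z lam t) α)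
      (deriv (z 0) α)

/-- The uniform chord-arc condition
`sup √(β² + ((λ-μ) t c(α))²) / |z_λ(t,α) - z_μ(t,α-β)| < ∞`, where a vanishing denominator is
allowed only together with a vanishing numerator. -/
def EquiChordArc (ℓ T : ℝ) (c : ℝ → ℝ) (z : ℝ → ℝ → ℂ) : Prop :=
  ∃ C : ℝ, ∀ t ∈ Icc 0 T, ∀ lam ∈ Icc (-1 : ℝ) 1, ∀ mu ∈ Icc (-1 : ℝ) 1,
    ∀ α : ℝ, ∀ β ∈ Icc (-(ℓ / 2)) (ℓ / 2),
      √(β ^ 2 + ((lam - mu) * t * c α) ^ 2) ≤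
        C * ‖zLam c z lam t α - zLam c z mu t (α - β)‖

/-- The standing assumptions on the growth rate and the pseudo-interface. -/
structure Admissible (ℓ : ℝ) (δ : ℝ≥0) (T : ℝ) (c : ℝ → ℝ) (z : ℝ → ℝ → ℂ) : Prop where
  c_mem : MemC1Holder ℓ δ c
  c_nonneg : ∀ α, 0 ≤ c α
  z_mem : C1InTime ℓ δ T z
  z_init_mem : MemC2Holder ℓ δ (z 0)
  z_init_arclength : ∀ α, ‖deriv (z 0) α‖ = 1
  z_init_clockwise : Clockwise ℓ (z 0)
  angle : EquiAngle T c z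
  chordArc : EquiChordArc ℓ T c z

/-! ### The Muskat-type operators -/

/-- `B_{a,b}`, for the density jump `ρ_+ - ρ_- = 2`. -/
def Bab (ℓ : ℝ) (c : ℝ → ℝ) (z : ℝ → ℝ → ℂ) (a b t α : ℝ) : ℂ :=
  (2 * Real.pi)⁻¹ • ∫ β in (-(ℓ / 2))..(ℓ / 2),
    ((1 / (zLam c z a t α - zLam c z b t β)).re : ℝ) •
      (deriv (zLam c z a t) α - deriv (zLam c z b t) β)

/-- `B_a = ∑_{b = ±} B_{a,b}`. -/
def Ba (ℓ : ℝ) (c : ℝ → ℝ) (z : ℝ → ℝ → ℂ) (a t α : ℝ) : ℂ :=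
  Bab ℓ c z a 1 t α + Bab ℓ c z a (-1) t α

/-- `B = (B_+ + B_-) / 2`. -/
def B (ℓ : ℝ) (c : ℝ → ℝ) (z : ℝ → ℝ → ℂ) (t α : ℝ) : ℂ :=
  (2 : ℝ)⁻¹ • (Ba ℓ c z 1 t α + Ba ℓ c z (-1) t α)

/-! ### The triplet -/

/-- The initial density: `1` inside the initial interface and `-1` outside. -/
def rhoInit (w : ℝ → ℂ) (x : ℂ) : ℝ :=
  (interiorDomain (range w)).indicator 1 x - (exteriorDomain (range w)).indicator 1 x

/-- The density `1_{Ω_+(t)} - 1_{Ω_-(t)}`. -/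
def rhoBar (c : ℝ → ℝ) (z : ℝ → ℝ → ℂ) (t : ℝ) (x : ℂ) : ℝ :=
  (OmegaPlus c z t).indicator 1 x - (OmegaMinus c z t).indicator 1 x

/-- The velocity given by the Biot-Savart law
`v^* = -(1/2πi) ∑_{b=±} ∫ (∂_α z_b(t,β))_2 / (x - z_b(t,β)) dβ`
(its values on the two curves, a null set, play no role). -/
def vBar (ℓ : ℝ) (c : ℝ → ℝ) (z : ℝ → ℝ → ℂ) (t : ℝ) (x : ℂ) : ℂ :=
  (starRingEnd ℂ) (-(2 * Real.pi * Complex.I)⁻¹ *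
    ((∫ β in (-(ℓ / 2))..(ℓ / 2),
        ((deriv (zLam c z 1 t) β).im : ℂ) / (x - zLam c z 1 t β)) +
      ∫ β in (-(ℓ / 2))..(ℓ / 2),
        ((deriv (zLam c z (-1) t) β).im : ℂ) / (x - zLam c z (-1) t β)))

/-- The relaxed momentum `m = ρ v - (1 - ρ²) (γ + i/2)`. -/
def mBar (ℓ : ℝ) (c : ℝ → ℝ) (z : ℝ → ℝ → ℂ) (γ : ℝ → ℂ → ℂ) (t : ℝ) (x : ℂ) : ℂ :=
  (rhoBar c z t x : ℂ) * vBar ℓ c z t x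
    - ((1 - rhoBar c z t x ^ 2 : ℝ) : ℂ) * (γ t x + Complex.I / 2)

/-- The regularity of `γ`: it is continuous on the space-time mixing zone, and for each
`0 < t ≤ T` it is `C^1` on `Ω_mix(t)` and has continuous boundary values `γb a t` (for
`a = ±1`) on the part of the curve `z_a(t)` where `c > 0`. -/
structure GammaRegular (T : ℝ) (c : ℝ → ℝ) (z : ℝ → ℝ → ℂ) (γ : ℝ → ℂ → ℂ)
    (γb : ℝ → ℝ → ℝ → ℂ) : Prop where
  continuousOn : ContinuousOn (fun p : ℝ × ℂ => γ p.1 p.2)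
    {p : ℝ × ℂ | p.1 ∈ Icc 0 T ∧ p.2 ∈ OmegaMix c z p.1}
  contDiffOn : ∀ t ∈ Ioc 0 T, ContDiffOn ℝ 1 (γ t) (OmegaMix c z t)
  tendsto : ∀ a ∈ ({1, -1} : Set ℝ), ∀ t ∈ Ioc 0 T, ∀ α, 0 < c α →
    Tendsto (γ t) (𝓝[OmegaMix c z t] (zLam c z a t α)) (𝓝 (γb a t α))
  continuousOn_trace : ∀ a ∈ ({1, -1} : Set ℝ), ∀ t ∈ Ioc 0 T,
    ContinuousOn (γb a t) {α | 0 < c α}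

/-- The divergence of a planar vector field. -/
def divergence (f : ℂ → ℂ) (x : ℂ) : ℝ :=
  (fderiv ℝ f x 1).re + (fderiv ℝ f x Complex.I).im

/-! ### Subsolutions -/

/-- The spatial gradient `∇φ = ∂_1 φ + i ∂_2 φ` of a function of `(t,x)`. -/
def spaceGrad (φ : ℝ × ℂ → ℝ) (t : ℝ) (x : ℂ) : ℂ :=
  ⟨fderiv ℝ (fun y => φ (t, y)) x 1, fderiv ℝ (fun y => φ (t, y)) x Complex.I⟩

/-- `f ∈ C([0,T]; L^∞_{w*}(ℝ²; E))`: each `f t` is essentially bounded, and the pairings with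
integrable functions are continuous in time. -/
def WeakStarContinuous {E : Type} [NormedAddCommGroup E] [InnerProductSpace ℝ E]
    (T : ℝ) (f : ℝ → ℂ → E) : Prop :=
  (∀ t ∈ Icc 0 T, MemLp (f t) ∞ (volume : Measure ℂ)) ∧
  ∀ g : ℂ → E, Integrable g (volume : Measure ℂ) →
    ContinuousOn (fun t => ∫ x : ℂ, inner ℝ (f t x) (g x)) (Icc 0 T)

/-- `(ρ, v, m)` is a subsolution to IPM on `[0,T]` with initial density `ρ₀` and zones `Ωp`,
`Ωm` (the non-mixing zones `Ω_+`, `Ω_-`) and `Ωx` (the mixing zone). -/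
structure IsSubsolution (T : ℝ) (ρ₀ : ℂ → ℝ) (ρ : ℝ → ℂ → ℝ) (v m : ℝ → ℂ → ℂ)
    (Ωp Ωm Ωx : ℝ → Set ℂ) : Prop where
  weakStar_rho : WeakStarContinuous T ρ
  weakStar_v : WeakStarContinuous T v
  weakStar_m : WeakStarContinuous T m
  rho_mem : ∀ t ∈ Icc 0 T, ∀ᵐ x ∂(volume : Measure ℂ), ρ t x ∈ Icc (-1 : ℝ) 1
  conservation : ∀ φ : ℝ × ℂ → ℝ, ContDiff ℝ 1 φ → HasCompactSupport φ → ∀ t ∈ Ioc 0 T,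
    (∫ s in (0 : ℝ)..t, ∫ x : ℂ,
        (ρ s x * deriv (fun r => φ (r, x)) s + inner ℝ (m s x) (spaceGrad φ s x)))
      = (∫ x : ℂ, ρ t x * φ (t, x)) - ∫ x : ℂ, ρ₀ x * φ (0, x)
  incompressible : ∀ φ : ℝ × ℂ → ℝ, ContDiff ℝ 1 φ → HasCompactSupport φ → ∀ t ∈ Ioc 0 T,
    (∫ s in (0 : ℝ)..t, ∫ x : ℂ, inner ℝ (v s x) (spaceGrad φ s x)) = 0
  darcy : ∀ φ : ℝ × ℂ → ℝ, ContDiff ℝ 1 φ → HasCompactSupport φ → ∀ t ∈ Ioc 0 T,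
    (∫ s in (0 : ℝ)..t, ∫ x : ℂ,
      inner ℝ (v s x + (ρ s x : ℂ) * Complex.I) (Complex.I * spaceGrad φ s x)) = 0
  isOpen : ∀ t ∈ Ioc 0 T, IsOpen (Ωp t) ∧ IsOpen (Ωm t) ∧ IsOpen (Ωx t)
  disjoint : ∀ t ∈ Ioc 0 T,
    Disjoint (Ωp t) (Ωm t) ∧ Disjoint (Ωp t) (Ωx t) ∧ Disjoint (Ωm t) (Ωx t)
  complementary : ∀ t ∈ Ioc 0 T, volume (Ωp t ∪ Ωm t ∪ Ωx t)ᶜ = 0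
  plus : ∀ t ∈ Ioc 0 T, ∀ x ∈ Ωp t, ρ t x = 1 ∧ m t x = (ρ t x : ℂ) * v t x
  minus : ∀ t ∈ Ioc 0 T, ∀ x ∈ Ωm t, ρ t x = -1 ∧ m t x = (ρ t x : ℂ) * v t x
  hull : ∀ t ∈ Ioc 0 T, ∀ x ∈ Ωx t,
    ‖2 * (m t x - (ρ t x : ℂ) * v t x) + ((1 - ρ t x ^ 2 : ℝ) : ℂ) * Complex.I‖
      < 1 - ρ t x ^ 2
  velocity_bdd : (⨆ t ∈ Icc 0 T, eLpNorm (v t) ∞ (volume : Measure ℂ)) < ∞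

end IPM

end

noncomputable section

namespace IPM

/-! ### Planar calculus -/

/-! Everything is expressed through winding numbers. Since `z_+` and `z_-` are clockwise Jordan
curves, off the curves the density is the linear expression `ρ = -1 - wn(z_+) - wn(z_-)`, and `1 -
ρ² = wn(z_+) - wn(z_-)` is the indicator of the mixing zone (`Admissible.rhoBar_eq_wn`,
`Admissible.wn_plus_sub_minus`, `Admissible.one_sub_rhoBar_sq`). Winding numbers and the velocity
are both Cauchy integrals, so the Cauchy-Pompeiu formula (`integral_grad_mul_cauchy`) turns pairings
with gradients of test functions into line integrals. Incompressibility and Darcy's law come out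
this way for every admissible configuration, so the content of the theorem is the conservation law
and the hull condition. In the mixing zone `ρ = 0` and `2(m - ρv) + i = -2γ`, so the hull condition
is exactly `|γ| < 1/2`.

For a curve `w` and a field `u` along it, let the flux be the integral of `ψ(w) u · (∂_α w)^⊥`. The
mass `∫ ρψ` has as time derivative the sum over `a = ±` of the fluxes of `∂_t z_a`
(`LoopFamily.integral_mul_wn_sub`), and `∫ ρ v · ∇ψ` is the sum of the fluxes of `B_a`
(`integral_wn_mul_inner_loopVel`). The constant field `i/2` of the mixing zone is also a difference
of fluxes. At a fixed time the conservation law therefore says that, for all `ψ`, the fluxes of `B_a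
- ∂_t z_a + a i/2` through the two curves add up to `∫_{Ω_mix} γ · ∇ψ`
(`Admissible.integral_mBar_sub`).

If `γ` is divergence free, that last integral is the flux of the traces `γ_a`
(`IsStrip.integral_inner_grad`), the boundary conditions give the balance at each time, and
integration in time gives the conservation law. Conversely, weak-star continuity of `m` localizes
the conservation law to every single time. Test functions supported in the mixing zone give `∇ · γ =
0`, and test functions concentrated at a point of one curve, away from the other, give the condition
where `tc > 0`. At `t = 0` the mixing zone is empty. Where `c = 0` also `c' = 0`, so the zone has
area `o(r²)` in a disc of radius `r`; against a gradient of size `1/r` it contributes `o(r)`, which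
cannot balance a nonzero normal velocity, whose flux is of order `r`.

The geometric input is that the angle and chord-arc conditions make the mixing zone an injectively
parametrized strip, and that crossing a strip changes the winding number by one
(`IsStrip.wn_sub_wn`). Applied to a thin collar of each curve, this also yields the Jordan property
(`IsStrip.jordan`), and the orientation persists in time by continuity of the signed area. The
analytic input is `Admissible.exists_closePair`: the tangents of the two curves are Hölder close in
terms of the distance of the points, even where the zone pinches, which makes the kernels of `v` and
`B_a` integrable uniformly. -/

/-- The gradient of a real function on the plane, as a complex number. -/
def grad (ψ : ℂ → ℝ) (x : ℂ) : ℂ := ⟨fderiv ℝ ψ x 1, fderiv ℝ ψ x Complex.I⟩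

lemma spaceGrad_eq_grad (φ : ℝ × ℂ → ℝ) (t : ℝ) (x : ℂ) :
    spaceGrad φ t x = grad (fun y => φ (t, y)) x := rfl

lemma inner_eq (v w : ℂ) : inner ℝ v w = v.re * w.re + v.im * w.im := by
  rw [Complex.inner]; simp; ring

lemma clm_apply_eq {E : Type*} [NormedAddCommGroup E] [NormedSpace ℝ E] (L : ℂ →L[ℝ] E) (v : ℂ) :
    L v = v.re • L 1 + v.im • L Complex.I := by
  conv_lhs => rw [show v = v.re • (1 : ℂ) + v.im • Complex.I by
    apply Complex.ext <;> simp]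
  rw [map_add, map_smul, map_smul]

lemma fderiv_eq_inner_grad (ψ : ℂ → ℝ) (x v : ℂ) :
    fderiv ℝ ψ x v = inner ℝ (grad ψ x) v := by
  rw [clm_apply_eq, inner_eq]; simp [grad, mul_comm]

lemma continuous_grad {ψ : ℂ → ℝ} (h : ContDiff ℝ 1 ψ) : Continuous (grad ψ) := by
  have h1 := h.continuous_fderiv one_ne_zero
  have : grad ψ = fun x => (fderiv ℝ ψ x 1 : ℂ) + (fderiv ℝ ψ x Complex.I : ℂ) * Complex.I := by
    funext x; exact (Complex.mk_eq_add_mul_I _ _)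
  rw [this]
  fun_prop

lemma hasCompactSupport_grad {ψ : ℂ → ℝ} (h : HasCompactSupport ψ) :
    HasCompactSupport (grad ψ) := by
  refine (h.fderiv (𝕜 := ℝ)).mono ?_
  refine Function.support_subset_iff'.2 fun x hx => ?_
  have : fderiv ℝ ψ x = 0 := by simpa using hx
  simp [grad, this, Complex.ext_iff]

/-- **Cauchy-Pompeiu formula** for compactly supported functions, at the origin. -/
lemma integral_grad_div_zero {ψ : ℂ → ℝ} (h : ContDiff ℝ 1 ψ) (hc : HasCompactSupport ψ) :
    ∫ x, grad ψ x / x = -2 * Real.pi * ψ 0 := by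
  obtain ⟨R, hR⟩ := hc.isCompact.isBounded.subset_closedBall (0 : ℂ)
  have hψ0 : ∀ x : ℂ, R < ‖x‖ → ψ x = 0 := fun x hx => by
    by_contra hne
    have := hR (subset_tsupport _ hne)
    simp at this; linarith
  have hG0 : ∀ x : ℂ, R < ‖x‖ → grad ψ x = 0 := fun x hx => by
    have : fderiv ℝ ψ x = 0 := by
      by_contra hne
      have := hR (support_fderiv_subset ℝ hne)
      simp at this; linarith
    simp [grad, this, Complex.ext_iff]
  rw [← Complex.integral_comp_polarCoord_symm]
  set e : ℝ → ℂ := fun θ => (Real.cos θ + Real.sin θ * Complex.I) with he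
  have hen : ∀ θ, ‖e θ‖ = 1 := fun θ => by
    have := Complex.norm_exp_ofReal_mul_I θ
    rw [Complex.exp_mul_I] at this; simp [he, this]
  have hecont : Continuous e := by fun_prop
  -- In polar coordinates the Jacobian cancels the pole and leaves `g`. Its real part is the radial
  -- derivative of `ψ`, with integral `-ψ 0` on each ray; its imaginary part is the angular
  -- derivative divided by the radius, with integral zero on each circle.
  set g : ℝ × ℝ → ℂ := fun p => grad ψ (p.1 * e p.2) * (starRingEnd ℂ) (e p.2) with hg
  have hgc : Continuous g := by
    have := continuous_grad h
    have h2 : Continuous fun p : ℝ × ℝ => (p.1 : ℂ) * e p.2 := by fun_prop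
    exact (this.comp h2).mul (Complex.continuous_conj.comp (hecont.comp continuous_snd))
  have hg0 : ∀ p : ℝ × ℝ, R < p.1 → g p = 0 := fun p hp => by
    simp only [hg]; rw [hG0, zero_mul]
    rw [norm_mul, hen, mul_one, Complex.norm_real]; exact hp.trans_le (le_abs_self _)
  have hgi : IntegrableOn g (Ioi (0 : ℝ) ×ˢ Ioo (-Real.pi) Real.pi) := by
    have h1 : IntegrableOn g (Icc (0 : ℝ) R ×ˢ Icc (-Real.pi) Real.pi) :=
      hgc.continuousOn.integrableOn_compact (isCompact_Icc.prod isCompact_Icc)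
    refine h1.of_forall_sdiff_eq_zero (measurableSet_Ioi.prod measurableSet_Ioo) ?_
    rintro p ⟨⟨hp1, hp2⟩, hp3⟩
    apply hg0
    by_contra hle
    exact hp3 ⟨⟨le_of_lt hp1, not_lt.1 hle⟩, Ioo_subset_Icc_self hp2⟩
  have hcongr : ∫ p in polarCoord.target,
      p.1 • (grad ψ (Complex.polarCoord.symm p) / Complex.polarCoord.symm p)
      = ∫ p in Ioi (0 : ℝ) ×ˢ Ioo (-Real.pi) Real.pi, g p := by
    refine setIntegral_congr_fun (measurableSet_Ioi.prod measurableSet_Ioo) fun p hp => ?_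
    have hp1 : (0 : ℝ) < p.1 := hp.1
    have hp1' : (p.1 : ℂ) ≠ 0 := by exact_mod_cast hp1.ne'
    have hee : e p.2 * (starRingEnd ℂ) (e p.2) = 1 := by
      rw [Complex.mul_conj, Complex.normSq_eq_norm_sq, hen]; simp
    have he0 : e p.2 ≠ 0 := fun h0 => by simp [h0] at hee
    have hpc : Complex.polarCoord.symm p = p.1 * e p.2 := by simp [he]
    simp only [hg, hpc, Complex.real_smul]
    field_simp
    linear_combination (-grad ψ (p.1 * e p.2)) * hee
  have hray : ∀ θ r, HasDerivAt (fun r : ℝ => ψ (r * e θ)) (g (r, θ)).re r := fun θ r => by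
    have h1 : HasDerivAt (fun r : ℝ => (r : ℂ) * e θ) (1 * e θ) r :=
      (Complex.ofRealCLM.hasDerivAt (x := r)).mul_const _ |>.congr_deriv (by simp)
    have h2 := ((h.differentiable one_ne_zero) ((r : ℂ) * e θ)).hasFDerivAt.comp_hasDerivAt r h1
    refine h2.congr_deriv ?_
    rw [fderiv_eq_inner_grad, inner_eq]
    simp [hg]
  have hang : ∀ r θ : ℝ, HasDerivAt (fun θ : ℝ => ψ (r * e θ)) (r * (g (r, θ)).im) θ := fun r θ => by
    have h0 : HasDerivAt e (-Real.sin θ + Real.cos θ * Complex.I) θ := by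
      have := ((Real.hasDerivAt_cos θ).ofReal_comp).add
        (((Real.hasDerivAt_sin θ).ofReal_comp).mul_const Complex.I)
      exact this.congr_deriv (by simp)
    have h2 := ((h.differentiable one_ne_zero) ((r : ℂ) * e θ)).hasFDerivAt.comp_hasDerivAt θ
      (h0.const_mul (r : ℂ))
    refine h2.congr_deriv ?_
    rw [fderiv_eq_inner_grad, inner_eq]
    simp [he, hg, -Complex.ofReal_cos, -Complex.ofReal_sin]; ring
  have hradial : ∀ θ, ∫ r in Ioi (0 : ℝ), (g (r, θ)).re = -ψ 0 := fun θ => by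
    have h1 : ContDiff ℝ 1 fun r : ℝ => ψ (r * e θ) :=
      h.comp ((Complex.ofRealCLM.contDiff).mul contDiff_const)
    have h2 : HasCompactSupport fun r : ℝ => ψ (r * e θ) := by
      refine HasCompactSupport.intro (isCompact_Icc (a := -R) (b := R)) fun r hr => hψ0 _ ?_
      rw [norm_mul, hen, mul_one, Complex.norm_real, Real.norm_eq_abs]
      by_contra hle
      exact hr (abs_le.1 (not_lt.1 hle))
    have := h2.integral_Ioi_deriv_eq h1 0
    rw [show deriv (fun r : ℝ => ψ (r * e θ)) = fun r => (g (r, θ)).re from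
      funext fun r => (hray θ r).deriv] at this
    simpa using this
  have hangular : ∀ r, 0 < r → ∫ θ in Ioo (-Real.pi) Real.pi, (g (r, θ)).im = 0 := fun r hr => by
    rw [← integral_Ioc_eq_integral_Ioo, ← intervalIntegral.integral_of_le (by linarith [Real.pi_pos])]
    have := intervalIntegral.integral_eq_sub_of_hasDerivAt (a := -Real.pi) (b := Real.pi)
      (fun θ _ => hang r θ) ((Continuous.intervalIntegrable (by fun_prop) _ _))
    rw [intervalIntegral.integral_const_mul] at this
    simp [he] at this
    exact this.resolve_left hr.ne'
  have hre : (∫ p in Ioi (0 : ℝ) ×ˢ Ioo (-Real.pi) Real.pi, g p).re = -2 * Real.pi * ψ 0 := by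
    have : (∫ p in Ioi (0 : ℝ) ×ˢ Ioo (-Real.pi) Real.pi, g p).re =
        ∫ p in Ioi (0 : ℝ) ×ˢ Ioo (-Real.pi) Real.pi, (g p).re := (integral_re hgi).symm
    rw [this, Measure.volume_eq_prod, ← Measure.prod_restrict, integral_prod_symm]
    · simp only [hradial]
      simp [Real.pi_pos.le]; ring_nf; simp
    · rw [Measure.prod_restrict]; exact hgi.re
  have him : (∫ p in Ioi (0 : ℝ) ×ˢ Ioo (-Real.pi) Real.pi, g p).im = 0 := by
    have : (∫ p in Ioi (0 : ℝ) ×ˢ Ioo (-Real.pi) Real.pi, g p).im =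
        ∫ p in Ioi (0 : ℝ) ×ˢ Ioo (-Real.pi) Real.pi, (g p).im := (integral_im hgi).symm
    rw [this, Measure.volume_eq_prod]
    refine (setIntegral_prod _ hgi.im).trans ?_
    simp only [RCLike.im_eq_complex_im]
    rw [setIntegral_congr_fun measurableSet_Ioi (fun r hr => hangular r hr)]
    simp
  rw [hcongr]
  apply Complex.ext
  · rw [hre]; simp
  · rw [him]; simp

lemma fderiv_comp_add_right' {F : Type*} [NormedAddCommGroup F] [NormedSpace ℝ F]
    (ψ : ℂ → F) (q x : ℂ) : fderiv ℝ (fun y => ψ (y + q)) x = fderiv ℝ ψ (x + q) :=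
  fderiv_comp_add_right q

/-- **Cauchy-Pompeiu formula** for compactly supported functions. -/
lemma integral_grad_div {ψ : ℂ → ℝ} (h : ContDiff ℝ 1 ψ) (hc : HasCompactSupport ψ) (q : ℂ) :
    ∫ x, grad ψ x / (x - q) = -2 * Real.pi * ψ q := by
  have h1 : ContDiff ℝ 1 fun y => ψ (y + q) := h.comp (contDiff_id.add contDiff_const)
  have h2 : HasCompactSupport fun y => ψ (y + q) :=
    hc.comp_homeomorph (Homeomorph.addRight q)
  have := integral_grad_div_zero h1 h2
  rw [← integral_add_right_eq_self _ q]
  simpa [grad, fderiv_comp_add_right'] using this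

/-! ### The Cauchy kernel -/

lemma integrableOn_inv_norm_sub (q : ℂ) (R : ℝ) :
    IntegrableOn (fun x : ℂ => ‖x - q‖⁻¹) (Metric.ball q R) := by
  have h0 : IntegrableOn (fun x : ℂ => ‖x‖⁻¹) (Metric.ball 0 R) := by
    refine integrableOn_ball_of_norm_le_rpow (α := 1) (C := 1) (by simp) (by simp) ?_ ?_
    · refine ae_of_all _ fun x => ?_
      simp [Real.rpow_neg_one]
    · exact (measurable_norm.inv).aestronglyMeasurable
  have := (measurePreserving_sub_right (volume : Measure ℂ) q).integrableOn_comp_preimage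
    (MeasurableEquiv.subRight q).measurableEmbedding (f := fun x : ℂ => ‖x‖⁻¹)
    (s := Metric.ball 0 R)
  have h2 := this.2 h0
  rwa [show (fun x : ℂ => x - q) ⁻¹' Metric.ball 0 R = Metric.ball q R by
    ext x; simp [dist_eq_norm]] at h2

lemma integral_inv_norm_sub_ball (q : ℂ) (R : ℝ) :
    ∫ x in Metric.ball q R, ‖x - q‖⁻¹ = ∫ x in Metric.ball (0 : ℂ) R, ‖x‖⁻¹ := by
  have := (measurePreserving_sub_right (volume : Measure ℂ) q).setIntegral_preimage_emb
    (MeasurableEquiv.subRight q).measurableEmbedding (fun x : ℂ => ‖x‖⁻¹) (Metric.ball 0 R)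
  rw [← this]
  congr 2
  ext x; simp [dist_eq_norm]

/-- For a bounded integrable `g`, the functions `g x / (x - q)` are integrable, uniformly in `q`. -/
lemma exists_integral_mul_inv_norm_le {g : ℂ → ℝ} (hg : Integrable g) {M : ℝ}
    (hM : ∀ x, |g x| ≤ M) :
    ∃ C, ∀ q : ℂ, Integrable (fun x => g x * ‖x - q‖⁻¹) ∧ ∫ x, |g x| * ‖x - q‖⁻¹ ≤ C := by
  set K := ∫ x in Metric.ball (0 : ℂ) 1, ‖x‖⁻¹
  have key : ∀ q : ℂ, Integrable (fun x => (Metric.ball q 1).indicator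
      (fun x => M * ‖x - q‖⁻¹) x + |g x|) := fun q =>
    ((integrable_indicator_iff Metric.isOpen_ball.measurableSet).2
      ((integrableOn_inv_norm_sub q 1).const_mul M)).add hg.abs
  -- Inside the unit disc around `q` the function is bounded by `M`; outside it the kernel is at
  -- most `1`.
  have hle : ∀ q x : ℂ, |g x| * ‖x - q‖⁻¹ ≤ (Metric.ball q 1).indicator
      (fun x => M * ‖x - q‖⁻¹) x + |g x| := fun q x => by
    by_cases hx : x ∈ Metric.ball q 1
    · rw [indicator_of_mem hx]
      have := mul_le_mul_of_nonneg_right (hM x) (inv_nonneg.2 (norm_nonneg (x - q)))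
      linarith [abs_nonneg (g x)]
    · rw [indicator_of_notMem hx, zero_add]
      have h1 : 1 ≤ ‖x - q‖ := by simpa [dist_eq_norm] using hx
      exact mul_le_of_le_one_right (abs_nonneg _) (inv_le_one_of_one_le₀ h1)
  have hmeas : ∀ q, AEStronglyMeasurable (fun x => g x * ‖x - q‖⁻¹) volume := fun q =>
    hg.1.mul ((measurable_norm.comp (measurable_id.sub_const q)).inv).aestronglyMeasurable
  refine ⟨M * K + ∫ x, |g x|, fun q => ⟨?_, ?_⟩⟩
  · refine (key q).mono' (hmeas q) (ae_of_all _ fun x => ?_)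
    rw [norm_mul, norm_inv, norm_norm]; exact hle q x
  · calc ∫ x, |g x| * ‖x - q‖⁻¹ ≤ ∫ x, ((Metric.ball q 1).indicator
      (fun x => M * ‖x - q‖⁻¹) x + |g x|) :=
        integral_mono_of_nonneg (ae_of_all _ fun x => by positivity) (key q)
          (ae_of_all _ (hle q))
      _ = _ := by
        rw [integral_add _ hg.abs, integral_indicator Metric.isOpen_ball.measurableSet,
          integral_const_mul, integral_inv_norm_sub_ball]
        exact (integrable_indicator_iff Metric.isOpen_ball.measurableSet).2
          ((integrableOn_inv_norm_sub q 1).const_mul M)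

/-! ### Loops and Cauchy integrals -/

/-- A `C^1` closed curve parametrized by the circle of length `ℓ`. -/
structure IsLoop (ℓ : ℝ) (w : ℝ → ℂ) : Prop where
  periodic : Function.Periodic w ℓ
  contDiff : ContDiff ℝ 1 w

lemma IsLoop.continuous {ℓ : ℝ} {w : ℝ → ℂ} (h : IsLoop ℓ w) : Continuous w :=
  h.contDiff.continuous

lemma IsLoop.continuous_deriv {ℓ : ℝ} {w : ℝ → ℂ} (h : IsLoop ℓ w) : Continuous (deriv w) :=
  h.contDiff.continuous_deriv le_rfl

lemma IsLoop.hasDerivAt {ℓ : ℝ} {w : ℝ → ℂ} (h : IsLoop ℓ w) (α : ℝ) :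
    HasDerivAt w (deriv w α) α :=
  (h.contDiff.differentiable one_ne_zero α).hasDerivAt

lemma periodic_deriv {E : Type*} [NormedAddCommGroup E] [NormedSpace ℝ E] {ℓ : ℝ} {w : ℝ → E}
    (h : Function.Periodic w ℓ) : Function.Periodic (deriv w) ℓ := fun α => by
  rw [← deriv_comp_add_const, h.funext]

lemma IsLoop.isCompact_range {ℓ : ℝ} {w : ℝ → ℂ} (h : IsLoop ℓ w) (hℓ : 0 < ℓ) :
    IsCompact (range w) :=
  h.periodic.compact_of_continuous hℓ.ne' h.continuous

lemma periodic_endpoint {E : Type*} {ℓ : ℝ} {w : ℝ → E}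
    (h : Function.Periodic w ℓ) : w (ℓ / 2) = w (-(ℓ / 2)) := by
  rw [← h (-(ℓ / 2))]; congr 1; ring

/-- The kernel `f x * (g β / (w β - x))` is jointly integrable. -/
lemma integrable_cauchy_kernel {f : ℂ → ℂ} (hf : Integrable f) {M : ℝ} (hM : ∀ x, ‖f x‖ ≤ M)
    {g w : ℝ → ℂ} (hg : Continuous g) (hw : Continuous w) (a b : ℝ) :
    Integrable (fun p : ℂ × ℝ => f p.1 * (g p.2 / (w p.2 - p.1)))
      (volume.prod (volume.restrict (Ioc a b))) := by
  obtain ⟨C, hC⟩ := exists_integral_mul_inv_norm_le hf.norm (M := M) (by simpa using hM)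
  have hm : AEStronglyMeasurable (fun p : ℂ × ℝ => f p.1 * (g p.2 / (w p.2 - p.1)))
      (volume.prod (volume.restrict (Ioc a b))) := by
    refine hf.1.comp_fst.mul ?_
    have h1 : Measurable fun p : ℂ × ℝ => g p.2 := hg.measurable.comp measurable_snd
    have h2 : Measurable fun p : ℂ × ℝ => w p.2 - p.1 :=
      (hw.measurable.comp measurable_snd).sub measurable_fst
    exact (h1.div h2).aestronglyMeasurable
  have hn : ∀ x β, ‖f x * (g β / (w β - x))‖ = ‖g β‖ * (‖f x‖ * ‖x - w β‖⁻¹) := fun x β => by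
    rw [norm_mul, norm_div, norm_sub_rev, div_eq_mul_inv]; ring
  rw [integrable_prod_iff' hm]
  refine ⟨ae_of_all _ fun β => ?_, ?_⟩
  · have h1 : Measurable fun x : ℂ => g β / (w β - x) :=
      measurable_const.div (measurable_const.sub measurable_id)
    exact (((hC (w β)).1).const_mul ‖g β‖).mono' (hf.1.mul h1.aestronglyMeasurable)
      (ae_of_all _ fun x => (hn x β).le)
  · have hi : Integrable (fun β => ‖g β‖ * C) (volume.restrict (Ioc a b)) :=
      ((hg.norm.mul continuous_const).integrableOn_Icc).mono_set Ioc_subset_Icc_self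
    refine hi.mono' hm.norm.prod_swap.integral_prod_right' (ae_of_all _ fun β => ?_)
    rw [Real.norm_of_nonneg (integral_nonneg fun _ => norm_nonneg _)]
    simp_rw [hn]
    rw [integral_const_mul]
    exact mul_le_mul_of_nonneg_left (by simpa using (hC (w β)).2) (norm_nonneg _)

/-- Fubini's theorem for the Cauchy integral. -/
lemma integral_mul_cauchy {f : ℂ → ℂ} (hf : Integrable f) {M : ℝ} (hM : ∀ x, ‖f x‖ ≤ M)
    {g w : ℝ → ℂ} (hg : Continuous g) (hw : Continuous w) {a b : ℝ} (hab : a ≤ b) :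
    ∫ x, f x * ∫ β in a..b, g β / (w β - x) =
      ∫ β in a..b, g β * ∫ x, f x / (w β - x) := by
  have h := integral_integral_swap (f := fun x β => f x * (g β / (w β - x)))
    (integrable_cauchy_kernel hf hM hg hw a b)
  simp only [intervalIntegral.integral_of_le hab]
  simp_rw [← integral_const_mul]
  rw [h]
  refine integral_congr_ae (ae_of_all _ fun β => ?_)
  simp only
  congr 1; ext x; ring

lemma integrable_mul_cauchy {f : ℂ → ℂ} (hf : Integrable f) {M : ℝ} (hM : ∀ x, ‖f x‖ ≤ M)
    {g w : ℝ → ℂ} (hg : Continuous g) (hw : Continuous w) {a b : ℝ} (hab : a ≤ b) :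
    Integrable fun x => f x * ∫ β in a..b, g β / (w β - x) := by
  have h := (integrable_cauchy_kernel hf hM hg hw a b).integral_prod_left
  simp only [intervalIntegral.integral_of_le hab]
  simp_rw [← integral_const_mul]
  exact h

lemma integrable_of_contDiff {E : Type*} [NormedAddCommGroup E] {f : ℂ → E} (h : Continuous f)
    (hc : HasCompactSupport f) :
    Integrable f ∧ ∃ M, ∀ x, ‖f x‖ ≤ M :=
  ⟨h.integrable_of_hasCompactSupport hc, h.bounded_above_of_compact_support hc⟩

/-- Fubini puts the planar integral inside, where the Cauchy-Pompeiu formula evaluates it at each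
point of the curve. It is used with `g = w'` for winding numbers and with `g = Im w'` for the
velocity. -/
lemma integral_grad_mul_cauchy {ψ : ℂ → ℝ} (h : ContDiff ℝ 1 ψ) (hc : HasCompactSupport ψ)
    {g w : ℝ → ℂ} (hg : Continuous g) (hw : Continuous w) {a b : ℝ} (hab : a ≤ b) :
    ∫ x, grad ψ x * ∫ β in a..b, g β / (w β - x) =
      2 * Real.pi * ∫ β in a..b, g β * ψ (w β) := by
  obtain ⟨h1, M, hM⟩ := integrable_of_contDiff (continuous_grad h) (hasCompactSupport_grad hc)
  rw [integral_mul_cauchy h1 hM hg hw hab, ← intervalIntegral.integral_const_mul]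
  refine intervalIntegral.integral_congr fun β _ => ?_
  have : ∫ x, grad ψ x / (w β - x) = 2 * Real.pi * ψ (w β) := by
    rw [show (fun x => grad ψ x / (w β - x)) = fun x => -(grad ψ x / (x - w β)) by
      funext x; rw [← div_neg, neg_sub], integral_neg, integral_grad_div h hc]
    ring
  simp only [this]; ring

/-! ### Winding numbers -/

/-- The real part of the winding number; it is the winding number off the curve. -/
def wn (ℓ : ℝ) (w : ℝ → ℂ) (x : ℂ) : ℝ := (windingNumber ℓ w x).re

section Winding

variable {ℓ : ℝ} {w : ℝ → ℂ}

lemma continuous_div_of_notMem (g : ℝ → ℂ) (hg : Continuous g) (hw : Continuous w) {x : ℂ}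
    (hx : x ∉ range w) : Continuous fun β => g β / (w β - x) :=
  hg.div (hw.sub continuous_const) fun β h => hx ⟨β, by linear_combination h⟩

/-- The real part of `w' / (w - x)` is the derivative of `log |w - x|`, which is periodic. Only this
reality is needed; integrality is never used. -/
lemma windingNumber_eq_ofReal (h : IsLoop ℓ w) {x : ℂ} (hx : x ∉ range w) :
    windingNumber ℓ w x = wn ℓ w x := by
  have hne : ∀ β, w β - x ≠ 0 := fun β h => hx ⟨β, by linear_combination h⟩
  have hcont := continuous_div_of_notMem _ h.continuous_deriv h.continuous hx
  have key : (∫ β in (-(ℓ / 2))..(ℓ / 2), deriv w β / (w β - x)).re = 0 := by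
    have h1 : (∫ β in (-(ℓ / 2))..(ℓ / 2), deriv w β / (w β - x)).re =
        ∫ β in (-(ℓ / 2))..(ℓ / 2), (deriv w β / (w β - x)).re :=
      (Complex.reCLM.intervalIntegral_comp_comm (hcont.intervalIntegrable _ _)).symm
    rw [h1, intervalIntegral.integral_eq_sub_of_hasDerivAt
      (f := fun β => Real.log (Complex.normSq (w β - x)) / 2)]
    · simp only [periodic_endpoint h.periodic, sub_self]
    · intro β _
      have hn : Complex.normSq (w β - x) ≠ 0 := by simpa using hne β
      have h2 : HasDerivAt (fun β => w β - x) (deriv w β) β := (h.hasDerivAt β).sub_const x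
      have hre : HasDerivAt (fun β => (w β - x).re) (deriv w β).re β :=
        Complex.reCLM.hasFDerivAt.comp_hasDerivAt β h2
      have him : HasDerivAt (fun β => (w β - x).im) (deriv w β).im β :=
        Complex.imCLM.hasFDerivAt.comp_hasDerivAt β h2
      have h3 : HasDerivAt (fun β => Complex.normSq (w β - x))
          (2 * ((deriv w β).re * (w β - x).re + (deriv w β).im * (w β - x).im)) β := by
        simp only [Complex.normSq_apply]
        exact ((hre.mul hre).add (him.mul him)).congr_deriv (by ring)
      refine ((h3.log hn).div_const 2).congr_deriv ?_
      rw [Complex.div_re]; field_simp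
    · exact ((Complex.continuous_re.comp hcont).intervalIntegrable _ _)
  apply Complex.ext
  · rfl
  · rw [Complex.ofReal_im, windingNumber, show (2 * Real.pi * Complex.I : ℂ)⁻¹ =
      ((-(2 * Real.pi)⁻¹ : ℝ) : ℂ) * Complex.I by
        rw [mul_inv, Complex.inv_I]; push_cast; ring]
    rw [mul_assoc, Complex.im_ofReal_mul, Complex.I_mul_im, key, mul_zero]

/-- For `x` farther out than the curve, `log (1 - w / x)` is a single-valued primitive, because `1 -
w / x` stays in the right half-plane. -/
lemma windingNumber_eq_zero_of_norm_lt (h : IsLoop ℓ w) {R : ℝ} (hR : ∀ β, ‖w β‖ ≤ R) {x : ℂ}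
    (hx : R < ‖x‖) : windingNumber ℓ w x = 0 := by
  have hx0 : x ≠ 0 := fun h0 => by
    have := (norm_nonneg _).trans (hR 0); simp [h0] at hx; linarith
  have hxw : x ∉ range w := by rintro ⟨β, rfl⟩; exact absurd (hR β) (not_le.2 hx)
  have hcont := continuous_div_of_notMem _ h.continuous_deriv h.continuous hxw
  have key : ∫ β in (-(ℓ / 2))..(ℓ / 2), deriv w β / (w β - x) = 0 := by
    rw [intervalIntegral.integral_eq_sub_of_hasDerivAt (f := fun β => Complex.log (1 - w β / x))]
    · simp only [periodic_endpoint h.periodic, sub_self]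
    · intro β _
      have hlt : ‖w β / x‖ < 1 := by
        rw [norm_div, div_lt_one (norm_pos_iff.2 hx0)]; exact (hR β).trans_lt hx
      have hslit : 1 - w β / x ∈ Complex.slitPlane := by
        left
        have := (Complex.re_le_norm (w β / x)).trans_lt hlt
        rw [Complex.sub_re, Complex.one_re]; linarith
      have h1 : HasDerivAt (fun β => 1 - w β / x) (-(deriv w β / x)) β :=
        ((h.hasDerivAt β).div_const x).const_sub 1
      refine (h1.clog_real hslit).congr_deriv ?_
      have hne : w β - x ≠ 0 := fun h0 => hxw ⟨β, by linear_combination h0⟩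
      have hne' : x - w β ≠ 0 := fun h0 => hxw ⟨β, by linear_combination -h0⟩
      field_simp
      ring
    · exact hcont.intervalIntegrable _ _
  rw [windingNumber, key, mul_zero]

/-- Differentiating under the integral gives `w' / (w - x)²`, the derivative of the periodic
function `-1 / (w - x)`. The winding number is thus locally constant off the curve. -/
lemma hasDerivAt_windingNumber (h : IsLoop ℓ w) (hℓ : 0 < ℓ) {x : ℂ} (hx : x ∉ range w) :
    HasDerivAt (windingNumber ℓ w) 0 x := by
  obtain ⟨ε, hε, hball⟩ := Metric.isOpen_iff.1 (h.isCompact_range hℓ).isClosed.isOpen_compl x hx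
  have hne : ∀ y ∈ Metric.ball x (ε / 2), ∀ β, ε / 2 ≤ ‖w β - y‖ := fun y hy β => by
    by_contra hlt
    refine hball ?_ ⟨β, rfl⟩
    rw [Metric.mem_ball] at hy ⊢
    calc dist (w β) x ≤ dist (w β) y + dist y x := dist_triangle _ _ _
      _ < ε := by rw [dist_eq_norm]; linarith [not_le.1 hlt]
  have hne0 : ∀ y ∈ Metric.ball x (ε / 2), ∀ β, w β - y ≠ 0 := fun y hy β h0 => by
    have := hne y hy β; rw [h0, norm_zero] at this; linarith
  have hnot : ∀ y ∈ Metric.ball x (ε / 2), y ∉ range w := by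
    rintro y hy ⟨β, rfl⟩; exact hne0 _ hy β (sub_self _)
  have hxb : x ∈ Metric.ball x (ε / 2) := Metric.mem_ball_self (half_pos hε)
  have hcd : Continuous fun β => deriv w β / (w β - x) ^ 2 :=
    h.continuous_deriv.div ((h.continuous.sub continuous_const).pow 2)
      fun β => pow_ne_zero 2 (hne0 x hxb β)
  have key := (intervalIntegral.hasDerivAt_integral_of_dominated_loc_of_deriv_le
    (𝕜 := ℂ) (μ := volume) (a := -(ℓ / 2)) (b := ℓ / 2)
    (F := fun y β => deriv w β / (w β - y)) (F' := fun y β => deriv w β / (w β - y) ^ 2) (x₀ := x)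
    (s := Metric.ball x (ε / 2)) (bound := fun β => ‖deriv w β‖ * ((ε / 2) ^ 2)⁻¹)
    (Metric.ball_mem_nhds x (half_pos hε)) ?_ ?_ ?_ ?_ ?_ ?_).2
  · have h0 : ∫ β in (-(ℓ / 2))..(ℓ / 2), deriv w β / (w β - x) ^ 2 = 0 := by
      rw [intervalIntegral.integral_eq_sub_of_hasDerivAt (f := fun β => -(w β - x)⁻¹)]
      · simp only [periodic_endpoint h.periodic, sub_self]
      · intro β _
        refine (((h.hasDerivAt β).sub_const x).inv (hne0 x hxb β)).neg.congr_deriv ?_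
        ring
      · exact hcd.intervalIntegrable _ _
    rw [h0] at key
    exact (key.const_mul (2 * Real.pi * Complex.I : ℂ)⁻¹).congr_deriv (mul_zero _)
  · filter_upwards [Metric.ball_mem_nhds x (half_pos hε)] with y hy
    exact (continuous_div_of_notMem _ h.continuous_deriv h.continuous
      (hnot y hy)).aestronglyMeasurable
  · exact (continuous_div_of_notMem _ h.continuous_deriv h.continuous hx).intervalIntegrable _ _
  · exact hcd.aestronglyMeasurable
  · refine ae_of_all _ fun β _ y hy => ?_
    rw [norm_div, norm_pow, div_eq_mul_inv]
    gcongr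
    exact hne y hy β
  · exact (h.continuous_deriv.norm.mul continuous_const).intervalIntegrable _ _
  · refine ae_of_all _ fun β _ y hy => ?_
    have h1 : HasDerivAt (fun y => w β - y) (-1) y := (hasDerivAt_id y).const_sub _
    refine ((h1.inv (hne0 y hy β)).const_mul (deriv w β)).congr_deriv ?_
    ring

lemma windingNumber_eq_of_mem_connectedComponentIn (h : IsLoop ℓ w) (hℓ : 0 < ℓ) {x y : ℂ}
    (hy : y ∈ connectedComponentIn (range w)ᶜ x) : windingNumber ℓ w y = windingNumber ℓ w x := by
  have hx : x ∈ (range w)ᶜ := by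
    by_contra hx; simp [connectedComponentIn_eq_empty hx] at hy
  have ho := (h.isCompact_range hℓ).isClosed.isOpen_compl
  have hsub := connectedComponentIn_subset (range w)ᶜ x
  refine (ho.connectedComponentIn (x := x)).is_const_of_deriv_eq_zero
    isPreconnected_connectedComponentIn ?_ ?_ hy (mem_connectedComponentIn hx)
  · exact fun y hy => (hasDerivAt_windingNumber h hℓ (hsub hy)).differentiableAt.differentiableWithinAt
  · exact fun y hy => (hasDerivAt_windingNumber h hℓ (hsub hy)).deriv

lemma wn_eq_of_isPreconnected (h : IsLoop ℓ w) (hℓ : 0 < ℓ) {s : Set ℂ} (hs : IsPreconnected s)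
    (hsw : s ⊆ (range w)ᶜ) {x y : ℂ} (hx : x ∈ s) (hy : y ∈ s) : wn ℓ w x = wn ℓ w y := by
  rw [wn, wn, windingNumber_eq_of_mem_connectedComponentIn h hℓ
    (hs.subset_connectedComponentIn hx hsw hy)]

lemma continuousAt_wn (h : IsLoop ℓ w) (hℓ : 0 < ℓ) {x : ℂ} (hx : x ∉ range w) :
    ContinuousAt (wn ℓ w) x :=
  Complex.continuous_re.continuousAt.comp (hasDerivAt_windingNumber h hℓ hx).continuousAt

lemma IsLoop.exists_bound (h : IsLoop ℓ w) (hℓ : 0 < ℓ) : ∃ R, ∀ β, ‖w β‖ ≤ R := by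
  obtain ⟨R, hR⟩ := (h.isCompact_range hℓ).isBounded.exists_norm_le
  exact ⟨R, fun β => hR _ ⟨β, rfl⟩⟩

/-- The curve is the image of the real axis, a null set of the plane, under the differentiable map
`ζ ↦ w (Re ζ)`. -/
lemma volume_range_eq_zero (h : IsLoop ℓ w) : volume (range w) = 0 := by
  have h1 : range w = (fun ζ : ℂ => w ζ.re) '' {ζ : ℂ | ζ.im = 0} := by
    ext x; constructor
    · rintro ⟨β, rfl⟩; exact ⟨β, by simp, by simp⟩
    · rintro ⟨ζ, _, rfl⟩; exact ⟨_, rfl⟩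
  rw [h1]
  refine addHaar_image_eq_zero_of_differentiableOn_of_addHaar_eq_zero volume ?_ ?_
  · exact ((h.contDiff.differentiable one_ne_zero).comp
      Complex.reCLM.differentiable).differentiableOn
  · have : {ζ : ℂ | ζ.im = 0} = (LinearMap.ker (Complex.imCLM : ℂ →ₗ[ℝ] ℝ) : Set ℂ) := by
      ext; simp
    rw [this]
    refine Measure.addHaar_submodule _ _ fun htop => ?_
    have : Complex.I ∈ LinearMap.ker (Complex.imCLM : ℂ →ₗ[ℝ] ℝ) := by rw [htop]; trivial
    simp at this

lemma ae_notMem_range (h : IsLoop ℓ w) : ∀ᵐ x : ℂ, x ∉ range w :=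
  measure_eq_zero_iff_ae_notMem.1 (volume_range_eq_zero h)

/-- Green's theorem for the gradient, in terms of the winding number. -/
lemma integral_wn_mul_grad (h : IsLoop ℓ w) (hℓ : 0 < ℓ) {ψ : ℂ → ℝ} (hψ : ContDiff ℝ 1 ψ)
    (hc : HasCompactSupport ψ) :
    ∫ x, (wn ℓ w x : ℂ) * grad ψ x =
      -Complex.I * ∫ β in (-(ℓ / 2))..(ℓ / 2), deriv w β * ψ (w β) := by
  have h1 := integral_grad_mul_cauchy hψ hc h.continuous_deriv h.continuous
    (show -(ℓ / 2) ≤ ℓ / 2 by linarith)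
  have h2 : ∫ x, (wn ℓ w x : ℂ) * grad ψ x = ∫ x, (2 * Real.pi * Complex.I)⁻¹ *
      (grad ψ x * ∫ β in (-(ℓ / 2))..(ℓ / 2), deriv w β / (w β - x)) := by
    refine integral_congr_ae ?_
    filter_upwards [ae_notMem_range h] with x hx
    rw [← windingNumber_eq_ofReal h hx, windingNumber]; ring
  rw [h2, integral_const_mul, h1, mul_inv, Complex.inv_I]
  have : (Real.pi : ℂ) ≠ 0 := by exact_mod_cast Real.pi_ne_zero
  field_simp

lemma integrable_mul_wn (h : IsLoop ℓ w) (hℓ : 0 < ℓ) {f : ℂ → ℝ} (hf : Continuous f)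
    (hc : HasCompactSupport f) : Integrable fun x => f x * wn ℓ w x := by
  obtain ⟨h1, M, hM⟩ := integrable_of_contDiff (Complex.continuous_ofReal.comp hf)
    (hc.comp_left (g := ((↑) : ℝ → ℂ)) (by simp))
  have := (integrable_mul_cauchy h1 hM h.continuous_deriv h.continuous
    (show -(ℓ / 2) ≤ ℓ / 2 by linarith)).const_mul (2 * Real.pi * Complex.I)⁻¹
  refine this.re.congr (ae_of_all _ fun x => ?_)
  simp only [wn, windingNumber, Function.comp]
  rw [← Complex.re_ofReal_mul]
  simp only [RCLike.re_eq_complex_re]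
  congr 1; ring

/-- **Green's theorem** in terms of the winding number. -/
lemma integral_wn_mul_divergence (h : IsLoop ℓ w) (hℓ : 0 < ℓ) {F : ℂ → ℂ} (hF : ContDiff ℝ 1 F)
    (hc : HasCompactSupport F) :
    ∫ x, wn ℓ w x * divergence F x =
      -∫ β in (-(ℓ / 2))..(ℓ / 2), inner ℝ (F (w β)) (Complex.I * deriv w β) := by
  have hre : ContDiff ℝ 1 fun x => (F x).re := Complex.reCLM.contDiff.comp hF
  have him : ContDiff ℝ 1 fun x => (F x).im := Complex.imCLM.contDiff.comp hF
  have hcre : HasCompactSupport fun x => (F x).re := hc.comp_left (g := Complex.re) rfl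
  have hcim : HasCompactSupport fun x => (F x).im := hc.comp_left (g := Complex.im) rfl
  have hdiff := hF.differentiable one_ne_zero
  have hgre : ∀ x, (grad (fun x => (F x).re) x).re = (fderiv ℝ F x 1).re := fun x => by
    have := (Complex.reCLM.hasFDerivAt.comp x (hdiff x).hasFDerivAt).fderiv
    simp only [grad]
    rw [show (fun x => (F x).re) = Complex.reCLM ∘ F from rfl, this]; rfl
  have hgim : ∀ x, (grad (fun x => (F x).im) x).im = (fderiv ℝ F x Complex.I).im := fun x => by
    have := (Complex.imCLM.hasFDerivAt.comp x (hdiff x).hasFDerivAt).fderiv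
    simp only [grad]
    rw [show (fun x => (F x).im) = Complex.imCLM ∘ F from rfl, this]; rfl
  have hint : ∀ {ψ : ℂ → ℝ}, ContDiff ℝ 1 ψ → HasCompactSupport ψ →
      Integrable fun x => (wn ℓ w x : ℂ) * grad ψ x := fun {ψ} hψ hcψ => by
    have hg := continuous_grad hψ
    have hcg := hasCompactSupport_grad hcψ
    have h1 := integrable_mul_wn h hℓ (Complex.continuous_re.comp hg)
      (hcg.comp_left (g := Complex.re) rfl)
    have h2 := integrable_mul_wn h hℓ (Complex.continuous_im.comp hg)
      (hcg.comp_left (g := Complex.im) rfl)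
    refine (h1.ofReal.add (h2.ofReal.mul_const Complex.I)).congr (ae_of_all _ fun x => ?_)
    simp only [Pi.add_apply, Function.comp]
    conv_rhs => rw [← Complex.re_add_im (grad ψ x)]
    simp only [RCLike.ofReal_mul, Complex.coe_algebraMap]
    ring
  have e1 := congrArg Complex.re (integral_wn_mul_grad h hℓ hre hcre)
  have e2 := congrArg Complex.im (integral_wn_mul_grad h hℓ him hcim)
  have t1 : (∫ x, (wn ℓ w x : ℂ) * grad (fun x => (F x).re) x).re =
      ∫ x, wn ℓ w x * (fderiv ℝ F x 1).re := by
    refine (integral_re (hint hre hcre)).symm.trans ?_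
    congr 1; ext x; rw [RCLike.re_eq_complex_re, Complex.re_ofReal_mul, hgre]
  have t2 : (∫ x, (wn ℓ w x : ℂ) * grad (fun x => (F x).im) x).im =
      ∫ x, wn ℓ w x * (fderiv ℝ F x Complex.I).im := by
    refine (integral_im (hint him hcim)).symm.trans ?_
    congr 1; ext x; rw [RCLike.im_eq_complex_im, Complex.im_ofReal_mul, hgim]
  have i1 : Integrable fun x => wn ℓ w x * (fderiv ℝ F x 1).re := by
    refine (hint hre hcre).re.congr (ae_of_all _ fun x => ?_)
    simp only [RCLike.re_eq_complex_re, Complex.re_ofReal_mul, hgre]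
  have i2 : Integrable fun x => wn ℓ w x * (fderiv ℝ F x Complex.I).im := by
    refine (hint him hcim).im.congr (ae_of_all _ fun x => ?_)
    simp only [RCLike.im_eq_complex_im, Complex.im_ofReal_mul, hgim]
  have hcr : Continuous fun β => deriv w β * ((F (w β)).re : ℂ) :=
    h.continuous_deriv.mul (Complex.continuous_ofReal.comp (hre.continuous.comp h.continuous))
  have hci : Continuous fun β => deriv w β * ((F (w β)).im : ℂ) :=
    h.continuous_deriv.mul (Complex.continuous_ofReal.comp (him.continuous.comp h.continuous))
  have s1 : (-Complex.I * ∫ β in (-(ℓ / 2))..(ℓ / 2), deriv w β * ((F (w β)).re : ℂ)).re =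
      ∫ β in (-(ℓ / 2))..(ℓ / 2), (deriv w β).im * (F (w β)).re := by
    rw [neg_mul, Complex.neg_re, Complex.I_mul_re, neg_neg]
    refine (Complex.imCLM.intervalIntegral_comp_comm (hcr.intervalIntegrable _ _)).symm.trans ?_
    simp
  have s2 : (-Complex.I * ∫ β in (-(ℓ / 2))..(ℓ / 2), deriv w β * ((F (w β)).im : ℂ)).im =
      -∫ β in (-(ℓ / 2))..(ℓ / 2), (deriv w β).re * (F (w β)).im := by
    rw [neg_mul, Complex.neg_im, Complex.I_mul_im]
    congr 1
    refine (Complex.reCLM.intervalIntegral_comp_comm (hci.intervalIntegrable _ _)).symm.trans ?_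
    simp
  simp only [divergence, mul_add]
  rw [integral_add i1 i2, ← t1, ← t2, e1, e2, s1, s2, ← sub_eq_add_neg,
    ← intervalIntegral.integral_sub, ← intervalIntegral.integral_neg]
  · refine intervalIntegral.integral_congr fun β _ => ?_
    simp only [inner_eq, Complex.I_mul_re, Complex.I_mul_im]; ring
  · exact ((Complex.continuous_im.comp h.continuous_deriv).mul
      (hre.continuous.comp h.continuous)).intervalIntegrable _ _
  · exact ((Complex.continuous_re.comp h.continuous_deriv).mul
      (him.continuous.comp h.continuous)).intervalIntegrable _ _

end Winding

/-! ### Integrals depending on a parameter in a compact interval -/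

section Parametric

variable {E : Type*} [NormedAddCommGroup E] [NormedSpace ℝ E] {a b : ℝ}

/-- The families of curves are continuous in time on a compact interval only. Projecting time onto
it makes them continuous everywhere, as needed for the theorems on parametric integrals. -/
lemma continuous_comp_projIcc {E : Type*} [TopologicalSpace E] {a b : ℝ} {f : ℝ → ℝ → E} (hab : a ≤ b)
    (hf : ContinuousOn (Function.uncurry f) (Icc a b ×ˢ univ)) :
    Continuous (Function.uncurry fun s β => f (projIcc a b hab s) β) := by
  have h1 : Continuous fun p : ℝ × ℝ => (((projIcc a b hab p.1 : ℝ), p.2) : ℝ × ℝ) :=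
    (continuous_subtype_val.comp (continuous_projIcc.comp continuous_fst)).prodMk continuous_snd
  exact hf.comp_continuous h1 fun p => ⟨(projIcc a b hab p.1).2, mem_univ _⟩

lemma continuousOn_slice {E : Type*} [TopologicalSpace E] {S : Set ℝ} {f : ℝ → ℝ → E}
    (hf : ContinuousOn (Function.uncurry f) (S ×ˢ univ)) (β : ℝ) :
    ContinuousOn (fun s => f s β) S := by
  have h1 : ContinuousOn (fun s => ((s, β) : ℝ × ℝ)) S := by fun_prop
  exact ContinuousOn.comp hf h1 fun s hs => ⟨hs, mem_univ _⟩

lemma continuousOn_integral {f : ℝ → ℝ → E} (hab : a ≤ b)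
    (hf : ContinuousOn (Function.uncurry f) (Icc a b ×ˢ univ)) (c d : ℝ) :
    ContinuousOn (fun s => ∫ β in c..d, f s β) (Icc a b) := by
  have h := intervalIntegral.continuous_parametric_intervalIntegral_of_continuous'
    (μ := volume) (continuous_comp_projIcc hab hf) c d
  refine h.continuousOn.congr fun s hs => ?_
  simp only [projIcc_of_mem hab hs]

lemma integral_swap_of_continuousOn {f : ℝ → ℝ → E} (hab : a ≤ b)
    (hf : ContinuousOn (Function.uncurry f) (Icc a b ×ˢ univ)) {c d : ℝ} (hcd : c ≤ d) :
    ∫ s in a..b, ∫ β in c..d, f s β = ∫ β in c..d, ∫ s in a..b, f s β := by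
  simp only [intervalIntegral.integral_of_le hab, intervalIntegral.integral_of_le hcd]
  refine integral_integral_swap ?_
  rw [Measure.prod_restrict]
  have : IntegrableOn (Function.uncurry f) (Icc a b ×ˢ Icc c d) :=
    (hf.mono (prod_mono_right (subset_univ _))).integrableOn_compact (isCompact_Icc.prod isCompact_Icc)
  exact this.mono_set (prod_mono Ioc_subset_Icc_self Ioc_subset_Icc_self)

lemma hasDerivWithinAt_primitive [CompleteSpace E] {f : ℝ → E} (hab : a ≤ b)
    (hf : ContinuousOn f (Icc a b)) {s : ℝ} (hs : s ∈ Icc a b) :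
    HasDerivWithinAt (fun u => ∫ x in a..u, f x) (f s) (Icc a b) s := by
  have hc : Continuous fun u => f (projIcc a b hab u) :=
    hf.comp_continuous (continuous_subtype_val.comp continuous_projIcc)
      fun u => (projIcc a b hab u).2
  have h1 := (intervalIntegral.integral_hasDerivAt_right (hc.intervalIntegrable a s)
    hc.aestronglyMeasurable.stronglyMeasurableAtFilter hc.continuousAt).hasDerivWithinAt (s := Icc a b)
  have hcongr : ∀ u ∈ Icc a b, ∫ x in a..u, f x = ∫ x in a..u, f (projIcc a b hab x) :=
    fun u hu => intervalIntegral.integral_congr fun x hx => by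
      rw [uIcc_of_le hu.1] at hx
      simp only [projIcc_of_mem hab ⟨hx.1, hx.2.trans hu.2⟩]
  rw [projIcc_of_mem hab hs] at h1
  exact h1.congr hcongr (hcongr s hs)

end Parametric

/-! ### The `∂̄`-potential of a function -/

/-- Every `C^1` function with compact support is the divergence of a `C^1` field, namely of its
Cauchy transform. -/
lemma exists_potential {ψ : ℂ → ℝ} (hψ : ContDiff ℝ 1 ψ) (hc : HasCompactSupport ψ) :
    ∃ P : ℂ → ℂ, ContDiff ℝ 1 P ∧ (∀ y, P y = ∫ x, (ψ x : ℂ) / (y - x)) ∧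
      ∀ y, fderiv ℝ P y 1 + Complex.I * fderiv ℝ P y Complex.I = 2 * Real.pi * ψ y := by
  set g : ℂ → ℂ := fun x => (ψ x : ℂ) with hg
  set f : ℂ → ℂ := fun x => x⁻¹ with hfdef
  have hgc : HasCompactSupport g := hc.comp_left (g := ((↑) : ℝ → ℂ)) (by simp)
  have hgd : ContDiff ℝ 1 g := Complex.ofRealCLM.contDiff.comp hψ
  have hf : LocallyIntegrable f := by
    intro x
    refine ⟨Metric.ball 0 (‖x‖ + 1), Metric.isOpen_ball.mem_nhds (by simp), ?_⟩
    have := integrableOn_inv_norm_sub 0 (‖x‖ + 1)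
    simp only [sub_zero] at this
    refine Integrable.mono' this measurable_inv.aestronglyMeasurable (ae_of_all _ fun y => ?_)
    simp [hfdef]
  set L := ContinuousLinearMap.mul ℝ ℂ with hL
  have hP : ∀ y, (convolution f g L volume) y = ∫ x, (ψ x : ℂ) / (y - x) := fun y => by
    rw [convolution_eq_swap]
    congr 1; ext x; simp [hL, hfdef, hg]; ring
  refine ⟨convolution f g L volume, hgc.contDiff_convolution_right (n := 1) L hf hgd, hP,
    fun y => ?_⟩
  have hd := (hgc.hasFDerivAt_convolution_right L hf hgd y).fderiv
  have happ : ∀ v, fderiv ℝ (convolution f g L volume) y v =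
      ∫ t, f t * (fderiv ℝ ψ (y - t) v : ℂ) := fun v => by
    rw [hd, convolution_precompR_apply L hf (hgc.fderiv ℝ) (hgd.continuous_fderiv one_ne_zero)]
    unfold convolution
    congr 1; ext t
    have : fderiv ℝ g (y - t) v = (fderiv ℝ ψ (y - t) v : ℂ) := by
      have := (Complex.ofRealCLM.hasFDerivAt.comp (y - t)
        (hψ.differentiable one_ne_zero (y - t)).hasFDerivAt).fderiv
      rw [show g = Complex.ofRealCLM ∘ ψ from rfl, this]; rfl
    simp [hL, this]
  have hint : ∀ v, Integrable fun t => f t * (fderiv ℝ ψ (y - t) v : ℂ) := fun v => by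
    have h1 : Continuous fun x => (fderiv ℝ ψ x v : ℂ) :=
      Complex.continuous_ofReal.comp ((hψ.continuous_fderiv one_ne_zero).clm_apply continuous_const)
    have h2 : HasCompactSupport fun x => (fderiv ℝ ψ x v : ℂ) :=
      (hc.fderiv (𝕜 := ℝ)).comp_left (g := fun T : ℂ →L[ℝ] ℝ => ((T v : ℝ) : ℂ)) (by simp)
    exact (h2.convolutionExists_right L hf h1 y)
  -- In the convolution the derivatives fall on `ψ`, and `∂₁ + i ∂₂` assembles them into `-∇ψ(x) /
  -- (x - y)` with `x = y - t`.
  have hpomp := integral_grad_div hψ hc y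
  rw [happ, happ, ← integral_const_mul, ← integral_add (hint 1) ((hint Complex.I).const_mul _)]
  rw [← integral_sub_left_eq_self _ volume y] at hpomp
  have : (fun t => f t * (fderiv ℝ ψ (y - t) 1 : ℂ) + Complex.I *
      (f t * (fderiv ℝ ψ (y - t) Complex.I : ℂ))) =
      fun t => -(grad ψ (y - t) / (y - t - y)) := by
    funext t
    rw [show y - t - y = -t by ring, div_neg, neg_neg]
    conv_rhs => rw [← Complex.re_add_im (grad ψ (y - t))]
    simp only [hfdef, grad]; ring
  rw [this, integral_neg, hpomp]; ring

/-- The winding number jumps in time as the curve passes a point, but its pairing with `ψ` is a line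
integral of the `C^1` potential `P`, which can be differentiated along a family of loops. -/
lemma integral_mul_wn_eq {ℓ : ℝ} {w : ℝ → ℂ} (h : IsLoop ℓ w) (hℓ : 0 < ℓ) {ψ : ℂ → ℝ}
    (hψ : Continuous ψ) (hc : HasCompactSupport ψ) {P : ℂ → ℂ}
    (hP : ∀ y, P y = ∫ x, (ψ x : ℂ) / (y - x)) :
    ∫ x, ψ x * wn ℓ w x = ((2 * Real.pi * Complex.I)⁻¹ *
      ∫ β in (-(ℓ / 2))..(ℓ / 2), P (w β) * deriv w β).re := by
  obtain ⟨h1, M, hM⟩ := integrable_of_contDiff (Complex.continuous_ofReal.comp hψ)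
    (hc.comp_left (g := ((↑) : ℝ → ℂ)) (by simp))
  have hab : -(ℓ / 2) ≤ ℓ / 2 := by linarith
  have e1 := integral_mul_cauchy h1 hM h.continuous_deriv h.continuous hab
  have i1 := (integrable_mul_cauchy h1 hM h.continuous_deriv h.continuous hab).const_mul
    (2 * Real.pi * Complex.I)⁻¹
  have e2 : ∫ β in (-(ℓ / 2))..(ℓ / 2), P (w β) * deriv w β =
      ∫ x, (Complex.ofReal ∘ ψ) x * ∫ β in (-(ℓ / 2))..(ℓ / 2), deriv w β / (w β - x) := by
    rw [e1]
    refine intervalIntegral.integral_congr fun β _ => ?_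
    simp only [hP, Function.comp]; ring
  rw [e2, ← integral_const_mul]
  refine Eq.trans ?_ (integral_re i1)
  refine integral_congr_ae (ae_of_all _ fun x => ?_)
  simp only [wn, windingNumber, RCLike.re_eq_complex_re, Function.comp]
  rw [← Complex.re_ofReal_mul]
  congr 1; ring

/-! ### Families of loops -/

/-- A `C^1` family `w s`, `a ≤ s ≤ b`, of loops, with velocity `v`. -/
structure LoopFamily (ℓ a b : ℝ) (w v : ℝ → ℝ → ℂ) : Prop where
  loop : ∀ s ∈ Icc a b, IsLoop ℓ (w s)
  vel : ∀ s ∈ Icc a b, IsLoop ℓ (v s)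
  cont : ContinuousOn (Function.uncurry w) (Icc a b ×ˢ univ)
  cont_deriv : ContinuousOn (Function.uncurry fun s => deriv (w s)) (Icc a b ×ˢ univ)
  cont_vel : ContinuousOn (Function.uncurry v) (Icc a b ×ˢ univ)
  cont_vel_deriv : ContinuousOn (Function.uncurry fun s => deriv (v s)) (Icc a b ×ˢ univ)
  hasDeriv : ∀ s ∈ Icc a b, ∀ α, HasDerivWithinAt (fun r => w r α) (v s α) (Icc a b) s
  hasDeriv_deriv : ∀ s ∈ Icc a b, ∀ α,
    HasDerivWithinAt (fun r => deriv (w r) α) (deriv (v s) α) (Icc a b) s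

section Family

variable {ℓ a b : ℝ} {w v : ℝ → ℝ → ℂ}

/-- The flux of the velocity of a family of loops, weighted by `ψ`. -/
def flux (ℓ : ℝ) (ψ : ℂ → ℝ) (w v : ℝ → ℂ) : ℝ :=
  ∫ β in (-(ℓ / 2))..(ℓ / 2), ψ (w β) * inner ℝ (v β) (Complex.I * deriv w β)

lemma LoopFamily.mono (h : LoopFamily ℓ a b w v) {c d : ℝ} (hac : a ≤ c) (hdb : d ≤ b) :
    LoopFamily ℓ c d w v where
  loop s hs := h.loop s (Icc_subset_Icc hac hdb hs)
  vel s hs := h.vel s (Icc_subset_Icc hac hdb hs)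
  cont := h.cont.mono (prod_mono_left (Icc_subset_Icc hac hdb))
  cont_deriv := h.cont_deriv.mono (prod_mono_left (Icc_subset_Icc hac hdb))
  cont_vel := h.cont_vel.mono (prod_mono_left (Icc_subset_Icc hac hdb))
  cont_vel_deriv := h.cont_vel_deriv.mono (prod_mono_left (Icc_subset_Icc hac hdb))
  hasDeriv s hs α := (h.hasDeriv s (Icc_subset_Icc hac hdb hs) α).mono (Icc_subset_Icc hac hdb)
  hasDeriv_deriv s hs α :=
    (h.hasDeriv_deriv s (Icc_subset_Icc hac hdb hs) α).mono (Icc_subset_Icc hac hdb)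

lemma LoopFamily.continuousOn_flux (h : LoopFamily ℓ a b w v) (hab : a ≤ b) {ψ : ℂ → ℝ}
    (hψ : Continuous ψ) : ContinuousOn (fun s => flux ℓ ψ (w s) (v s)) (Icc a b) := by
  refine continuousOn_integral (f := fun s β => ψ (w s β) *
    inner ℝ (v s β) (Complex.I * deriv (w s) β)) hab ?_ _ _
  exact (hψ.comp_continuousOn h.cont).mul
    (ContinuousOn.inner (𝕜 := ℝ) h.cont_vel (continuousOn_const.mul h.cont_deriv))

lemma dbar_algebra {p1 p2 q vr vi wr wi : ℂ} (h : p1 + Complex.I * p2 = q) :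
    (vr * p1 + vi * p2) * (wr + wi * Complex.I) - (wr * p1 + wi * p2) * (vr + vi * Complex.I) =
      -Complex.I * (q * (vr * -wi + vi * wr)) := by
  linear_combination (-Complex.I * (vr * -wi + vi * wr)) * h
    + (vr * -wi + vi * wr) * p2 * Complex.I_sq

/-- The left side is antisymmetric in `v` and `w`, hence a multiple of their area form, and the
factor sees only the `∂̄`-part `A 1 + i A i` of the real-linear map. -/
lemma dbar_clm_algebra (A : ℂ →L[ℝ] ℂ) {q : ℂ} (h : A 1 + Complex.I * A Complex.I = q)
    (v w : ℂ) :
    A v * w - A w * v = -Complex.I * (q * (inner ℝ v (Complex.I * w) : ℝ)) := by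
  rw [clm_apply_eq A v, clm_apply_eq A w, inner_eq, Complex.I_mul_re, Complex.I_mul_im]
  simp only [Complex.real_smul]
  have := dbar_algebra (vr := v.re) (vi := v.im) (wr := w.re) (wi := w.im) h
  rw [Complex.re_add_im, Complex.re_add_im] at this
  rw [this]; push_cast; ring

/-- The integrand is the time derivative of `P(w) w'`. Subtracting the derivative of the periodic
function `P(w) v` along the loop leaves the antisymmetric expression of `dbar_clm_algebra`, in which
only `ψ` survives. -/
lemma integral_fderiv_potential_eq_flux {w v : ℝ → ℂ} (hw : IsLoop ℓ w) (hv : IsLoop ℓ v)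
    {ψ : ℂ → ℝ} {P : ℂ → ℂ} (hPd : ContDiff ℝ 1 P)
    (hP : ∀ y, fderiv ℝ P y 1 + Complex.I * fderiv ℝ P y Complex.I = 2 * Real.pi * ψ y) :
    ∫ β in (-(ℓ / 2))..(ℓ / 2), (fderiv ℝ P (w β) (v β) * deriv w β + P (w β) * deriv v β) =
      -(2 * Real.pi * Complex.I) * (flux ℓ ψ w v : ℝ) := by
  have hPdiff := hPd.differentiable one_ne_zero
  have hPc := hPd.continuous_fderiv one_ne_zero
  have hder : ∀ β, HasDerivAt (fun β => P (w β) * v β)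
      (fderiv ℝ P (w β) (deriv w β) * v β + P (w β) * deriv v β) β := fun β =>
    ((hPdiff _).hasFDerivAt.comp_hasDerivAt β (hw.hasDerivAt β)).mul (hv.hasDerivAt β)
  have hc1 : Continuous fun β => fderiv ℝ P (w β) (deriv w β) * v β + P (w β) * deriv v β :=
    (((hPc.comp hw.continuous).clm_apply hw.continuous_deriv).mul hv.continuous).add
      ((hPd.continuous.comp hw.continuous).mul hv.continuous_deriv)
  have hc2 : Continuous fun β => fderiv ℝ P (w β) (v β) * deriv w β + P (w β) * deriv v β :=
    (((hPc.comp hw.continuous).clm_apply hv.continuous).mul hw.continuous_deriv).add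
      ((hPd.continuous.comp hw.continuous).mul hv.continuous_deriv)
  have hz := intervalIntegral.integral_eq_sub_of_hasDerivAt (a := -(ℓ / 2)) (b := ℓ / 2)
    (fun β _ => hder β) (hc1.intervalIntegrable _ _)
  rw [periodic_endpoint hw.periodic, periodic_endpoint hv.periodic, sub_self] at hz
  rw [flux, ← intervalIntegral.integral_ofReal, ← intervalIntegral.integral_const_mul]
  refine (sub_zero _).symm.trans ?_
  rw [← hz, ← intervalIntegral.integral_sub (hc2.intervalIntegrable _ _)
    (hc1.intervalIntegrable _ _)]
  refine intervalIntegral.integral_congr fun β _ => ?_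
  have := dbar_clm_algebra (fderiv ℝ P (w β)) (hP (w β)) (v β) (deriv w β)
  push_cast
  linear_combination this

/-- The variation of the integral of `ψ` against the winding number, for a family of loops. -/
lemma LoopFamily.integral_mul_wn_sub (h : LoopFamily ℓ a b w v) (hℓ : 0 < ℓ) (hab : a ≤ b)
    {ψ : ℂ → ℝ} (hψ : ContDiff ℝ 1 ψ) (hc : HasCompactSupport ψ) :
    (∫ x, ψ x * wn ℓ (w b) x) - ∫ x, ψ x * wn ℓ (w a) x =
      -∫ s in a..b, flux ℓ ψ (w s) (v s) := by
  obtain ⟨P, hPd, hP, hPdbar⟩ := exists_potential hψ hc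
  have hℓ2 : -(ℓ / 2) ≤ ℓ / 2 := by linarith
  have hPdiff := hPd.differentiable one_ne_zero
  have hPc := hPd.continuous_fderiv one_ne_zero
  set f' : ℝ → ℝ → ℂ := fun s β => fderiv ℝ P (w s β) (v s β) * deriv (w s) β +
    P (w s β) * deriv (v s) β with hf'
  have hDP : ContinuousOn (Function.uncurry fun s β => fderiv ℝ P (w s β) (v s β))
      (Icc a b ×ˢ univ) := (hPc.comp_continuousOn h.cont).clm_apply h.cont_vel
  have hf'c : ContinuousOn (Function.uncurry f') (Icc a b ×ˢ univ) :=
    (hDP.mul h.cont_deriv).add ((hPd.continuous.comp_continuousOn h.cont).mul h.cont_vel_deriv)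
  have hftc : ∀ β, P (w b β) * deriv (w b) β - P (w a β) * deriv (w a) β =
      ∫ s in a..b, f' s β := fun β => by
    rw [intervalIntegral.integral_eq_sub_of_hasDerivAt_of_le hab
      (f := fun s => P (w s β) * deriv (w s) β)]
    · exact (hPd.continuous.comp_continuousOn (continuousOn_slice h.cont β)).mul
        (continuousOn_slice h.cont_deriv β)
    · intro s hs
      have hn := Icc_mem_nhds hs.1 hs.2
      have hs' := Ioo_subset_Icc_self hs
      have h1 := (h.hasDeriv s hs' β).hasDerivAt hn
      have h2 := (h.hasDeriv_deriv s hs' β).hasDerivAt hn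
      exact ((hPdiff _).hasFDerivAt.comp_hasDerivAt s h1).mul h2
    · refine ContinuousOn.intervalIntegrable ?_
      rw [uIcc_of_le hab]
      exact continuousOn_slice hf'c β
  have hinner : ∀ s ∈ Icc a b, ∫ β in (-(ℓ / 2))..(ℓ / 2), f' s β =
      -(2 * Real.pi * Complex.I) * (flux ℓ ψ (w s) (v s) : ℝ) := fun s hs =>
    integral_fderiv_potential_eq_flux (h.loop s hs) (h.vel s hs) hPd hPdbar
  rw [integral_mul_wn_eq (h.loop b (right_mem_Icc.2 hab)) hℓ hψ.continuous hc hP,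
    integral_mul_wn_eq (h.loop a (left_mem_Icc.2 hab)) hℓ hψ.continuous hc hP,
    ← Complex.sub_re, ← mul_sub, ← intervalIntegral.integral_sub]
  · have e1 : ∫ β in (-(ℓ / 2))..(ℓ / 2), (P (w b β) * deriv (w b) β - P (w a β) * deriv (w a) β) =
        -(2 * Real.pi * Complex.I) * ((∫ s in a..b, flux ℓ ψ (w s) (v s) : ℝ) : ℂ) := by
      simp_rw [hftc]
      rw [← integral_swap_of_continuousOn hab hf'c hℓ2, ← intervalIntegral.integral_ofReal,
        ← intervalIntegral.integral_const_mul]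
      refine intervalIntegral.integral_congr fun s hs => ?_
      rw [uIcc_of_le hab] at hs
      exact hinner s hs
    have hpi : (2 * Real.pi * Complex.I : ℂ) ≠ 0 := Complex.two_pi_I_ne_zero
    rw [e1, neg_mul, mul_neg, inv_mul_cancel_left₀ hpi, Complex.neg_re, Complex.ofReal_re]
  · have hw := h.loop b (right_mem_Icc.2 hab)
    exact ((hPd.continuous.comp hw.continuous).mul hw.continuous_deriv).intervalIntegrable _ _
  · have hw := h.loop a (left_mem_Icc.2 hab)
    exact ((hPd.continuous.comp hw.continuous).mul hw.continuous_deriv).intervalIntegrable _ _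

lemma LoopFamily.hasDerivWithinAt_integral_mul_wn (h : LoopFamily ℓ a b w v) (hℓ : 0 < ℓ)
    (hab : a ≤ b) {ψ : ℂ → ℝ} (hψ : ContDiff ℝ 1 ψ) (hc : HasCompactSupport ψ) {s : ℝ}
    (hs : s ∈ Icc a b) :
    HasDerivWithinAt (fun s => ∫ x, ψ x * wn ℓ (w s) x) (-flux ℓ ψ (w s) (v s)) (Icc a b) s := by
  have h1 := ((hasDerivWithinAt_primitive hab (h.continuousOn_flux hab hψ.continuous) hs).neg).const_add
    (∫ x, ψ x * wn ℓ (w a) x)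
  have h2 : ∀ r ∈ Icc a b, ∫ x, ψ x * wn ℓ (w r) x = (∫ x, ψ x * wn ℓ (w a) x) +
      -∫ s in a..r, flux ℓ ψ (w s) (v s) := fun r hr => by
    rw [← (h.mono le_rfl hr.2).integral_mul_wn_sub hℓ hr.1 hψ hc]; ring
  exact h1.congr h2 (h2 s hs)

end Family

/-! ### Strips between two loops -/

lemma clm_det_eq (L : ℂ →L[ℝ] ℂ) : L.det = inner ℝ (L Complex.I) (Complex.I * L 1) := by
  have h : L.det = LinearMap.det (L : ℂ →ₗ[ℝ] ℂ) := rfl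
  rw [h, ← LinearMap.det_toMatrix Complex.basisOneI, Matrix.det_fin_two, inner_eq]
  simp [LinearMap.toMatrix_apply]
  ring

lemma integrable_wn {ℓ : ℝ} {w : ℝ → ℂ} (h : IsLoop ℓ w) (hℓ : 0 < ℓ) : Integrable (wn ℓ w) := by
  obtain ⟨R, hR⟩ := h.exists_bound hℓ
  have hR0 : 0 ≤ R := (norm_nonneg _).trans (hR 0)
  let ψ : ContDiffBump (0 : ℂ) := ⟨R + 1, R + 2, by linarith, by linarith⟩
  refine (integrable_mul_wn h hℓ ψ.continuous ψ.hasCompactSupport).congr (ae_of_all _ fun x => ?_)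
  by_cases hx : ‖x‖ ≤ R
  · have : ψ x = 1 := ψ.one_of_mem_closedBall (by
      rw [Metric.mem_closedBall, dist_zero_right]; change ‖x‖ ≤ R + 1; linarith)
    simp [this]
  · simp [wn, windingNumber_eq_zero_of_norm_lt h hR (not_le.1 hx)]

/-- The curve `w + s p`. -/
def strip (w p : ℝ → ℂ) (s α : ℝ) : ℂ := w α + s • p α

/-- The region swept by the curves `w + s p`, `0 < s < 1`, where `p` does not vanish. -/
def stripRegion (w p : ℝ → ℂ) : Set ℂ :=
  {x | ∃ α s, p α ≠ 0 ∧ s ∈ Ioo (0 : ℝ) 1 ∧ x = strip w p s α}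

/-- The Jacobian of `(α, s) ↦ w α + s p α`, with the sign that makes it nonnegative when `p` points
to the right of the curves. -/
def stripJac (w p : ℝ → ℂ) (α s : ℝ) : ℝ :=
  -inner ℝ (p α) (Complex.I * (deriv w α + s • deriv p α))

/-- The curves `w + s p`, `0 ≤ s ≤ 1`, are disjoint, move to the right as `s` increases, and
meet only where `p = 0`. -/
structure IsStrip (ℓ : ℝ) (w p : ℝ → ℂ) : Prop where
  loop : IsLoop ℓ w
  loop_dir : IsLoop ℓ p
  jac_pos : ∀ α, p α ≠ 0 → ∀ s ∈ Icc (0 : ℝ) 1, 0 < stripJac w p α s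
  inj : ∀ α β, ∀ s ∈ Icc (0 : ℝ) 1, ∀ r ∈ Icc (0 : ℝ) 1, strip w p s α = strip w p r β →
    (∃ k : ℤ, β = α + k * ℓ) ∧ (s = r ∨ p α = 0)

section Strip

variable {ℓ : ℝ} {w p : ℝ → ℂ}

lemma isLoop_strip (hw : IsLoop ℓ w) (hp : IsLoop ℓ p) (s : ℝ) : IsLoop ℓ (strip w p s) where
  periodic α := by simp only [strip, hw.periodic α, hp.periodic α]
  contDiff := hw.contDiff.add (hp.contDiff.const_smul s)

lemma deriv_strip (hw : IsLoop ℓ w) (hp : IsLoop ℓ p) (s α : ℝ) :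
    deriv (strip w p s) α = deriv w α + s • deriv p α :=
  ((hw.hasDerivAt α).add ((hp.hasDerivAt α).const_smul s)).deriv

lemma strip_zero : strip w p 0 = w := by ext α; simp [strip]

lemma loopFamily_strip (hw : IsLoop ℓ w) (hp : IsLoop ℓ p) :
    LoopFamily ℓ 0 1 (strip w p) (fun _ => p) where
  loop s _ := isLoop_strip hw hp s
  vel _ _ := hp
  cont := by
    have := hw.continuous; have := hp.continuous
    unfold Function.uncurry strip
    fun_prop
  cont_deriv := by
    have := hw.continuous_deriv; have := hp.continuous_deriv
    simp only [Function.uncurry_def, deriv_strip hw hp]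
    fun_prop
  cont_vel := by
    have := hp.continuous
    simp only [Function.uncurry_def]
    fun_prop
  cont_vel_deriv := by
    have := hp.continuous_deriv
    simp only [Function.uncurry_def]
    fun_prop
  hasDeriv s _ α := by
    have := ((hasDerivAt_id s).smul_const (p α)).const_add (w α)
    simpa [strip] using this.hasDerivWithinAt
  hasDeriv_deriv s _ α := by
    have := ((hasDerivAt_id s).smul_const (deriv p α)).const_add (deriv w α)
    simp only [deriv_strip hw hp]
    simpa using this.hasDerivWithinAt

/-- The parametrization of a strip as a map of the plane. -/
def stripMap (w p : ℝ → ℂ) (ζ : ℂ) : ℂ := strip w p ζ.im ζ.re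

lemma contDiff_stripMap (hw : IsLoop ℓ w) (hp : IsLoop ℓ p) : ContDiff ℝ 1 (stripMap w p) :=
  (hw.contDiff.comp Complex.reCLM.contDiff).add
    (Complex.imCLM.contDiff.smul (hp.contDiff.comp Complex.reCLM.contDiff))

lemma hasFDerivAt_stripMap (hw : IsLoop ℓ w) (hp : IsLoop ℓ p) (ζ : ℂ) :
    HasFDerivAt (stripMap w p) (Complex.reCLM.smulRight (deriv w ζ.re + ζ.im • deriv p ζ.re) +
      Complex.imCLM.smulRight (p ζ.re)) ζ := by
  have h1 := (hw.hasDerivAt ζ.re).hasFDerivAt.comp ζ Complex.reCLM.hasFDerivAt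
  have h2 := (hp.hasDerivAt ζ.re).hasFDerivAt.comp ζ Complex.reCLM.hasFDerivAt
  refine (h1.add (Complex.imCLM.hasFDerivAt.smul h2)).congr_fderiv ?_
  ext v
  simp only [add_apply, ContinuousLinearMap.smulRight_apply,
    smul_apply, ContinuousLinearMap.comp_apply, Complex.reCLM_apply,
    Complex.imCLM_apply, ContinuousLinearMap.toSpanSingleton_apply, Function.comp_apply]
  module

lemma fderiv_stripMap (hw : IsLoop ℓ w) (hp : IsLoop ℓ p) (ζ : ℂ) :
    fderiv ℝ (stripMap w p) ζ 1 = deriv w ζ.re + ζ.im • deriv p ζ.re ∧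
    fderiv ℝ (stripMap w p) ζ Complex.I = p ζ.re := by
  rw [(hasFDerivAt_stripMap hw hp ζ).fderiv]; simp

lemma det_fderiv_stripMap (hw : IsLoop ℓ w) (hp : IsLoop ℓ p) (ζ : ℂ) :
    (fderiv ℝ (stripMap w p) ζ).det = -stripJac w p ζ.re ζ.im := by
  rw [clm_det_eq, (fderiv_stripMap hw hp ζ).1, (fderiv_stripMap hw hp ζ).2, stripJac, neg_neg]

lemma stripJac_eq_zero {α : ℝ} (h : p α = 0) (s : ℝ) : stripJac w p α s = 0 := by
  simp [stripJac, h]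

lemma continuous_stripJac (hw : IsLoop ℓ w) (hp : IsLoop ℓ p) :
    Continuous fun q : ℝ × ℝ => stripJac w p q.1 q.2 := by
  have := hw.continuous_deriv; have := hp.continuous_deriv; have := hp.continuous
  unfold stripJac
  fun_prop

/-- The set of parameters of the strip. -/
def stripParam (p : ℝ → ℂ) : Set ℂ := {ζ | p ζ.re ≠ 0 ∧ ζ.im ∈ Ioo (0 : ℝ) 1}

lemma isOpen_stripParam (hp : Continuous p) : IsOpen (stripParam p) :=
  (isOpen_ne_fun (hp.comp Complex.continuous_re) continuous_const).inter
    (isOpen_Ioo.preimage Complex.continuous_im)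

lemma stripRegion_eq_image : stripRegion w p = stripMap w p '' stripParam p := by
  ext x; constructor
  · rintro ⟨α, s, hα, hs, rfl⟩; exact ⟨⟨α, s⟩, ⟨hα, hs⟩, rfl⟩
  · rintro ⟨ζ, ⟨h1, h2⟩, rfl⟩; exact ⟨ζ.re, ζ.im, h1, h2, rfl⟩

lemma IsStrip.det_ne_zero (h : IsStrip ℓ w p) {ζ : ℂ} (hζ : ζ ∈ stripParam p) :
    (fderiv ℝ (stripMap w p) ζ).det ≠ 0 := by
  rw [det_fderiv_stripMap h.loop h.loop_dir]
  exact neg_ne_zero.2 (h.jac_pos _ hζ.1 _ (Ioo_subset_Icc_self hζ.2)).ne'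

/-- The derivative of the strip map as an equivalence. -/
def IsStrip.derivEquiv (h : IsStrip ℓ w p) {ζ : ℂ} (hζ : ζ ∈ stripParam p) : ℂ ≃L[ℝ] ℂ :=
  (fderiv ℝ (stripMap w p) ζ).toContinuousLinearEquivOfDetNeZero (h.det_ne_zero hζ)

lemma IsStrip.hasFDerivAt_equiv (h : IsStrip ℓ w p) {ζ : ℂ} (hζ : ζ ∈ stripParam p) :
    HasFDerivAt (stripMap w p) (h.derivEquiv hζ : ℂ →L[ℝ] ℂ) ζ := by
  have : (h.derivEquiv hζ : ℂ →L[ℝ] ℂ) = fderiv ℝ (stripMap w p) ζ := by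
    ext v; rfl
  rw [this]
  exact ((contDiff_stripMap h.loop h.loop_dir).differentiable one_ne_zero ζ).hasFDerivAt

lemma IsStrip.isOpen_stripRegion (h : IsStrip ℓ w p) : IsOpen (stripRegion w p) := by
  rw [stripRegion_eq_image, isOpen_iff_mem_nhds]
  rintro _ ⟨ζ, hζ, rfl⟩
  have hs : HasStrictFDerivAt (stripMap w p) (h.derivEquiv hζ : ℂ →L[ℝ] ℂ) ζ :=
    (contDiff_stripMap h.loop h.loop_dir).contDiffAt.hasStrictFDerivAt' (h.hasFDerivAt_equiv hζ)
      one_ne_zero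
  rw [← hs.map_nhds_eq_of_equiv]
  exact image_mem_map ((isOpen_stripParam h.loop_dir.continuous).mem_nhds hζ)

lemma exists_int_mem_Ioc (hℓ : 0 < ℓ) (α : ℝ) :
    ∃ k : ℤ, α + k * ℓ ∈ Ioc (-(ℓ / 2)) (ℓ / 2) := by
  obtain ⟨k, hk, -⟩ := existsUnique_add_zsmul_mem_Ioc hℓ α (-(ℓ / 2))
  refine ⟨k, ?_⟩
  simp only [zsmul_eq_mul] at hk
  rwa [show -(ℓ / 2) + ℓ = ℓ / 2 by ring] at hk

lemma periodic_int_mul {E : Type*} {f : ℝ → E} (hf : Function.Periodic f ℓ) (α : ℝ) (k : ℤ) :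
    f (α + k * ℓ) = f α := (hf.int_mul k) α

/-- Change of variables in a strip. -/
lemma IsStrip.setIntegral_stripRegion (h : IsStrip ℓ w p) (hℓ : 0 < ℓ) {F : Type*}
    [NormedAddCommGroup F] [NormedSpace ℝ F] (f : ℂ → F) :
    ∫ x in stripRegion w p, f x =
      ∫ q in Ioc (-(ℓ / 2)) (ℓ / 2) ×ˢ Ioo (0 : ℝ) 1,
        stripJac w p q.1 q.2 • f (strip w p q.2 q.1) := by
  set S : Set ℂ := {ζ | ζ.re ∈ Ioc (-(ℓ / 2)) (ℓ / 2)} ∩ stripParam p with hS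
  have hSm : MeasurableSet S := (Complex.measurable_re measurableSet_Ioc).inter
    (isOpen_stripParam h.loop_dir.continuous).measurableSet
  have himg : stripRegion w p = stripMap w p '' S := by
    ext x; constructor
    · rintro ⟨α, s, hα, hs, rfl⟩
      obtain ⟨k, hk⟩ := exists_int_mem_Ioc hℓ α
      refine ⟨⟨α + k * ℓ, s⟩, ⟨hk, ?_, hs⟩, ?_⟩
      · simpa [periodic_int_mul h.loop_dir.periodic] using hα
      · simp only [stripMap, periodic_int_mul (isLoop_strip h.loop h.loop_dir s).periodic]
    · rintro ⟨ζ, ⟨-, h1, h2⟩, rfl⟩; exact ⟨ζ.re, ζ.im, h1, h2, rfl⟩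
  have hinj : InjOn (stripMap w p) S := by
    rintro ζ ⟨hζ1, hζ2, hζ3⟩ ξ ⟨hξ1, hξ2, hξ3⟩ heq
    obtain ⟨⟨k, hk⟩, h2⟩ := h.inj _ _ _ (Ioo_subset_Icc_self hζ3) _ (Ioo_subset_Icc_self hξ3) heq
    have him := h2.resolve_right hζ2
    have hk0 : k = 0 := by
      simp only [mem_ofPred_eq, mem_Ioc] at hζ1 hξ1
      have h3 : (k : ℝ) < 1 := by
        by_contra hge; nlinarith [not_lt.1 hge]
      have h4 : (-1 : ℝ) < k := by
        by_contra hge; nlinarith [not_lt.1 hge]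
      have h3' : k < 1 := by exact_mod_cast h3
      have h4' : -1 < k := by exact_mod_cast h4
      omega
    refine Complex.ext ?_ him
    rw [hk, hk0]; simp
  have hdiff := (contDiff_stripMap h.loop h.loop_dir).differentiable one_ne_zero
  rw [himg, integral_image_eq_integral_abs_det_fderiv_smul volume hSm
    (fun ζ _ => (hdiff ζ).hasFDerivAt.hasFDerivWithinAt) hinj]
  have hsub : S ⊆ {ζ | ζ.re ∈ Ioc (-(ℓ / 2)) (ℓ / 2) ∧ ζ.im ∈ Ioo (0 : ℝ) 1} :=
    fun ζ hζ => ⟨hζ.1, hζ.2.2⟩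
  have hbig : MeasurableSet {ζ : ℂ | ζ.re ∈ Ioc (-(ℓ / 2)) (ℓ / 2) ∧ ζ.im ∈ Ioo (0 : ℝ) 1} :=
    (Complex.measurable_re measurableSet_Ioc).inter (Complex.measurable_im measurableSet_Ioo)
  have e1 : ∫ ζ in S, |(fderiv ℝ (stripMap w p) ζ).det| • f (stripMap w p ζ) =
      ∫ ζ in {ζ : ℂ | ζ.re ∈ Ioc (-(ℓ / 2)) (ℓ / 2) ∧ ζ.im ∈ Ioo (0 : ℝ) 1},
        stripJac w p ζ.re ζ.im • f (strip w p ζ.im ζ.re) := by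
    refine Eq.trans ?_ (setIntegral_eq_of_subset_of_forall_sdiff_eq_zero hbig hsub ?_).symm
    · refine setIntegral_congr_fun hSm fun ζ hζ => ?_
      simp only [det_fderiv_stripMap h.loop h.loop_dir, abs_neg]
      rw [abs_of_pos (h.jac_pos _ hζ.2.1 _ (Ioo_subset_Icc_self hζ.2.2))]; rfl
    · rintro ζ ⟨⟨h1, h2⟩, h3⟩
      have : p ζ.re = 0 := by
        by_contra hne; exact h3 ⟨h1, hne, h2⟩
      rw [stripJac_eq_zero this, zero_smul]
  rw [e1, ← Complex.volume_preserving_equiv_real_prod.symm.setIntegral_preimage_emb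
    Complex.measurableEquivRealProd.symm.measurableEmbedding]
  rfl

/-- The winding numbers of the two boundary curves of a strip differ by the indicator of the
strip. -/
lemma IsStrip.wn_sub_wn (h : IsStrip ℓ w p) (hℓ : 0 < ℓ) {x : ℂ} (hx0 : x ∉ range w)
    (hx1 : x ∉ range (strip w p 1)) :
    wn ℓ (strip w p 1) x - wn ℓ w x = (stripRegion w p).indicator 1 x := by
  have hl1 := isLoop_strip h.loop h.loop_dir 1
  have hℓ2 : -(ℓ / 2) ≤ ℓ / 2 := by linarith
  set K := (fun q : ℝ × ℝ => strip w p q.1 q.2) '' (Icc (0 : ℝ) 1 ×ˢ Icc (-(ℓ / 2)) (ℓ / 2)) with hK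
  have hcont : Continuous fun q : ℝ × ℝ => strip w p q.1 q.2 := by
    have := h.loop.continuous; have := h.loop_dir.continuous
    unfold strip; fun_prop
  have hKc : IsCompact K := (isCompact_Icc.prod isCompact_Icc).image hcont
  have hEK : stripRegion w p ⊆ K := by
    rintro _ ⟨α, s, -, hs, rfl⟩
    obtain ⟨k, hk⟩ := exists_int_mem_Ioc hℓ α
    exact ⟨(s, α + k * ℓ), ⟨Ioo_subset_Icc_self hs, Ioc_subset_Icc_self hk⟩,
      periodic_int_mul (isLoop_strip h.loop h.loop_dir s).periodic α k⟩
  have hKE : ∀ y ∈ K, y ∉ range w → y ∉ range (strip w p 1) → y ∈ stripRegion w p := by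
    rintro _ ⟨⟨s, α⟩, ⟨hs, -⟩, rfl⟩ h0 h1
    have hp : p α ≠ 0 := fun hp => h0 ⟨α, by simp [strip, hp]⟩
    refine ⟨α, s, hp, ⟨lt_of_le_of_ne hs.1 fun h' => ?_, lt_of_le_of_ne hs.2 fun h' => ?_⟩, rfl⟩
    · exact h0 ⟨α, by simp [strip, ← h']⟩
    · exact h1 ⟨α, by simp [h']⟩
  have hEo := h.isOpen_stripRegion
  have hEfin : volume (stripRegion w p) < ∞ := 
    (measure_mono hEK).trans_lt (hKc.measure_lt_top (μ := volume))
  have hEint : Integrable ((stripRegion w p).indicator (1 : ℂ → ℝ)) :=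
    (integrable_indicator_iff hEo.measurableSet).2 (integrableOn_const hEfin.ne)
  set f : ℂ → ℝ := fun x => wn ℓ (strip w p 1) x - wn ℓ w x - (stripRegion w p).indicator 1 x
    with hf
  have hfint : Integrable f := ((integrable_wn hl1 hℓ).sub (integrable_wn h.loop hℓ)).sub hEint
  -- Against a smooth function, the difference of the winding numbers is computed by the variation
  -- formula for the curves `w + s p`, and the indicator by the change of variables. Both give minus
  -- the same integral of fluxes.
  have hae : ∀ᵐ x, f x = 0 := by
    refine ae_eq_zero_of_integral_contDiff_smul_eq_zero hfint.locallyIntegrable fun g hg hgc => ?_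
    have hg1 : ContDiff ℝ 1 g := hg.of_le (by exact_mod_cast le_top)
    have hvar := (loopFamily_strip h.loop h.loop_dir).integral_mul_wn_sub hℓ zero_le_one hg1 hgc
    rw [strip_zero] at hvar
    have i1 := integrable_mul_wn hl1 hℓ hg1.continuous hgc
    have i0 := integrable_mul_wn h.loop hℓ hg1.continuous hgc
    have i2 : Integrable fun x => g x * (stripRegion w p).indicator 1 x := by
      have := (hg1.continuous.integrable_of_hasCompactSupport (μ := volume) hgc).indicator
        hEo.measurableSet
      refine this.congr (ae_of_all _ fun x => ?_)
      by_cases hx : x ∈ stripRegion w p <;> simp [hx]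
    have e2 : ∫ x, g x * (stripRegion w p).indicator 1 x = ∫ x in stripRegion w p, g x := by
      rw [← integral_indicator hEo.measurableSet]
      congr 1; ext x
      by_cases hx : x ∈ stripRegion w p <;> simp [hx]
    have e3 : ∫ x in stripRegion w p, g x =
        -∫ s in (0 : ℝ)..1, flux ℓ g (strip w p s) p := by
      have hc : Continuous fun q : ℝ × ℝ => stripJac w p q.1 q.2 • g (strip w p q.2 q.1) :=
        (continuous_stripJac h.loop h.loop_dir).smul (hg1.continuous.comp (hcont.comp continuous_swap))
      have hi : IntegrableOn (fun q : ℝ × ℝ => stripJac w p q.1 q.2 • g (strip w p q.2 q.1))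
          (Ioc (-(ℓ / 2)) (ℓ / 2) ×ˢ Ioo (0 : ℝ) 1) :=
        (hc.continuousOn.integrableOn_compact (isCompact_Icc.prod isCompact_Icc)).mono_set
          (prod_mono Ioc_subset_Icc_self Ioo_subset_Icc_self)
      rw [h.setIntegral_stripRegion hℓ, intervalIntegral.integral_of_le zero_le_one,
        ← integral_neg, integral_Ioc_eq_integral_Ioo, Measure.volume_eq_prod,
        ← Measure.prod_restrict, integral_prod_symm _ (by rw [Measure.prod_restrict]; exact hi)]
      refine setIntegral_congr_fun measurableSet_Ioo fun s _ => ?_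
      simp only [flux]
      rw [intervalIntegral.integral_of_le hℓ2, ← integral_neg]
      refine integral_congr_ae (ae_of_all _ fun α => ?_)
      simp only [stripJac, deriv_strip h.loop h.loop_dir, smul_eq_mul]; ring
    have : ∀ x, g x • f x = g x * wn ℓ (strip w p 1) x - g x * wn ℓ w x -
        g x * (stripRegion w p).indicator 1 x := fun x => by
      simp only [hf, smul_eq_mul]; ring
    simp_rw [this]
    have i01 : Integrable fun x => g x * wn ℓ (strip w p 1) x - g x * wn ℓ w x := i1.sub i0
    rw [integral_sub i01 i2, integral_sub i1 i0, hvar, e2, e3, sub_self]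
  -- Off the two boundary curves the compact set `K` and the open strip coincide, so the indicator
  -- is locally constant there. Continuity then upgrades the almost everywhere identity to the given
  -- point.
  have hind : ContinuousAt ((stripRegion w p).indicator (1 : ℂ → ℝ)) x := by
    by_cases hx : x ∈ stripRegion w p
    · refine continuousAt_const.congr (f := fun _ => (1 : ℝ)) ?_
      filter_upwards [hEo.mem_nhds hx] with y hy
      rw [indicator_of_mem hy]; rfl
    · have hxK : x ∈ Kᶜ := fun hxK => hx (hKE x hxK hx0 hx1)
      refine continuousAt_const.congr (f := fun _ => (0 : ℝ)) ?_
      filter_upwards [hKc.isClosed.isOpen_compl.mem_nhds hxK] with y hy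
      exact (indicator_of_notMem (fun hy' => hy (hEK hy')) _).symm
  have hfc : ContinuousAt f x :=
    ((continuousAt_wn hl1 hℓ hx1).sub (continuousAt_wn h.loop hℓ hx0)).sub hind
  have hdense := Measure.dense_of_ae hae
  have := hfc.continuousWithinAt.mem_closure_image (hdense x)
  have himg : f '' {x | f x = 0} ⊆ {0} := by rintro _ ⟨y, hy, rfl⟩; exact hy
  have h0 : f x = 0 := by simpa using closure_mono himg this
  exact sub_eq_zero.1 h0

/-- Part of a strip is a strip. -/
lemma IsStrip.sub (h : IsStrip ℓ w p) {a b : ℝ} (ha : 0 ≤ a) (hab : a < b) (hb : b ≤ 1) :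
    IsStrip ℓ (strip w p a) (fun α => (b - a) • p α) := by
  have hp : IsLoop ℓ (fun α => (b - a) • p α) :=
    ⟨fun α => by simp only [h.loop_dir.periodic α], h.loop_dir.contDiff.const_smul (b - a)⟩
  have hba : 0 < b - a := sub_pos.2 hab
  have hmem : ∀ s ∈ Icc (0 : ℝ) 1, a + s * (b - a) ∈ Icc (0 : ℝ) 1 := fun s hs =>
    ⟨by nlinarith [hs.1], by nlinarith [hs.2]⟩
  have hstrip : ∀ s α, strip (strip w p a) (fun α => (b - a) • p α) s α =
      strip w p (a + s * (b - a)) α := fun s α => by simp only [strip]; module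
  have hd : ∀ α, deriv (fun α => (b - a) • p α) α = (b - a) • deriv p α := fun α =>
    ((h.loop_dir.hasDerivAt α).const_smul (b - a)).deriv
  refine ⟨isLoop_strip h.loop h.loop_dir a, hp, fun α hα s hs => ?_, fun α β s hs r hr heq => ?_⟩
  · have hα' : p α ≠ 0 := fun h0 => hα (by simp [h0])
    have := h.jac_pos α hα' _ (hmem s hs)
    have e : stripJac (strip w p a) (fun α => (b - a) • p α) α s =
        (b - a) * stripJac w p α (a + s * (b - a)) := by
      simp only [stripJac, hd, deriv_strip h.loop h.loop_dir]
      rw [real_inner_smul_left, mul_neg]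
      congr 4; module
    rw [e]; positivity
  · rw [hstrip, hstrip] at heq
    obtain ⟨h1, h2⟩ := h.inj α β _ (hmem s hs) _ (hmem r hr) heq
    refine ⟨h1, h2.imp (fun h3 => ?_) fun h3 => by simp [h3]⟩
    have : s * (b - a) = r * (b - a) := by linarith
    exact mul_right_cancel₀ hba.ne' this

lemma mem_stripRegion_sub {a b : ℝ} (hab : a < b) {x : ℂ} :
    x ∈ stripRegion (strip w p a) (fun α => (b - a) • p α) ↔
      ∃ α s, p α ≠ 0 ∧ s ∈ Ioo a b ∧ x = strip w p s α := by
  have hba : 0 < b - a := sub_pos.2 hab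
  constructor
  · rintro ⟨α, s, hα, hs, rfl⟩
    refine ⟨α, a + s * (b - a), fun h0 => hα (by simp [h0]), ⟨by nlinarith [hs.1], by
      nlinarith [hs.2]⟩, ?_⟩
    simp only [strip]; module
  · rintro ⟨α, s, hα, hs, rfl⟩
    refine ⟨α, (s - a) / (b - a), smul_ne_zero hba.ne' hα,
      ⟨div_pos (by linarith [hs.1]) hba, (div_lt_one hba).2 (by linarith [hs.2])⟩, ?_⟩
    simp only [strip, smul_smul]
    rw [div_mul_cancel₀ _ hba.ne']; module

end Strip

/-! ### Interior and exterior of a loop with a collar -/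

section Jordan

variable {ℓ : ℝ} {w p : ℝ → ℂ}

lemma isPreconnected_norm_gt {R : ℝ} (hR : 0 ≤ R) : IsPreconnected {x : ℂ | R < ‖x‖} := by
  have h : {x : ℂ | R < ‖x‖} =
      (fun q : ℝ × ℝ => (q.1 : ℂ) * Complex.exp (q.2 * Complex.I)) '' (Ioi R ×ˢ univ) := by
    ext x; constructor
    · intro hx
      exact ⟨(‖x‖, x.arg), ⟨hx, mem_univ _⟩, Complex.norm_mul_exp_arg_mul_I x⟩
    · rintro ⟨q, ⟨hq, -⟩, rfl⟩
      simp only [mem_Ioi] at hq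
      simpa [abs_of_pos (hR.trans_lt hq)] using hq
  rw [h]
  refine (isPreconnected_Ioi.prod isPreconnected_univ).image _ ?_
  fun_prop

lemma exists_norm_gt_of_unbounded {s : Set ℂ} (hs : ¬ Bornology.IsBounded s) (R : ℝ) :
    ∃ y ∈ s, R < ‖y‖ := by
  by_contra! h
  exact hs (isBounded_iff_forall_norm_le.2 ⟨R, h⟩)

/-- An unbounded component contains points beyond the curve, where the winding number vanishes, and
the winding number is constant on components. -/
lemma wn_eq_zero_of_mem_exteriorDomain (h : IsLoop ℓ w) (hℓ : 0 < ℓ) {x : ℂ}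
    (hx : x ∈ exteriorDomain (range w)) : wn ℓ w x = 0 := by
  obtain ⟨R, hR⟩ := h.exists_bound hℓ
  obtain ⟨y, hy, hRy⟩ := exists_norm_gt_of_unbounded hx.2 R
  rw [wn, ← windingNumber_eq_of_mem_connectedComponentIn h hℓ hy,
    windingNumber_eq_zero_of_norm_lt h hR hRy, Complex.zero_re]

lemma mem_interior_or_exterior {Γ : Set ℂ} {x : ℂ} (hx : x ∉ Γ) :
    x ∈ interiorDomain Γ ∨ x ∈ exteriorDomain Γ := by
  by_cases h : Bornology.IsBounded (connectedComponentIn Γᶜ x)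
  · exact Or.inl ⟨hx, h⟩
  · exact Or.inr ⟨hx, h⟩

lemma isOpen_interiorDomain {Γ : Set ℂ} (hΓ : IsClosed Γ) : IsOpen (interiorDomain Γ) := by
  refine isOpen_iff_mem_nhds.2 fun x hx => ?_
  have hxΓ : x ∈ Γᶜ := hx.1
  filter_upwards [(hΓ.isOpen_compl.connectedComponentIn (x := x)).mem_nhds
    (mem_connectedComponentIn hxΓ)] with y hy
  refine ⟨connectedComponentIn_subset _ _ hy, ?_⟩
  rw [← connectedComponentIn_eq hy]; exact hx.2

lemma isOpen_exteriorDomain {Γ : Set ℂ} (hΓ : IsClosed Γ) : IsOpen (exteriorDomain Γ) := by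
  refine isOpen_iff_mem_nhds.2 fun x hx => ?_
  have hxΓ : x ∈ Γᶜ := hx.1
  filter_upwards [(hΓ.isOpen_compl.connectedComponentIn (x := x)).mem_nhds
    (mem_connectedComponentIn hxΓ)] with y hy
  refine ⟨connectedComponentIn_subset _ _ hy, ?_⟩
  rw [← connectedComponentIn_eq hy]; exact hx.2

/-- The set swept by the curves `w + s p` for `s` in an interval. -/
def sweep (w p : ℝ → ℂ) (a b : ℝ) : Set ℂ := {x | ∃ α s, s ∈ Ioo a b ∧ x = strip w p s α}

lemma isPreconnected_sweep (hw : Continuous w) (hp : Continuous p) (a b : ℝ) :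
    IsPreconnected (sweep w p a b) := by
  have h : sweep w p a b = (fun q : ℝ × ℝ => strip w p q.1 q.2) '' (Ioo a b ×ˢ univ) := by
    ext x; constructor
    · rintro ⟨α, s, hs, rfl⟩; exact ⟨(s, α), ⟨hs, mem_univ _⟩, rfl⟩
    · rintro ⟨q, ⟨hq, -⟩, rfl⟩; exact ⟨q.2, q.1, hq, rfl⟩
  rw [h]
  refine (isPreconnected_Ioo.prod isPreconnected_univ).image _ ?_
  unfold strip; fun_prop

/-- A connected component of the complement of the central curve of a strip meets one of the two
halves of the strip. -/
lemma IsStrip.component_meets_sweep (h : IsStrip ℓ w p) (hℓ : 0 < ℓ) (hp : ∀ α, p α ≠ 0) {y : ℂ}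
    (hy : y ∉ range (strip w p (1 / 2))) :
    ∃ q ∈ connectedComponentIn (range (strip w p (1 / 2)))ᶜ y,
      q ∈ sweep w p 0 (1 / 2) ∨ q ∈ sweep w p (1 / 2) 1 := by
  set Γ := range (strip w p (1 / 2))
  have hΓ : IsClosed Γ := ((isLoop_strip h.loop h.loop_dir _).isCompact_range hℓ).isClosed
  set U := connectedComponentIn Γᶜ y with hU
  have hUo : IsOpen U := hΓ.isOpen_compl.connectedComponentIn
  have hyU : y ∈ U := mem_connectedComponentIn hy
  have hUΓ : U ⊆ Γᶜ := connectedComponentIn_subset _ _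
  by_contra! hno
  -- If the component avoided both halves, no point of the curve could be in its closure, since such
  -- a point has a neighbourhood consisting of the two halves and the curve. A limit point off the
  -- curve is in the component anyway. So the component would be closed and open, hence the whole
  -- plane.
  have hclosed : IsClosed U := by
    refine isClosed_of_closure_subset fun q hq => ?_
    by_cases hqΓ : q ∈ Γ
    · exfalso
      obtain ⟨α, rfl⟩ := hqΓ
      have hmem : strip w p (1 / 2) α ∈ stripRegion w p :=
        ⟨α, 1 / 2, hp α, by norm_num, rfl⟩
      obtain ⟨q, ⟨β, s, -, hs, rfl⟩, hqU⟩ :=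
        mem_closure_iff.1 hq _ h.isOpen_stripRegion hmem
      rcases lt_trichotomy s (1 / 2) with h1 | h1 | h1
      · exact (hno _ hqU).1 ⟨β, s, ⟨hs.1, h1⟩, rfl⟩
      · exact hUΓ hqU ⟨β, by rw [h1]⟩
      · exact (hno _ hqU).2 ⟨β, s, ⟨h1, hs.2⟩, rfl⟩
    · have hV : IsOpen (connectedComponentIn Γᶜ q) := hΓ.isOpen_compl.connectedComponentIn
      obtain ⟨r, hr1, hr2⟩ := mem_closure_iff.1 hq _ hV (mem_connectedComponentIn hqΓ)
      have e1 := connectedComponentIn_eq hr1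
      have e2 := connectedComponentIn_eq hr2
      rw [hU, e2, ← e1]
      exact mem_connectedComponentIn hqΓ
  have huniv : U = univ := IsClopen.eq_univ ⟨hclosed, hUo⟩ ⟨y, hyU⟩
  exact hUΓ (huniv ▸ mem_univ (strip w p (1 / 2) 0)) ⟨0, rfl⟩

/-- The interior of the central curve of a strip is nonempty, and the winding number is constant
there, equal to `1` or `-1`. -/
lemma IsStrip.jordan (h : IsStrip ℓ w p) (hℓ : 0 < ℓ) (hp : ∀ α, p α ≠ 0) :
    (interiorDomain (range (strip w p (1 / 2)))).Nonempty ∧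
    ∃ ε : ℝ, (ε = 1 ∨ ε = -1) ∧
      ∀ x ∈ interiorDomain (range (strip w p (1 / 2))), wn ℓ (strip w p (1 / 2)) x = ε := by
  set M := strip w p (1 / 2) with hM
  have hMl : IsLoop ℓ M := isLoop_strip h.loop h.loop_dir _
  have hl1 : IsLoop ℓ (strip w p 1) := isLoop_strip h.loop h.loop_dir _
  have hsub := h.sub (a := 1 / 2) (b := 1) (by norm_num) (by norm_num) le_rfl
  have hend : strip (strip w p (1 / 2)) (fun α => ((1 : ℝ) - 1 / 2) • p α) 1 = strip w p 1 := by
    ext α; simp only [strip]; module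
  have hoff : ∀ s ∈ Icc (0 : ℝ) 1, ∀ r ∈ Icc (0 : ℝ) 1, s ≠ r → ∀ α,
      strip w p s α ∉ range (strip w p r) := by
    rintro s hs r hr hsr α ⟨β, hβ⟩
    exact ((h.inj α β s hs r hr hβ.symm).2).elim hsr (hp α)
  have hL : sweep w p 0 (1 / 2) ⊆ (range M)ᶜ := by
    rintro _ ⟨α, s, hs, rfl⟩
    exact hoff s ⟨hs.1.le, by linarith [hs.2]⟩ _ (by norm_num) hs.2.ne α
  have hR : sweep w p (1 / 2) 1 ⊆ (range M)ᶜ := by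
    rintro _ ⟨α, s, hs, rfl⟩
    exact hoff s ⟨by linarith [hs.1], hs.2.le⟩ _ (by norm_num) hs.1.ne' α
  have hN : sweep w p 0 1 ⊆ (range (strip w p 1))ᶜ := by
    rintro _ ⟨α, s, hs, rfl⟩
    exact hoff s ⟨hs.1.le, hs.2.le⟩ _ (by norm_num) hs.2.ne α
  have hLN : sweep w p 0 (1 / 2) ⊆ sweep w p 0 1 := by
    rintro _ ⟨α, s, hs, rfl⟩; exact ⟨α, s, ⟨hs.1, by linarith [hs.2]⟩, rfl⟩
  have hRN : sweep w p (1 / 2) 1 ⊆ sweep w p 0 1 := by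
    rintro _ ⟨α, s, hs, rfl⟩; exact ⟨α, s, ⟨by linarith [hs.1], hs.2⟩, rfl⟩
  have hc := h.loop.continuous
  have hcp := h.loop_dir.continuous
  -- The winding number of the last curve has one value `k` on the whole collar, because the collar
  -- is connected and misses that curve. Comparison through the half strip between the central and
  -- the last curve gives the value `k` for the central curve on one half and `k - 1` on the other.
  obtain ⟨k, hk⟩ : ∃ k, ∀ x ∈ sweep w p 0 1, wn ℓ (strip w p 1) x = k :=
    ⟨wn ℓ (strip w p 1) (strip w p (1 / 2) 0), fun x hx =>
      wn_eq_of_isPreconnected hl1 hℓ (isPreconnected_sweep hc hcp 0 1) hN hx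
        ⟨0, 1 / 2, by norm_num, rfl⟩⟩
  have hwL : ∀ x ∈ sweep w p 0 (1 / 2), wn ℓ M x = k := fun x hx => by
    have h1 := hsub.wn_sub_wn hℓ (hL hx) (by rw [hend]; exact hN (hLN hx))
    rw [hend, indicator_of_notMem, hk x (hLN hx)] at h1
    · linarith
    · rw [mem_stripRegion_sub (by norm_num)]
      rintro ⟨β, r, -, hr, hxr⟩
      obtain ⟨α, s, hs, rfl⟩ := hx
      have h2 := (h.inj α β s ⟨hs.1.le, by linarith [hs.2]⟩ r
        ⟨by linarith [hr.1], hr.2.le⟩ hxr).2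
      exact h2.elim (fun h3 => by linarith [hs.2, hr.1]) (hp α)
  have hwR : ∀ x ∈ sweep w p (1 / 2) 1, wn ℓ M x = k - 1 := fun x hx => by
    have h1 := hsub.wn_sub_wn hℓ (hR hx) (by rw [hend]; exact hN (hRN hx))
    rw [hend, indicator_of_mem, hk x (hRN hx)] at h1
    · simp only [Pi.one_apply] at h1; linarith
    · rw [mem_stripRegion_sub (by norm_num)]
      obtain ⟨α, s, hs, rfl⟩ := hx
      exact ⟨α, s, hp α, hs, rfl⟩
  have hLne : (sweep w p 0 (1 / 2)).Nonempty := ⟨_, 0, 1 / 4, by norm_num, rfl⟩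
  have hRne : (sweep w p (1 / 2) 1).Nonempty := ⟨_, 0, 3 / 4, by norm_num, rfl⟩
  have hcomp : ∀ y ∉ range M, sweep w p 0 (1 / 2) ⊆ connectedComponentIn (range M)ᶜ y ∨
      sweep w p (1 / 2) 1 ⊆ connectedComponentIn (range M)ᶜ y := fun y hy => by
    obtain ⟨q, hq, hq'⟩ := h.component_meets_sweep hℓ hp hy
    rw [connectedComponentIn_eq hq]
    exact hq'.imp
      (fun h1 => (isPreconnected_sweep hc hcp _ _).subset_connectedComponentIn h1 hL)
      (fun h1 => (isPreconnected_sweep hc hcp _ _).subset_connectedComponentIn h1 hR)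
  have hwc : ∀ {x y}, y ∈ connectedComponentIn (range M)ᶜ x → wn ℓ M y = wn ℓ M x := fun hy => by
    rw [wn, wn, windingNumber_eq_of_mem_connectedComponentIn hMl hℓ hy]
  obtain ⟨B, hB⟩ := hMl.exists_bound hℓ
  have hB0 : 0 ≤ B := (norm_nonneg _).trans (hB 0)
  have hfar : {x : ℂ | B < ‖x‖} ⊆ (range M)ᶜ := by
    rintro _ hx ⟨β, rfl⟩; exact absurd (hB β) (not_le.2 hx)
  have hy0 : ((B + 1 : ℝ) : ℂ) ∈ {x : ℂ | B < ‖x‖} := by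
    simp only [mem_ofPred_eq, Complex.norm_real, Real.norm_eq_abs]
    rw [abs_of_pos (by linarith)]; linarith
  set y0 : ℂ := ((B + 1 : ℝ) : ℂ)
  have hwy0 : wn ℓ M y0 = 0 := by
    rw [wn, windingNumber_eq_zero_of_norm_lt hMl hB hy0, Complex.zero_re]
  have hext : ∀ x, ¬ Bornology.IsBounded (connectedComponentIn (range M)ᶜ x) →
      connectedComponentIn (range M)ᶜ x = connectedComponentIn (range M)ᶜ y0 := fun x hx => by
    obtain ⟨y, hy, hBy⟩ := exists_norm_gt_of_unbounded hx B
    rw [connectedComponentIn_eq hy]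
    exact connectedComponentIn_eq
      ((isPreconnected_norm_gt hB0).subset_connectedComponentIn hBy hfar hy0)
  have hunb : ¬ Bornology.IsBounded (connectedComponentIn (range M)ᶜ y0) := fun hb => by
    obtain ⟨C, hC⟩ := isBounded_iff_forall_norm_le.1 hb
    have hsubset := (isPreconnected_norm_gt hB0).subset_connectedComponentIn hy0 hfar
    have hn : ‖((max B C + 1 : ℝ) : ℂ)‖ = max B C + 1 := by
      rw [Complex.norm_real, Real.norm_of_nonneg (by linarith [le_max_left B C])]
    have := hC _ (hsubset (a := ((max B C + 1 : ℝ) : ℂ)) (by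
      simp only [mem_ofPred_eq, hn]; linarith [le_max_left B C]))
    rw [hn] at this
    linarith [le_max_right B C]
  have hint : ∀ x ∈ interiorDomain (range M), ∀ q ∈ connectedComponentIn (range M)ᶜ y0,
      q ∉ connectedComponentIn (range M)ᶜ x := fun x hx q hq hq' => by
    refine hunb ?_
    rw [connectedComponentIn_eq hq, ← connectedComponentIn_eq hq']
    exact hx.2
  have hne_of : ∀ q, q ∉ range M → wn ℓ M q ≠ 0 → q ∈ interiorDomain (range M) :=
    fun q hq hq0 => (mem_interior_or_exterior hq).resolve_right
      fun he => hq0 (wn_eq_zero_of_mem_exteriorDomain hMl hℓ he)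
  -- Every component contains one of the two halves. The unbounded component contains one of them,
  -- and its winding number zero determines `k`. The other half then has winding number `1` or `-1`,
  -- so it lies in the interior, and it is the half contained in every bounded component.
  rcases hcomp y0 (hfar hy0) with hc0 | hc0
  · obtain ⟨q, hq⟩ := hLne
    have hk0 : k = 0 := by rw [← hwL q hq, hwc (hc0 hq), hwy0]
    refine ⟨?_, -1, Or.inr rfl, fun x hx => ?_⟩
    · obtain ⟨r, hr⟩ := hRne
      exact ⟨r, hne_of r (hR hr) (by rw [hwR r hr, hk0]; norm_num)⟩
    · rcases hcomp x hx.1 with h1 | h1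
      · exact absurd (h1 hq) (hint x hx q (hc0 hq))
      · obtain ⟨r, hr⟩ := hRne
        rw [← hwc (h1 hr), hwR r hr, hk0]; norm_num
  · obtain ⟨q, hq⟩ := hRne
    have hk0 : k - 1 = 0 := by rw [← hwR q hq, hwc (hc0 hq), hwy0]
    refine ⟨?_, 1, Or.inl rfl, fun x hx => ?_⟩
    · obtain ⟨r, hr⟩ := hLne
      exact ⟨r, hne_of r (hL hr) (by rw [hwL r hr]; linarith)⟩
    · rcases hcomp x hx.1 with h1 | h1
      · obtain ⟨r, hr⟩ := hLne
        rw [← hwc (h1 hr), hwL r hr]; linarith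
      · exact absurd (h1 hq) (hint x hx q (hc0 hq))

lemma exists_mean_value {f f' : ℝ → ℝ} (hf : ∀ x, HasDerivAt f (f' x) x) (a b : ℝ) :
    ∃ c, |c - a| ≤ |b - a| ∧ f b - f a = f' c * (b - a) := by
  have key : ∀ {a b : ℝ}, a < b → ∃ c ∈ Ioo a b, f b - f a = f' c * (b - a) := fun {a b} hab => by
    obtain ⟨c, hc, h⟩ := exists_hasDerivAt_eq_slope f f' hab
      (fun x _ => (hf x).continuousAt.continuousWithinAt) (fun x _ => hf x)
    exact ⟨c, hc, by rw [h, div_mul_cancel₀ _ (sub_pos.2 hab).ne']⟩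
  rcases lt_trichotomy a b with h | h | h
  · obtain ⟨c, hc, e⟩ := key h
    refine ⟨c, ?_, e⟩
    rw [abs_of_pos (sub_pos.2 hc.1), abs_of_pos (sub_pos.2 h)]; linarith [hc.2]
  · exact ⟨a, by simp, by simp [h]⟩
  · obtain ⟨c, hc, e⟩ := key h
    refine ⟨c, ?_, by linarith⟩
    rw [abs_of_neg (sub_neg.2 hc.2), abs_of_neg (sub_neg.2 h)]; linarith [hc.1]

lemma periodic_exists_bound {E : Type*} [NormedAddCommGroup E] {f : ℝ → E}
    (hf : Function.Periodic f ℓ) (hℓ : 0 < ℓ) (hc : Continuous f) : ∃ M, ∀ α, ‖f α‖ ≤ M := by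
  obtain ⟨R, hR⟩ := (hf.compact_of_continuous hℓ.ne' hc).isBounded.exists_norm_le
  exact ⟨R, fun β => hR _ ⟨β, rfl⟩⟩

lemma inner_I_mul_I_mul (v w : ℂ) : inner ℝ (Complex.I * v) (Complex.I * w) = inner ℝ v w := by
  simp only [inner_eq, Complex.I_mul_re, Complex.I_mul_im]; ring

lemma inner_I_mul_self (v : ℂ) : inner ℝ (Complex.I * v) v = 0 := by
  simp only [inner_eq, Complex.I_mul_re, Complex.I_mul_im]; ring

lemma norm_I_mul (v : ℂ) : ‖Complex.I * v‖ = ‖v‖ := by simp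

/-- A loop with the chord-arc property and a transversal `C^1` direction is the central curve of a
strip. -/
lemma exists_collar {τ : ℝ → ℂ} (hw : IsLoop ℓ w) (hτ : IsLoop ℓ τ) (hℓ : 0 < ℓ)
    (hτ1 : ∀ α, ‖τ α‖ = 1) (hangle : ∀ α, 0 < inner ℝ (deriv w α) (τ α)) {C : ℝ}
    (hC : ∀ α, ∀ β ∈ Icc (-(ℓ / 2)) (ℓ / 2), |β| ≤ C * ‖w α - w (α - β)‖) :
    ∃ W p, IsStrip ℓ W p ∧ (∀ α, p α ≠ 0) ∧ strip W p (1 / 2) = w := by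
  obtain ⟨M, hM⟩ := periodic_exists_bound (periodic_deriv hw.periodic) hℓ hw.continuous_deriv
  obtain ⟨L, hL⟩ := periodic_exists_bound (periodic_deriv hτ.periodic) hℓ hτ.continuous_deriv
  have hM0 : 0 ≤ M := (norm_nonneg _).trans (hM 0)
  have hL0 : 0 ≤ L := (norm_nonneg _).trans (hL 0)
  have hC0 : 0 ≤ C := by
    have h1 := hC 0 (ℓ / 2) ⟨by linarith, le_rfl⟩
    rw [abs_of_pos (by linarith)] at h1
    by_contra hneg
    nlinarith [norm_nonneg (w 0 - w (0 - ℓ / 2)), not_le.1 hneg]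
  obtain ⟨A, hA0, hA⟩ : ∃ A > 0, ∀ α, A ≤ inner ℝ (deriv w α) (τ α) := by
    have hper : Function.Periodic (fun α => inner ℝ (deriv w α) (τ α)) ℓ := fun α => by
      simp only [periodic_deriv hw.periodic α, hτ.periodic α]
    obtain ⟨m, ⟨α, rfl⟩, hm⟩ := (hper.compact_of_continuous hℓ.ne'
      (hw.continuous_deriv.inner hτ.continuous)).exists_isLeast (range_nonempty _)
    exact ⟨_, hangle α, fun β => hm ⟨β, rfl⟩⟩
  have hlip : ∀ a b, ‖τ a - τ b‖ ≤ L * |a - b| := fun a b =>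
    convex_univ.norm_image_sub_le_of_norm_deriv_le
      (fun x _ => hτ.contDiff.differentiable one_ne_zero x) (fun x _ => hL x) (mem_univ b)
      (mem_univ a)
  -- The width `e = A / (4 D)` of the collar satisfies `e L ≤ A / 4`, which keeps the Jacobian
  -- positive, and `e (2 M L C) ≤ A / 4`, which limits the rotation of `τ` between two points of the
  -- curve joined across the collar.
  set D := 1 + L + 2 * M * L * C with hD
  have hD1 : 1 ≤ D := by have : 0 ≤ 2 * M * L * C := by positivity
                         linarith
  set e := A / (4 * D) with he
  have he0 : 0 < e := by positivity
  have heD : e * D = A / 4 := by rw [he]; field_simp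
  have heL : e * L ≤ A / 4 := by
    rw [← heD]; gcongr; have : 0 ≤ 2 * M * L * C := by positivity
    linarith
  have heM : e * (2 * M * L * C) ≤ A / 4 := by
    rw [← heD]; gcongr; linarith
  have hstrip : ∀ s α, strip (fun α => w α + e • (Complex.I * τ α))
      (fun α => (-2 * e) • (Complex.I * τ α)) s α =
      w α + (e * (1 - 2 * s)) • (Complex.I * τ α) := fun s α => by
    simp only [strip]; module
  have hIτ : IsLoop ℓ fun α => Complex.I * τ α :=
    ⟨fun α => by simp only [hτ.periodic α], contDiff_const.mul hτ.contDiff⟩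
  have hdIτ : ∀ α, HasDerivAt (fun α => Complex.I * τ α) (Complex.I * deriv τ α) α := fun α =>
    (hτ.hasDerivAt α).const_mul _
  have hσ : ∀ s ∈ Icc (0 : ℝ) 1, |e * (1 - 2 * s)| ≤ e := fun s hs => by
    rw [abs_mul, abs_of_pos he0]
    exact mul_le_of_le_one_right he0.le (abs_le.2 ⟨by linarith [hs.2], by linarith [hs.1]⟩)
  have hτne : ∀ α, τ α ≠ 0 := fun α h0 => by simpa [h0] using hτ1 α
  refine ⟨fun α => w α + e • (Complex.I * τ α), fun α => (-2 * e) • (Complex.I * τ α),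
    ⟨⟨fun α => ?_, ?_⟩, ⟨fun α => ?_, ?_⟩, fun α _ s hs => ?_, fun α β s hs r hr heq => ?_⟩,
    fun α => ?_, ?_⟩
  · simp only [hw.periodic α, hτ.periodic α]
  · exact hw.contDiff.add (hIτ.contDiff.const_smul e)
  · simp only [hτ.periodic α]
  · exact hIτ.contDiff.const_smul (-2 * e)
  · have d1 : deriv (fun α => w α + e • (Complex.I * τ α)) α =
        deriv w α + e • (Complex.I * deriv τ α) :=
      ((hw.hasDerivAt α).add ((hdIτ α).const_smul e)).deriv
    have d2 : deriv (fun α => (-2 * e) • (Complex.I * τ α)) α =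
        (-2 * e) • (Complex.I * deriv τ α) := ((hdIτ α).const_smul (-2 * e)).deriv
    have e1 : stripJac (fun α => w α + e • (Complex.I * τ α))
        (fun α => (-2 * e) • (Complex.I * τ α)) α s =
        2 * e * (inner ℝ (deriv w α) (τ α) +
          e * (1 - 2 * s) * inner ℝ (Complex.I * deriv τ α) (τ α)) := by
      rw [stripJac, d1, d2, real_inner_smul_left, inner_I_mul_I_mul, smul_smul, add_assoc,
        ← add_smul, inner_add_right, real_inner_smul_right, real_inner_comm, real_inner_comm
          (τ α) (Complex.I * deriv τ α)]
      ring
    have h1 : |e * (1 - 2 * s) * inner ℝ (Complex.I * deriv τ α) (τ α)| ≤ e * L := by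
      rw [abs_mul]
      refine mul_le_mul (hσ s hs) ?_ (abs_nonneg _) he0.le
      refine (abs_real_inner_le_norm _ _).trans ?_
      rw [hτ1, mul_one, norm_I_mul]; exact hL α
    rw [e1]
    have h2 := hA α
    have h3 := (abs_le.1 h1).1
    have : 0 < inner ℝ (deriv w α) (τ α) +
          e * (1 - 2 * s) * inner ℝ (Complex.I * deriv τ α) (τ α) := by linarith
    positivity
  · rw [hstrip, hstrip] at heq
    set σ := e * (1 - 2 * s) with hσd
    set ρ := e * (1 - 2 * r) with hρd
    obtain ⟨k, hk⟩ := exists_int_mem_Ioc hℓ (α - β)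
    set b := α - β + k * ℓ with hb
    have hβ : α - b = β + (-k : ℤ) * ℓ := by rw [hb]; push_cast; ring
    have hwβ : w β = w (α - b) := by rw [hβ, periodic_int_mul hw.periodic]
    have hτβ : τ β = τ (α - b) := by rw [hβ, periodic_int_mul hτ.periodic]
    rw [hwβ, hτβ] at heq
    have hdiff : w α - w (α - b) = ρ • (Complex.I * τ (α - b)) - σ • (Complex.I * τ α) := by
      linear_combination (exp := 1) heq
    have hbC : |b| ≤ C * (2 * e) := by
      refine (hC α b (Ioc_subset_Icc_self hk)).trans (mul_le_mul_of_nonneg_left ?_ hC0)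
      rw [hdiff]
      refine (norm_sub_le _ _).trans ?_
      rw [norm_smul, norm_smul, norm_I_mul, norm_I_mul, hτ1, hτ1, Real.norm_eq_abs,
        Real.norm_eq_abs]
      linarith [hσ s hs, hσ r hr]
    -- If two points of the collar coincide, project the chord of the base points onto `τ α`. The
    -- mean value theorem makes the projection at least `A / 2 * |b|`. The normal displacements
    -- contribute at most `A / 4 * |b|`, because `i τ α` is orthogonal to `τ α` and only the change
    -- of `τ` counts. Hence `b = 0`.
    have hf : ∀ x, HasDerivAt (fun x => inner ℝ (w x) (τ α)) (inner ℝ (deriv w x) (τ α)) x :=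
      fun x => by
        have := (hw.hasDerivAt x).inner ℝ (hasDerivAt_const x (τ α))
        simpa using this
    obtain ⟨c, hc, hmv⟩ := exists_mean_value hf α (α - b)
    have hcb : |c - α| ≤ |b| := by simpa using hc
    have hlow : A / 2 ≤ inner ℝ (deriv w c) (τ α) := by
      have h1 : inner ℝ (deriv w c) (τ α) = inner ℝ (deriv w c) (τ c) -
          inner ℝ (deriv w c) (τ c - τ α) := by rw [inner_sub_right]; ring
      have h2 : |inner ℝ (deriv w c) (τ c - τ α)| ≤ A / 4 := by
        refine (abs_real_inner_le_norm _ _).trans ?_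
        calc ‖deriv w c‖ * ‖τ c - τ α‖ ≤ M * (L * (C * (2 * e))) := by
              gcongr
              · exact hM c
              · exact (hlip c α).trans (by gcongr; exact hcb.trans hbC)
          _ = e * (2 * M * L * C) := by ring
          _ ≤ A / 4 := heM
      linarith [hA c, (abs_le.1 h2).2]
    have hup : |inner ℝ (w α - w (α - b)) (τ α)| ≤ A / 4 * |b| := by
      have h1 : inner ℝ (w α - w (α - b)) (τ α) =
          ρ * inner ℝ (Complex.I * (τ (α - b) - τ α)) (τ α) := by
        rw [hdiff, mul_sub, inner_sub_left, inner_sub_left, real_inner_smul_left,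
          real_inner_smul_left, inner_I_mul_self]
        ring
      rw [h1, abs_mul]
      calc |ρ| * |inner ℝ (Complex.I * (τ (α - b) - τ α)) (τ α)| ≤ e * (L * |b|) := by
            refine mul_le_mul (hσ r hr) ?_ (abs_nonneg _) he0.le
            refine (abs_real_inner_le_norm _ _).trans ?_
            rw [hτ1, mul_one, norm_I_mul]
            simpa using hlip (α - b) α
        _ = e * L * |b| := by ring
        _ ≤ A / 4 * |b| := by gcongr
    have hb0 : b = 0 := by
      by_contra hne
      have hbp : 0 < |b| := abs_pos.2 hne
      have h1 : |inner ℝ (w α - w (α - b)) (τ α)| = inner ℝ (deriv w c) (τ α) * |b| := by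
        rw [inner_sub_left, abs_sub_comm, hmv, abs_mul, abs_of_pos (by linarith : (0:ℝ) < inner ℝ (deriv w c) (τ α))]
        simp
      rw [h1] at hup
      have := le_of_mul_le_mul_right hup hbp
      linarith
    refine ⟨⟨k, ?_⟩, Or.inl ?_⟩
    · have : α - β + k * ℓ = 0 := hb ▸ hb0
      linarith
    · rw [hb0, sub_zero, sub_self] at hdiff
      have h1 : (ρ - σ) • (Complex.I * τ α) = 0 := by rw [sub_smul]; exact hdiff.symm
      rcases smul_eq_zero.1 h1 with h2 | h2
      · have : e * (s - r) = 0 := by rw [hσd, hρd] at h2; linarith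
        rcases mul_eq_zero.1 this with h3 | h3
        · exact absurd h3 he0.ne'
        · linarith
      · exact absurd h2 (mul_ne_zero Complex.I_ne_zero (hτne α))
  · exact smul_ne_zero (by linarith) (mul_ne_zero Complex.I_ne_zero (hτne α))
  · ext α; rw [hstrip]; norm_num

end Jordan

/-! ### Regularity of the curves -/

section HolderBounds

variable {E : Type} [NormedAddCommGroup E]

lemma MemHolder.exists_norm_sub_le {δ : ℝ≥0} {f : ℝ → E} (h : MemHolder δ f) :
    ∃ H, 0 ≤ H ∧ ∀ α β, ‖f α - f β‖ ≤ H * |α - β| ^ (δ : ℝ) := by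
  obtain ⟨C, hC⟩ := h
  refine ⟨C, C.2, fun α β => ?_⟩
  have := hC.dist_le α β
  rwa [dist_eq_norm, Real.dist_eq] at this

lemma bounds_of_c1HolderNorm_le [NormedSpace ℝ E] {δ K : ℝ≥0} {f : ℝ → E} (h : c1HolderNorm δ f ≤ K) :
    (∀ α, ‖f α‖ ≤ K) ∧ (∀ α, ‖deriv f α‖ ≤ K) ∧
      ∀ α β, ‖deriv f α - deriv f β‖ ≤ K * |α - β| ^ (δ : ℝ) := by
  have h1 : max (⨆ α, ‖f α‖ₑ) (⨆ α, ‖deriv f α‖ₑ) ≤ K := le_self_add.trans h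
  have h2 : eHolderNorm δ (deriv f) ≤ K := le_add_self.trans h
  refine ⟨fun α => ?_, fun α => ?_, fun α β => ?_⟩
  · have := (le_iSup (fun α => ‖f α‖ₑ) α).trans ((le_max_left _ _).trans h1)
    exact_mod_cast (enorm_le_coe.1 this)
  · have := (le_iSup (fun α => ‖deriv f α‖ₑ) α).trans ((le_max_right _ _).trans h1)
    exact_mod_cast (enorm_le_coe.1 this)
  · have hm : MemHolder δ (deriv f) := eHolderNorm_lt_top.1 (h2.trans_lt ENNReal.coe_lt_top)
    have h3 : nnHolderNorm δ (deriv f) ≤ K := by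
      rw [← ENNReal.coe_le_coe, hm.coe_nnHolderNorm_eq_eHolderNorm]; exact h2
    have := hm.holderWith.dist_le α β
    rw [dist_eq_norm, Real.dist_eq] at this
    refine this.trans (mul_le_mul_of_nonneg_right (by exact_mod_cast h3) (by positivity))

lemma continuousOn_uncurry_of_uniform {S : Set ℝ} {f : ℝ → ℝ → E}
    (h : ∀ t ∈ S, ∀ ε > 0, ∀ᶠ s in 𝓝[S] t, ∀ α, ‖f s α - f t α‖ ≤ ε)
    (hc : ∀ t ∈ S, Continuous (f t)) : ContinuousOn (Function.uncurry f) (S ×ˢ univ) := by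
  rintro ⟨t, α⟩ ⟨ht, -⟩
  rw [ContinuousWithinAt, nhdsWithin_prod_eq, nhdsWithin_univ, Metric.tendsto_nhds]
  intro ε hε
  have h1 := (h t ht (ε / 2) (half_pos hε)).prod_inl (𝓝 α)
  have h2 : ∀ᶠ β in 𝓝 α, dist (f t β) (f t α) < ε / 2 :=
    Metric.tendsto_nhds.1 (hc t ht).continuousAt _ (half_pos hε)
  filter_upwards [h1, h2.prod_inr (𝓝[S] t)] with q hq1 hq2
  calc dist (f q.1 q.2) (f t α) ≤ dist (f q.1 q.2) (f t q.2) + dist (f t q.2) (f t α) :=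
        dist_triangle _ _ _
    _ < ε / 2 + ε / 2 := add_lt_add_of_le_of_lt (by rw [dist_eq_norm]; exact hq1 q.2) hq2
    _ = ε := add_halves ε

/-- Bounded and Hölder continuous with exponent `θ`. -/
def BddHolder (θ : ℝ) (f : ℝ → E) : Prop :=
  ∃ M, 0 ≤ M ∧ (∀ α, ‖f α‖ ≤ M) ∧ ∀ α β, ‖f α - f β‖ ≤ M * |α - β| ^ θ

/-- For a bounded function the Hölder exponent may be lowered: at distance at most `1` the smaller
power is larger, and beyond that the bound suffices. -/
lemma bddHolder_of_le {θ r : ℝ} (hθ : 0 < θ) (hr : θ ≤ r) {f : ℝ → E} {M H : ℝ}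
    (hM : ∀ α, ‖f α‖ ≤ M) (hH0 : 0 ≤ H) (hH : ∀ α β, ‖f α - f β‖ ≤ H * |α - β| ^ r) :
    BddHolder θ f := by
  have hM0 : 0 ≤ M := (norm_nonneg _).trans (hM 0)
  refine ⟨2 * M + H, by positivity, fun α => (hM α).trans (by linarith), fun α β => ?_⟩
  rcases le_total |α - β| 1 with h | h
  · have hpow : |α - β| ^ r ≤ |α - β| ^ θ := by
      rcases (abs_nonneg (α - β)).eq_or_lt with h0 | h0
      · rw [← h0, Real.zero_rpow hθ.ne', Real.zero_rpow (hθ.trans_le hr).ne']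
      · exact Real.rpow_le_rpow_of_exponent_ge h0 h hr
    calc ‖f α - f β‖ ≤ H * |α - β| ^ r := hH α β
      _ ≤ H * |α - β| ^ θ := by gcongr
      _ ≤ (2 * M + H) * |α - β| ^ θ := by gcongr; linarith
  · have h1 : 1 ≤ |α - β| ^ θ := Real.one_le_rpow h hθ.le
    calc ‖f α - f β‖ ≤ ‖f α‖ + ‖f β‖ := norm_sub_le _ _
      _ ≤ 2 * M := by linarith [hM α, hM β]
      _ ≤ (2 * M + H) * 1 := by linarith
      _ ≤ (2 * M + H) * |α - β| ^ θ := by gcongr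

lemma bddHolder_of_deriv_bound [NormedSpace ℝ E] {θ : ℝ} (hθ : 0 < θ) (hθ1 : θ ≤ 1) {f : ℝ → E} {M L : ℝ}
    (hd : Differentiable ℝ f) (hM : ∀ α, ‖f α‖ ≤ M) (hL : ∀ α, ‖deriv f α‖ ≤ L) :
    BddHolder θ f := by
  refine bddHolder_of_le hθ hθ1 hM ((norm_nonneg _).trans (hL 0)) fun α β => ?_
  rw [Real.rpow_one]
  exact convex_univ.norm_image_sub_le_of_norm_deriv_le (fun x _ => hd x) (fun x _ => hL x)
    (mem_univ β) (mem_univ α)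

lemma BddHolder.smul [NormedSpace ℝ E] {θ : ℝ} {f : ℝ → ℝ} {g : ℝ → E} (hf : BddHolder θ f) (hg : BddHolder θ g) :
    BddHolder θ fun α => f α • g α := by
  obtain ⟨M, hM0, hM, hMH⟩ := hf
  obtain ⟨N, hN0, hN, hNH⟩ := hg
  refine ⟨2 * M * N, by positivity, fun α => ?_, fun α β => ?_⟩
  · rw [norm_smul]
    calc ‖f α‖ * ‖g α‖ ≤ M * N := by gcongr; exacts [hM α, hN α]
      _ ≤ 2 * M * N := by nlinarith [mul_nonneg hM0 hN0]
  · rw [show f α • g α - f β • g β = f α • (g α - g β) + (f α - f β) • g β by module]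
    calc ‖f α • (g α - g β) + (f α - f β) • g β‖ ≤ ‖f α‖ * ‖g α - g β‖ + ‖f α - f β‖ * ‖g β‖ := by
          refine (norm_add_le _ _).trans ?_
          rw [norm_smul, norm_smul]
      _ ≤ M * (N * |α - β| ^ θ) + M * |α - β| ^ θ * N := by
          gcongr
          exacts [hM α, hNH α β, hMH α β, hN β]
      _ = 2 * M * N * |α - β| ^ θ := by ring

lemma BddHolder.add {θ : ℝ} {f g : ℝ → E} (hf : BddHolder θ f) (hg : BddHolder θ g) :
    BddHolder θ fun α => f α + g α := by
  obtain ⟨M, hM0, hM, hMH⟩ := hf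
  obtain ⟨N, hN0, hN, hNH⟩ := hg
  refine ⟨M + N, by positivity, fun α => (norm_add_le _ _).trans (add_le_add (hM α) (hN α)),
    fun α β => ?_⟩
  rw [add_sub_add_comm, add_mul]
  exact (norm_add_le _ _).trans (add_le_add (hMH α β) (hNH α β))

/-- A nonnegative function with Hölder continuous derivative controls its derivative. -/
lemma abs_deriv_le_rpow {c : ℝ → ℝ} (hc : Differentiable ℝ c) (hc0 : ∀ α, 0 ≤ c α) {θ H : ℝ}
    (hθ : 0 < θ) (hH0 : 0 ≤ H) (hH : ∀ α β, ‖deriv c α - deriv c β‖ ≤ H * |α - β| ^ θ) (α : ℝ) :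
    |deriv c α| ≤ (1 + H) * c α ^ (θ / (1 + θ)) := by
  rcases (hc0 α).eq_or_lt with h0 | h0
  · have hmin : IsLocalMin c α := Filter.Eventually.of_forall fun β => by rw [← h0]; exact hc0 β
    rw [hmin.deriv_eq_zero, abs_zero]
    have := Real.rpow_nonneg (hc0 α) (θ / (1 + θ)); positivity
  -- Nonnegativity of `c` at `α ± η` gives `|c'(α)| η ≤ c(α) + H η^(1+θ)`. This choice of `η` makes
  -- `c(α) = η^(1+θ)`, balancing the two terms.
  · set η := c α ^ (1 / (1 + θ)) with hη
    have hη0 : 0 < η := Real.rpow_pos_of_pos h0 _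
    have hηθ : η ^ θ = c α ^ (θ / (1 + θ)) := by
      rw [hη, ← Real.rpow_mul h0.le]; congr 1; field_simp
    have hcη : c α = η * η ^ θ := by
      rw [hηθ, hη, ← Real.rpow_add h0, ← add_div, div_self (by linarith), Real.rpow_one]
    have key : ∀ h : ℝ, |h| = η → -(deriv c α * h) ≤ c α + H * η ^ θ * η := fun h hh => by
      obtain ⟨ξ, hξ, e⟩ := exists_mean_value (fun x => (hc x).hasDerivAt) α (α + h)
      rw [add_sub_cancel_left, hh] at hξ
      have h1 : |deriv c ξ - deriv c α| ≤ H * η ^ θ :=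
        (hH ξ α).trans (by gcongr)
      have h2 : |(deriv c ξ - deriv c α) * h| ≤ H * η ^ θ * η := by
        rw [abs_mul, hh]; gcongr
      have h3 := (abs_le.1 h2).2
      have h4 := hc0 (α + h)
      rw [add_sub_cancel_left] at e
      linarith
    have h1 := key η (abs_of_pos hη0)
    have h2 := key (-η) (by rw [abs_neg, abs_of_pos hη0])
    rw [← hηθ]
    refine le_of_mul_le_mul_right ?_ hη0
    rw [← abs_of_pos hη0, ← abs_mul, abs_of_pos hη0]
    refine abs_le.2 ⟨?_, ?_⟩ <;> nlinarith

end HolderBounds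

/-! ### Curves depending on time in a `C^1` way with values in `C^{1,δ}` -/

section C1InTime

variable {ℓ T : ℝ} {δ : ℝ≥0} {z : ℝ → ℝ → ℂ}

lemma MemC1Holder.isLoop {f : ℝ → ℂ} (h : MemC1Holder ℓ δ f) : IsLoop ℓ f := ⟨h.1, h.2.1⟩

lemma eventually_bounds_of_tendsto {E : Type} [NormedAddCommGroup E] [NormedSpace ℝ E]
    {F : Filter ℝ} {f : ℝ → ℝ → E} (h : Tendsto (fun s => c1HolderNorm δ (f s)) F (𝓝 0)) {ε : ℝ}
    (hε : 0 < ε) :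
    ∀ᶠ s in F, (∀ α, ‖f s α‖ ≤ ε) ∧ (∀ α, ‖deriv (f s) α‖ ≤ ε) ∧
      ∀ α β, ‖deriv (f s) α - deriv (f s) β‖ ≤ ε * |α - β| ^ (δ : ℝ) := by
  lift ε to ℝ≥0 using hε.le
  have hε' : (0 : ℝ≥0∞) < ε := by exact_mod_cast hε
  filter_upwards [h.eventually_lt_const hε'] with s hs
  exact bounds_of_c1HolderNorm_le hs.le

lemma C1InTime.deriv_quotient (h : C1InTime ℓ δ T z) {s t : ℝ} (hs : s ∈ Icc 0 T)
    (ht : t ∈ Icc 0 T) (α : ℝ) :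
    deriv (fun α => (s - t)⁻¹ • (z s α - z t α) - timeDeriv T z t α) α =
      (s - t)⁻¹ • (deriv (z s) α - deriv (z t) α) - deriv (timeDeriv T z t) α := by
  have h1 : HasDerivAt (fun α => z s α - z t α) (deriv (z s) α - deriv (z t) α) α :=
    ((h.mem s hs).isLoop.hasDerivAt α).sub ((h.mem t ht).isLoop.hasDerivAt α)
  have h2 : HasDerivAt (fun α => (s - t)⁻¹ • (z s α - z t α))
      ((s - t)⁻¹ • (deriv (z s) α - deriv (z t) α)) α := h1.const_smul (s - t)⁻¹
  have h3 : HasDerivAt (fun α => (s - t)⁻¹ • (z s α - z t α) - timeDeriv T z t α)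
      ((s - t)⁻¹ • (deriv (z s) α - deriv (z t) α) - deriv (timeDeriv T z t) α) α :=
    h2.sub ((h.mem_deriv t ht).isLoop.hasDerivAt α)
  exact h3.deriv

lemma C1InTime.hasDerivWithinAt (h : C1InTime ℓ δ T z) {t : ℝ} (ht : t ∈ Icc 0 T) (α : ℝ) :
    HasDerivWithinAt (fun s => z s α) (timeDeriv T z t α) (Icc 0 T) t ∧
    HasDerivWithinAt (fun s => deriv (z s) α) (deriv (timeDeriv T z t) α) (Icc 0 T) t := by
  have hmem : ∀ᶠ s in 𝓝[Icc 0 T \ {t}] t, s ∈ Icc 0 T :=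
    (eventually_mem_nhdsWithin).mono fun s hs => hs.1
  constructor <;> rw [hasDerivWithinAt_iff_tendsto_slope, Metric.tendsto_nhds] <;> intro ε hε <;>
    filter_upwards [eventually_bounds_of_tendsto (h.differentiable t ht) (half_pos hε), hmem]
      with s hs hsT
  · rw [dist_eq_norm, slope_def_module]
    exact (hs.1 α).trans_lt (half_lt_self hε)
  · rw [dist_eq_norm, slope_def_module, ← h.deriv_quotient hsT ht]
    exact (hs.2.1 α).trans_lt (half_lt_self hε)

lemma MemC1Holder.exists_bounds {f : ℝ → ℂ} (h : MemC1Holder ℓ δ f) (hℓ : 0 < ℓ) :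
    ∃ N, 0 ≤ N ∧ (∀ α, ‖f α‖ ≤ N) ∧ (∀ α, ‖deriv f α‖ ≤ N) ∧
      ∀ α β, ‖deriv f α - deriv f β‖ ≤ N * |α - β| ^ (δ : ℝ) := by
  obtain ⟨A, hA⟩ := periodic_exists_bound h.1 hℓ h.2.1.continuous
  obtain ⟨A', hA'⟩ := periodic_exists_bound (periodic_deriv h.1) hℓ (h.2.1.continuous_deriv le_rfl)
  obtain ⟨H, hH0, hH⟩ := MemHolder.exists_norm_sub_le h.2.2
  have h1 : 0 ≤ A := (norm_nonneg _).trans (hA 0)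
  have h2 : 0 ≤ A' := (norm_nonneg _).trans (hA' 0)
  refine ⟨A + A' + H, by positivity, fun α => (hA α).trans (by linarith),
    fun α => (hA' α).trans (by linarith), fun α β => (hH α β).trans ?_⟩
  gcongr; linarith

/-- Continuity in time with values in `C^{1,δ}`. -/
lemma C1InTime.eventually_sub_le (h : C1InTime ℓ δ T z) (hℓ : 0 < ℓ) {t : ℝ} (ht : t ∈ Icc 0 T)
    {ε : ℝ} (hε : 0 < ε) :
    ∀ᶠ s in 𝓝[Icc 0 T] t, (∀ α, ‖z s α - z t α‖ ≤ ε) ∧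
      (∀ α, ‖deriv (z s) α - deriv (z t) α‖ ≤ ε) ∧
      ∀ α β, ‖(deriv (z s) α - deriv (z t) α) - (deriv (z s) β - deriv (z t) β)‖ ≤
        ε * |α - β| ^ (δ : ℝ) := by
  obtain ⟨N, hN0, hN1, hN2, hN3⟩ := (h.mem_deriv t ht).exists_bounds hℓ
  have hq := eventually_nhdsWithin_iff.1 (eventually_bounds_of_tendsto (h.differentiable t ht)
    one_pos)
  have hsmall : ∀ᶠ s in 𝓝 t, |s - t| * (1 + N) < ε := by
    have : Tendsto (fun s => |s - t| * (1 + N)) (𝓝 t) (𝓝 0) := by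
      have hc : Continuous fun s => |s - t| * (1 + N) := by fun_prop
      simpa using hc.tendsto t
    exact this.eventually_lt_const hε
  rw [eventually_nhdsWithin_iff]
  filter_upwards [hq, hsmall] with s hqs hss hs
  rcases eq_or_ne s t with rfl | hne
  · simp only [sub_self, norm_zero]
    exact ⟨fun _ => hε.le, fun _ => hε.le, fun _ _ => by positivity⟩
  · obtain ⟨h1, h2, h3⟩ := hqs ⟨hs, hne⟩
    have hst : s - t ≠ 0 := sub_ne_zero.2 hne
    have e0 : ∀ v u : ℂ, v = (s - t) • (((s - t)⁻¹ • v - u) + u) := fun v u => by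
      rw [sub_add_cancel, smul_smul, mul_inv_cancel₀ hst, one_smul]
    simp only [h.deriv_quotient hs ht] at h2 h3
    refine ⟨fun α => ?_, fun α => ?_, fun α β => ?_⟩
    · rw [e0 (z s α - z t α) (timeDeriv T z t α), norm_smul, Real.norm_eq_abs]
      refine le_trans ?_ hss.le
      gcongr
      exact (norm_add_le _ _).trans (add_le_add (h1 α) (hN1 α))
    · rw [e0 (deriv (z s) α - deriv (z t) α) (deriv (timeDeriv T z t) α), norm_smul,
        Real.norm_eq_abs]
      refine le_trans ?_ hss.le
      gcongr
      exact (norm_add_le _ _).trans (add_le_add (h2 α) (hN2 α))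
    · rw [e0 (deriv (z s) α - deriv (z t) α) (deriv (timeDeriv T z t) α),
        e0 (deriv (z s) β - deriv (z t) β) (deriv (timeDeriv T z t) β), ← smul_sub, norm_smul,
        Real.norm_eq_abs, add_sub_add_comm]
      calc |s - t| * ‖_ + _‖ ≤ |s - t| * (1 * |α - β| ^ (δ : ℝ) + N * |α - β| ^ (δ : ℝ)) := by
            gcongr
            exact (norm_add_le _ _).trans (add_le_add (h3 α β) (hN3 α β))
        _ = |s - t| * (1 + N) * |α - β| ^ (δ : ℝ) := by ring
        _ ≤ ε * |α - β| ^ (δ : ℝ) := by gcongr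

lemma C1InTime.loopFamily (h : C1InTime ℓ δ T z) (hℓ : 0 < ℓ) :
    LoopFamily ℓ 0 T z (timeDeriv T z) where
  loop t ht := (h.mem t ht).isLoop
  vel t ht := (h.mem_deriv t ht).isLoop
  cont := continuousOn_uncurry_of_uniform
    (fun t ht ε hε => (h.eventually_sub_le hℓ ht hε).mono fun s hs => hs.1)
    fun t ht => (h.mem t ht).isLoop.continuous
  cont_deriv := continuousOn_uncurry_of_uniform
    (fun t ht ε hε => (h.eventually_sub_le hℓ ht hε).mono fun s hs => hs.2.1)
    fun t ht => (h.mem t ht).isLoop.continuous_deriv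
  cont_vel := continuousOn_uncurry_of_uniform
    (fun t ht ε hε => (eventually_bounds_of_tendsto (h.continuous_deriv t ht) hε).mono
      fun s hs => hs.1)
    fun t ht => (h.mem_deriv t ht).isLoop.continuous
  cont_vel_deriv := continuousOn_uncurry_of_uniform
    (fun t ht ε hε => by
      filter_upwards [eventually_bounds_of_tendsto (h.continuous_deriv t ht) hε,
        self_mem_nhdsWithin] with s hs hsT α
      have : deriv (fun α => timeDeriv T z s α - timeDeriv T z t α) α =
          deriv (timeDeriv T z s) α - deriv (timeDeriv T z t) α :=
        (((h.mem_deriv s hsT).isLoop.hasDerivAt α).sub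
          ((h.mem_deriv t ht).isLoop.hasDerivAt α)).deriv
      rw [← this]; exact hs.2.1 α)
    fun t ht => (h.mem_deriv t ht).isLoop.continuous_deriv
  hasDeriv t ht α := (h.hasDerivWithinAt ht α).1
  hasDeriv_deriv t ht α := (h.hasDerivWithinAt ht α).2

/-- Continuity in time with values in `C^{1,δ}` gives a bound near each time, and compactness of
`[0,T]` makes it uniform. -/
lemma C1InTime.exists_holder_bound (h : C1InTime ℓ δ T z) (hℓ : 0 < ℓ) :
    ∃ H, 0 ≤ H ∧ ∀ t ∈ Icc 0 T, (∀ α, ‖deriv (z t) α‖ ≤ H) ∧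
      ∀ α β, ‖deriv (z t) α - deriv (z t) β‖ ≤ H * |α - β| ^ (δ : ℝ) := by
  refine isCompact_Icc.induction_on (p := fun S => ∃ H, 0 ≤ H ∧ ∀ t ∈ S,
    (∀ α, ‖deriv (z t) α‖ ≤ H) ∧
      ∀ α β, ‖deriv (z t) α - deriv (z t) β‖ ≤ H * |α - β| ^ (δ : ℝ)) ?_ ?_ ?_ ?_
  · exact ⟨0, le_rfl, by simp⟩
  · rintro S S' hSS ⟨H, hH0, hH⟩
    exact ⟨H, hH0, fun t ht => hH t (hSS ht)⟩
  · rintro S S' ⟨H, hH0, hH⟩ ⟨H', hH0', hH'⟩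
    refine ⟨H + H', by positivity, ?_⟩
    rintro t (ht | ht)
    · refine ⟨fun α => ((hH t ht).1 α).trans (by linarith), fun α β => ((hH t ht).2 α β).trans ?_⟩
      gcongr; linarith
    · refine ⟨fun α => ((hH' t ht).1 α).trans (by linarith), fun α β => ((hH' t ht).2 α β).trans ?_⟩
      gcongr; linarith
  · intro t ht
    obtain ⟨N, hN0, -, hN2, hN3⟩ := (h.mem t ht).exists_bounds hℓ
    refine ⟨_, h.eventually_sub_le hℓ ht one_pos, N + 1, by positivity, fun s hs => ?_⟩
    obtain ⟨-, h2, h3⟩ := hs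
    refine ⟨fun α => ?_, fun α β => ?_⟩
    · rw [show deriv (z s) α = deriv (z t) α + (deriv (z s) α - deriv (z t) α) by ring]
      exact (norm_add_le _ _).trans (add_le_add (hN2 α) (h2 α))
    · rw [show deriv (z s) α - deriv (z s) β = (deriv (z t) α - deriv (z t) β) +
        ((deriv (z s) α - deriv (z t) α) - (deriv (z s) β - deriv (z t) β)) by ring, add_mul]
      exact (norm_add_le _ _).trans (add_le_add (hN3 α β) (h3 α β))

end C1InTime

/-! ### The curves of an admissible configuration -/

/-- The direction `c τ^⊥` in which the mixing zone grows. -/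
def mixDir (c : ℝ → ℝ) (z : ℝ → ℝ → ℂ) (α : ℝ) : ℂ := c α • (Complex.I * deriv (z 0) α)

/-- The velocity `∂_t z_a`. -/
def zVel (T : ℝ) (c : ℝ → ℝ) (z : ℝ → ℝ → ℂ) (a t α : ℝ) : ℂ :=
  timeDeriv T z t α - a • mixDir c z α

/-- Two loops that satisfy a mutual chord-arc condition, with tangents that are Hölder close in
terms of the distance of the points. -/
structure IsClosePair (ℓ C κ : ℝ) (w u : ℝ → ℂ) : Prop where
  chord : ∀ α, ∀ β ∈ Icc (-(ℓ / 2)) (ℓ / 2), |β| ≤ C * ‖w α - u (α - β)‖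
  holder : ∀ α, ∀ β ∈ Icc (-(ℓ / 2)) (ℓ / 2),
    ‖deriv w α - deriv u (α - β)‖ ≤ C * ‖w α - u (α - β)‖ ^ κ

section Admissible

variable {ℓ T : ℝ} {δ : ℝ≥0} {c : ℝ → ℝ} {z : ℝ → ℝ → ℂ}

lemma zLam_eq (a t : ℝ) : zLam c z a t = fun α => z t α - (a * t) • mixDir c z α := by
  ext α
  simp only [zLam, mixDir, Complex.real_smul]; push_cast; ring

lemma Admissible.isLoop_tangent (h : Admissible ℓ δ T c z) : IsLoop ℓ (deriv (z 0)) where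
  periodic := periodic_deriv h.z_init_mem.1
  contDiff := ((contDiff_succ_iff_deriv (n := 1)).1 (by
    rw [one_add_one_eq_two]; exact h.z_init_mem.2.1)).2.2

lemma Admissible.isLoop_mixDir (h : Admissible ℓ δ T c z) : IsLoop ℓ (mixDir c z) where
  periodic α := by simp only [mixDir, h.c_mem.1 α, h.isLoop_tangent.periodic α]
  contDiff := h.c_mem.2.1.smul (contDiff_const.mul h.isLoop_tangent.contDiff)

lemma Admissible.isLoop_zLam (h : Admissible ℓ δ T c z) (a : ℝ) {t : ℝ} (ht : t ∈ Icc 0 T) :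
    IsLoop ℓ (zLam c z a t) := by
  rw [zLam_eq]
  exact ⟨fun α => by simp only [(h.z_mem.mem t ht).1 α, h.isLoop_mixDir.periodic α],
    (h.z_mem.mem t ht).2.1.sub (h.isLoop_mixDir.contDiff.const_smul (a * t))⟩

lemma Admissible.deriv_zLam (h : Admissible ℓ δ T c z) (a : ℝ) {t : ℝ} (ht : t ∈ Icc 0 T) (α : ℝ) :
    deriv (zLam c z a t) α = deriv (z t) α - (a * t) • deriv (mixDir c z) α := by
  rw [zLam_eq]
  exact (((h.z_mem.mem t ht).isLoop.hasDerivAt α).sub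
    ((h.isLoop_mixDir.hasDerivAt α).const_smul (a * t))).deriv

lemma Admissible.loopFamily (h : Admissible ℓ δ T c z) (hℓ : 0 < ℓ) (a : ℝ) :
    LoopFamily ℓ 0 T (zLam c z a) (zVel T c z a) := by
  have hz := h.z_mem.loopFamily hℓ
  have hd := h.isLoop_mixDir
  have hvel : ∀ t ∈ Icc 0 T, ∀ α,
      deriv (zVel T c z a t) α = deriv (timeDeriv T z t) α - a • deriv (mixDir c z) α :=
    fun t ht α => (((hz.vel t ht).hasDerivAt α).sub ((hd.hasDerivAt α).const_smul a)).deriv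
  have c1 : Continuous fun q : ℝ × ℝ => (a * q.1) • mixDir c z q.2 :=
    (continuous_const.mul continuous_fst).smul (hd.continuous.comp continuous_snd)
  have c2 : Continuous fun q : ℝ × ℝ => (a * q.1) • deriv (mixDir c z) q.2 :=
    (continuous_const.mul continuous_fst).smul (hd.continuous_deriv.comp continuous_snd)
  have c3 : Continuous fun q : ℝ × ℝ => a • mixDir c z q.2 :=
    (hd.continuous.comp continuous_snd).const_smul a
  have c4 : Continuous fun q : ℝ × ℝ => a • deriv (mixDir c z) q.2 :=
    (hd.continuous_deriv.comp continuous_snd).const_smul a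
  refine ⟨fun t ht => h.isLoop_zLam a ht, fun t ht => ⟨fun α => ?_, ?_⟩, ?_, ?_, ?_, ?_, ?_, ?_⟩
  · simp only [zVel, (hz.vel t ht).periodic α, hd.periodic α]
  · exact (hz.vel t ht).contDiff.sub (hd.contDiff.const_smul a)
  · refine (hz.cont.sub c1.continuousOn).congr fun q _ => ?_
    simp only [Function.uncurry_def, zLam_eq]; rfl
  · refine (hz.cont_deriv.sub c2.continuousOn).congr fun q hq => ?_
    simp only [Function.uncurry_def, h.deriv_zLam a hq.1]; rfl
  · exact hz.cont_vel.sub c3.continuousOn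
  · refine (hz.cont_vel_deriv.sub c4.continuousOn).congr fun q hq => ?_
    simp only [Function.uncurry_def, hvel q.1 hq.1]; rfl
  · intro t ht α
    have h1 : HasDerivWithinAt (fun r : ℝ => (a * r) • mixDir c z α) (a • mixDir c z α)
        (Icc 0 T) t := by
      simpa using (((hasDerivAt_id t).const_mul a).smul_const (mixDir c z α)).hasDerivWithinAt
    simp only [zLam_eq]
    exact (hz.hasDeriv t ht α).sub h1
  · intro t ht α
    have h1 : HasDerivWithinAt (fun r : ℝ => (a * r) • deriv (mixDir c z) α)
        (a • deriv (mixDir c z) α) (Icc 0 T) t := by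
      simpa using (((hasDerivAt_id t).const_mul a).smul_const
        (deriv (mixDir c z) α)).hasDerivWithinAt
    rw [hvel t ht]
    exact ((hz.hasDeriv_deriv t ht α).sub h1).congr (fun r hr => h.deriv_zLam a hr α)
      (h.deriv_zLam a ht α)

lemma Admissible.timeDeriv_zLam (h : Admissible ℓ δ T c z) (hℓ : 0 < ℓ) (hT : 0 < T) (a : ℝ)
    {t : ℝ} (ht : t ∈ Icc 0 T) (α : ℝ) : timeDeriv T (zLam c z a) t α = zVel T c z a t α :=
  ((h.loopFamily hℓ a).hasDeriv t ht α).derivWithin (uniqueDiffOn_Icc hT t ht)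

lemma zVel_eq_timeDeriv_of_c_eq_zero {a t α : ℝ} (hc : c α = 0) :
    zVel T c z a t α = timeDeriv T z t α := by simp [zVel, mixDir, hc]

lemma Admissible.inner_deriv_pos (h : Admissible ℓ δ T c z) {t : ℝ} (ht : t ∈ Icc 0 T) {a : ℝ}
    (ha : a ∈ Icc (-1 : ℝ) 1) (α : ℝ) : 0 < inner ℝ (deriv (zLam c z a t) α) (deriv (z 0) α) := by
  obtain ⟨A, hA, hh⟩ := h.angle
  have h1 := hA.trans_le (hh t ht a ha α)
  rw [real_inner_smul_left] at h1
  exact pos_of_mul_pos_right h1 (by positivity)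

lemma Admissible.chord (h : Admissible ℓ δ T c z) :
    ∃ C, 0 < C ∧ ∀ t ∈ Icc 0 T, ∀ a ∈ Icc (-1 : ℝ) 1, ∀ b ∈ Icc (-1 : ℝ) 1, ∀ α,
      ∀ β ∈ Icc (-(ℓ / 2)) (ℓ / 2),
      |β| ≤ C * ‖zLam c z a t α - zLam c z b t (α - β)‖ ∧
      |(a - b) * t * c α| ≤ C * ‖zLam c z a t α - zLam c z b t (α - β)‖ := by
  obtain ⟨C, hC⟩ := h.chordArc
  refine ⟨max C 1, by positivity, fun t ht a ha b hb α β hβ => ?_⟩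
  have h1 : √(β ^ 2 + ((a - b) * t * c α) ^ 2) ≤
      max C 1 * ‖zLam c z a t α - zLam c z b t (α - β)‖ :=
    (hC t ht a ha b hb α β hβ).trans (by gcongr; exact le_max_left _ _)
  exact ⟨(Real.abs_le_sqrt (by nlinarith [sq_nonneg ((a - b) * t * c α)])).trans h1,
    (Real.abs_le_sqrt (by nlinarith [sq_nonneg β])).trans h1⟩

/-- The tangents of `z_a` at `α` and of `z_b` at `α - β` differ by Hölder increments in `β` and by
`(a - b) t` times the derivative of `c τ^⊥` at `α`. The latter does not shrink with `β`. But a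
nonnegative function with Hölder derivative satisfies `|c'| ≲ c^κ` with `κ = θ / (1 + θ)`, and the
chord-arc condition bounds `|(a - b) t c|` by the distance of the two points. Both parts are
therefore controlled by that distance to the power `κ`, uniformly up to the points where the zone
closes, and the singular kernels are dominated by `|β|^(κ-1)`. -/
lemma Admissible.exists_closePair (h : Admissible ℓ δ T c z) (hℓ : 0 < ℓ) (hδ : 0 < δ)
    (hT : 0 < T) :
    ∃ C κ, 0 < C ∧ 0 < κ ∧ κ < 1 ∧ ∀ t ∈ Icc 0 T, ∀ a ∈ Icc (-1 : ℝ) 1,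
      (∀ α, ‖deriv (zLam c z a t) α‖ ≤ C) ∧
      ∀ b ∈ Icc (-1 : ℝ) 1, IsClosePair ℓ C κ (zLam c z a t) (zLam c z b t) := by
  obtain ⟨C, hC0, hC⟩ := h.chord
  obtain ⟨H, hH0, hH⟩ := h.z_mem.exists_holder_bound hℓ
  -- The exponent `δ` is only assumed positive, so it is lowered to at most `1`, where Lipschitz
  -- functions are Hölder as well.
  set θ : ℝ := min δ 1 with hθ
  have hδ' : (0 : ℝ) < δ := by exact_mod_cast hδ
  have hθ0 : 0 < θ := lt_min hδ' one_pos
  have hθ1 : θ ≤ 1 := min_le_right _ _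
  have hθδ : θ ≤ δ := min_le_left _ _
  set κ : ℝ := θ / (1 + θ) with hκ
  have hκ0 : 0 < κ := by positivity
  have hκθ : κ ≤ θ := div_le_self hθ0.le (by linarith)
  have hκ1 : κ < 1 := by rw [hκ, div_lt_one (by linarith)]; linarith
  have hτ := h.isLoop_tangent
  obtain ⟨Mc, hMc⟩ := periodic_exists_bound h.c_mem.1 hℓ h.c_mem.2.1.continuous
  obtain ⟨Mc', hMc'⟩ := periodic_exists_bound (periodic_deriv h.c_mem.1) hℓ
    (h.c_mem.2.1.continuous_deriv le_rfl)
  obtain ⟨N, hN⟩ := periodic_exists_bound (periodic_deriv hτ.periodic) hℓ hτ.continuous_deriv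
  have hMc0 : 0 ≤ Mc := (norm_nonneg _).trans (hMc 0)
  have hN0 : 0 ≤ N := (norm_nonneg _).trans (hN 0)
  obtain ⟨Hc, hHc0, hHc⟩ := MemHolder.exists_norm_sub_le h.c_mem.2.2
  obtain ⟨Hτ, hHτ0, hHτ⟩ := MemHolder.exists_norm_sub_le h.z_init_mem.2.2
  have bc : BddHolder θ c := bddHolder_of_deriv_bound hθ0 hθ1
    (h.c_mem.2.1.differentiable one_ne_zero) hMc hMc'
  have bc' : BddHolder θ (deriv c) := bddHolder_of_le hθ0 hθδ hMc' hHc0 hHc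
  have bτ : BddHolder θ (fun α => Complex.I * deriv (z 0) α) := by
    obtain ⟨M, hM0, h1, h2⟩ := bddHolder_of_deriv_bound hθ0 hθ1
      (hτ.contDiff.differentiable one_ne_zero) (fun α => (h.z_init_arclength α).le) hN
    exact ⟨M, hM0, fun α => by rw [norm_I_mul]; exact h1 α,
      fun α β => by rw [← mul_sub, norm_I_mul]; exact h2 α β⟩
  have bτ' : BddHolder θ (fun α => Complex.I * deriv (deriv (z 0)) α) := by
    obtain ⟨M, hM0, h1, h2⟩ := bddHolder_of_le hθ0 hθδ hN hHτ0 hHτ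
    exact ⟨M, hM0, fun α => by rw [norm_I_mul]; exact h1 α,
      fun α β => by rw [← mul_sub, norm_I_mul]; exact h2 α β⟩
  have hdir : ∀ α, deriv (mixDir c z) α =
      c α • (Complex.I * deriv (deriv (z 0)) α) + deriv c α • (Complex.I * deriv (z 0) α) :=
    fun α => (((h.c_mem.2.1.differentiable one_ne_zero α).hasDerivAt).smul
      ((hτ.hasDerivAt α).const_mul Complex.I)).deriv
  have bdir : BddHolder κ (deriv (mixDir c z)) := by
    rw [funext hdir]
    obtain ⟨M, hM0, h1, h2⟩ := (bc.smul bτ').add (bc'.smul bτ)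
    exact bddHolder_of_le hκ0 hκθ h1 hM0 h2
  obtain ⟨H', hH0', hH1', hH2'⟩ := bddHolder_of_le hθ0 le_rfl (f := deriv c) hMc'
    bc'.choose_spec.1 bc'.choose_spec.2.2
  -- smallness of the derivative of the direction
  have hsmall : ∀ α, ‖deriv (mixDir c z) α‖ ≤ (Mc ^ (1 - κ) * N + (1 + H')) * c α ^ κ := fun α => by
    have e1 : c α ≤ Mc ^ (1 - κ) * c α ^ κ := by
      rcases (h.c_nonneg α).eq_or_lt with h0 | h0
      · rw [← h0, Real.zero_rpow hκ0.ne', mul_zero]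
      · calc c α = c α ^ (1 - κ) * c α ^ κ := by
              rw [← Real.rpow_add h0, sub_add_cancel, Real.rpow_one]
          _ ≤ Mc ^ (1 - κ) * c α ^ κ := by
              gcongr
              exact (le_abs_self _).trans (hMc α)
    have e2 := abs_deriv_le_rpow (h.c_mem.2.1.differentiable one_ne_zero) h.c_nonneg hθ0 hH0' hH2' α
    rw [hdir]
    calc ‖_ + _‖ ≤ ‖c α • (Complex.I * deriv (deriv (z 0)) α)‖ +
          ‖deriv c α • (Complex.I * deriv (z 0) α)‖ := norm_add_le _ _
      _ = c α * ‖deriv (deriv (z 0)) α‖ + |deriv c α| := by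
          rw [norm_smul, norm_smul, norm_I_mul, norm_I_mul, h.z_init_arclength, mul_one,
            Real.norm_eq_abs, Real.norm_eq_abs, abs_of_nonneg (h.c_nonneg α)]
      _ ≤ (Mc ^ (1 - κ) * c α ^ κ) * N + (1 + H') * c α ^ κ := by
          have := h.c_nonneg α
          gcongr
          exact hN α
      _ = _ := by ring
  obtain ⟨G, hG0, hG1, hG2⟩ := bdir
  set P := Mc ^ (1 - κ) * N + (1 + H')
  have hP0 : 0 ≤ P := by positivity
  set Q := (2 * H + H) * C ^ κ + (2 * T) ^ (1 - κ) * P * C ^ κ + T * (G * C ^ κ)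
  have hQ0 : 0 ≤ Q := by positivity
  refine ⟨C + (H + T * G) + Q, κ, by positivity, hκ0, hκ1, fun t ht a ha => ⟨fun α => ?_,
    fun b hb => ⟨fun α β hβ => ?_, fun α β hβ => ?_⟩⟩⟩
  · rw [h.deriv_zLam a ht]
    have ha1 : |a| ≤ 1 := abs_le.2 ha
    calc ‖_ - _‖ ≤ ‖deriv (z t) α‖ + ‖(a * t) • deriv (mixDir c z) α‖ := norm_sub_le _ _
      _ ≤ H + (1 * T) * G := by
          rw [norm_smul, norm_mul, Real.norm_eq_abs, Real.norm_eq_abs, abs_of_nonneg ht.1]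
          gcongr
          exacts [(hH t ht).1 α, ht.1, ht.2, hG1 α]
      _ ≤ _ := by linarith
  · refine (hC t ht a ha b hb α β hβ).1.trans ?_
    gcongr
    have : 0 ≤ H + T * G := by positivity
    linarith
  · set D := ‖zLam c z a t α - zLam c z b t (α - β)‖
    obtain ⟨k1, k2⟩ := hC t ht a ha b hb α β hβ
    have hD0 : 0 ≤ D := norm_nonneg _
    have hβκ : |β| ^ κ ≤ C ^ κ * D ^ κ := by
      rw [← Real.mul_rpow hC0.le hD0]; gcongr
    have hzH : ‖deriv (z t) α - deriv (z t) (α - β)‖ ≤ (2 * H + H) * (C ^ κ * D ^ κ) := by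
      have hb1 : ‖deriv (z t) α - deriv (z t) (α - β)‖ ≤ (2 * H + H) * |β| ^ κ := by
        have e := (hH t ht).2 α (α - β)
        rw [sub_sub_cancel] at e
        rcases le_total |β| 1 with h1 | h1
        · rcases (abs_nonneg β).eq_or_lt with h0 | h0
          · rw [← h0, Real.zero_rpow hδ'.ne'] at e
            rw [← h0, Real.zero_rpow hκ0.ne']; linarith
          · refine e.trans ?_
            have := Real.rpow_le_rpow_of_exponent_ge h0 h1 (hκθ.trans hθδ)
            have h5 : 0 ≤ |β| ^ κ := by positivity
            nlinarith
        · have h2 : 1 ≤ |β| ^ κ := Real.one_le_rpow h1 hκ0.le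
          have h3 := norm_sub_le (deriv (z t) α) (deriv (z t) (α - β))
          have h4 := (hH t ht).1 α
          have h5 := (hH t ht).1 (α - β)
          nlinarith
      exact hb1.trans (by gcongr)
    have hgH : ‖deriv (mixDir c z) α - deriv (mixDir c z) (α - β)‖ ≤ G * (C ^ κ * D ^ κ) := by
      have e := hG2 α (α - β)
      rw [sub_sub_cancel] at e
      exact e.trans (by gcongr)
    -- The factor `|(a - b) t|` is split into its powers `1 - κ` and `κ`. The first is bounded by
    -- `2T`; the second joins `c^κ`, and the product is the power `κ` of the quantity controlled by
    -- the chord-arc condition.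
    have hst : ‖((a - b) * t) • deriv (mixDir c z) α‖ ≤
        (2 * T) ^ (1 - κ) * P * (C ^ κ * D ^ κ) := by
      rw [norm_smul, Real.norm_eq_abs]
      rcases (abs_nonneg ((a - b) * t)).eq_or_lt with h0 | h0
      · rw [← h0, zero_mul]; positivity
      · have e1 : |(a - b) * t| ≤ 2 * T := by
          rw [abs_mul, abs_of_nonneg ht.1]
          have : |a - b| ≤ 2 := abs_le.2 ⟨by linarith [ha.1, hb.2], by linarith [ha.2, hb.1]⟩
          gcongr
          exacts [ht.1, ht.2]
        have e2 : |(a - b) * t| * c α ≤ C * D := by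
          rw [abs_mul, abs_of_nonneg (h.c_nonneg α)] at k2; exact k2
        calc |(a - b) * t| * ‖deriv (mixDir c z) α‖ ≤ |(a - b) * t| * (P * c α ^ κ) := by
              gcongr; exact hsmall α
          _ = |(a - b) * t| ^ (1 - κ) * P * (|(a - b) * t| ^ κ * c α ^ κ) := by
              nth_rewrite 1 [show |(a - b) * t| = |(a - b) * t| ^ (1 - κ) * |(a - b) * t| ^ κ by
                rw [← Real.rpow_add h0, sub_add_cancel, Real.rpow_one]]
              ring
          _ = |(a - b) * t| ^ (1 - κ) * P * (|(a - b) * t| * c α) ^ κ := by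
              rw [Real.mul_rpow h0.le (h.c_nonneg α)]
          _ ≤ (2 * T) ^ (1 - κ) * P * (C * D) ^ κ := by
              have := mul_nonneg h0.le (h.c_nonneg α)
              gcongr
          _ = _ := by rw [Real.mul_rpow hC0.le hD0]
    rw [h.deriv_zLam a ht, h.deriv_zLam b ht]
    have hbt : |b * t| ≤ T := by
      rw [abs_mul, abs_of_nonneg ht.1]
      have : |b| ≤ 1 := abs_le.2 hb
      nlinarith [ht.1, ht.2, abs_nonneg b]
    calc ‖_‖ = ‖(deriv (z t) α - deriv (z t) (α - β)) - ((a - b) * t) • deriv (mixDir c z) α -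
          (b * t) • (deriv (mixDir c z) α - deriv (mixDir c z) (α - β))‖ := by
            congr 1
            simp only [Complex.real_smul]; push_cast; ring
      _ ≤ ‖deriv (z t) α - deriv (z t) (α - β)‖ + ‖((a - b) * t) • deriv (mixDir c z) α‖ +
          ‖(b * t) • (deriv (mixDir c z) α - deriv (mixDir c z) (α - β))‖ :=
            (norm_sub_le _ _).trans (add_le_add_left (norm_sub_le _ _) _)
      _ ≤ (2 * H + H) * (C ^ κ * D ^ κ) + (2 * T) ^ (1 - κ) * P * (C ^ κ * D ^ κ) +
          T * (G * (C ^ κ * D ^ κ)) := by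
            rw [norm_smul (b * t), Real.norm_eq_abs]
            gcongr
      _ = Q * D ^ κ := by ring
      _ ≤ _ := by
            gcongr
            have : 0 ≤ H + T * G := by positivity
            linarith

/-! ### The mixing zone as a strip -/

/-- The mixing zone is viewed as the strip from `z_-` to `z_+` in the direction `-2 t c τ^⊥`, with
parameter `s = (λ + 1) / 2`. -/
lemma strip_zLam (s t : ℝ) :
    strip (zLam c z (-1) t) (fun α => (-2 * t) • mixDir c z α) s = zLam c z (2 * s - 1) t := by
  ext α
  simp only [strip, zLam_eq, Complex.real_smul]; push_cast; ring

lemma Admissible.mixDir_ne_zero (h : Admissible ℓ δ T c z) {t : ℝ} (ht : 0 ≤ t) (α : ℝ) :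
    (-2 * t) • mixDir c z α ≠ 0 ↔ 0 < t * c α := by
  have hτ : deriv (z 0) α ≠ 0 := by
    rw [← norm_ne_zero_iff, h.z_init_arclength]; exact one_ne_zero
  rw [(mul_nonneg ht (h.c_nonneg α)).lt_iff_ne, mixDir, smul_smul]
  have := Complex.I_ne_zero
  simp only [ne_eq, smul_eq_zero, mul_eq_zero, hτ, this, or_false, eq_comm (a := (0 : ℝ))]
  norm_num

lemma stripRegion_eq_omegaMix (h : Admissible ℓ δ T c z) {t : ℝ} (ht : 0 ≤ t) :
    stripRegion (zLam c z (-1) t) (fun α => (-2 * t) • mixDir c z α) = OmegaMix c z t := by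
  ext x
  constructor
  · rintro ⟨α, s, hp, hs, rfl⟩
    exact ⟨α, 2 * s - 1, (h.mixDir_ne_zero ht α).1 hp, ⟨by linarith [hs.1], by linarith [hs.2]⟩,
      by rw [strip_zLam]⟩
  · rintro ⟨α, a, hp, ha, rfl⟩
    refine ⟨α, (a + 1) / 2, (h.mixDir_ne_zero ht α).2 hp,
      ⟨by linarith [ha.1], by linarith [ha.2]⟩, ?_⟩
    rw [strip_zLam]; congr 1; ring

lemma Admissible.stripJac_eq (h : Admissible ℓ δ T c z) {t : ℝ} (ht : t ∈ Icc 0 T) (s α : ℝ) :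
    stripJac (zLam c z (-1) t) (fun α => (-2 * t) • mixDir c z α) α s =
      2 * (t * c α) * inner ℝ (deriv (zLam c z (2 * s - 1) t) α) (deriv (z 0) α) := by
  have hp : IsLoop ℓ (fun α => (-2 * t) • mixDir c z α) :=
    ⟨fun α => by simp only [h.isLoop_mixDir.periodic α],
      h.isLoop_mixDir.contDiff.const_smul (-2 * t)⟩
  rw [stripJac, ← deriv_strip (h.isLoop_zLam _ ht) hp, strip_zLam, mixDir, smul_smul,
    real_inner_smul_left, inner_I_mul_I_mul, real_inner_comm]
  ring

/-- The angle condition provides the sign of the Jacobian. In the chord-arc condition, a vanishing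
distance forces `β = 0` modulo the period and `(λ - μ) t c = 0`, which is the injectivity away from
the closing points. -/
lemma Admissible.isStrip (h : Admissible ℓ δ T c z) (hℓ : 0 < ℓ) {t : ℝ} (ht : t ∈ Icc 0 T) :
    IsStrip ℓ (zLam c z (-1) t) (fun α => (-2 * t) • mixDir c z α) where
  loop := h.isLoop_zLam _ ht
  loop_dir := ⟨fun α => by simp only [h.isLoop_mixDir.periodic α],
      h.isLoop_mixDir.contDiff.const_smul (-2 * t)⟩
  jac_pos α hα s hs := by
    rw [h.stripJac_eq ht]
    have h1 := (h.mixDir_ne_zero ht.1 α).1 hα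
    have h2 := h.inner_deriv_pos ht (a := 2 * s - 1) ⟨by linarith [hs.1], by linarith [hs.2]⟩ α
    positivity
  inj α β s hs r hr e := by
    obtain ⟨C, hC0, hC⟩ := h.chord
    obtain ⟨k, hk⟩ := exists_int_mem_Ioc hℓ (α - β)
    simp only [strip_zLam] at e
    have hper : zLam c z (2 * r - 1) t (α - (α - β + k * ℓ)) = zLam c z (2 * r - 1) t β := by
      have := periodic_int_mul (h.isLoop_zLam (2 * r - 1) ht).periodic β (-k)
      rw [← this]; congr 1; push_cast; ring
    obtain ⟨h1, h2⟩ := hC t ht (2 * s - 1) ⟨by linarith [hs.1], by linarith [hs.2]⟩ (2 * r - 1)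
      ⟨by linarith [hr.1], by linarith [hr.2]⟩ α (α - β + k * ℓ) ⟨hk.1.le, hk.2⟩
    rw [hper, ← e, sub_self, norm_zero, mul_zero] at h1 h2
    have h3 := abs_nonpos_iff.1 h1
    refine ⟨⟨k, by linarith⟩, ?_⟩
    have h4 := abs_nonpos_iff.1 h2
    by_cases hp : (-2 * t) • mixDir c z α = 0
    · exact Or.inr hp
    · have h5 := (h.mixDir_ne_zero ht.1 α).1 hp
      rw [mul_assoc] at h4
      rcases mul_eq_zero.1 h4 with h6 | h6
      · left; linarith
      · exact absurd h6 h5.ne'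

end Admissible

/-! ### The zones -/

lemma exists_bound_of_continuousOn_periodic {E : Type*} [NormedAddCommGroup E] {ℓ a b : ℝ}
    (hℓ : 0 < ℓ) {f : ℝ → ℝ → E} (hf : ContinuousOn (Function.uncurry f) (Icc a b ×ˢ univ))
    (hp : ∀ t ∈ Icc a b, Function.Periodic (f t) ℓ) :
    ∃ R, ∀ t ∈ Icc a b, ∀ α, ‖f t α‖ ≤ R := by
  obtain ⟨R, hR⟩ := (isCompact_Icc.prod (isCompact_Icc (a := -(ℓ / 2)) (b := ℓ / 2))).exists_bound_of_continuousOn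
    (hf.mono (prod_mono_right (subset_univ _)))
  refine ⟨R, fun t ht α => ?_⟩
  obtain ⟨k, hk⟩ := exists_int_mem_Ioc hℓ α
  rw [← periodic_int_mul (hp t ht) α k]
  exact hR (t, α + k * ℓ) ⟨ht, hk.1.le, hk.2⟩

lemma wn_mem_of_sign {ℓ : ℝ} (hℓ : 0 < ℓ) {w : ℝ → ℂ} (h : IsLoop ℓ w) {ε : ℝ}
    (hε : ∀ x ∈ interiorDomain (range w), wn ℓ w x = ε) {x : ℂ} (hx : x ∉ range w) :
    wn ℓ w x = (interiorDomain (range w)).indicator (fun _ => ε) x := by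
  by_cases hi : x ∈ interiorDomain (range w)
  · rw [indicator_of_mem hi, hε x hi]
  · rw [indicator_of_notMem hi]
    exact wn_eq_zero_of_mem_exteriorDomain h hℓ ((mem_interior_or_exterior hx).resolve_left hi)

/-- The orientation of a continuous family of Jordan curves is constant. -/
lemma LoopFamily.wn_eq_neg_one {ℓ T : ℝ} {w v : ℝ → ℝ → ℂ} (h : LoopFamily ℓ 0 T w v) (hℓ : 0 < ℓ)
    (hT : 0 ≤ T)
    (hj : ∀ t ∈ Icc 0 T, (interiorDomain (range (w t))).Nonempty ∧ ∃ ε : ℝ, (ε = 1 ∨ ε = -1) ∧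
      ∀ x ∈ interiorDomain (range (w t)), wn ℓ (w t) x = ε)
    (h0 : ∀ x ∈ interiorDomain (range (w 0)), wn ℓ (w 0) x = -1) :
    ∀ t ∈ Icc 0 T, ∀ x ∈ interiorDomain (range (w t)), wn ℓ (w t) x = -1 := by
  obtain ⟨R, hR⟩ := exists_bound_of_continuousOn_periodic hℓ h.cont fun t ht => (h.loop t ht).periodic
  have hR0 : 0 ≤ R := (norm_nonneg _).trans (hR 0 ⟨le_rfl, hT⟩ 0)
  let φ : ContDiffBump (0 : ℂ) := ⟨R + 1, R + 2, by linarith, by linarith⟩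
  have hφd : ContDiff ℝ 1 φ := φ.contDiff
  have hφc : HasCompactSupport φ := φ.hasCompactSupport
  -- This is the signed area of the interior, since `φ` equals `1` there. It is continuous in time
  -- and never zero, so its sign cannot change from the negative initial one.
  set A : ℝ → ℝ := fun t => ∫ x, φ x * wn ℓ (w t) x with hA
  have hAc : ContinuousOn A (Icc 0 T) := fun t ht =>
    (h.hasDerivWithinAt_integral_mul_wn hℓ hT hφd hφc ht).continuousWithinAt
  have key : ∀ t ∈ Icc 0 T, ∀ ε : ℝ, (ε = 1 ∨ ε = -1) →
      (∀ x ∈ interiorDomain (range (w t)), wn ℓ (w t) x = ε) →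
      ∃ m : ℝ, 0 < m ∧ A t = ε * m := fun t ht ε hε hwn => by
    have hl := h.loop t ht
    have hop := isOpen_interiorDomain (hl.isCompact_range hℓ).isClosed
    have hsub : interiorDomain (range (w t)) ⊆ Metric.closedBall 0 (R + 1) := fun x hx => by
      rw [mem_closedBall_zero_iff]
      by_contra hlt
      have h2 := windingNumber_eq_zero_of_norm_lt hl (hR t ht) (x := x) (by linarith)
      have h3 := hwn x hx
      rw [wn, h2, Complex.zero_re] at h3
      rcases hε with rfl | rfl <;> norm_num at h3
    have hfin : volume (interiorDomain (range (w t))) ≠ ⊤ :=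
      ((measure_mono hsub).trans_lt (isCompact_closedBall _ _).measure_lt_top).ne
    refine ⟨(volume (interiorDomain (range (w t)))).toReal,
      ENNReal.toReal_pos (hop.measure_pos _ (hj t ht).1).ne' hfin, ?_⟩
    have e : (fun x => φ x * wn ℓ (w t) x) =ᵐ[volume]
        (interiorDomain (range (w t))).indicator fun _ => ε := by
      filter_upwards [ae_notMem_range hl] with x hx
      rw [wn_mem_of_sign hℓ hl hwn hx]
      by_cases hi : x ∈ interiorDomain (range (w t))
      · rw [indicator_of_mem hi, φ.one_of_mem_closedBall (hsub hi), one_mul]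
      · rw [indicator_of_notMem hi, mul_zero]
    rw [hA]; dsimp only
    rw [integral_congr_ae e, integral_indicator hop.measurableSet, setIntegral_const, smul_eq_mul,
      mul_comm, Measure.real]
  intro t ht
  obtain ⟨-, ε, hε, hwn⟩ := hj t ht
  obtain ⟨m, hm, hAt⟩ := key t ht ε hε hwn
  have hT0 : (0 : ℝ) ∈ Icc 0 T := ⟨le_rfl, hT⟩
  obtain ⟨m0, hm0, hA0⟩ := key 0 hT0 (-1) (Or.inr rfl) h0
  rcases hε with rfl | rfl
  · exfalso
    have h0mem : (0 : ℝ) ∈ Icc (A 0) (A t) := ⟨by rw [hA0]; linarith, by rw [hAt]; linarith⟩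
    obtain ⟨s, hs, hs0⟩ := isPreconnected_Icc.intermediate_value hT0 ht hAc h0mem
    obtain ⟨-, ε, hε, hwn⟩ := hj s hs
    obtain ⟨m, hm, hAs⟩ := key s hs ε hε hwn
    rw [hs0] at hAs
    rcases hε with rfl | rfl <;> linarith
  · exact hwn

section Admissible

variable {ℓ T : ℝ} {δ : ℝ≥0} {c : ℝ → ℝ} {z : ℝ → ℝ → ℂ}

lemma zLam_zero (a : ℝ) : zLam c z a 0 = z 0 := by ext α; simp [zLam]

lemma Admissible.jordan (h : Admissible ℓ δ T c z) (hℓ : 0 < ℓ) {a : ℝ} (ha : a ∈ Icc (-1 : ℝ) 1)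
    {t : ℝ} (ht : t ∈ Icc 0 T) :
    (interiorDomain (range (zLam c z a t))).Nonempty ∧ ∃ ε : ℝ, (ε = 1 ∨ ε = -1) ∧
      ∀ x ∈ interiorDomain (range (zLam c z a t)), wn ℓ (zLam c z a t) x = ε := by
  obtain ⟨C, hC0, hC⟩ := h.chord
  obtain ⟨W, p, hs, hp, e⟩ := exists_collar (h.isLoop_zLam a ht) h.isLoop_tangent hℓ
    h.z_init_arclength (h.inner_deriv_pos ht ha) fun α β hβ => (hC t ht a ha a ha α β hβ).1
  have := hs.jordan hℓ hp
  rwa [e] at this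

lemma Admissible.wn_eq (h : Admissible ℓ δ T c z) (hℓ : 0 < ℓ) (hT : 0 < T) {a : ℝ}
    (ha : a ∈ Icc (-1 : ℝ) 1) {t : ℝ} (ht : t ∈ Icc 0 T) {x : ℂ} (hx : x ∉ range (zLam c z a t)) :
    wn ℓ (zLam c z a t) x = (interiorDomain (range (zLam c z a t))).indicator (fun _ => -1) x := by
  refine wn_mem_of_sign hℓ (h.isLoop_zLam a ht) ?_ hx
  refine (h.loopFamily hℓ a).wn_eq_neg_one hℓ hT.le (fun t ht => h.jordan hℓ ha ht) ?_ t ht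
  intro x hx
  rw [zLam_zero] at hx ⊢
  rw [wn, h.z_init_clockwise x hx]; simp

lemma one_mem_Icc : (1 : ℝ) ∈ Icc (-1 : ℝ) 1 := ⟨by norm_num, le_rfl⟩

lemma neg_one_mem_Icc : (-1 : ℝ) ∈ Icc (-1 : ℝ) 1 := ⟨le_rfl, by norm_num⟩

lemma Admissible.wn_plus (h : Admissible ℓ δ T c z) (hℓ : 0 < ℓ) (hT : 0 < T) {t : ℝ}
    (ht : t ∈ Icc 0 T) {x : ℂ} (hx : x ∉ range (zLam c z 1 t)) :
    wn ℓ (zLam c z 1 t) x = -(OmegaPlus c z t).indicator 1 x := by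
  rw [h.wn_eq hℓ hT one_mem_Icc ht hx, OmegaPlus]
  by_cases hi : x ∈ interiorDomain (range (zLam c z 1 t)) <;> simp [hi]

lemma Admissible.wn_minus (h : Admissible ℓ δ T c z) (hℓ : 0 < ℓ) (hT : 0 < T) {t : ℝ}
    (ht : t ∈ Icc 0 T) {x : ℂ} (hx : x ∉ range (zLam c z (-1) t)) :
    wn ℓ (zLam c z (-1) t) x = (OmegaMinus c z t).indicator 1 x - 1 := by
  rw [h.wn_eq hℓ hT neg_one_mem_Icc ht hx, OmegaMinus]
  by_cases hi : x ∈ interiorDomain (range (zLam c z (-1) t))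
  · have he : x ∉ exteriorDomain (range (zLam c z (-1) t)) := fun h2 => h2.2 hi.2
    simp [hi, he]
  · have he := (mem_interior_or_exterior hx).resolve_left hi
    simp [hi, he]

/-- Combined with `wn_plus` and `wn_minus` this reads `1_{Ω_+} + 1_{Ω_-} + 1_{Ω_mix} = 1` off the
two curves, which is the disjointness and the covering property of the zones at once. -/
lemma Admissible.wn_plus_sub_minus (h : Admissible ℓ δ T c z) (hℓ : 0 < ℓ) {t : ℝ}
    (ht : t ∈ Icc 0 T) {x : ℂ} (hx : x ∉ range (zLam c z 1 t)) (hx' : x ∉ range (zLam c z (-1) t)) :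
    wn ℓ (zLam c z 1 t) x - wn ℓ (zLam c z (-1) t) x = (OmegaMix c z t).indicator 1 x := by
  have e : strip (zLam c z (-1) t) (fun α => (-2 * t) • mixDir c z α) 1 = zLam c z 1 t := by
    rw [strip_zLam]; norm_num
  have := (h.isStrip hℓ ht).wn_sub_wn hℓ hx' (by rwa [e])
  rwa [e, stripRegion_eq_omegaMix h ht.1] at this

lemma Admissible.notMem_range_of_mem_mix (h : Admissible ℓ δ T c z) (hℓ : 0 < ℓ) {t : ℝ}
    (ht : t ∈ Icc 0 T) {x : ℂ} (hx : x ∈ OmegaMix c z t) :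
    x ∉ range (zLam c z 1 t) ∧ x ∉ range (zLam c z (-1) t) := by
  rw [← stripRegion_eq_omegaMix h ht.1] at hx
  obtain ⟨α, s, hp, hs, rfl⟩ := hx
  have hs' := Ioo_subset_Icc_self hs
  constructor
  · rintro ⟨β, hβ⟩
    have h0 : zLam c z 1 t β = strip (zLam c z (-1) t) (fun α => (-2 * t) • mixDir c z α) 1 β := by
      rw [strip_zLam]; norm_num
    rw [h0] at hβ
    rcases ((h.isStrip hℓ ht).inj α β s hs' 1 ⟨zero_le_one, le_rfl⟩ hβ.symm).2 with h1 | h1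
    · exact hs.2.ne h1
    · exact hp h1
  · rintro ⟨β, hβ⟩
    have h0 : zLam c z (-1) t β = strip (zLam c z (-1) t) (fun α => (-2 * t) • mixDir c z α) 0 β := by
      rw [strip_zero]
    rw [h0] at hβ
    rcases ((h.isStrip hℓ ht).inj α β s hs' 0 ⟨le_rfl, zero_le_one⟩ hβ.symm).2 with h1 | h1
    · exact hs.1.ne' h1
    · exact hp h1

lemma Admissible.disjoint_zones (h : Admissible ℓ δ T c z) (hℓ : 0 < ℓ) (hT : 0 < T) {t : ℝ}
    (ht : t ∈ Icc 0 T) :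
    Disjoint (OmegaPlus c z t) (OmegaMinus c z t) ∧ Disjoint (OmegaPlus c z t) (OmegaMix c z t) ∧
      Disjoint (OmegaMinus c z t) (OmegaMix c z t) := by
  refine ⟨?_, ?_, ?_⟩ <;> rw [Set.disjoint_left] <;> intro x hx hx'
  · have h1 := h.wn_plus_sub_minus hℓ ht hx.1 hx'.1
    rw [h.wn_plus hℓ hT ht hx.1, h.wn_minus hℓ hT ht hx'.1, indicator_of_mem hx,
      indicator_of_mem hx'] at h1
    have : (0 : ℝ) ≤ (OmegaMix c z t).indicator 1 x := indicator_nonneg (by simp) _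
    simp only [Pi.one_apply] at h1; linarith
  · obtain ⟨h2, h3⟩ := h.notMem_range_of_mem_mix hℓ ht hx'
    have h1 := h.wn_plus_sub_minus hℓ ht h2 h3
    rw [h.wn_plus hℓ hT ht h2, h.wn_minus hℓ hT ht h3, indicator_of_mem hx,
      indicator_of_mem hx'] at h1
    have : (0 : ℝ) ≤ (OmegaMinus c z t).indicator 1 x := indicator_nonneg (by simp) _
    simp only [Pi.one_apply] at h1; linarith
  · obtain ⟨h2, h3⟩ := h.notMem_range_of_mem_mix hℓ ht hx'
    have h1 := h.wn_plus_sub_minus hℓ ht h2 h3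
    rw [h.wn_plus hℓ hT ht h2, h.wn_minus hℓ hT ht h3, indicator_of_mem hx,
      indicator_of_mem hx'] at h1
    have : (0 : ℝ) ≤ (OmegaPlus c z t).indicator 1 x := indicator_nonneg (by simp) _
    simp only [Pi.one_apply] at h1; linarith

lemma Admissible.isOpen_zones (h : Admissible ℓ δ T c z) (hℓ : 0 < ℓ) {t : ℝ} (ht : t ∈ Icc 0 T) :
    IsOpen (OmegaPlus c z t) ∧ IsOpen (OmegaMinus c z t) ∧ IsOpen (OmegaMix c z t) := by
  refine ⟨isOpen_interiorDomain ((h.isLoop_zLam _ ht).isCompact_range hℓ).isClosed,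
    isOpen_exteriorDomain ((h.isLoop_zLam _ ht).isCompact_range hℓ).isClosed, ?_⟩
  rw [← stripRegion_eq_omegaMix h ht.1]
  exact (h.isStrip hℓ ht).isOpen_stripRegion

lemma Admissible.mem_zones (h : Admissible ℓ δ T c z) (hℓ : 0 < ℓ) (hT : 0 < T) {t : ℝ}
    (ht : t ∈ Icc 0 T) {x : ℂ} (hx : x ∉ range (zLam c z 1 t)) (hx' : x ∉ range (zLam c z (-1) t)) :
    x ∈ OmegaPlus c z t ∪ OmegaMinus c z t ∪ OmegaMix c z t := by
  by_contra hn
  simp only [mem_union, not_or] at hn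
  have h1 := h.wn_plus_sub_minus hℓ ht hx hx'
  rw [h.wn_plus hℓ hT ht hx, h.wn_minus hℓ hT ht hx', indicator_of_notMem hn.1.1,
    indicator_of_notMem hn.1.2, indicator_of_notMem hn.2] at h1
  norm_num at h1

lemma Admissible.ae_notMem (h : Admissible ℓ δ T c z) {t : ℝ} (ht : t ∈ Icc 0 T) :
    ∀ᵐ x : ℂ, x ∉ range (zLam c z 1 t) ∧ x ∉ range (zLam c z (-1) t) := by
  filter_upwards [ae_notMem_range (h.isLoop_zLam 1 ht), ae_notMem_range (h.isLoop_zLam (-1) ht)]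
    with x h1 h2 using ⟨h1, h2⟩

lemma Admissible.volume_compl_zones (h : Admissible ℓ δ T c z) (hℓ : 0 < ℓ) (hT : 0 < T) {t : ℝ}
    (ht : t ∈ Icc 0 T) :
    volume (OmegaPlus c z t ∪ OmegaMinus c z t ∪ OmegaMix c z t)ᶜ = 0 := by
  rw [measure_eq_zero_iff_ae_notMem]
  filter_upwards [h.ae_notMem ht] with x hx hn
  exact hn (h.mem_zones hℓ hT ht hx.1 hx.2)

lemma rhoBar_abs_le (t : ℝ) (x : ℂ) : rhoBar c z t x ∈ Icc (-1 : ℝ) 1 := by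
  rw [rhoBar]
  by_cases h1 : x ∈ OmegaPlus c z t <;> by_cases h2 : x ∈ OmegaMinus c z t <;>
    simp [h1, h2]

lemma Admissible.rhoBar_plus (h : Admissible ℓ δ T c z) (hℓ : 0 < ℓ) (hT : 0 < T) {t : ℝ}
    (ht : t ∈ Icc 0 T) {x : ℂ} (hx : x ∈ OmegaPlus c z t) : rhoBar c z t x = 1 := by
  have := Set.disjoint_left.1 (h.disjoint_zones hℓ hT ht).1 hx
  simp [rhoBar, hx, this]

lemma Admissible.rhoBar_minus (h : Admissible ℓ δ T c z) (hℓ : 0 < ℓ) (hT : 0 < T) {t : ℝ}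
    (ht : t ∈ Icc 0 T) {x : ℂ} (hx : x ∈ OmegaMinus c z t) : rhoBar c z t x = -1 := by
  have := Set.disjoint_right.1 (h.disjoint_zones hℓ hT ht).1 hx
  simp [rhoBar, hx, this]

lemma Admissible.rhoBar_mix (h : Admissible ℓ δ T c z) (hℓ : 0 < ℓ) (hT : 0 < T) {t : ℝ}
    (ht : t ∈ Icc 0 T) {x : ℂ} (hx : x ∈ OmegaMix c z t) : rhoBar c z t x = 0 := by
  have h1 := Set.disjoint_right.1 (h.disjoint_zones hℓ hT ht).2.1 hx
  have h2 := Set.disjoint_right.1 (h.disjoint_zones hℓ hT ht).2.2 hx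
  simp [rhoBar, h1, h2]

/-- The density becomes linear in the two winding numbers, so each pairing with it splits into a
constant part and one line integral per curve. -/
lemma Admissible.rhoBar_eq_wn (h : Admissible ℓ δ T c z) (hℓ : 0 < ℓ) (hT : 0 < T) {t : ℝ}
    (ht : t ∈ Icc 0 T) {x : ℂ} (hx : x ∉ range (zLam c z 1 t)) (hx' : x ∉ range (zLam c z (-1) t)) :
    rhoBar c z t x = -1 - wn ℓ (zLam c z 1 t) x - wn ℓ (zLam c z (-1) t) x := by
  rw [rhoBar, h.wn_plus hℓ hT ht hx, h.wn_minus hℓ hT ht hx']; ring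

lemma Admissible.one_sub_rhoBar_sq (h : Admissible ℓ δ T c z) (hℓ : 0 < ℓ) (hT : 0 < T) {t : ℝ}
    (ht : t ∈ Icc 0 T) {x : ℂ} (hx : x ∉ range (zLam c z 1 t)) (hx' : x ∉ range (zLam c z (-1) t)) :
    1 - rhoBar c z t x ^ 2 = (OmegaMix c z t).indicator 1 x := by
  rcases h.mem_zones hℓ hT ht hx hx' with (hp | hm) | hmix
  · rw [h.rhoBar_plus hℓ hT ht hp,
      indicator_of_notMem (Set.disjoint_left.1 (h.disjoint_zones hℓ hT ht).2.1 hp)]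
    norm_num
  · rw [h.rhoBar_minus hℓ hT ht hm,
      indicator_of_notMem (Set.disjoint_left.1 (h.disjoint_zones hℓ hT ht).2.2 hm)]
    norm_num
  · rw [h.rhoBar_mix hℓ hT ht hmix, indicator_of_mem hmix]; norm_num

lemma Admissible.wn_mem (h : Admissible ℓ δ T c z) (hℓ : 0 < ℓ) (hT : 0 < T) {a : ℝ}
    (ha : a ∈ Icc (-1 : ℝ) 1) {t : ℝ} (ht : t ∈ Icc 0 T) {x : ℂ} (hx : x ∉ range (zLam c z a t)) :
    |wn ℓ (zLam c z a t) x| ≤ 1 := by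
  rw [h.wn_eq hℓ hT ha ht hx]
  by_cases hi : x ∈ interiorDomain (range (zLam c z a t)) <;> simp [hi]

lemma rhoBar_zero : rhoBar c z 0 = rhoInit (z 0) := by
  ext x; simp only [rhoBar, rhoInit, OmegaPlus, OmegaMinus, zLam_zero]

lemma omegaMix_zero : OmegaMix c z 0 = ∅ := by
  ext x; simp [OmegaMix]

end Admissible

/-! ### Cauchy integrals along a family of loops -/

lemma eventually_forall_norm_sub_le {E : Type*} [NormedAddCommGroup E] {ℓ a b : ℝ}
    (hℓ : 0 < ℓ) {f : ℝ → ℝ → E} (hf : ContinuousOn (Function.uncurry f) (Icc a b ×ˢ univ))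
    (hp : ∀ t ∈ Icc a b, Function.Periodic (f t) ℓ) {t : ℝ} (ht : t ∈ Icc a b) {ε : ℝ}
    (hε : 0 < ε) : ∀ᶠ s in 𝓝[Icc a b] t, ∀ α, ‖f s α - f t α‖ < ε := by
  have hK := isCompact_Icc (a := a) (b := b) |>.prod (isCompact_Icc (a := -(ℓ / 2)) (b := ℓ / 2))
  have hu := hK.uniformContinuousOn_of_continuous (hf.mono (prod_mono_right (subset_univ _)))
  obtain ⟨d, hd, hdε⟩ := Metric.uniformContinuousOn_iff.1 hu ε hε
  filter_upwards [self_mem_nhdsWithin,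
    mem_nhdsWithin_of_mem_nhds (Metric.ball_mem_nhds t hd)] with s hs hsd α
  obtain ⟨k, hk⟩ := exists_int_mem_Ioc hℓ α
  rw [← periodic_int_mul (hp t ht) α k, ← periodic_int_mul (hp s hs) α k, ← dist_eq_norm]
  refine hdε (s, α + k * ℓ) ⟨hs, hk.1.le, hk.2⟩ (t, α + k * ℓ) ⟨ht, hk.1.le, hk.2⟩ ?_
  rw [Prod.dist_eq, dist_self, max_eq_left dist_nonneg]
  exact hsd

lemma eventually_le_norm_sub {ℓ a b : ℝ} (hℓ : 0 < ℓ) {w : ℝ → ℝ → ℂ}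
    (hw : ContinuousOn (Function.uncurry w) (Icc a b ×ˢ univ))
    (hl : ∀ t ∈ Icc a b, IsLoop ℓ (w t)) {t : ℝ} (ht : t ∈ Icc a b) {x : ℂ}
    (hx : x ∉ range (w t)) :
    ∃ ε, 0 < ε ∧ ∀ᶠ q in 𝓝[Icc a b ×ˢ univ] (t, x), ∀ β, ε ≤ ‖q.2 - w q.1 β‖ := by
  obtain ⟨ε, hε, hball⟩ :=
    Metric.isOpen_iff.1 ((hl t ht).isCompact_range hℓ).isClosed.isOpen_compl x hx
  have hfar : ∀ β, ε ≤ ‖x - w t β‖ := fun β => by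
    by_contra hlt
    have hm : w t β ∈ Metric.ball x ε := by
      rw [Metric.mem_ball, dist_comm, dist_eq_norm]; exact not_le.1 hlt
    exact hball hm ⟨β, rfl⟩
  refine ⟨ε / 3, by positivity, ?_⟩
  have h1 := (eventually_forall_norm_sub_le hℓ hw (fun t ht => (hl t ht).periodic) ht
    (ε := ε / 3) (by positivity)).prod_inl (𝓝 x)
  have h2 : ∀ᶠ y in 𝓝 x, ‖y - x‖ < ε / 3 := by
    filter_upwards [Metric.ball_mem_nhds x (ε := ε / 3) (by positivity)] with y hy
    rwa [Metric.mem_ball, dist_eq_norm] at hy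
  have h3 := h2.prod_inr (𝓝[Icc a b] t)
  rw [nhdsWithin_prod_eq, nhdsWithin_univ]
  filter_upwards [h1, h3] with q hq1 hq2 β
  have e : x - w t β = (q.2 - w q.1 β) - (q.2 - x) + (w q.1 β - w t β) := by ring
  have := hfar β
  rw [e] at this
  have h4 := norm_add_le ((q.2 - w q.1 β) - (q.2 - x)) (w q.1 β - w t β)
  have h5 := norm_sub_le (q.2 - w q.1 β) (q.2 - x)
  linarith [hq1 β]

lemma continuousWithinAt_cauchy {ℓ a b : ℝ} (hℓ : 0 < ℓ) {w g : ℝ → ℝ → ℂ}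
    (hw : ContinuousOn (Function.uncurry w) (Icc a b ×ˢ univ))
    (hl : ∀ t ∈ Icc a b, IsLoop ℓ (w t))
    (hg : ContinuousOn (Function.uncurry g) (Icc a b ×ˢ univ))
    (hgp : ∀ t ∈ Icc a b, Function.Periodic (g t) ℓ) {t : ℝ} (ht : t ∈ Icc a b) {x : ℂ}
    (hx : x ∉ range (w t)) (c d : ℝ) :
    ContinuousWithinAt (fun q : ℝ × ℂ => ∫ β in c..d, g q.1 β / (q.2 - w q.1 β))
      (Icc a b ×ˢ univ) (t, x) := by
  obtain ⟨ε, hε, hfar⟩ := eventually_le_norm_sub hℓ hw hl ht hx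
  obtain ⟨M, hM⟩ := exists_bound_of_continuousOn_periodic hℓ hg hgp
  have hM0 : 0 ≤ M := (norm_nonneg _).trans (hM t ht 0)
  have hmem : ∀ᶠ q : ℝ × ℂ in 𝓝[Icc a b ×ˢ univ] (t, x), q.1 ∈ Icc a b :=
    eventually_mem_nhdsWithin.mono fun q hq => hq.1
  have hslice : ∀ {f : ℝ → ℝ → ℂ}, ContinuousOn (Function.uncurry f) (Icc a b ×ˢ univ) →
      ∀ s ∈ Icc a b, Continuous (f s) := fun hf s hs =>
    hf.comp_continuous (by fun_prop : Continuous fun β : ℝ => (s, β)) fun β => ⟨hs, mem_univ _⟩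
  refine intervalIntegral.continuousWithinAt_of_dominated_interval (bound := fun _ => M / ε)
    ?_ ?_ intervalIntegrable_const ?_
  · filter_upwards [hfar, hmem] with q hq hqm
    have : Continuous fun β => g q.1 β / (q.2 - w q.1 β) :=
      (hslice hg _ hqm).div (continuous_const.sub (hslice hw _ hqm)) fun β => by
        rw [← norm_pos_iff]; exact hε.trans_le (hq β)
    exact this.aestronglyMeasurable
  · filter_upwards [hfar, hmem] with q hq hqm
    refine Eventually.of_forall fun β _ => ?_
    rw [norm_div]
    exact div_le_div₀ hM0 (hM _ hqm β) hε (hq β)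
  · refine Eventually.of_forall fun β _ => ?_
    have hmap : Tendsto (fun q : ℝ × ℂ => (q.1, β)) (𝓝[Icc a b ×ˢ univ] (t, x))
        (𝓝[Icc a b ×ˢ univ] (t, β)) := by
      refine tendsto_nhdsWithin_iff.2 ⟨?_, hmem.mono fun q hq => ⟨hq, mem_univ _⟩⟩
      exact ((by fun_prop : Continuous fun q : ℝ × ℂ => (q.1, β)).tendsto (t, x)).mono_left
        nhdsWithin_le_nhds
    have h1 : ContinuousWithinAt (fun q : ℝ × ℂ => g q.1 β) (Icc a b ×ˢ univ) (t, x) :=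
      (hg (t, β) ⟨ht, mem_univ _⟩).tendsto.comp hmap
    have h2 : ContinuousWithinAt (fun q : ℝ × ℂ => w q.1 β) (Icc a b ×ˢ univ) (t, x) :=
      (hw (t, β) ⟨ht, mem_univ _⟩).tendsto.comp hmap
    refine h1.div (continuous_snd.continuousWithinAt.sub h2) fun h0 => hx ⟨β, ?_⟩
    exact (sub_eq_zero.1 h0).symm

/-! ### The velocity generated by a loop -/

/-- The velocity generated by the loop `u`. -/
def loopVel (ℓ : ℝ) (u : ℝ → ℂ) (x : ℂ) : ℂ :=
  (starRingEnd ℂ) (-(2 * Real.pi * Complex.I)⁻¹ *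
    ∫ β in (-(ℓ / 2))..(ℓ / 2), ((deriv u β).im : ℂ) / (x - u β))

lemma vBar_eq (ℓ : ℝ) (c : ℝ → ℝ) (z : ℝ → ℝ → ℂ) (t : ℝ) (x : ℂ) :
    vBar ℓ c z t x = loopVel ℓ (zLam c z 1 t) x + loopVel ℓ (zLam c z (-1) t) x := by
  rw [vBar, loopVel, loopVel, mul_add, map_add]

lemma conj_vel (ℓ : ℝ) (u : ℝ → ℂ) (x : ℂ) :
    (starRingEnd ℂ) (loopVel ℓ u x) = (2 * Real.pi * Complex.I)⁻¹ *
      ∫ β in (-(ℓ / 2))..(ℓ / 2), ((deriv u β).im : ℂ) / (u β - x) := by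
  rw [loopVel, Complex.conj_conj, neg_mul, ← mul_neg, ← intervalIntegral.integral_neg]
  congr 1
  refine intervalIntegral.integral_congr fun β _ => ?_
  rw [← div_neg, neg_sub]

lemma LoopFamily.continuousWithinAt_vel {ℓ a b : ℝ} {w v : ℝ → ℝ → ℂ} (h : LoopFamily ℓ a b w v)
    (hℓ : 0 < ℓ) {t : ℝ} (ht : t ∈ Icc a b) {x : ℂ} (hx : x ∉ range (w t)) :
    ContinuousWithinAt (fun q : ℝ × ℂ => loopVel ℓ (w q.1) q.2) (Icc a b ×ˢ univ) (t, x) := by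
  have h1 := continuousWithinAt_cauchy hℓ h.cont h.loop (g := fun s β => ((deriv (w s) β).im : ℂ))
    ((Complex.continuous_ofReal.comp Complex.continuous_im).comp_continuousOn h.cont_deriv)
    (fun t ht α => by simp only [periodic_deriv (h.loop t ht).periodic α]) ht hx
    (-(ℓ / 2)) (ℓ / 2)
  exact Complex.continuous_conj.continuousAt.comp_continuousWithinAt (continuousWithinAt_const.mul h1)

lemma LoopFamily.continuousWithinAt_wn {ℓ a b : ℝ} {w v : ℝ → ℝ → ℂ} (h : LoopFamily ℓ a b w v)
    (hℓ : 0 < ℓ) {t : ℝ} (ht : t ∈ Icc a b) {x : ℂ} (hx : x ∉ range (w t)) :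
    ContinuousWithinAt (fun q : ℝ × ℂ => wn ℓ (w q.1) q.2) (Icc a b ×ˢ univ) (t, x) := by
  have h1 := continuousWithinAt_cauchy hℓ h.cont h.loop (g := fun s β => -deriv (w s) β)
    h.cont_deriv.neg
    (fun t ht α => by simp only [periodic_deriv (h.loop t ht).periodic α]) ht hx
    (-(ℓ / 2)) (ℓ / 2)
  have h2 := Complex.continuous_re.continuousAt.comp_continuousWithinAt
    (ContinuousWithinAt.mul (f := fun _ => (2 * Real.pi * Complex.I : ℂ)⁻¹)
      continuousWithinAt_const h1)
  refine h2.congr (fun q _ => ?_) ?_ <;>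
  · simp only [wn, windingNumber, Function.comp]
    congr 2
    refine intervalIntegral.integral_congr fun β _ => ?_
    rw [neg_div, ← div_neg, neg_sub]

lemma continuousAt_vel {ℓ : ℝ} (hℓ : 0 < ℓ) {u : ℝ → ℂ} (h : IsLoop ℓ u) {x : ℂ}
    (hx : x ∉ range u) : ContinuousAt (loopVel ℓ u) x := by
  -- A single loop is a constant family, the strip with zero direction, so continuity in space
  -- follows from the joint continuity for families.
  have h0 : IsLoop ℓ (fun _ => (0 : ℂ)) := ⟨fun _ => rfl, contDiff_const⟩
  have := (loopFamily_strip h h0).continuousWithinAt_vel hℓ (t := 0) ⟨le_rfl, zero_le_one⟩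
    (by rwa [strip_zero])
  have hcomp : Tendsto (fun y : ℂ => ((0 : ℝ), y)) (𝓝 x) (𝓝[Icc 0 1 ×ˢ univ] (0, x)) :=
    tendsto_nhdsWithin_iff.2 ⟨(by fun_prop : Continuous fun y : ℂ => ((0 : ℝ), y)).tendsto x,
      Eventually.of_forall fun y => ⟨⟨le_rfl, zero_le_one⟩, mem_univ _⟩⟩
  have h2 := this.tendsto.comp hcomp
  simp only [Function.comp_def, strip_zero] at h2
  exact h2

lemma aestronglyMeasurable_vel {ℓ : ℝ} (hℓ : 0 < ℓ) {u : ℝ → ℂ} (h : IsLoop ℓ u) :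
    AEStronglyMeasurable (loopVel ℓ u) volume := by
  have ho := (h.isCompact_range hℓ).isClosed.isOpen_compl
  have h1 : AEStronglyMeasurable (loopVel ℓ u) (volume.restrict (range u)ᶜ) :=
    ContinuousOn.aestronglyMeasurable
      (fun x hx => (continuousAt_vel hℓ h hx).continuousWithinAt) ho.measurableSet
  have h2 : volume.restrict (range u)ᶜ = volume :=
    Measure.restrict_eq_self_of_ae_mem (ae_notMem_range h)
  rwa [h2] at h1

lemma intervalIntegrable_abs_rpow {r : ℝ} (hr : -1 < r) (L : ℝ) :
    IntervalIntegrable (fun β : ℝ => |β| ^ r) volume (-L) L := by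
  have key : ∀ L, 0 ≤ L → IntervalIntegrable (fun β : ℝ => |β| ^ r) volume 0 L := fun L hL => by
    refine (intervalIntegral.intervalIntegrable_rpow' hr).congr fun β hβ => ?_
    rw [uIoc_of_le hL] at hβ
    simp only [abs_of_pos hβ.1]
  have key2 : ∀ L, 0 ≤ L → IntervalIntegrable (fun β : ℝ => |β| ^ r) volume (-L) L :=
    fun L hL => by
      have h1 := (IntervalIntegrable.iff_comp_neg (by simp)).1 (key L hL)
      simp only [abs_neg, neg_zero] at h1
      exact h1.symm.trans (key L hL)
  rcases le_total 0 L with hL | hL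
  · exact key2 L hL
  · have := (key2 (-L) (by linarith)).symm
    rwa [neg_neg] at this

lemma intervalIntegral_reflect {E : Type*} [NormedAddCommGroup E] [NormedSpace ℝ E] {ℓ : ℝ}
    {f : ℝ → E} (hf : Function.Periodic f ℓ) (α : ℝ) :
    ∫ β in (-(ℓ / 2))..(ℓ / 2), f β = ∫ β in (-(ℓ / 2))..(ℓ / 2), f (α - β) := by
  rw [intervalIntegral.integral_comp_sub_left]
  have := hf.intervalIntegral_add_eq (-(ℓ / 2)) (α - ℓ / 2)
  rw [show -(ℓ / 2) + ℓ = ℓ / 2 by ring, show α - ℓ / 2 + ℓ = α - -(ℓ / 2) by ring] at this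
  exact this

lemma IsClosePair.rpow_le {ℓ C κ : ℝ} {w u : ℝ → ℂ} (h : IsClosePair ℓ C κ w u) (hC : 0 < C)
    (hκ : κ < 1) {α β : ℝ} (hβ : β ∈ Icc (-(ℓ / 2)) (ℓ / 2)) (hβ0 : β ≠ 0) :
    0 < ‖w α - u (α - β)‖ ∧
      ‖w α - u (α - β)‖ ^ (κ - 1) ≤ C ^ (1 - κ) * |β| ^ (κ - 1) := by
  have h1 := h.chord α β hβ
  have h2 : 0 < |β| := abs_pos.2 hβ0
  have h3 : 0 < ‖w α - u (α - β)‖ := pos_of_mul_pos_right (h2.trans_le h1) hC.le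
  refine ⟨h3, ?_⟩
  calc ‖w α - u (α - β)‖ ^ (κ - 1) ≤ (|β| / C) ^ (κ - 1) := by
        refine Real.rpow_le_rpow_of_nonpos (by positivity) ?_ (by linarith)
        rw [div_le_iff₀ hC]; linarith
    _ = C ^ (1 - κ) * |β| ^ (κ - 1) := by
        rw [Real.div_rpow h2.le hC.le, ← neg_sub 1 κ, Real.rpow_neg hC.le]
        field_simp

/-- The velocity generated by a loop is bounded in terms of the constants of the loop and the
winding number. -/
lemma norm_vel_le {ℓ C κ : ℝ} {u : ℝ → ℂ} (hu : IsLoop ℓ u) (h : IsClosePair ℓ C κ u u)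
    (hℓ : 0 < ℓ) (hC : 0 < C) (hκ0 : 0 < κ) (hκ : κ < 1) {x : ℂ} (hx : x ∉ range u) :
    ‖loopVel ℓ u x‖ ≤ |wn ℓ u x| + (2 * Real.pi)⁻¹ *
      ∫ β in (-(ℓ / 2))..(ℓ / 2), 4 * C * C ^ (1 - κ) * |β| ^ (κ - 1) := by
  have hℓ2 : -(ℓ / 2) ≤ ℓ / 2 := by linarith
  obtain ⟨-, ⟨α, rfl⟩, hmin⟩ := (hu.isCompact_range hℓ).exists_isMinOn (range_nonempty u)
    (f := fun y => ‖x - y‖) (by fun_prop)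
  have hmin' : ∀ β, ‖x - u α‖ ≤ ‖x - u β‖ := fun β => hmin ⟨β, rfl⟩
  have hne : ∀ β, x - u β ≠ 0 := fun β h0 => hx ⟨β, (sub_eq_zero.1 h0).symm⟩
  -- At the point of the curve nearest to `x`, subtracting `q u'` from `Im u'` cancels the
  -- numerator, and nearby it leaves a Hölder small one. The subtracted part is `q` times a winding
  -- number, with `‖q‖ ≤ 1`.
  set q : ℂ := ((deriv u α).im : ℂ) / deriv u α with hq
  have hq1 : ‖q‖ ≤ 1 := by
    rw [hq, norm_div, Complex.norm_real]
    exact div_le_one_of_le₀ (Complex.abs_im_le_norm _) (norm_nonneg _)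
  -- A vanishing derivative would make the curve move by less than `|y| / C` over a short parameter
  -- distance `|y|`, against the chord-arc condition.
  have hu0 : deriv u α ≠ 0 := fun h0 => by
    have hd := (hu.hasDerivAt α)
    rw [h0] at hd
    have h1 := (hasDerivAt_iff_isLittleO_nhds_zero.1 hd).def (c := (2 * C)⁻¹) (by positivity)
    have h2 : ∀ᶠ y : ℝ in 𝓝 0, |y| < ℓ / 2 := by
      filter_upwards [Metric.ball_mem_nhds (0 : ℝ) (half_pos hℓ)] with y hy
      rwa [mem_ball_zero_iff] at hy
    obtain ⟨r, hr, hball⟩ := Metric.eventually_nhds_iff.1 (h1.and h2)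
    obtain ⟨h3, h4⟩ := hball (y := r / 2) (by
      rw [dist_zero_right, Real.norm_eq_abs, abs_of_pos (by linarith)]; linarith)
    have h5 := h.chord α (-(r / 2)) ⟨by linarith [(abs_lt.1 h4).2], by linarith⟩
    rw [smul_zero, sub_zero, norm_sub_rev, Real.norm_eq_abs, ← sub_neg_eq_add] at h3
    rw [abs_neg] at h5
    have h6 : |r / 2| ≤ C * ((2 * C)⁻¹ * |r / 2|) := h5.trans (by gcongr)
    rw [show C * ((2 * C)⁻¹ * |r / 2|) = |r / 2| / 2 by field_simp] at h6
    rw [abs_of_pos (by linarith)] at h6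
    linarith
  set R : ℝ → ℂ := fun β => ((deriv u β).im - q * deriv u β) / (x - u β) with hR
  have hcd := hu.continuous_deriv
  have hRc : Continuous R :=
    ((Complex.continuous_ofReal.comp (Complex.continuous_im.comp hcd)).sub
      (continuous_const.mul hcd)).div (continuous_const.sub hu.continuous) hne
  have hDc : Continuous fun β => deriv u β / (u β - x) :=
    hcd.div (hu.continuous.sub continuous_const) fun β h0 => hx ⟨β, sub_eq_zero.1 h0⟩
  have hRper : Function.Periodic R ℓ := fun β => by
    simp only [hR, hu.periodic β, periodic_deriv hu.periodic β]
  have hsplit : ∫ β in (-(ℓ / 2))..(ℓ / 2), ((deriv u β).im : ℂ) / (x - u β) =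
      (∫ β in (-(ℓ / 2))..(ℓ / 2), R β) -
        q * ∫ β in (-(ℓ / 2))..(ℓ / 2), deriv u β / (u β - x) := by
    have hqD : Continuous fun β => q * (deriv u β / (u β - x)) := continuous_const.mul hDc
    rw [← intervalIntegral.integral_const_mul, ← intervalIntegral.integral_sub
      (hRc.intervalIntegrable _ _) (hqD.intervalIntegrable _ _)]
    refine intervalIntegral.integral_congr fun β _ => ?_
    simp only [hR]
    rw [← neg_sub x (u β)]
    field_simp [hne β]
    ring
  have hpi : (2 * Real.pi * Complex.I : ℂ) ≠ 0 := Complex.two_pi_I_ne_zero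
  have hW : ∫ β in (-(ℓ / 2))..(ℓ / 2), deriv u β / (u β - x) =
      2 * Real.pi * Complex.I * wn ℓ u x := by
    rw [← windingNumber_eq_ofReal hu hx, windingNumber, mul_inv_cancel_left₀ hpi]
  have hRint : ‖∫ β in (-(ℓ / 2))..(ℓ / 2), R β‖ ≤
      ∫ β in (-(ℓ / 2))..(ℓ / 2), 4 * C * C ^ (1 - κ) * |β| ^ (κ - 1) := by
    rw [intervalIntegral_reflect hRper α]
    refine intervalIntegral.norm_integral_le_of_norm_le hℓ2 ?_
      ((intervalIntegrable_abs_rpow (by linarith) _).const_mul _)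
    have h0 : ∀ᵐ β : ℝ, β ≠ 0 := by simp [ae_iff]
    filter_upwards [h0] with β hβ0 hβ
    have hβ' := Ioc_subset_Icc_self hβ
    obtain ⟨hD, hDκ⟩ := h.rpow_le hC hκ (α := α) hβ' hβ0
    set D := ‖u α - u (α - β)‖
    -- As `u α` is a nearest point, the distance from `x` to another point of the curve is at least
    -- half the chord, so the integrand is dominated independently of how close `x` is to the curve.
    have hDx : D ≤ 2 * ‖x - u (α - β)‖ := by
      have := norm_sub_le (x - u (α - β)) (x - u α)
      rw [show x - u (α - β) - (x - u α) = u α - u (α - β) by ring] at this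
      linarith [hmin' (α - β)]
    have hnum : ‖((deriv u (α - β)).im : ℂ) - q * deriv u (α - β)‖ ≤ 2 * (C * D ^ κ) := by
      have e : ((deriv u (α - β)).im : ℂ) - q * deriv u (α - β) =
          -((deriv u α - deriv u (α - β)).im : ℂ) + q * (deriv u α - deriv u (α - β)) := by
        rw [Complex.sub_im, mul_sub, show q * deriv u α = ((deriv u α).im : ℂ) by
          rw [hq, div_mul_cancel₀ _ hu0]]
        push_cast; ring
      rw [e]
      have h1 := h.holder α β hβ'
      calc ‖_ + _‖ ≤ ‖-((deriv u α - deriv u (α - β)).im : ℂ)‖ +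
            ‖q * (deriv u α - deriv u (α - β))‖ := norm_add_le _ _
        _ ≤ ‖deriv u α - deriv u (α - β)‖ + 1 * ‖deriv u α - deriv u (α - β)‖ := by
            rw [norm_neg, norm_mul, Complex.norm_real]
            gcongr
            exact Complex.abs_im_le_norm _
        _ ≤ _ := by linarith
    calc ‖R (α - β)‖ = ‖((deriv u (α - β)).im : ℂ) - q * deriv u (α - β)‖ / ‖x - u (α - β)‖ :=
          norm_div _ _
      _ ≤ 2 * (C * D ^ κ) / (D / 2) := by
          gcongr
          linarith
      _ = 4 * C * D ^ (κ - 1) := by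
          rw [Real.rpow_sub hD, Real.rpow_one]; field_simp; norm_num
      _ ≤ 4 * C * (C ^ (1 - κ) * |β| ^ (κ - 1)) := by gcongr
      _ = _ := by ring
  rw [loopVel, Complex.norm_conj, hsplit, hW, norm_mul, norm_neg, norm_inv]
  have hn : ‖(2 * Real.pi * Complex.I : ℂ)‖ = 2 * Real.pi := by
    simp [abs_of_pos Real.pi_pos]
  have hpos := Real.pi_pos
  rw [hn]
  calc (2 * Real.pi)⁻¹ * ‖_ - _‖ ≤ (2 * Real.pi)⁻¹ * (‖∫ β in (-(ℓ / 2))..(ℓ / 2), R β‖ +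
        ‖q * (2 * Real.pi * Complex.I * wn ℓ u x)‖) := by gcongr; exact norm_sub_le _ _
    _ ≤ (2 * Real.pi)⁻¹ * ((∫ β in (-(ℓ / 2))..(ℓ / 2), 4 * C * C ^ (1 - κ) * |β| ^ (κ - 1)) +
        1 * (2 * Real.pi * |wn ℓ u x|)) := by
        rw [norm_mul q, norm_mul (2 * Real.pi * Complex.I : ℂ), hn, Complex.norm_real,
          Real.norm_eq_abs]
        gcongr
    _ = _ := by field_simp; ring

/-! ### Divergence and vorticity of the velocity of a loop, and integrals of derivatives -/

section Incompressible

variable {ℓ : ℝ} {u : ℝ → ℂ}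

lemma integral_grad_mul_conj_vel (hℓ : 0 < ℓ) (hu : IsLoop ℓ u) {ψ : ℂ → ℝ} (hψ : ContDiff ℝ 1 ψ)
    (hc : HasCompactSupport ψ) :
    ∫ x, grad ψ x * (starRingEnd ℂ) (loopVel ℓ u x) =
      -Complex.I * ((∫ β in (-(ℓ / 2))..(ℓ / 2), (deriv u β).im * ψ (u β) : ℝ) : ℂ) := by
  have hg : Continuous fun β => ((deriv u β).im : ℂ) :=
    Complex.continuous_ofReal.comp (Complex.continuous_im.comp hu.continuous_deriv)
  have h1 := integral_grad_mul_cauchy hψ hc hg hu.continuous (a := -(ℓ / 2)) (b := ℓ / 2)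
    (by linarith)
  simp only [conj_vel, mul_left_comm (grad ψ _)]
  rw [integral_const_mul, h1, ← intervalIntegral.integral_ofReal]
  push_cast
  have hpi : (Real.pi : ℂ) ≠ 0 := by exact_mod_cast Real.pi_ne_zero
  rw [mul_inv, mul_inv, Complex.inv_I]
  field_simp

lemma inner_eq_re_mul_conj (v g : ℂ) : inner ℝ v g = (g * (starRingEnd ℂ) v).re := by
  simp only [inner_eq, Complex.mul_re, Complex.conj_re, Complex.conj_im]; ring

lemma integrable_grad_mul_conj_vel (hℓ : 0 < ℓ) (hu : IsLoop ℓ u) {f : ℂ → ℂ} (hf : Continuous f)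
    (hc : HasCompactSupport f) : Integrable fun x => f x * (starRingEnd ℂ) (loopVel ℓ u x) := by
  have hg : Continuous fun β => ((deriv u β).im : ℂ) :=
    Complex.continuous_ofReal.comp (Complex.continuous_im.comp hu.continuous_deriv)
  obtain ⟨h1, M, hM⟩ := integrable_of_contDiff hf hc
  have := (integrable_mul_cauchy h1 hM hg hu.continuous (a := -(ℓ / 2)) (b := ℓ / 2)
    (by linarith)).const_mul (2 * Real.pi * Complex.I)⁻¹
  refine this.congr (Eventually.of_forall fun x => ?_)
  simp only [conj_vel]; ring

/-- The density `Im u'` is real, so the pairing of `∇ψ` with the conjugate velocity is purely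
imaginary. The vanishing real part is incompressibility; the imaginary part is the vorticity carried
by the curve. -/
lemma integral_inner_vel_grad (hℓ : 0 < ℓ) (hu : IsLoop ℓ u) {ψ : ℂ → ℝ} (hψ : ContDiff ℝ 1 ψ)
    (hc : HasCompactSupport ψ) :
    ∫ x, inner ℝ (loopVel ℓ u x) (grad ψ x) = 0 ∧
    ∫ x, inner ℝ (loopVel ℓ u x) (Complex.I * grad ψ x) =
      ∫ β in (-(ℓ / 2))..(ℓ / 2), (deriv u β).im * ψ (u β) := by
  have hi := integrable_grad_mul_conj_vel hℓ hu (continuous_grad hψ) (hasCompactSupport_grad hc)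
  have h1 := integral_grad_mul_conj_vel hℓ hu hψ hc
  constructor
  · simp only [inner_eq_re_mul_conj]
    refine Eq.trans (integral_re (𝕜 := ℂ) hi) ?_
    rw [h1]; simp
  · simp only [inner_eq_re_mul_conj, mul_assoc]
    refine Eq.trans (integral_re (𝕜 := ℂ) (hi.const_mul Complex.I)) ?_
    rw [integral_const_mul, h1, ← mul_assoc]
    simp

lemma integral_fderiv_apply_eq_zero {E : Type*} [NormedAddCommGroup E] [NormedSpace ℝ E]
    [CompleteSpace E] {f : ℂ → E} (hf : ContDiff ℝ 1 f) (hc : HasCompactSupport f) (v : ℂ) :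
    ∫ x, fderiv ℝ f x v = 0 := by
  have hcd : Continuous fun x => fderiv ℝ f x v :=
    (hf.continuous_fderiv one_ne_zero).clm_apply continuous_const
  have hcs : HasCompactSupport fun x => fderiv ℝ f x v := hc.fderiv_apply (𝕜 := ℝ) v
  have := integral_bilinear_hasLineDerivAt_right_eq_neg_left_of_integrable
    (μ := (volume : Measure ℂ)) (f := fun _ : ℂ => (1 : ℝ)) (f' := fun _ => (0 : ℝ)) (v := v)
    (g := f) (g' := fun x => fderiv ℝ f x v) (B := ContinuousLinearMap.lsmul ℝ ℝ)
    (by simp)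
    (by simpa using hcd.integrable_of_hasCompactSupport hcs)
    (by simpa using hf.continuous.integrable_of_hasCompactSupport hc)
    (fun x _ => (hasFDerivAt_const (1 : ℝ) x).hasLineDerivAt v)
    (fun x _ => (hf.differentiable one_ne_zero x).hasFDerivAt.hasLineDerivAt v)
  simpa using this

lemma integral_grad_eq_zero {ψ : ℂ → ℝ} (hψ : ContDiff ℝ 1 ψ) (hc : HasCompactSupport ψ) :
    ∫ x, grad ψ x = 0 := by
  obtain ⟨hi, -⟩ := integrable_of_contDiff (continuous_grad hψ) (hasCompactSupport_grad hc)
  have h1 := integral_re (𝕜 := ℂ) hi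
  have h2 := integral_im (𝕜 := ℂ) hi
  refine Complex.ext ?_ ?_
  · refine (h1.symm).trans (integral_fderiv_apply_eq_zero hψ hc 1)
  · refine (h2.symm).trans (integral_fderiv_apply_eq_zero hψ hc Complex.I)

lemma integral_divergence_eq_zero {F : ℂ → ℂ} (hF : ContDiff ℝ 1 F) (hc : HasCompactSupport F) :
    ∫ x, divergence F x = 0 := by
  have key : ∀ v, Integrable fun x => fderiv ℝ F x v := fun v =>
    ((hF.continuous_fderiv one_ne_zero).clm_apply continuous_const).integrable_of_hasCompactSupport
      (hc.fderiv_apply (𝕜 := ℝ) v)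
  have h1 := integral_re (𝕜 := ℂ) (key 1)
  have h2 := integral_im (𝕜 := ℂ) (key Complex.I)
  rw [integral_fderiv_apply_eq_zero hF hc] at h1 h2
  unfold divergence
  refine (integral_add (key 1).re (key Complex.I).im).trans ?_
  rw [h1, h2]; simp

end Incompressible

/-! ### The flux of the velocity through a loop -/

/-- The Muskat-type operator: the velocity at the points of `w`, generated by `u`, up to a tangential
field. -/
def muskat (ℓ : ℝ) (w u : ℝ → ℂ) (α : ℝ) : ℂ :=
  (2 * Real.pi)⁻¹ • ∫ β in (-(ℓ / 2))..(ℓ / 2),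
    ((1 / (w α - u β)).re : ℝ) • (deriv w α - deriv u β)

section Muskat

variable {ℓ C κ : ℝ} {w u : ℝ → ℂ}

lemma muskat_eq_reflect (hu : IsLoop ℓ u) (α : ℝ) :
    muskat ℓ w u α = (2 * Real.pi)⁻¹ • ∫ β in (-(ℓ / 2))..(ℓ / 2),
      ((1 / (w α - u (α - β))).re : ℝ) • (deriv w α - deriv u (α - β)) := by
  rw [muskat]
  congr 1
  refine intervalIntegral_reflect (f := fun β => ((1 / (w α - u β)).re : ℝ) •
    (deriv w α - deriv u β)) (fun β => ?_) α
  simp only [hu.periodic β, periodic_deriv hu.periodic β]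

lemma re_one_div (y : ℂ) : (1 / y).re = y.re * (‖y‖ ^ 2)⁻¹ := by
  rw [one_div, Complex.inv_re, ← Complex.normSq_eq_norm_sq, div_eq_mul_inv]

/-- The bound of the kernel of the Muskat-type operators. -/
lemma IsClosePair.kernel_le (h : IsClosePair ℓ C κ w u) (hC : 0 < C) (hκ : κ < 1) {α β e : ℝ}
    (he : 0 ≤ e) (hβ : β ∈ Icc (-(ℓ / 2)) (ℓ / 2)) (hβ0 : β ≠ 0) :
    |(w α - u (α - β)).re * (‖w α - u (α - β)‖ ^ 2 + e)⁻¹| * ‖deriv w α - deriv u (α - β)‖ ≤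
      C * C ^ (1 - κ) * |β| ^ (κ - 1) := by
  obtain ⟨hD, hDκ⟩ := h.rpow_le hC hκ (α := α) hβ hβ0
  set D := ‖w α - u (α - β)‖
  have h1 : |(w α - u (α - β)).re * (D ^ 2 + e)⁻¹| ≤ D⁻¹ := by
    rw [abs_mul, abs_of_nonneg (a := (D ^ 2 + e)⁻¹) (by positivity)]
    calc |(w α - u (α - β)).re| * (D ^ 2 + e)⁻¹ ≤ D * (D ^ 2)⁻¹ := by
          gcongr
          · exact Complex.abs_re_le_norm _
          · linarith
      _ = D⁻¹ := by field_simp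
  calc _ ≤ D⁻¹ * (C * D ^ κ) := mul_le_mul h1 (h.holder α β hβ) (norm_nonneg _) (by positivity)
    _ = C * D ^ (κ - 1) := by rw [Real.rpow_sub hD, Real.rpow_one]; field_simp
    _ ≤ C * (C ^ (1 - κ) * |β| ^ (κ - 1)) := by gcongr
    _ = _ := by ring

/-- Centred at `α`, the kernel is dominated by a multiple of `|β|^(κ-1)`, independently of `α`. -/
lemma continuous_muskat (hw : IsLoop ℓ w) (hu : IsLoop ℓ u) (h : IsClosePair ℓ C κ w u) (hℓ : 0 < ℓ)
    (hC : 0 < C) (hκ0 : 0 < κ) (hκ : κ < 1) : Continuous (muskat ℓ w u) := by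
  have hwc := hw.continuous; have hwd := hw.continuous_deriv
  have huc := hu.continuous; have hud := hu.continuous_deriv
  have hℓ2 : -(ℓ / 2) ≤ ℓ / 2 := by linarith
  have h0 : ∀ᵐ β : ℝ, β ≠ 0 := by simp [ae_iff]
  simp only [funext (muskat_eq_reflect (w := w) hu), re_one_div]
  refine Continuous.const_smul ?_ (2 * Real.pi)⁻¹
  refine intervalIntegral.continuous_of_dominated_interval
    (bound := fun β => C * C ^ (1 - κ) * |β| ^ (κ - 1)) ?_ ?_
    ((intervalIntegrable_abs_rpow (by linarith) _).const_mul _) ?_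
  · intro α
    refine Measurable.aestronglyMeasurable ?_
    have m1 : Measurable fun β => w α - u (α - β) := (by fun_prop : Continuous _).measurable
    have m2 : Measurable fun β => deriv w α - deriv u (α - β) := (by fun_prop : Continuous _).measurable
    exact ((Complex.measurable_re.comp m1).mul ((m1.norm.pow_const 2).inv)).smul m2
  · intro α
    filter_upwards [h0] with β hβ0 hβ
    rw [uIoc_of_le hℓ2] at hβ
    rw [norm_smul, Real.norm_eq_abs]
    have := h.kernel_le hC hκ (α := α) (le_refl 0) (Ioc_subset_Icc_self hβ) hβ0
    rwa [add_zero] at this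
  · filter_upwards [h0] with β hβ0 hβ
    rw [uIoc_of_le hℓ2] at hβ
    have hne : ∀ α, ‖w α - u (α - β)‖ ^ 2 ≠ 0 := fun α =>
      pow_ne_zero 2 (h.rpow_le hC hκ (α := α) (Ioc_subset_Icc_self hβ) hβ0).1.ne'
    have c1 : Continuous fun α => w α - u (α - β) := by fun_prop
    have c2 : Continuous fun α => deriv w α - deriv u (α - β) := by fun_prop
    exact ((Complex.continuous_re.comp c1).mul ((c1.norm.pow 2).inv₀ hne)).smul c2

/-- The regularised kernel of the Biot-Savart law. -/
def regKernel (e : ℝ) (y : ℂ) : ℂ := (‖y‖ ^ 2 + e)⁻¹ • (Complex.I * y)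

lemma norm_regKernel_le {e : ℝ} (he : 0 ≤ e) (y : ℂ) : ‖regKernel e y‖ ≤ ‖y‖⁻¹ := by
  rw [regKernel, norm_smul, norm_I_mul, Real.norm_eq_abs, abs_of_nonneg (by positivity)]
  rcases (norm_nonneg y).eq_or_lt with h0 | h0
  · simp [← h0]
  · calc (‖y‖ ^ 2 + e)⁻¹ * ‖y‖ ≤ (‖y‖ ^ 2)⁻¹ * ‖y‖ := by gcongr; linarith
      _ = ‖y‖⁻¹ := by field_simp

lemma hasFDerivAt_inv_norm_sq_add {e : ℝ} (he : 0 < e) (q x : ℂ) :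
    HasFDerivAt (fun x : ℂ => (‖x - q‖ ^ 2 + e)⁻¹)
      (-((‖x - q‖ ^ 2 + e) ^ 2)⁻¹ • (2 • (innerSL ℝ (x - q)))) x := by
  have h1 : HasFDerivAt (fun x : ℂ => ‖x - q‖ ^ 2) (2 • (innerSL ℝ (x - q))) x := by
    simpa using ((hasFDerivAt_id x).sub_const q).norm_sq
  exact (hasDerivAt_inv (by positivity)).comp_hasFDerivAt x (h1.add_const e)

lemma contDiff_smul_regKernel {e : ℝ} (he : 0 < e) (q : ℂ) {φ : ℂ → ℝ} (hφ : ContDiff ℝ 1 φ) :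
    ContDiff ℝ 1 fun x => φ x • regKernel e (x - q) := by
  have h1 : ContDiff ℝ 1 fun x : ℂ => (‖x - q‖ ^ 2 + e)⁻¹ :=
    (((contDiff_id.sub contDiff_const).norm_sq ℝ).add contDiff_const).inv fun x => by positivity
  exact hφ.smul (h1.smul (contDiff_const.mul (contDiff_id.sub contDiff_const)))

/-- The regularised kernel is the rotated gradient of `log(|y|² + e) / 2`, hence divergence free,
and only the gradient of `φ` contributes. -/
lemma divergence_smul_regKernel {e : ℝ} (he : 0 < e) (q : ℂ) {φ : ℂ → ℝ} (hφ : ContDiff ℝ 1 φ)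
    (x : ℂ) : divergence (fun x => φ x • regKernel e (x - q)) x =
      inner ℝ (regKernel e (x - q)) (grad φ x) := by
  have h1 := hasFDerivAt_inv_norm_sq_add he q x
  have h2 : HasFDerivAt (fun x : ℂ => Complex.I * (x - q))
      (Complex.I • ContinuousLinearMap.id ℝ ℂ) x :=
    ((hasFDerivAt_id x).sub_const q).const_mul Complex.I
  obtain ⟨r, hr⟩ : ∃ r, r = (‖x - q‖ ^ 2 + e)⁻¹ := ⟨_, rfl⟩
  obtain ⟨r', hr'⟩ : ∃ r', r' = -((‖x - q‖ ^ 2 + e) ^ 2)⁻¹ := ⟨_, rfl⟩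
  have h3 : HasFDerivAt (fun x => φ x • regKernel e (x - q))
      (φ x • (r • (Complex.I • ContinuousLinearMap.id ℝ ℂ) +
        (r' • (2 • (innerSL ℝ (x - q)))).smulRight (Complex.I * (x - q))) +
        (fderiv ℝ φ x).smulRight (r • (Complex.I * (x - q)))) x := by
    rw [hr, hr']
    exact ((hφ.differentiable one_ne_zero x).hasFDerivAt).smul (h1.smul h2)
  rw [divergence, h3.fderiv, inner_eq, regKernel, ← hr]
  simp [grad]
  ring

lemma integral_wn_mul_regKernel (hℓ : 0 < ℓ) (hw : IsLoop ℓ w) {e : ℝ} (he : 0 < e) (q : ℂ)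
    {φ : ℂ → ℝ} (hφ : ContDiff ℝ 1 φ) (hc : HasCompactSupport φ) :
    ∫ x, wn ℓ w x * inner ℝ (regKernel e (x - q)) (grad φ x) =
      -∫ α in (-(ℓ / 2))..(ℓ / 2), φ (w α) *
        (inner ℝ (w α - q) (deriv w α) * (‖w α - q‖ ^ 2 + e)⁻¹) := by
  have := integral_wn_mul_divergence hw hℓ (contDiff_smul_regKernel he q hφ) (hc.smul_right)
  simp only [divergence_smul_regKernel he q hφ] at this
  rw [this]
  congr 1
  refine intervalIntegral.integral_congr fun α _ => ?_
  simp only [regKernel, real_inner_smul_left, inner_I_mul_I_mul]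
  ring

/-- The integrand is the derivative along the loop of `-log(|p - u|² + e) / 2`, which is periodic.
-/
lemma integral_inner_mul_inv_eq_zero (hu : IsLoop ℓ u) {e : ℝ} (he : 0 < e) (p : ℂ) :
    ∫ β in (-(ℓ / 2))..(ℓ / 2), inner ℝ (p - u β) (deriv u β) * (‖p - u β‖ ^ 2 + e)⁻¹ = 0 := by
  have huc := hu.continuous; have hud := hu.continuous_deriv
  have hpos : ∀ β, ‖p - u β‖ ^ 2 + e ≠ 0 := fun β => by positivity
  have hder : ∀ β, HasDerivAt (fun β => -(1 / 2) * Real.log (‖p - u β‖ ^ 2 + e))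
      (inner ℝ (p - u β) (deriv u β) * (‖p - u β‖ ^ 2 + e)⁻¹) β := fun β => by
    have h1 := ((((hu.hasDerivAt β).const_sub p).norm_sq).add_const e).log (hpos β)
    refine (h1.const_mul (-(1 / 2))).congr_deriv ?_
    rw [inner_neg_right]; field_simp
  rw [intervalIntegral.integral_eq_sub_of_hasDerivAt (fun β _ => hder β)
    (Continuous.intervalIntegrable
      ((Continuous.inner (𝕜 := ℝ) (by fun_prop) hud).mul ((by fun_prop : Continuous fun β =>
        ‖p - u β‖ ^ 2 + e).inv₀ hpos)) _ _)]
  rw [periodic_endpoint hu.periodic, sub_self]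

/-- With `y = w - u`, `a = w'` and `b = u'`, this exchanges the two tangents. The term with `y · u'`
is a total derivative in the parameter of `u`, and the remaining numerator contains `w' - u'`, which
is small near the singularity. -/
lemma im_mul_inner_eq (y a b : ℂ) :
    b.im * inner ℝ y a = a.im * inner ℝ y b - y.re * inner ℝ (a - b) (Complex.I * a) := by
  simp only [inner_eq, Complex.I_mul_re, Complex.I_mul_im, Complex.sub_re, Complex.sub_im]; ring

/-- The exchange of tangents replaces the kernel that is singular on the diagonal by the one of the
Muskat-type operator, so no principal value is left in the limit `e → 0`. -/
lemma integral_im_mul_regKernel (hu : IsLoop ℓ u) {e : ℝ} (he : 0 < e) (α : ℝ) :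
    ∫ β in (-(ℓ / 2))..(ℓ / 2), (deriv u β).im *
        (inner ℝ (w α - u β) (deriv w α) * (‖w α - u β‖ ^ 2 + e)⁻¹) =
      -∫ β in (-(ℓ / 2))..(ℓ / 2), (w α - u β).re * (‖w α - u β‖ ^ 2 + e)⁻¹ *
        inner ℝ (deriv w α - deriv u β) (Complex.I * deriv w α) := by
  have huc := hu.continuous; have hud := hu.continuous_deriv
  have hinv : Continuous fun β => (‖w α - u β‖ ^ 2 + e)⁻¹ :=
    (by fun_prop : Continuous fun β => ‖w α - u β‖ ^ 2 + e).inv₀ fun β => by positivity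
  have c1 : Continuous fun β => (deriv w α).im *
      (inner ℝ (w α - u β) (deriv u β) * (‖w α - u β‖ ^ 2 + e)⁻¹) :=
    continuous_const.mul ((Continuous.inner (𝕜 := ℝ) (by fun_prop) hud).mul hinv)
  have c2 : Continuous fun β => (w α - u β).re * (‖w α - u β‖ ^ 2 + e)⁻¹ *
        inner ℝ (deriv w α - deriv u β) (Complex.I * deriv w α) :=
    ((Complex.continuous_re.comp (by fun_prop)).mul hinv).mul
      (Continuous.inner (𝕜 := ℝ) (by fun_prop) continuous_const)
  have h0 := integral_inner_mul_inv_eq_zero hu he (w α)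
  have h1 : ∫ β in (-(ℓ / 2))..(ℓ / 2), (deriv w α).im *
      (inner ℝ (w α - u β) (deriv u β) * (‖w α - u β‖ ^ 2 + e)⁻¹) = 0 := by
    rw [intervalIntegral.integral_const_mul, h0, mul_zero]
  have c3 : Continuous fun β => (deriv u β).im *
      (inner ℝ (w α - u β) (deriv w α) * (‖w α - u β‖ ^ 2 + e)⁻¹) :=
    (Complex.continuous_im.comp hud).mul
      ((Continuous.inner (𝕜 := ℝ) (by fun_prop) continuous_const).mul hinv)
  rw [eq_neg_iff_add_eq_zero, ← intervalIntegral.integral_add (c3.intervalIntegrable _ _)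
    (c2.intervalIntegrable _ _)]
  refine Eq.trans (intervalIntegral.integral_congr fun β _ => ?_) h1
  linear_combination (‖w α - u β‖ ^ 2 + e)⁻¹ * im_mul_inner_eq (w α - u β) (deriv w α) (deriv u β)

/-- The regularised normal component of the Muskat-type operator. -/
def muskatReg (ℓ : ℝ) (w u : ℝ → ℂ) (e α : ℝ) : ℝ :=
  ∫ β in (-(ℓ / 2))..(ℓ / 2), (w α - u β).re * (‖w α - u β‖ ^ 2 + e)⁻¹ *
        inner ℝ (deriv w α - deriv u β) (Complex.I * deriv w α)

lemma muskatReg_eq_reflect (hu : IsLoop ℓ u) (e α : ℝ) :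
    muskatReg ℓ w u e α = ∫ β in (-(ℓ / 2))..(ℓ / 2),
      (w α - u (α - β)).re * (‖w α - u (α - β)‖ ^ 2 + e)⁻¹ *
        inner ℝ (deriv w α - deriv u (α - β)) (Complex.I * deriv w α) :=
  intervalIntegral_reflect (f := fun β => (w α - u β).re * (‖w α - u β‖ ^ 2 + e)⁻¹ *
        inner ℝ (deriv w α - deriv u β) (Complex.I * deriv w α)) (fun β => by
    simp only [hu.periodic β, periodic_deriv hu.periodic β]) α

lemma IsClosePair.reg_kernel_le (h : IsClosePair ℓ C κ w u) (hC : 0 < C) (hκ : κ < 1) {α β e : ℝ}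
    (he : 0 ≤ e) (hβ : β ∈ Icc (-(ℓ / 2)) (ℓ / 2)) (hβ0 : β ≠ 0) :
    ‖(w α - u (α - β)).re * (‖w α - u (α - β)‖ ^ 2 + e)⁻¹ *
        inner ℝ (deriv w α - deriv u (α - β)) (Complex.I * deriv w α)‖ ≤
      ‖deriv w α‖ * (C * C ^ (1 - κ) * |β| ^ (κ - 1)) := by
  rw [norm_mul, Real.norm_eq_abs]
  have h1 := h.kernel_le hC hκ (α := α) he hβ hβ0
  have h2 := norm_inner_le_norm (𝕜 := ℝ) (deriv w α - deriv u (α - β)) (Complex.I * deriv w α)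
  rw [norm_I_mul] at h2
  calc _ ≤ |(w α - u (α - β)).re * (‖w α - u (α - β)‖ ^ 2 + e)⁻¹| *
        (‖deriv w α - deriv u (α - β)‖ * ‖deriv w α‖) := by gcongr
    _ = ‖deriv w α‖ * (|(w α - u (α - β)).re * (‖w α - u (α - β)‖ ^ 2 + e)⁻¹| *
        ‖deriv w α - deriv u (α - β)‖) := by ring
    _ ≤ _ := by gcongr

lemma norm_muskatReg_le (hu : IsLoop ℓ u) (h : IsClosePair ℓ C κ w u) (hℓ : 0 < ℓ)
    (hC : 0 < C) (hκ0 : 0 < κ) (hκ : κ < 1) {e : ℝ} (he : 0 ≤ e) (α : ℝ) :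
    ‖muskatReg ℓ w u e α‖ ≤
      ‖deriv w α‖ * ∫ β in (-(ℓ / 2))..(ℓ / 2), C * C ^ (1 - κ) * |β| ^ (κ - 1) := by
  have h0 : ∀ᵐ β : ℝ, β ≠ 0 := by simp [ae_iff]
  rw [muskatReg_eq_reflect hu, ← intervalIntegral.integral_const_mul]
  refine intervalIntegral.norm_integral_le_of_norm_le (by linarith) ?_
    (((intervalIntegrable_abs_rpow (by linarith) _).const_mul _).const_mul _)
  filter_upwards [h0] with β hβ0 hβ
  exact h.reg_kernel_le hC hκ he (Ioc_subset_Icc_self hβ) hβ0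

/-- The kernel bound does not depend on `e`, so dominated convergence applies. -/
lemma tendsto_muskatReg (hu : IsLoop ℓ u) (h : IsClosePair ℓ C κ w u) (hℓ : 0 < ℓ)
    (hC : 0 < C) (hκ0 : 0 < κ) (hκ : κ < 1) (α : ℝ) :
    Tendsto (fun e => muskatReg ℓ w u e α) (𝓝[>] 0)
      (𝓝 (2 * Real.pi * inner ℝ (muskat ℓ w u α) (Complex.I * deriv w α))) := by
  have huc := hu.continuous; have hud := hu.continuous_deriv
  have hℓ2 : -(ℓ / 2) ≤ ℓ / 2 := by linarith
  have h0 : ∀ᵐ β : ℝ, β ≠ 0 := by simp [ae_iff]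
  have hpos : ∀ᶠ e : ℝ in 𝓝[>] 0, 0 < e := eventually_mem_nhdsWithin
  have m1 : Measurable fun β => w α - u (α - β) := (by fun_prop : Continuous _).measurable
  have m2 : Measurable fun β => deriv w α - deriv u (α - β) := (by fun_prop : Continuous _).measurable
  have hint : IntervalIntegrable (fun β => ((1 / (w α - u (α - β))).re : ℝ) •
      (deriv w α - deriv u (α - β))) volume (-(ℓ / 2)) (ℓ / 2) := by
    refine (((intervalIntegrable_abs_rpow (r := κ - 1) (by linarith) _).const_mul
      (C * C ^ (1 - κ)))).mono_fun' ?_ ?_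
    · simp only [re_one_div]
      exact (((Complex.measurable_re.comp m1).mul
        ((m1.norm.pow_const 2).inv)).smul m2).aestronglyMeasurable
    · refine (ae_restrict_iff' measurableSet_uIoc).2 ?_
      filter_upwards [h0] with β hβ0 hβ
      rw [uIoc_of_le hℓ2] at hβ
      rw [norm_smul, Real.norm_eq_abs, re_one_div]
      have := h.kernel_le hC hκ (α := α) (le_refl 0) (Ioc_subset_Icc_self hβ) hβ0
      rwa [add_zero] at this
  have hlim : 2 * Real.pi * inner ℝ (muskat ℓ w u α) (Complex.I * deriv w α) =
      ∫ β in (-(ℓ / 2))..(ℓ / 2), (w α - u (α - β)).re * (‖w α - u (α - β)‖ ^ 2)⁻¹ *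
        inner ℝ (deriv w α - deriv u (α - β)) (Complex.I * deriv w α) := by
    have hpi : (2 * Real.pi : ℝ) ≠ 0 := by positivity
    rw [muskat_eq_reflect hu, real_inner_smul_left, mul_inv_cancel_left₀ hpi, real_inner_comm,
      ← innerSL_apply_apply ℝ, ← ContinuousLinearMap.intervalIntegral_comp_comm _ hint]
    refine intervalIntegral.integral_congr fun β _ => ?_
    simp only [innerSL_apply_apply, real_inner_smul_right, re_one_div, real_inner_comm]
  rw [hlim]
  simp only [muskatReg_eq_reflect hu]
  refine intervalIntegral.tendsto_integral_filter_of_dominated_convergence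
    (fun β => ‖deriv w α‖ * (C * C ^ (1 - κ) * |β| ^ (κ - 1))) ?_ ?_
    (((intervalIntegrable_abs_rpow (by linarith) _).const_mul _).const_mul _) ?_
  · refine Eventually.of_forall fun e => ?_
    exact (((Complex.measurable_re.comp m1).mul
        (((m1.norm.pow_const 2).add_const e).inv)).mul
        (m2.inner (𝕜 := ℝ) measurable_const)).aestronglyMeasurable
  · filter_upwards [hpos] with e he
    filter_upwards [h0] with β hβ0 hβ
    rw [uIoc_of_le hℓ2] at hβ
    exact h.reg_kernel_le hC hκ he.le (Ioc_subset_Icc_self hβ) hβ0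
  · filter_upwards [h0] with β hβ0 hβ
    rw [uIoc_of_le hℓ2] at hβ
    have hD := (h.rpow_le hC hκ (α := α) (Ioc_subset_Icc_self hβ) hβ0).1
    refine Tendsto.mul_const _ (Tendsto.const_mul _ ?_)
    have : ContinuousAt (fun e : ℝ => (‖w α - u (α - β)‖ ^ 2 + e)⁻¹) 0 :=
      ContinuousAt.inv₀ (by fun_prop) (by rw [add_zero]; positivity)
    have h2 := this.tendsto
    simp only [add_zero] at h2
    exact h2.mono_left nhdsWithin_le_nhds

end Muskat

/-! ### Pairing of the velocity of one loop with the winding number of another -/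

section VelocityFlux

variable {ℓ C κ N : ℝ} {w u : ℝ → ℂ}

lemma aestronglyMeasurable_wn (hℓ : 0 < ℓ) (h : IsLoop ℓ w) :
    AEStronglyMeasurable (wn ℓ w) volume := by
  have ho := (h.isCompact_range hℓ).isClosed.isOpen_compl
  have h1 : AEStronglyMeasurable (wn ℓ w) (volume.restrict (range w)ᶜ) :=
    ContinuousOn.aestronglyMeasurable
      (fun x hx => (continuousAt_wn h hℓ hx).continuousWithinAt) ho.measurableSet
  have h2 : volume.restrict (range w)ᶜ = volume :=
    Measure.restrict_eq_self_of_ae_mem (ae_notMem_range h)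
  rwa [h2] at h1

lemma inner_regKernel_zero (y g : ℂ) :
    inner ℝ (regKernel 0 y) g = (Complex.I * (g / -y)).re := by
  rw [regKernel, add_zero, ← Complex.normSq_eq_norm_sq, inner_eq_re_mul_conj, div_neg,
    div_eq_mul_inv, Complex.inv_def]
  simp only [Complex.real_smul, map_mul, Complex.conj_I, Complex.conj_ofReal]
  congr 1; ring

lemma tendsto_regKernel (y : ℂ) : Tendsto (fun e => regKernel e y) (𝓝[>] 0) (𝓝 (regKernel 0 y)) := by
  rcases eq_or_ne y 0 with rfl | hy
  · simp [regKernel]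
  · have hy' : 0 < ‖y‖ := norm_pos_iff.2 hy
    have h0 : ContinuousAt (fun e : ℝ => (‖y‖ ^ 2 + e)⁻¹) 0 :=
      ContinuousAt.inv₀ (by fun_prop) (by rw [add_zero]; positivity)
    have : ContinuousAt (fun e : ℝ => (‖y‖ ^ 2 + e)⁻¹ • (Complex.I * y)) 0 :=
      h0.smul continuousAt_const
    exact this.tendsto.mono_left nhdsWithin_le_nhds

lemma measurable_regKernel (e : ℝ) (q : ℂ) : Measurable fun x => regKernel e (x - q) := by
  have h1 : Measurable fun x : ℂ => x - q := measurable_id.sub_const q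
  exact (((h1.norm.pow_const 2).add_const e).inv).smul (h1.const_mul Complex.I)

/-- Convergence of the regularised Biot-Savart pairing. -/
lemma tendsto_integral_inner_regKernel {f : ℂ → ℂ} (hf : Integrable f) {M : ℝ}
    (hM : ∀ x, ‖f x‖ ≤ M) :
    ∃ K, (∀ q, ∀ e, 0 ≤ e → |∫ x, inner ℝ (regKernel e (x - q)) (f x)| ≤ K) ∧
      ∀ q, Tendsto (fun e => ∫ x, inner ℝ (regKernel e (x - q)) (f x)) (𝓝[>] 0)
        (𝓝 (Complex.I * ∫ x, f x / (q - x)).re) := by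
  obtain ⟨K, hK⟩ := exists_integral_mul_inv_norm_le hf.norm (M := M) (by simpa using hM)
  have hbd : ∀ q e, 0 ≤ e → ∀ x, ‖inner ℝ (regKernel e (x - q)) (f x)‖ ≤ ‖f x‖ * ‖x - q‖⁻¹ :=
    fun q e he x => by
      refine (norm_inner_le_norm _ _).trans ?_
      rw [mul_comm]
      gcongr
      exact norm_regKernel_le he _
  refine ⟨K, fun q e he => ?_, fun q => ?_⟩
  · have h1 := norm_integral_le_of_norm_le (hK q).1 (Eventually.of_forall (hbd q e he))
    refine h1.trans ?_
    have := (hK q).2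
    simpa using this
  · have hJ : Integrable fun x => f x / (q - x) := by
      refine (hK q).1.mono' ?_ (Eventually.of_forall fun x => ?_)
      · simp only [div_eq_mul_inv]
        exact hf.aestronglyMeasurable.mul
          ((measurable_const.sub measurable_id).inv).aestronglyMeasurable
      · rw [norm_div, norm_sub_rev, div_eq_mul_inv]
    have e1 : (Complex.I * ∫ x, f x / (q - x)).re =
        ∫ x, inner ℝ (regKernel 0 (x - q)) (f x) := by
      rw [← integral_const_mul]
      refine Eq.trans (integral_re (𝕜 := ℂ) (hJ.const_mul Complex.I)).symm ?_
      refine integral_congr_ae (Eventually.of_forall fun x => ?_)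
      simp only [inner_regKernel_zero, neg_sub]; rfl
    rw [e1]
    refine tendsto_integral_filter_of_dominated_convergence (fun x => ‖f x‖ * ‖x - q‖⁻¹) ?_ ?_
      (hK q).1 ?_
    · exact Eventually.of_forall fun e =>
        (measurable_regKernel e q).aestronglyMeasurable.inner hf.aestronglyMeasurable
    · filter_upwards [eventually_mem_nhdsWithin (a := (0 : ℝ)) (s := Ioi 0)] with e he
      exact Eventually.of_forall (hbd q e (mem_Ioi.1 he).le)
    · exact Eventually.of_forall fun x => (tendsto_regKernel _).inner tendsto_const_nhds

lemma continuous_muskatReg (hw : IsLoop ℓ w) (hu : IsLoop ℓ u) {e : ℝ} (he : 0 < e) :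
    Continuous (muskatReg ℓ w u e) := by
  have hwc := hw.continuous; have hwd := hw.continuous_deriv
  have huc := hu.continuous; have hud := hu.continuous_deriv
  refine intervalIntegral.continuous_parametric_intervalIntegral_of_continuous' (f := fun α β =>
    (w α - u β).re * (‖w α - u β‖ ^ 2 + e)⁻¹ *
        inner ℝ (deriv w α - deriv u β) (Complex.I * deriv w α)) ?_ _ _
  have c1 : Continuous fun q : ℝ × ℝ => w q.1 - u q.2 := by fun_prop
  have c2 : Continuous fun q : ℝ × ℝ => deriv w q.1 - deriv u q.2 := by fun_prop
  have hp : ∀ q : ℝ × ℝ, ‖w q.1 - u q.2‖ ^ 2 + e ≠ 0 := fun q => by positivity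
  have c3 : Continuous fun q : ℝ × ℝ => (‖w q.1 - u q.2‖ ^ 2 + e)⁻¹ :=
    ((c1.norm.pow 2).add continuous_const).inv₀ hp
  exact ((Complex.continuous_re.comp c1).mul c3).mul
    (Continuous.inner (𝕜 := ℝ) c2 (by fun_prop))

/-- Green's theorem for the velocity would need its boundary values on `w`, which are singular when
`w` and `u` touch or coincide. With the regularised kernel the field is `C^1`. Green's theorem on
`w`, Fubini and the exchange of tangents then give the regularised Muskat-type operator, and both
sides converge as `e → 0` by dominated convergence. -/
lemma integral_wn_mul_inner_loopVel (hw : IsLoop ℓ w) (hu : IsLoop ℓ u) (h : IsClosePair ℓ C κ w u)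
    (hℓ : 0 < ℓ) (hC : 0 < C) (hκ0 : 0 < κ) (hκ : κ < 1) (hN : ∀ x ∉ range w, |wn ℓ w x| ≤ N)
    {φ : ℂ → ℝ} (hφ : ContDiff ℝ 1 φ) (hc : HasCompactSupport φ) :
    ∫ x, wn ℓ w x * inner ℝ (loopVel ℓ u x) (grad φ x) =
      -∫ α in (-(ℓ / 2))..(ℓ / 2),
        φ (w α) * inner ℝ (muskat ℓ w u α) (Complex.I * deriv w α) := by
  have hwc := hw.continuous; have hwd := hw.continuous_deriv
  have huc := hu.continuous; have hud := hu.continuous_deriv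
  have hℓ2 : -(ℓ / 2) ≤ ℓ / 2 := by linarith
  obtain ⟨hgI, M, hM⟩ := integrable_of_contDiff (continuous_grad hφ) (hasCompactSupport_grad hc)
  have hM0 : 0 ≤ M := (norm_nonneg _).trans (hM 0)
  -- The bound on the winding number is known off the curve only; on the null set `range w` the
  -- value is replaced by zero.
  set n : ℂ → ℝ := (range w)ᶜ.indicator (wn ℓ w) with hn
  have hne : n =ᵐ[volume] wn ℓ w := by
    filter_upwards [ae_notMem_range hw] with x hx using indicator_of_mem hx _
  have hN0 : 0 ≤ N := by
    obtain ⟨x, hx⟩ := (ae_notMem_range hw).exists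
    exact (abs_nonneg _).trans (hN x hx)
  have hnN : ∀ x, |n x| ≤ N := fun x => by
    by_cases hx : x ∈ range w
    · rw [hn, indicator_of_notMem (by simpa using hx), abs_zero]; exact hN0
    · rw [hn, indicator_of_mem hx]; exact hN x hx
  set f : ℂ → ℂ := fun x => n x * grad φ x with hf
  have hfle : ∀ x, ‖f x‖ ≤ N * ‖grad φ x‖ := fun x => by
    rw [hf, norm_mul, Complex.norm_real]; gcongr; exact hnN x
  have hfM : ∀ x, ‖f x‖ ≤ N * M := fun x => (hfle x).trans (by gcongr; exact hM x)
  have hfI : Integrable f := by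
    refine (hgI.norm.const_mul N).mono' ?_ (Eventually.of_forall hfle)
    exact (Complex.continuous_ofReal.comp_aestronglyMeasurable
      ((aestronglyMeasurable_wn hℓ hw).congr hne.symm)).mul hgI.aestronglyMeasurable
  obtain ⟨K, hK, hlim⟩ := tendsto_integral_inner_regKernel hfI hfM
  have hinner : ∀ (y : ℂ) x, inner ℝ y (f x) = n x * inner ℝ y (grad φ x) := fun y x => by
    simp only [hf, inner_eq, Complex.re_ofReal_mul, Complex.im_ofReal_mul]; ring
  -- the regularised pairing as a line integral
  have hIe : ∀ e, 0 < e → ∀ q, ∫ x, inner ℝ (regKernel e (x - q)) (f x) =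
      -∫ α in (-(ℓ / 2))..(ℓ / 2), φ (w α) *
        (inner ℝ (w α - q) (deriv w α) * (‖w α - q‖ ^ 2 + e)⁻¹) := fun e he q => by
    rw [← integral_wn_mul_regKernel hℓ hw he q hφ hc]
    refine integral_congr_ae ?_
    filter_upwards [hne] with x hx
    rw [hinner, hx]
  have hjoint : ∀ e : ℝ, 0 < e → Continuous fun p : ℝ × ℝ => φ (w p.2) *
      (inner ℝ (w p.2 - u p.1) (deriv w p.2) * (‖w p.2 - u p.1‖ ^ 2 + e)⁻¹) := fun e he => by
    have c1 : Continuous fun p : ℝ × ℝ => w p.2 - u p.1 := by fun_prop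
    have hp : ∀ p : ℝ × ℝ, ‖w p.2 - u p.1‖ ^ 2 + e ≠ 0 := fun p => by positivity
    have c3 : Continuous fun p : ℝ × ℝ => (‖w p.2 - u p.1‖ ^ 2 + e)⁻¹ :=
      ((c1.norm.pow 2).add continuous_const).inv₀ hp
    exact (hφ.continuous.comp (by fun_prop)).mul
      ((Continuous.inner (𝕜 := ℝ) c1 (by fun_prop)).mul c3)
  have hpos : ∀ᶠ e : ℝ in 𝓝[>] 0, 0 < e := eventually_mem_nhdsWithin
  have hdC : Continuous fun β => (deriv u β).im := Complex.continuous_im.comp hud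
  have hbK : IntervalIntegrable (fun β => |(deriv u β).im| * K) volume (-(ℓ / 2)) (ℓ / 2) :=
    (hdC.abs.mul continuous_const).intervalIntegrable _ _
  -- limit of the left-hand side
  have hL : Tendsto (fun e => ∫ β in (-(ℓ / 2))..(ℓ / 2),
      (deriv u β).im * ∫ x, inner ℝ (regKernel e (x - u β)) (f x)) (𝓝[>] 0)
      (𝓝 (∫ β in (-(ℓ / 2))..(ℓ / 2),
        (deriv u β).im * (Complex.I * ∫ x, f x / (u β - x)).re)) := by
    refine intervalIntegral.tendsto_integral_filter_of_dominated_convergence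
      (fun β => |(deriv u β).im| * K) ?_ ?_ hbK ?_
    · filter_upwards [hpos] with e he
      simp only [hIe e he]
      have := intervalIntegral.continuous_parametric_intervalIntegral_of_continuous'
        (μ := volume) (f := fun β α => φ (w α) *
          (inner ℝ (w α - u β) (deriv w α) * (‖w α - u β‖ ^ 2 + e)⁻¹)) (hjoint e he)
          (-(ℓ / 2)) (ℓ / 2)
      exact (hdC.mul this.neg).aestronglyMeasurable
    · filter_upwards [hpos] with e he
      refine Eventually.of_forall fun β _ => ?_
      rw [norm_mul, Real.norm_eq_abs]
      gcongr
      exact hK _ e he.le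
    · exact Eventually.of_forall fun β _ => (hlim (u β)).const_mul _
  -- limit of the right-hand side
  set K2 := ∫ β in (-(ℓ / 2))..(ℓ / 2), C * C ^ (1 - κ) * |β| ^ (κ - 1)
  have hbK2 : IntervalIntegrable (fun α => |φ (w α)| * (‖deriv w α‖ * K2)) volume
      (-(ℓ / 2)) (ℓ / 2) :=
    ((hφ.continuous.comp hwc).abs.mul (hwd.norm.mul continuous_const)).intervalIntegrable _ _
  have hR : Tendsto (fun e => ∫ α in (-(ℓ / 2))..(ℓ / 2), φ (w α) * muskatReg ℓ w u e α) (𝓝[>] 0)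
      (𝓝 (∫ α in (-(ℓ / 2))..(ℓ / 2), φ (w α) *
        (2 * Real.pi * inner ℝ (muskat ℓ w u α) (Complex.I * deriv w α)))) := by
    refine intervalIntegral.tendsto_integral_filter_of_dominated_convergence
      (fun α => |φ (w α)| * (‖deriv w α‖ * K2)) ?_ ?_ hbK2 ?_
    · filter_upwards [hpos] with e he
      exact ((hφ.continuous.comp hwc).mul (continuous_muskatReg hw hu he)).aestronglyMeasurable
    · filter_upwards [hpos] with e he
      refine Eventually.of_forall fun α _ => ?_
      rw [norm_mul, Real.norm_eq_abs]
      gcongr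
      exact norm_muskatReg_le hu h hℓ hC hκ0 hκ he.le α
    · exact Eventually.of_forall fun α _ =>
        (tendsto_muskatReg hu h hℓ hC hκ0 hκ α).const_mul _
  -- both sides agree for positive `e`
  have hEq : ∀ᶠ e in 𝓝[>] (0 : ℝ), ∫ β in (-(ℓ / 2))..(ℓ / 2),
      (deriv u β).im * ∫ x, inner ℝ (regKernel e (x - u β)) (f x) =
        ∫ α in (-(ℓ / 2))..(ℓ / 2), φ (w α) * muskatReg ℓ w u e α := by
    filter_upwards [hpos] with e he
    have hcj : Continuous fun p : ℝ × ℝ => (deriv u p.1).im * (φ (w p.2) *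
        (inner ℝ (w p.2 - u p.1) (deriv w p.2) * (‖w p.2 - u p.1‖ ^ 2 + e)⁻¹)) :=
      (hdC.comp continuous_fst).mul (hjoint e he)
    have hswap := integral_swap_of_continuousOn hℓ2 (f := fun β α => (deriv u β).im * (φ (w α) *
        (inner ℝ (w α - u β) (deriv w α) * (‖w α - u β‖ ^ 2 + e)⁻¹))) hcj.continuousOn hℓ2
    simp only [hIe e he, mul_neg, intervalIntegral.integral_neg,
      ← intervalIntegral.integral_const_mul]
    rw [hswap, ← intervalIntegral.integral_neg]
    refine intervalIntegral.integral_congr fun α _ => ?_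
    rw [muskatReg, ← neg_neg (∫ β in (-(ℓ / 2))..(ℓ / 2), (w α - u β).re * _ * _),
      ← integral_im_mul_regKernel hu he α, mul_neg, ← intervalIntegral.integral_const_mul]
    congr 1
    refine intervalIntegral.integral_congr fun β _ => ?_
    ring
  have hfin := tendsto_nhds_unique (hL.congr' hEq) hR
  -- the velocity
  have hgc : Continuous fun β => ((deriv u β).im : ℂ) := Complex.continuous_ofReal.comp hdC
  have hv1 := integral_mul_cauchy hfI hfM hgc huc hℓ2
  have hvI : Integrable fun x => f x * (starRingEnd ℂ) (loopVel ℓ u x) := by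
    refine ((integrable_mul_cauchy hfI hfM hgc huc hℓ2).const_mul
      (2 * Real.pi * Complex.I)⁻¹).congr (Eventually.of_forall fun x => ?_)
    simp only [conj_vel]; ring
  have hJI : Integrable (fun β => ((deriv u β).im : ℂ) * ∫ x, f x / (u β - x))
      (volume.restrict (Ioc (-(ℓ / 2)) (ℓ / 2))) := by
    refine (integrable_cauchy_kernel hfI hfM hgc huc (-(ℓ / 2)) (ℓ / 2)).integral_prod_right.congr
      (Eventually.of_forall fun β => ?_)
    simp only
    rw [← integral_const_mul]
    refine integral_congr_ae (Eventually.of_forall fun x => ?_)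
    simp only; ring
  have e1 : ∫ x, wn ℓ w x * inner ℝ (loopVel ℓ u x) (grad φ x) =
      (∫ x, f x * (starRingEnd ℂ) (loopVel ℓ u x)).re := by
    refine Eq.trans ?_ (integral_re (𝕜 := ℂ) hvI)
    refine integral_congr_ae ?_
    filter_upwards [hne] with x hx
    rw [← hx, ← hinner, inner_eq_re_mul_conj]; rfl
  have e2 : ∫ x, f x * (starRingEnd ℂ) (loopVel ℓ u x) = (2 * Real.pi * Complex.I)⁻¹ *
      ∫ β in (-(ℓ / 2))..(ℓ / 2), ((deriv u β).im : ℂ) * ∫ x, f x / (u β - x) := by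
    rw [← hv1, ← integral_const_mul]
    refine integral_congr_ae (Eventually.of_forall fun x => ?_)
    simp only [conj_vel]; ring
  have e3 : (Complex.I * ∫ β in (-(ℓ / 2))..(ℓ / 2),
      ((deriv u β).im : ℂ) * ∫ x, f x / (u β - x)).re =
      ∫ β in (-(ℓ / 2))..(ℓ / 2), (deriv u β).im * (Complex.I * ∫ x, f x / (u β - x)).re := by
    rw [← intervalIntegral.integral_const_mul, intervalIntegral.integral_of_le hℓ2,
      intervalIntegral.integral_of_le hℓ2]
    refine Eq.trans (integral_re (𝕜 := ℂ) (hJI.const_mul Complex.I)).symm ?_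
    refine integral_congr_ae (Eventually.of_forall fun β => ?_)
    simp only
    rw [mul_left_comm]
    exact Complex.re_ofReal_mul _ _
  have e4 : ∀ X : ℂ, ((2 * Real.pi * Complex.I)⁻¹ * X).re = -(2 * Real.pi)⁻¹ * (Complex.I * X).re := by
    intro X
    rw [show (2 * Real.pi * Complex.I : ℂ)⁻¹ * X = ((-(2 * Real.pi)⁻¹ : ℝ) : ℂ) * (Complex.I * X) by
      rw [mul_inv, Complex.inv_I]; push_cast; ring]
    exact Complex.re_ofReal_mul _ _
  rw [e1, e2, e4, e3, hfin, ← intervalIntegral.integral_const_mul, ← intervalIntegral.integral_neg]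
  refine intervalIntegral.integral_congr fun α _ => ?_
  have := Real.pi_pos
  field_simp

end VelocityFlux

/-! ### Divergence-free fields in a strip -/

lemma divergence_smul {s : ℂ → ℝ} {γ : ℂ → ℂ} {x : ℂ} (hs : DifferentiableAt ℝ s x)
    (hγ : DifferentiableAt ℝ γ x) :
    divergence (fun y => s y • γ y) x = inner ℝ (γ x) (grad s x) + s x * divergence γ x := by
  have h : fderiv ℝ (fun y => s y • γ y) x = _ := (hs.hasFDerivAt.smul hγ.hasFDerivAt).fderiv
  rw [divergence, h, divergence, inner_eq]
  simp [grad]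
  ring

lemma divergence_congr {f g : ℂ → ℂ} {x : ℂ} (h : f =ᶠ[𝓝 x] g) : divergence f x = divergence g x := by
  rw [divergence, divergence, h.fderiv_eq]

section Cutoff

variable {ℓ d : ℝ} {w p : ℝ → ℂ} {χ σ : ℝ → ℝ}

/-- Functions of the parameters of a strip, compactly supported in the strip. -/
lemma IsStrip.exists_cutoff (h : IsStrip ℓ w p) (hℓ : 0 < ℓ) (hχ : ContDiff ℝ 1 χ)
    (hχp : Function.Periodic χ ℓ) (hσ : ContDiff ℝ 1 σ) (hd : 0 < d)
    (hχd : ∀ α, χ α ≠ 0 → d ≤ ‖p α‖) (hσd : ∀ s ∈ Icc (0 : ℝ) 1, σ s ≠ 0 → s ∈ Icc d (1 - d)) :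
    ∃ η : ℂ → ℝ, ContDiff ℝ 1 η ∧ HasCompactSupport η ∧ tsupport η ⊆ stripRegion w p ∧
      ∀ ζ ∈ stripParam p, η (stripMap w p ζ) = χ ζ.re * σ ζ.im := by
  classical
  -- The chosen parameter `g x` is determined only up to the period and need not depend continuously
  -- on `x`. Periodicity of `χ` makes the value of `η` independent of the choice, and near each
  -- point `η` is written with a smooth local inverse of the strip map instead.
  have hex : ∀ x : ℂ, ∃ ζ : ℂ, x ∈ stripRegion w p → ζ ∈ stripParam p ∧ stripMap w p ζ = x :=
    fun x => by
      by_cases hx : x ∈ stripRegion w p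
      · rw [stripRegion_eq_image] at hx
        obtain ⟨ζ, hζ, e⟩ := hx
        exact ⟨ζ, fun _ => ⟨hζ, e⟩⟩
      · exact ⟨0, fun h => absurd h hx⟩
  choose g hg using hex
  set η : ℂ → ℝ := (stripRegion w p).indicator fun x => χ (g x).re * σ (g x).im with hη
  have hmem : ∀ ζ ∈ stripParam p, stripMap w p ζ ∈ stripRegion w p := fun ζ hζ => by
    rw [stripRegion_eq_image]; exact ⟨ζ, hζ, rfl⟩
  have hval : ∀ ζ ∈ stripParam p, η (stripMap w p ζ) = χ ζ.re * σ ζ.im := fun ζ hζ => by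
    rw [hη, indicator_of_mem (hmem ζ hζ)]
    obtain ⟨h1, h2⟩ := hg _ (hmem ζ hζ)
    obtain ⟨⟨k, hk⟩, h3⟩ := h.inj _ _ _ (Ioo_subset_Icc_self hζ.2) _ (Ioo_subset_Icc_self h1.2)
      h2.symm
    rw [hk, periodic_int_mul hχp, ← h3.resolve_right hζ.1]
  set S : Set ℂ := (Icc (-(ℓ / 2)) (ℓ / 2) ×ℂ Icc d (1 - d)) ∩ {ζ | d ≤ ‖p ζ.re‖} with hS
  have hpc := h.loop_dir.continuous
  have hScomp : IsCompact S := (isCompact_Icc.reProdIm isCompact_Icc).inter_right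
    (isClosed_le continuous_const (hpc.comp Complex.continuous_re).norm)
  have hSsub : S ⊆ stripParam p := fun ζ hζ =>
    ⟨norm_pos_iff.1 (hd.trans_le hζ.2), hd.trans_le hζ.1.2.1, by
      have : ζ.im ≤ 1 - d := hζ.1.2.2; linarith⟩
  set K := stripMap w p '' S with hK
  have hKcomp : IsCompact K := hScomp.image (contDiff_stripMap h.loop h.loop_dir).continuous
  have hKsub : K ⊆ stripRegion w p := by
    rintro _ ⟨ζ, hζ, rfl⟩; exact hmem ζ (hSsub hζ)
  have hsupp : Function.support η ⊆ K := by
    intro x hx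
    have hxE : x ∈ stripRegion w p := by
      by_contra hn; exact hx (indicator_of_notMem hn _)
    rw [hη, Function.mem_support, indicator_of_mem hxE] at hx
    obtain ⟨h1, h2⟩ := hg x hxE
    obtain ⟨k, hk⟩ := exists_int_mem_Ioc hℓ (g x).re
    refine ⟨⟨(g x).re + k * ℓ, (g x).im⟩, ⟨⟨Ioc_subset_Icc_self hk, hσd _ (Ioo_subset_Icc_self h1.2)
      (right_ne_zero_of_mul hx)⟩, ?_⟩, ?_⟩
    · simp only [mem_ofPred_eq, periodic_int_mul h.loop_dir.periodic]
      exact hχd _ (left_ne_zero_of_mul hx)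
    · refine Eq.trans ?_ h2
      simp only [stripMap, periodic_int_mul (isLoop_strip h.loop h.loop_dir _).periodic]
  have hts : tsupport η ⊆ K := closure_minimal hsupp hKcomp.isClosed
  refine ⟨η, contDiff_iff_contDiffAt.2 fun x => ?_, hKcomp.of_isClosed_subset (isClosed_tsupport η) hts,
    hts.trans hKsub, hval⟩
  by_cases hx : x ∈ stripRegion w p
  · obtain ⟨h1, h2⟩ := hg x hx
    have hcd : ContDiffAt ℝ 1 (stripMap w p) (g x) :=
      (contDiff_stripMap h.loop h.loop_dir).contDiffAt
    have hs := hcd.hasStrictFDerivAt' (h.hasFDerivAt_equiv h1) one_ne_zero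
    have hinv := hcd.to_localInverse (h.hasFDerivAt_equiv h1) one_ne_zero
    have hr := hs.eventually_right_inverse
    have ht := hs.localInverse_tendsto
    rw [h2] at hinv hr ht
    have hev := ht.eventually ((isOpen_stripParam hpc).mem_nhds h1)
    refine ContDiffAt.congr_of_eventuallyEq
      (f := fun y => χ (hs.localInverse _ _ _ y).re * σ (hs.localInverse _ _ _ y).im) ?_ ?_
    · exact ((hχ.contDiffAt.comp x (Complex.reCLM.contDiff.contDiffAt.comp x hinv))).mul
        (hσ.contDiffAt.comp x (Complex.imCLM.contDiff.contDiffAt.comp x hinv))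
    · filter_upwards [hr, hev] with y hy1 hy2
      conv_lhs => rw [← hy1]
      exact hval _ hy2
  · have : η =ᶠ[𝓝 x] fun _ => 0 :=
      notMem_tsupport_iff_eventuallyEq.1 fun hx' => hx (hKsub (hts hx'))
    exact contDiffAt_const.congr_of_eventuallyEq this

lemma stripJac_smul_eq (g a b : ℂ) : -inner ℝ b (Complex.I * a) * g.re =
      inner ℝ g (Complex.I * b) * a.re - inner ℝ g (Complex.I * a) * b.re ∧
    -inner ℝ b (Complex.I * a) * g.im =
      inner ℝ g (Complex.I * b) * a.im - inner ℝ g (Complex.I * a) * b.im := by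
  simp only [inner_eq, Complex.I_mul_re, Complex.I_mul_im]
  constructor <;> ring

/-- This is Cramer's rule for the components of `g` along `a` and `b`, with the determinant kept on
the left: it expresses the derivative of the cutoff along `γ` by its derivatives in the strip
parameters. -/
lemma stripJac_mul_clm (L : ℂ →L[ℝ] ℝ) (g a b : ℂ) : -inner ℝ b (Complex.I * a) * L g =
    inner ℝ g (Complex.I * b) * L a - inner ℝ g (Complex.I * a) * L b := by
  obtain ⟨h1, h2⟩ := stripJac_smul_eq g a b
  rw [clm_apply_eq L g, clm_apply_eq L a, clm_apply_eq L b]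
  simp only [smul_eq_mul]
  linear_combination L 1 * h1 + L Complex.I * h2

/-- The weak form of `∇ ⬝ γ = 0` in the coordinates of a strip. -/
lemma IsStrip.integral_cutoff_eq_zero (h : IsStrip ℓ w p) (hℓ : 0 < ℓ) (hχ : ContDiff ℝ 1 χ)
    (hχp : Function.Periodic χ ℓ) (hσ : ContDiff ℝ 1 σ) (hd : 0 < d)
    (hχd : ∀ α, χ α ≠ 0 → d ≤ ‖p α‖) (hσd : ∀ s ∈ Icc (0 : ℝ) 1, σ s ≠ 0 → s ∈ Icc d (1 - d))
    {γ : ℂ → ℂ} (hγ : ContDiffOn ℝ 1 γ (stripRegion w p))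
    (hdiv : ∀ x ∈ stripRegion w p, divergence γ x = 0) {φ : ℂ → ℝ} (hφ : ContDiff ℝ 1 φ) :
    ∫ q in Ioc (-(ℓ / 2)) (ℓ / 2) ×ˢ Ioo (0 : ℝ) 1,
      (stripJac w p q.1 q.2 * (χ q.1 * σ q.2) *
          inner ℝ (γ (strip w p q.2 q.1)) (grad φ (strip w p q.2 q.1)) +
        φ (strip w p q.2 q.1) *
          (inner ℝ (γ (strip w p q.2 q.1)) (Complex.I * p q.1) * (deriv χ q.1 * σ q.2) -
          inner ℝ (γ (strip w p q.2 q.1)) (Complex.I * (deriv w q.1 + q.2 • deriv p q.1)) *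
            (χ q.1 * deriv σ q.2))) = 0 := by
  obtain ⟨η, hη, hηc, hηs, hηv⟩ := h.exists_cutoff hℓ hχ hχp hσ hd hχd hσd
  have hE := h.isOpen_stripRegion
  have hηd := hη.differentiable one_ne_zero
  have hφd := hφ.differentiable one_ne_zero
  set F : ℂ → ℂ := fun x => (η x * φ x) • γ x with hF
  have hγd : ∀ x ∈ stripRegion w p, ContDiffAt ℝ 1 γ x := fun x hx => hγ.contDiffAt (hE.mem_nhds hx)
  have hoff : ∀ x ∉ stripRegion w p, F =ᶠ[𝓝 x] fun _ => 0 := fun x hx => by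
    filter_upwards [notMem_tsupport_iff_eventuallyEq.1 fun hx' => hx (hηs hx')] with y hy
    simp only [hF]; rw [hy]; simp
  have hFd : ContDiff ℝ 1 F := contDiff_iff_contDiffAt.2 fun x => by
    by_cases hx : x ∈ stripRegion w p
    · exact (hη.mul hφ).contDiffAt.smul (hγd x hx)
    · exact contDiffAt_const.congr_of_eventuallyEq (hoff x hx)
  have hFc : HasCompactSupport F := by
    refine HasCompactSupport.smul_right (f := fun x => η x * φ x) ?_
    exact hηc.mul_right
  have h0 := integral_divergence_eq_zero hFd hFc
  have hdivF : ∀ x ∈ stripRegion w p, divergence F x =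
      η x * inner ℝ (γ x) (grad φ x) + φ x * fderiv ℝ η x (γ x) := fun x hx => by
    rw [hF, divergence_smul (s := fun x => η x * φ x) (hηd.mul hφd x) ((hγd x hx).differentiableAt one_ne_zero), hdiv x hx,
      mul_zero, add_zero, inner_eq, fderiv_eq_inner_grad, inner_eq, inner_eq]
    have h1 : fderiv ℝ (fun y => η y * φ y) x = _ :=
      ((hηd x).hasFDerivAt.mul (hφd x).hasFDerivAt).fderiv
    simp only [grad, h1]
    simp
    ring
  have h1 : ∫ x in stripRegion w p, divergence F x = 0 := by
    rw [setIntegral_eq_integral_of_forall_compl_eq_zero fun x hx => ?_, h0]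
    rw [divergence_congr (hoff x hx)]; simp [divergence]
  rw [h.setIntegral_stripRegion hℓ] at h1
  refine Eq.trans (setIntegral_congr_fun (measurableSet_Ioc.prod measurableSet_Ioo) ?_) h1
  rintro ⟨α, s⟩ ⟨-, hs⟩
  simp only [smul_eq_mul]
  -- Where the strip is pinched, `χ` vanishes in a neighbourhood and the Jacobian is zero, so both
  -- integrands vanish although the strip parameters degenerate.
  by_cases hp : p α = 0
  · have hχ0 : χ =ᶠ[𝓝 α] fun _ => 0 := by
      have hc : Continuous fun α => ‖p α‖ := h.loop_dir.continuous.norm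
      have : ∀ᶠ β in 𝓝 α, ‖p β‖ < d :=
        (hc.tendsto α).eventually_lt_const (by simpa [hp] using hd)
      filter_upwards [this] with β hβ
      by_contra hne; exact absurd (hχd β hne) (not_le.2 hβ)
    rw [stripJac_eq_zero hp, hχ0.deriv_eq, hχ0.self_of_nhds]
    simp
  · have hζ : (⟨α, s⟩ : ℂ) ∈ stripParam p := ⟨hp, hs⟩
    have hx : strip w p s α ∈ stripRegion w p := ⟨α, s, hp, hs, rfl⟩
    have e1 : η (strip w p s α) = χ α * σ s := hηv _ hζ
    have e2 : (fun ζ => η (stripMap w p ζ)) =ᶠ[𝓝 (⟨α, s⟩ : ℂ)] fun ζ => χ ζ.re * σ ζ.im := by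
      filter_upwards [(isOpen_stripParam h.loop_dir.continuous).mem_nhds hζ] with ζ hζ using hηv ζ hζ
    have e3 := ((hηd _).hasFDerivAt.comp (⟨α, s⟩ : ℂ)
      (hasFDerivAt_stripMap h.loop h.loop_dir ⟨α, s⟩)).fderiv
    have e4 : HasFDerivAt (fun ζ : ℂ => χ ζ.re * σ ζ.im) _ (⟨α, s⟩ : ℂ) :=
      (((hχ.differentiable one_ne_zero α).hasDerivAt.comp_hasFDerivAt (⟨α, s⟩ : ℂ)
        Complex.reCLM.hasFDerivAt)).mul
      ((hσ.differentiable one_ne_zero s).hasDerivAt.comp_hasFDerivAt (⟨α, s⟩ : ℂ)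
        Complex.imCLM.hasFDerivAt)
    have e5 := e3.symm.trans (e2.fderiv_eq.trans e4.fderiv)
    have e6 : fderiv ℝ η (strip w p s α) (deriv w α + s • deriv p α) = deriv χ α * σ s := by
      have := DFunLike.congr_fun e5 1
      simp only [ContinuousLinearMap.comp_apply, add_apply, ContinuousLinearMap.smulRight_apply,
        Complex.reCLM_apply, Complex.imCLM_apply, Complex.one_re, Complex.one_im, one_smul,
        zero_smul, add_zero, smul_apply, zero_add, smul_eq_mul, mul_one, mul_zero] at this
      rw [mul_comm (deriv χ α)]
      exact this
    have e7 : fderiv ℝ η (strip w p s α) (p α) = χ α * deriv σ s := by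
      have := DFunLike.congr_fun e5 Complex.I
      simp only [ContinuousLinearMap.comp_apply, add_apply, ContinuousLinearMap.smulRight_apply,
        Complex.reCLM_apply, Complex.imCLM_apply, Complex.I_re, Complex.I_im, one_smul,
        zero_smul, add_zero, smul_apply, zero_add, smul_eq_mul, mul_one, mul_zero] at this
      exact this
    have e8 := stripJac_mul_clm (fderiv ℝ η (strip w p s α)) (γ (strip w p s α))
      (deriv w α + s • deriv p α) (p α)
    rw [e6, e7] at e8
    rw [hdivF _ hx, e1, stripJac]
    linear_combination -φ (strip w p s α) * e8

end Cutoff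

/-! ### Boundary layers -/

/-- A smooth step, from `0` on `(-∞, 1]` to `1` on `[2, ∞)`. -/
def step (r : ℝ) : ℝ := Real.smoothTransition (r - 1)

lemma contDiff_step {n : ℕ∞} : ContDiff ℝ n step :=
  Real.smoothTransition.contDiff.comp (contDiff_id.sub contDiff_const)

lemma step_of_le {r : ℝ} (h : r ≤ 1) : step r = 0 :=
  Real.smoothTransition.zero_of_nonpos (by linarith)

lemma step_of_ge {r : ℝ} (h : 2 ≤ r) : step r = 1 :=
  Real.smoothTransition.one_of_one_le (by linarith)

lemma step_mem (r : ℝ) : 0 ≤ step r ∧ step r ≤ 1 :=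
  ⟨Real.smoothTransition.nonneg _, Real.smoothTransition.le_one _⟩

lemma continuous_deriv_step : Continuous (deriv step) :=
  (contDiff_step (n := 1)).continuous_deriv le_rfl

lemma hasDerivAt_step (r : ℝ) : HasDerivAt step (deriv step r) r :=
  ((contDiff_step (n := 1)).differentiable one_ne_zero r).hasDerivAt

lemma deriv_step_of_lt {r : ℝ} (h : r < 1) : deriv step r = 0 := by
  have : step =ᶠ[𝓝 r] fun _ => 0 := by
    filter_upwards [Iio_mem_nhds h] with y hy using step_of_le (mem_Iio.1 hy).le
  rw [this.deriv_eq, deriv_const]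

lemma deriv_step_of_gt {r : ℝ} (h : 2 < r) : deriv step r = 0 := by
  have : step =ᶠ[𝓝 r] fun _ => 1 := by
    filter_upwards [Ioi_mem_nhds h] with y hy using step_of_ge (mem_Ioi.1 hy).le
  rw [this.deriv_eq, deriv_const]

lemma exists_deriv_step_bound : ∃ D, 0 ≤ D ∧ ∀ r, |deriv step r| ≤ D := by
  obtain ⟨D, hD⟩ := (isCompact_Icc (a := (1 : ℝ)) (b := 2)).exists_bound_of_continuousOn
    continuous_deriv_step.continuousOn
  have hD0 : 0 ≤ D := (norm_nonneg _).trans (hD 1 ⟨le_rfl, by norm_num⟩)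
  refine ⟨D, hD0, fun r => ?_⟩
  rcases lt_or_ge r 1 with h | h
  · rw [deriv_step_of_lt h, abs_zero]; exact hD0
  · rcases lt_or_ge 2 r with h2 | h2
    · rw [deriv_step_of_gt h2, abs_zero]; exact hD0
    · exact hD r ⟨h, h2⟩

section Layer

variable {G : ℝ → ℝ} {M L D e : ℝ}

/-- The substitution `s = e r` confines the integral to `1 ≤ r ≤ 2`, the transition region of the
step. -/
lemma integral_layer_eq (hG : Measurable G) (hb : ∀ s ∈ Icc (0 : ℝ) 1, |G s| ≤ M)
    (he : 0 < e) (he2 : e ≤ 1 / 2) :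
    ∫ s in (0 : ℝ)..1, G s * (deriv step (s / e) / e) =
      ∫ r in (1 : ℝ)..2, G (e * r) * deriv step r := by
  obtain ⟨D, hD0, hD⟩ := exists_deriv_step_bound
  have hM0 : 0 ≤ M := (abs_nonneg _).trans (hb 0 ⟨le_rfl, zero_le_one⟩)
  have h2 : 2 ≤ 1 / e := by rw [le_div_iff₀ he]; linarith
  set f : ℝ → ℝ := fun r => G (e * r) * deriv step r with hf
  have hfm : Measurable f :=
    (hG.comp (measurable_id.const_mul e)).mul continuous_deriv_step.measurable
  have e1 : ∫ s in (0 : ℝ)..1, G s * (deriv step (s / e) / e) = ∫ r in (0 : ℝ)..(1 / e), f r := by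
    have h1 := intervalIntegral.integral_comp_div (a := 0) (b := 1) (fun r => e⁻¹ * f r) he.ne'
    rw [intervalIntegral.integral_const_mul e⁻¹ f, smul_eq_mul, zero_div,
      mul_inv_cancel_left₀ he.ne'] at h1
    rw [← h1]
    refine intervalIntegral.integral_congr fun s _ => ?_
    simp only [hf, mul_div_cancel₀ s he.ne']
    ring
  have hii : ∀ a b, 0 ≤ a → a ≤ b → b ≤ 1 / e → IntervalIntegrable f volume a b :=
    fun a b ha hab hb' => by
      rw [intervalIntegrable_iff_integrableOn_Ioc_of_le hab]
      refine IntegrableOn.of_bound (by simp) hfm.aestronglyMeasurable (M * D) ?_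
      refine (ae_restrict_iff' measurableSet_Ioc).2 (Eventually.of_forall fun r hr => ?_)
      rw [norm_mul]
      have h3 : e * r ∈ Icc (0 : ℝ) 1 := by
        have := hr.2.trans hb'
        rw [le_div_iff₀ he] at this
        exact ⟨mul_nonneg he.le (ha.trans hr.1.le), by linarith⟩
      exact mul_le_mul (hb _ h3) (hD r) (abs_nonneg _) hM0
  rw [e1, ← intervalIntegral.integral_add_adjacent_intervals
    (hii 0 1 le_rfl zero_le_one (by linarith)) (hii 1 (1 / e) zero_le_one (by linarith) le_rfl),
    ← intervalIntegral.integral_add_adjacent_intervals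
    (hii 1 2 zero_le_one (by norm_num) h2) (hii 2 (1 / e) (by norm_num) h2 le_rfl)]
  have z1 : ∫ r in (0 : ℝ)..1, f r = 0 := by
    rw [intervalIntegral.integral_of_le zero_le_one, ← integral_Ioc_eq_integral_Ioo.symm]
    refine setIntegral_eq_zero_of_forall_eq_zero fun r hr => ?_
    simp only [hf, deriv_step_of_lt hr.2, mul_zero]
  have z2 : ∫ r in (2 : ℝ)..(1 / e), f r = 0 := by
    rw [intervalIntegral.integral_of_le h2]
    refine setIntegral_eq_zero_of_forall_eq_zero fun r hr => ?_
    simp only [hf, deriv_step_of_gt hr.1, mul_zero]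
  rw [z1, z2, zero_add, add_zero]

lemma abs_integral_layer_le (hG : Measurable G) (hb : ∀ s ∈ Icc (0 : ℝ) 1, |G s| ≤ M)
    (hD : ∀ r, |deriv step r| ≤ D) (he : 0 < e) (he2 : e ≤ 1 / 2) :
    |∫ s in (0 : ℝ)..1, G s * (deriv step (s / e) / e)| ≤ M * D := by
  have hM0 : 0 ≤ M := (abs_nonneg _).trans (hb 0 ⟨le_rfl, zero_le_one⟩)
  rw [integral_layer_eq hG hb he he2]
  have := intervalIntegral.norm_integral_le_of_norm_le_const (a := 1) (b := 2) (C := M * D)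
    (f := fun r => G (e * r) * deriv step r) fun r hr => by
      rw [uIoc_of_le (by norm_num)] at hr
      rw [norm_mul]
      refine mul_le_mul (hb _ ⟨?_, ?_⟩) (hD r) (abs_nonneg _) hM0
      · exact mul_nonneg he.le (by linarith [hr.1])
      · nlinarith [hr.2]
  rw [Real.norm_eq_abs] at this
  norm_num at this
  exact this

/-- The scaled derivative of the step has integral one and concentrates at `0` from the right, so
only the one-sided limit of `G` is needed. -/
lemma tendsto_integral_layer (hG : Measurable G) (hb : ∀ s ∈ Icc (0 : ℝ) 1, |G s| ≤ M)
    (hL : Tendsto G (𝓝[>] 0) (𝓝 L)) :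
    Tendsto (fun e => ∫ s in (0 : ℝ)..1, G s * (deriv step (s / e) / e)) (𝓝[>] 0) (𝓝 L) := by
  obtain ⟨D, hD0, hD⟩ := exists_deriv_step_bound
  have hM0 : 0 ≤ M := (abs_nonneg _).trans (hb 0 ⟨le_rfl, zero_le_one⟩)
  have hsmall : ∀ᶠ e : ℝ in 𝓝[>] 0, 0 < e ∧ e ≤ 1 / 2 := by
    filter_upwards [Ioc_mem_nhdsGT (show (0 : ℝ) < 1 / 2 by norm_num)] with e he using he
  have hL1 : L = ∫ r in (1 : ℝ)..2, L * deriv step r := by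
    rw [intervalIntegral.integral_const_mul, intervalIntegral.integral_eq_sub_of_hasDerivAt
      (fun r _ => hasDerivAt_step r) (continuous_deriv_step.intervalIntegrable _ _),
      step_of_ge le_rfl, step_of_le le_rfl]
    ring
  have h1 : Tendsto (fun e => ∫ r in (1 : ℝ)..2, G (e * r) * deriv step r) (𝓝[>] 0) (𝓝 L) := by
    rw [show 𝓝 L = 𝓝 (∫ r in (1 : ℝ)..2, L * deriv step r) by rw [← hL1]]
    refine intervalIntegral.tendsto_integral_filter_of_dominated_convergence (fun _ => M * D) ?_ ?_
      intervalIntegrable_const ?_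
    · exact Eventually.of_forall fun e => ((hG.comp (measurable_id.const_mul e)).mul
        continuous_deriv_step.measurable).aestronglyMeasurable
    · filter_upwards [hsmall] with e he
      refine Eventually.of_forall fun r hr => ?_
      rw [uIoc_of_le (by norm_num)] at hr
      rw [norm_mul]
      refine mul_le_mul (hb _ ⟨?_, ?_⟩) (hD r) (abs_nonneg _) hM0
      · exact mul_nonneg he.1.le (by linarith [hr.1])
      · nlinarith [hr.2, he.2]
    · refine Eventually.of_forall fun r hr => ?_
      rw [uIoc_of_le (by norm_num)] at hr
      have hr0 : 0 < r := by linarith [hr.1]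
      refine Tendsto.mul_const _ (hL.comp (tendsto_nhdsWithin_iff.2 ⟨?_, ?_⟩))
      · have : Tendsto (fun e : ℝ => e * r) (𝓝 0) (𝓝 (0 * r)) := tendsto_id.mul_const r
        rw [zero_mul] at this
        exact this.mono_left nhdsWithin_le_nhds
      · filter_upwards [hsmall] with e he using mul_pos he.1 hr0
  refine h1.congr' ?_
  filter_upwards [hsmall] with e he using (integral_layer_eq hG hb he.1 he.2).symm

end Layer

/-! ### Flux of a bounded divergence-free field through the boundary of a strip -/

section StripFlux

variable {ℓ K : ℝ} {w p : ℝ → ℂ}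

/-- The cutoff in the direction across a strip. -/
def crossCutoff (e s : ℝ) : ℝ := step (s / e) + step ((1 - s) / e) - 1

/-- The cutoff away from the zeros of the direction of a strip. -/
def alongCutoff (p : ℝ → ℂ) (e α : ℝ) : ℝ := step (‖p α‖ ^ 2 / e ^ 2)

lemma contDiff_crossCutoff (e : ℝ) : ContDiff ℝ 1 (crossCutoff e) :=
  ((contDiff_step.comp (contDiff_id.div_const e)).add
    (contDiff_step.comp ((contDiff_const.sub contDiff_id).div_const e))).sub contDiff_const

lemma deriv_crossCutoff (e s : ℝ) :
    deriv (crossCutoff e) s = deriv step (s / e) / e - deriv step ((1 - s) / e) / e := by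
  have h1 : HasDerivAt (fun s => step (s / e)) (deriv step (s / e) * (1 / e)) s :=
    (hasDerivAt_step _).comp s ((hasDerivAt_id s).div_const e)
  have h2 : HasDerivAt (fun s => step ((1 - s) / e)) (deriv step ((1 - s) / e) * (-1 / e)) s :=
    (hasDerivAt_step _).comp s (((hasDerivAt_id s).const_sub 1).div_const e)
  have h3 : HasDerivAt (crossCutoff e) _ s := (h1.add h2).sub_const 1
  rw [h3.deriv]; ring

lemma abs_crossCutoff_le (e s : ℝ) : |crossCutoff e s| ≤ 1 := by
  have h1 := step_mem (s / e)
  have h2 := step_mem ((1 - s) / e)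
  rw [crossCutoff, abs_le]; constructor <;> linarith

lemma crossCutoff_support {e s : ℝ} (he : 0 < e) (he4 : e ≤ 1 / 4)
    (h : crossCutoff e s ≠ 0) : s ∈ Icc e (1 - e) := by
  refine ⟨?_, ?_⟩ <;> by_contra hlt <;> refine h ?_ <;> rw [not_le] at hlt
  · rw [crossCutoff, step_of_le (by rw [div_le_one he]; exact hlt.le),
      step_of_ge (by rw [le_div_iff₀ he]; linarith)]
    norm_num
  · rw [crossCutoff, step_of_ge (by rw [le_div_iff₀ he]; linarith),
      step_of_le (by rw [div_le_one he]; linarith)]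
    norm_num

lemma contDiff_alongCutoff (hp : IsLoop ℓ p) (e : ℝ) : ContDiff ℝ 1 (alongCutoff p e) :=
  contDiff_step.comp ((hp.contDiff.norm_sq ℝ).div_const _)

lemma periodic_alongCutoff (hp : IsLoop ℓ p) (e : ℝ) : Function.Periodic (alongCutoff p e) ℓ :=
  fun α => by simp only [alongCutoff, hp.periodic α]

lemma alongCutoff_support {e α : ℝ} (he : 0 < e) (h : alongCutoff p e α ≠ 0) : e ≤ ‖p α‖ := by
  by_contra hlt
  rw [not_le] at hlt
  refine h (step_of_le ?_)
  rw [div_le_one (by positivity)]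
  gcongr

lemma deriv_alongCutoff (hp : IsLoop ℓ p) (e α : ℝ) : deriv (alongCutoff p e) α =
    deriv step (‖p α‖ ^ 2 / e ^ 2) * (2 * inner ℝ (p α) (deriv p α) / e ^ 2) := by
  have h1 := (hp.hasDerivAt α).norm_sq.div_const (e ^ 2)
  exact ((hasDerivAt_step _).comp α h1).deriv

/-- The derivative of the cutoff is of size `1 / e`, but it vanishes where `‖p‖² > 2 e²`. In the
weak form it always comes with `γ · (i p)`, whose factor `‖p‖` compensates. This is why the pinched
ends of the strip contribute nothing in the limit. -/
lemma norm_mul_abs_deriv_alongCutoff_le (hp : IsLoop ℓ p) {D P : ℝ} (hD : ∀ r, |deriv step r| ≤ D)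
    {α e : ℝ} (hP : ‖deriv p α‖ ≤ P) (he : 0 < e) :
    ‖p α‖ * |deriv (alongCutoff p e) α| ≤ 4 * D * P := by
  have hD0 : 0 ≤ D := (abs_nonneg _).trans (hD 0)
  have hP0 : 0 ≤ P := (norm_nonneg _).trans hP
  rcases lt_or_ge 2 (‖p α‖ ^ 2 / e ^ 2) with h | h
  · rw [deriv_alongCutoff hp, deriv_step_of_gt h, zero_mul, abs_zero, mul_zero]; positivity
  · rw [deriv_alongCutoff hp, abs_mul, abs_div, abs_mul, abs_two, abs_of_pos (a := e ^ 2) (by positivity)]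
    have h1 : |inner ℝ (p α) (deriv p α)| ≤ ‖p α‖ * P :=
      (abs_real_inner_le_norm _ _).trans (by gcongr)
    calc ‖p α‖ * (|deriv step (‖p α‖ ^ 2 / e ^ 2)| * (2 * |inner ℝ (p α) (deriv p α)| / e ^ 2))
        ≤ ‖p α‖ * (D * (2 * (‖p α‖ * P) / e ^ 2)) := by gcongr; exact hD _
      _ = 2 * D * P * (‖p α‖ ^ 2 / e ^ 2) := by ring
      _ ≤ 2 * D * P * 2 := by gcongr
      _ = _ := by ring

lemma eventually_lt_div {r : ℝ} (hr : 0 < r) (A : ℝ) : ∀ᶠ e : ℝ in 𝓝[>] 0, A < r / e := by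
  simp only [div_eq_mul_inv]
  exact (tendsto_inv_nhdsGT_zero.const_mul_atTop hr).eventually_gt_atTop A

lemma eventually_alongCutoff_eq {α : ℝ} (h : p α ≠ 0) :
    ∀ᶠ e : ℝ in 𝓝[>] 0, alongCutoff p e α = 1 ∧ 2 < ‖p α‖ ^ 2 / e ^ 2 := by
  filter_upwards [eventually_lt_div (norm_pos_iff.2 h) 2] with e he
  have : 2 < ‖p α‖ ^ 2 / e ^ 2 := by rw [← div_pow]; nlinarith
  exact ⟨step_of_ge this.le, this⟩

lemma eventually_crossCutoff_eq {s : ℝ} (hs : s ∈ Ioo (0 : ℝ) 1) :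
    ∀ᶠ e : ℝ in 𝓝[>] 0, crossCutoff e s = 1 := by
  filter_upwards [eventually_lt_div hs.1 2, eventually_lt_div (sub_pos.2 hs.2) 2] with e h1 h2
  rw [crossCutoff, step_of_ge h1.le, step_of_ge h2.le]; norm_num

/-- The reflection `s ↦ 1 - s` carries the layer at `1` to a layer at `0`, with the opposite sign.
-/
lemma integral_mul_deriv_crossCutoff {G : ℝ → ℝ} {M : ℝ} (hG : Measurable G)
    (hb : ∀ s ∈ Icc (0 : ℝ) 1, |G s| ≤ M) (e : ℝ) :
    ∫ s in (0 : ℝ)..1, G s * deriv (crossCutoff e) s =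
      (∫ s in (0 : ℝ)..1, G s * (deriv step (s / e) / e)) -
        ∫ s in (0 : ℝ)..1, G (1 - s) * (deriv step (s / e) / e) := by
  have hM0 : 0 ≤ M := (abs_nonneg _).trans (hb 0 ⟨le_rfl, zero_le_one⟩)
  obtain ⟨D, hD0, hD⟩ := exists_deriv_step_bound
  have key : ∀ f : ℝ → ℝ, Measurable f → IntervalIntegrable
      (fun s => G s * (deriv step (f s) / e)) volume 0 1 := fun f hf => by
    rw [intervalIntegrable_iff_integrableOn_Ioc_of_le zero_le_one]
    refine IntegrableOn.of_bound (by simp) (hG.mul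
      ((continuous_deriv_step.measurable.comp hf).div_const e)).aestronglyMeasurable
      (M * (D / |e|)) ?_
    refine (ae_restrict_iff' measurableSet_Ioc).2 (Eventually.of_forall fun s hs => ?_)
    rw [norm_mul, norm_div]
    refine mul_le_mul (hb _ (Ioc_subset_Icc_self hs)) ?_ (by positivity) hM0
    exact div_le_div_of_nonneg_right (hD _) (abs_nonneg _)
  have h2 : ∫ s in (0 : ℝ)..1, G (1 - s) * (deriv step (s / e) / e) =
      ∫ s in (0 : ℝ)..1, G s * (deriv step ((1 - s) / e) / e) := by
    have := intervalIntegral.integral_comp_sub_left (a := 0) (b := 1)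
      (fun s => G s * (deriv step ((1 - s) / e) / e)) 1
    simp only [sub_sub_cancel, sub_self, sub_zero] at this
    exact this
  rw [h2, ← intervalIntegral.integral_sub
    (key (fun s => s / e) (measurable_id.div_const e))
    (key (fun s => (1 - s) / e) ((measurable_const.sub measurable_id).div_const e))]
  refine intervalIntegral.integral_congr fun s _ => ?_
  simp only [deriv_crossCutoff]; ring

lemma measurable_reflect {G : ℝ → ℝ} (hG : Measurable G) : Measurable fun s => G (1 - s) :=
  hG.comp (measurable_const.sub measurable_id)

lemma tendsto_integral_mul_deriv_crossCutoff {G : ℝ → ℝ} {M L0 L1 : ℝ} (hG : Measurable G)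
    (hb : ∀ s ∈ Icc (0 : ℝ) 1, |G s| ≤ M) (h0 : Tendsto G (𝓝[>] 0) (𝓝 L0))
    (h1 : Tendsto G (𝓝[<] 1) (𝓝 L1)) :
    Tendsto (fun e => ∫ s in (0 : ℝ)..1, G s * deriv (crossCutoff e) s) (𝓝[>] 0)
      (𝓝 (L0 - L1)) := by
  simp only [integral_mul_deriv_crossCutoff hG hb]
  refine (tendsto_integral_layer hG hb h0).sub (tendsto_integral_layer (measurable_reflect hG)
    (fun s hs => hb _ ⟨by linarith [hs.2], by linarith [hs.1]⟩) (h1.comp ?_))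
  refine tendsto_nhdsWithin_iff.2 ⟨?_, ?_⟩
  · have : Tendsto (fun s : ℝ => 1 - s) (𝓝 0) (𝓝 (1 - 0)) := tendsto_const_nhds.sub tendsto_id
    rw [sub_zero] at this
    exact this.mono_left nhdsWithin_le_nhds
  · filter_upwards [self_mem_nhdsWithin] with s hs
    have : (0 : ℝ) < s := hs
    show 1 - s < 1
    linarith

lemma abs_integral_mul_deriv_crossCutoff_le {G : ℝ → ℝ} {M D : ℝ} (hG : Measurable G)
    (hb : ∀ s ∈ Icc (0 : ℝ) 1, |G s| ≤ M) (hD : ∀ r, |deriv step r| ≤ D) {e : ℝ} (he : 0 < e)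
    (he2 : e ≤ 1 / 2) : |∫ s in (0 : ℝ)..1, G s * deriv (crossCutoff e) s| ≤ 2 * (M * D) := by
  rw [integral_mul_deriv_crossCutoff hG hb]
  have h1 := abs_integral_layer_le hG hb hD he he2
  have h2 := abs_integral_layer_le (measurable_reflect hG)
    (fun s hs => hb _ ⟨by linarith [hs.2], by linarith [hs.1]⟩) hD he he2
  refine (abs_sub _ _).trans ?_
  linarith

lemma tendsto_strip_nhdsWithin {α : ℝ} (hα : p α ≠ 0) {r : ℝ}
    {I : Set ℝ} (hI : ∀ᶠ s in 𝓝[I] r, s ∈ Ioo (0 : ℝ) 1) :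
    Tendsto (fun s => strip w p s α) (𝓝[I] r) (𝓝[stripRegion w p] (strip w p r α)) := by
  refine tendsto_nhdsWithin_iff.2 ⟨?_, hI.mono fun s hs => ⟨α, s, hα, hs, rfl⟩⟩
  have : Continuous fun s => strip w p s α :=
    continuous_const.add (continuous_id.smul continuous_const)
  exact (this.tendsto r).mono_left nhdsWithin_le_nhds

/-- The flux of a bounded divergence-free field through the boundary of a strip. -/
lemma IsStrip.integral_inner_grad_of_measurable (h : IsStrip ℓ w p) (hℓ : 0 < ℓ) {γ : ℂ → ℂ}
    (hm : Measurable γ) (hb : ∀ x, ‖γ x‖ ≤ K)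
    (hγ : ContDiffOn ℝ 1 γ (stripRegion w p))
    (hdiv : ∀ x ∈ stripRegion w p, divergence γ x = 0) {γ0 γ1 : ℝ → ℂ}
    (h0 : ∀ α, p α ≠ 0 → Tendsto γ (𝓝[stripRegion w p] (strip w p 0 α)) (𝓝 (γ0 α)))
    (h1 : ∀ α, p α ≠ 0 → Tendsto γ (𝓝[stripRegion w p] (strip w p 1 α)) (𝓝 (γ1 α)))
    {φ : ℂ → ℝ} (hφ : ContDiff ℝ 1 φ) (hc : HasCompactSupport φ) :
    ∫ x in stripRegion w p, inner ℝ (γ x) (grad φ x) =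
      ∫ α in (-(ℓ / 2))..(ℓ / 2), {α | p α ≠ 0}.indicator (fun α =>
        φ (strip w p 0 α) * inner ℝ (γ0 α) (Complex.I * (deriv w α + (0 : ℝ) • deriv p α)) -
        φ (strip w p 1 α) * inner ℝ (γ1 α) (Complex.I * (deriv w α + (1 : ℝ) • deriv p α))) α := by
  have hwc := h.loop.continuous; have hwd := h.loop.continuous_deriv
  have hpc := h.loop_dir.continuous; have hpd := h.loop_dir.continuous_deriv
  have hℓ2 : -(ℓ / 2) ≤ ℓ / 2 := by linarith
  set R : Set (ℝ × ℝ) := Ioc (-(ℓ / 2)) (ℓ / 2) ×ˢ Ioo (0 : ℝ) 1 with hR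
  have hRm : MeasurableSet R := measurableSet_Ioc.prod measurableSet_Ioo
  have hRfin : volume R ≠ ⊤ := by
    rw [hR, Measure.volume_eq_prod, Measure.prod_prod]
    exact ENNReal.mul_ne_top (by simp) (by simp)
  have : IsFiniteMeasure (volume.restrict R) := ⟨by
    rw [Measure.restrict_apply_univ]; exact hRfin.lt_top⟩
  obtain ⟨W, hW⟩ := periodic_exists_bound (periodic_deriv h.loop.periodic) hℓ hwd
  obtain ⟨P, hP⟩ := periodic_exists_bound h.loop_dir.periodic hℓ hpc
  obtain ⟨Q, hQ⟩ := periodic_exists_bound (periodic_deriv h.loop_dir.periodic) hℓ hpd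
  obtain ⟨-, Mφ, hMφ⟩ := integrable_of_contDiff hφ.continuous hc
  obtain ⟨-, Mg, hMg⟩ := integrable_of_contDiff (continuous_grad hφ) (hasCompactSupport_grad hc)
  obtain ⟨D, hD0, hD⟩ := exists_deriv_step_bound
  have hW0 : 0 ≤ W := (norm_nonneg _).trans (hW 0)
  have hP0 : 0 ≤ P := (norm_nonneg _).trans (hP 0)
  have hQ0 : 0 ≤ Q := (norm_nonneg _).trans (hQ 0)
  have hMφ0 : 0 ≤ Mφ := (norm_nonneg _).trans (hMφ 0)
  have hMg0 : 0 ≤ Mg := (norm_nonneg _).trans (hMg 0)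
  have hK0 : 0 ≤ K := (norm_nonneg _).trans (hb 0)
  have hX : Continuous fun q : ℝ × ℝ => strip w p q.2 q.1 := by unfold strip; fun_prop
  set a : ℝ × ℝ → ℂ := fun q => deriv w q.1 + q.2 • deriv p q.1 with ha
  have hac : Continuous a := by fun_prop
  have hab : ∀ α, ∀ s ∈ Icc (0 : ℝ) 1, ‖a (α, s)‖ ≤ W + Q := fun α s hs => by
    refine (norm_add_le _ _).trans (add_le_add (hW α) ?_)
    rw [norm_smul, Real.norm_eq_abs, abs_of_nonneg hs.1]
    calc s * ‖deriv p α‖ ≤ 1 * Q := by gcongr; exacts [hs.2, hQ α]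
      _ = Q := one_mul Q
  have hJb : ∀ α, ∀ s ∈ Icc (0 : ℝ) 1, |stripJac w p α s| ≤ P * (W + Q) := fun α s hs => by
    rw [stripJac, abs_neg]
    refine (abs_real_inner_le_norm _ _).trans ?_
    rw [norm_I_mul]
    gcongr
    exacts [hP α, hab α s hs]
  have hγm : Measurable fun q : ℝ × ℝ => γ (strip w p q.2 q.1) := hm.comp hX.measurable
  have hJm : Measurable fun q : ℝ × ℝ => stripJac w p q.1 q.2 :=
    (continuous_stripJac h.loop h.loop_dir).measurable
  set V0 : ℝ × ℝ → ℝ := fun q => inner ℝ (γ (strip w p q.2 q.1)) (grad φ (strip w p q.2 q.1))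
    with hV0
  have hV0m : Measurable V0 := hγm.inner ((continuous_grad hφ).comp hX).measurable
  have hV0b : ∀ q, |V0 q| ≤ K * Mg := fun q => (abs_real_inner_le_norm _ _).trans (by
    gcongr; exacts [hb _, hMg _])
  set G : ℝ × ℝ → ℝ := fun q =>
    φ (strip w p q.2 q.1) * inner ℝ (γ (strip w p q.2 q.1)) (Complex.I * a q) with hG
  have hGm : Measurable G := (hφ.continuous.comp hX).measurable.mul
    (hγm.inner (continuous_const.mul hac).measurable)
  have hGb : ∀ α, ∀ s ∈ Icc (0 : ℝ) 1, |G (α, s)| ≤ Mφ * (K * (W + Q)) := fun α s hs => by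
    rw [hG, abs_mul]
    gcongr
    · exact hMφ _
    · refine (abs_real_inner_le_norm _ _).trans ?_
      rw [norm_I_mul]
      gcongr
      exacts [hb _, hab α s hs]
  have hGα : ∀ α, Measurable fun s => G (α, s) := fun α => hGm.comp measurable_prodMk_left
  have hχm : ∀ e, Measurable fun q : ℝ × ℝ => alongCutoff p e q.1 := fun e =>
    ((contDiff_alongCutoff h.loop_dir e).continuous.comp continuous_fst).measurable
  have hχ'm : ∀ e, Measurable fun q : ℝ × ℝ => deriv (alongCutoff p e) q.1 := fun e =>
    (((contDiff_alongCutoff h.loop_dir e).continuous_deriv le_rfl).comp continuous_fst).measurable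
  have hσm : ∀ e, Measurable fun q : ℝ × ℝ => crossCutoff e q.2 := fun e =>
    ((contDiff_crossCutoff e).continuous.comp continuous_snd).measurable
  have hσ'm : ∀ e, Measurable fun q : ℝ × ℝ => deriv (crossCutoff e) q.2 := fun e =>
    (((contDiff_crossCutoff e).continuous_deriv le_rfl).comp continuous_snd).measurable
  have hχb : ∀ e α, |alongCutoff p e α| ≤ 1 := fun e α => by
    rw [alongCutoff, abs_of_nonneg (step_mem _).1]; exact (step_mem _).2
  have hsmall : ∀ᶠ e : ℝ in 𝓝[>] 0, 0 < e ∧ e ≤ 1 / 4 := by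
    filter_upwards [Ioc_mem_nhdsGT (show (0 : ℝ) < 1 / 4 by norm_num)] with e he using he
  -- The weak form of `∇ · γ = 0` is `F1 + F2 = F3` after integration. As `e → 0` the bulk term `F1`
  -- gives the integral over the strip, `F2`, with the derivative of the cutoff along the strip, is
  -- bounded and tends to zero pointwise, and `F3`, with the derivative across, gives the traces at
  -- the two boundary curves.
  set F1 : ℝ → ℝ × ℝ → ℝ := fun e q =>
    stripJac w p q.1 q.2 * (alongCutoff p e q.1 * crossCutoff e q.2) * V0 q with hF1
  set F2 : ℝ → ℝ × ℝ → ℝ := fun e q => φ (strip w p q.2 q.1) *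
    (inner ℝ (γ (strip w p q.2 q.1)) (Complex.I * p q.1) *
      (deriv (alongCutoff p e) q.1 * crossCutoff e q.2)) with hF2
  set F3 : ℝ → ℝ × ℝ → ℝ := fun e q =>
    alongCutoff p e q.1 * (G q * deriv (crossCutoff e) q.2) with hF3
  have hF1m : ∀ e, Measurable (F1 e) := fun e => (hJm.mul ((hχm e).mul (hσm e))).mul hV0m
  have hF2m : ∀ e, Measurable (F2 e) := fun e => (hφ.continuous.comp hX).measurable.mul
    ((hγm.inner (continuous_const.mul (hpc.comp continuous_fst)).measurable).mul
      ((hχ'm e).mul (hσm e)))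
  have hF3m : ∀ e, Measurable (F3 e) := fun e => (hχm e).mul (hGm.mul (hσ'm e))
  have hF1b : ∀ e, ∀ q ∈ R, ‖F1 e q‖ ≤ P * (W + Q) * (1 * 1) * (K * Mg) := fun e q hq => by
    rw [hF1, norm_mul, norm_mul, norm_mul]
    gcongr
    · exact hJb _ _ (Ioo_subset_Icc_self hq.2)
    · exact hχb _ _
    · exact abs_crossCutoff_le _ _
    · exact hV0b q
  have hF2b : ∀ e, 0 < e → ∀ q, ‖F2 e q‖ ≤ Mφ * (K * (4 * D * Q)) := fun e he q => by
    rw [hF2, norm_mul, norm_mul, norm_mul]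
    have e1 : ‖inner ℝ (γ (strip w p q.2 q.1)) (Complex.I * p q.1)‖ ≤ K * ‖p q.1‖ := by
      refine (norm_inner_le_norm _ _).trans ?_
      rw [norm_I_mul]; gcongr; exact hb _
    calc ‖φ (strip w p q.2 q.1)‖ * (‖inner ℝ (γ (strip w p q.2 q.1)) (Complex.I * p q.1)‖ *
          (‖deriv (alongCutoff p e) q.1‖ * ‖crossCutoff e q.2‖))
        ≤ Mφ * (K * ‖p q.1‖ * (‖deriv (alongCutoff p e) q.1‖ * 1)) := by
          gcongr
          · exact hMφ _
          · exact abs_crossCutoff_le _ _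
      _ = Mφ * (K * (‖p q.1‖ * |deriv (alongCutoff p e) q.1|)) := by
          rw [Real.norm_eq_abs (deriv _ _)]; ring
      _ ≤ _ := by
          exact mul_le_mul_of_nonneg_left (mul_le_mul_of_nonneg_left
            (norm_mul_abs_deriv_alongCutoff_le h.loop_dir hD (hQ _) he) hK0) hMφ0
  have hF1I : ∀ e, IntegrableOn (F1 e) R := fun e =>
    IntegrableOn.of_bound hRfin.lt_top (hF1m e).aestronglyMeasurable _
      ((ae_restrict_iff' hRm).2 (Eventually.of_forall (hF1b e)))
  have hF2I : ∀ e, 0 < e → IntegrableOn (F2 e) R := fun e he =>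
    IntegrableOn.of_bound hRfin.lt_top (hF2m e).aestronglyMeasurable _
      (Eventually.of_forall (hF2b e he))
  have hF3I : ∀ e, IntegrableOn (F3 e) R := fun e => by
    refine IntegrableOn.of_bound hRfin.lt_top (hF3m e).aestronglyMeasurable
      (1 * (Mφ * (K * (W + Q)) * (D / |e| + D / |e|))) ((ae_restrict_iff' hRm).2
        (Eventually.of_forall fun q hq => ?_))
    rw [hF3, norm_mul, norm_mul]
    have e1 : ‖deriv (crossCutoff e) q.2‖ ≤ D / |e| + D / |e| := by
      rw [deriv_crossCutoff]
      refine (norm_sub_le _ _).trans ?_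
      rw [norm_div, norm_div, Real.norm_eq_abs e]
      gcongr
      · exact hD _
      · exact hD _
    gcongr
    · exact hχb _ _
    · exact hGb _ _ (Ioo_subset_Icc_self hq.2)
  have hid : ∀ᶠ e in 𝓝[>] (0 : ℝ), (∫ q in R, F1 e q) + ∫ q in R, F2 e q = ∫ q in R, F3 e q := by
    filter_upwards [hsmall] with e he
    have := h.integral_cutoff_eq_zero hℓ (contDiff_alongCutoff h.loop_dir e)
      (periodic_alongCutoff h.loop_dir e) (contDiff_crossCutoff e) he.1
      (fun α => alongCutoff_support he.1) (fun s _ => crossCutoff_support he.1 he.2) hγ hdiv hφ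
    have hI12 : IntegrableOn (fun q => F1 e q + F2 e q) R := (hF1I e).add (hF2I e he.1)
    rw [← sub_eq_zero, ← integral_add (hF1I e) (hF2I e he.1), ← integral_sub hI12 (hF3I e)]
    refine Eq.trans (integral_congr_ae (Eventually.of_forall fun q => ?_)) this
    simp only [hF1, hF2, hF3, hG, hV0, ha]
    ring
  have hL1 : Tendsto (fun e => ∫ q in R, F1 e q) (𝓝[>] 0)
      (𝓝 (∫ x in stripRegion w p, inner ℝ (γ x) (grad φ x))) := by
    rw [h.setIntegral_stripRegion hℓ]
    refine tendsto_integral_filter_of_dominated_convergence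
      (fun _ => P * (W + Q) * (1 * 1) * (K * Mg)) ?_ ?_ (integrable_const _) ?_
    · exact Eventually.of_forall fun e => (hF1m e).aestronglyMeasurable
    · exact Eventually.of_forall fun e =>
        (ae_restrict_iff' hRm).2 (Eventually.of_forall (hF1b e))
    · refine (ae_restrict_iff' hRm).2 (Eventually.of_forall fun q hq => ?_)
      refine tendsto_const_nhds.congr' ?_
      by_cases hp : p q.1 = 0
      · refine Eventually.of_forall fun e => ?_
        simp [hF1, stripJac_eq_zero hp]
      · filter_upwards [eventually_alongCutoff_eq hp, eventually_crossCutoff_eq hq.2] with e e1 e2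
        simp [hF1, hV0, e1.1, e2]
  have hL2 : Tendsto (fun e => ∫ q in R, F2 e q) (𝓝[>] 0) (𝓝 0) := by
    rw [show (0 : ℝ) = ∫ q in R, (0 : ℝ) by simp]
    refine tendsto_integral_filter_of_dominated_convergence
      (fun _ => Mφ * (K * (4 * D * Q))) ?_ ?_ (integrable_const _) ?_
    · exact Eventually.of_forall fun e => (hF2m e).aestronglyMeasurable
    · simp only [integral_zero]
      filter_upwards [hsmall] with e he using Eventually.of_forall (hF2b e he.1)
    · refine (ae_restrict_iff' hRm).2 (Eventually.of_forall fun q hq => ?_)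
      refine tendsto_const_nhds.congr' ?_
      simp only [integral_zero]
      by_cases hp : p q.1 = 0
      · refine Eventually.of_forall fun e => ?_
        simp [hF2, hp]
      · filter_upwards [eventually_alongCutoff_eq hp] with e e1
        simp [hF2, deriv_alongCutoff h.loop_dir, deriv_step_of_gt e1.2]
  have hF3eq : ∀ e, ∫ q in R, F3 e q = ∫ α in (-(ℓ / 2))..(ℓ / 2),
      alongCutoff p e α * ∫ s in (0 : ℝ)..1, G (α, s) * deriv (crossCutoff e) s := fun e => by
    have hI := hF3I e
    rw [hR, Measure.volume_eq_prod] at hI ⊢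
    rw [setIntegral_prod _ hI, intervalIntegral.integral_of_le hℓ2]
    refine integral_congr_ae (Eventually.of_forall fun α => ?_)
    simp only [hF3]
    rw [integral_const_mul, intervalIntegral.integral_of_le zero_le_one,
      integral_Ioc_eq_integral_Ioo]
  have hF3m' : ∀ e, AEStronglyMeasurable (fun α =>
      alongCutoff p e α * ∫ s in (0 : ℝ)..1, G (α, s) * deriv (crossCutoff e) s)
      (volume.restrict (Ioc (-(ℓ / 2)) (ℓ / 2))) := fun e => by
    have hI := hF3I e
    rw [IntegrableOn, hR, Measure.volume_eq_prod, ← Measure.prod_restrict] at hI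
    refine hI.integral_prod_left.aestronglyMeasurable.congr (Eventually.of_forall fun α => ?_)
    simp only [hF3]
    rw [integral_const_mul, intervalIntegral.integral_of_le zero_le_one,
      integral_Ioc_eq_integral_Ioo]
  have hL3 : Tendsto (fun e => ∫ q in R, F3 e q) (𝓝[>] 0)
      (𝓝 (∫ α in (-(ℓ / 2))..(ℓ / 2), {α | p α ≠ 0}.indicator (fun α =>
        φ (strip w p 0 α) * inner ℝ (γ0 α) (Complex.I * (deriv w α + (0 : ℝ) • deriv p α)) -
        φ (strip w p 1 α) * inner ℝ (γ1 α) (Complex.I * (deriv w α + (1 : ℝ) • deriv p α))) α)) := by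
    simp only [hF3eq]
    refine intervalIntegral.tendsto_integral_filter_of_dominated_convergence
      (fun _ => 1 * (2 * (Mφ * (K * (W + Q)) * D))) ?_ ?_ intervalIntegrable_const ?_
    · refine Eventually.of_forall fun e => ?_
      rw [uIoc_of_le hℓ2]; exact hF3m' e
    · filter_upwards [hsmall] with e he
      refine Eventually.of_forall fun α _ => ?_
      rw [norm_mul]
      gcongr
      · exact hχb _ _
      · exact abs_integral_mul_deriv_crossCutoff_le (hGα α) (hGb α) hD he.1 (by linarith [he.2])
    · refine Eventually.of_forall fun α _ => ?_
      by_cases hp : p α = 0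
      · rw [indicator_of_notMem (by simpa using hp)]
        refine tendsto_const_nhds.congr fun e => ?_
        rw [alongCutoff, hp]
        simp [step_of_le zero_le_one]
      · rw [indicator_of_mem (by simpa using hp)]
        have hlim : ∀ {r : ℝ} {I : Set ℝ} {g : ℂ}, (∀ᶠ s in 𝓝[I] r, s ∈ Ioo (0 : ℝ) 1) →
            Tendsto γ (𝓝[stripRegion w p] (strip w p r α)) (𝓝 g) →
            Tendsto (fun s => G (α, s)) (𝓝[I] r) (𝓝 (φ (strip w p r α) *
              inner ℝ g (Complex.I * (deriv w α + r • deriv p α)))) := fun {r I g} hI hg => by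
          have t1 := tendsto_strip_nhdsWithin (w := w) hp hI
          have t2 := ((hφ.continuous.tendsto _).mono_left nhdsWithin_le_nhds).comp t1
          have t3 : Tendsto (fun s : ℝ => Complex.I * (deriv w α + s • deriv p α)) (𝓝[I] r)
              (𝓝 (Complex.I * (deriv w α + r • deriv p α))) :=
            ((by fun_prop : Continuous fun s : ℝ =>
              Complex.I * (deriv w α + s • deriv p α)).tendsto r).mono_left nhdsWithin_le_nhds
          exact t2.mul ((hg.comp t1).inner t3)
        have hn0 : ∀ᶠ s in 𝓝[>] (0 : ℝ), s ∈ Ioo (0 : ℝ) 1 := Ioo_mem_nhdsGT zero_lt_one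
        have hn1 : ∀ᶠ s in 𝓝[<] (1 : ℝ), s ∈ Ioo (0 : ℝ) 1 := Ioo_mem_nhdsLT zero_lt_one
        have t := tendsto_integral_mul_deriv_crossCutoff (hGα α) (hGb α)
          (hlim hn0 (h0 α hp)) (hlim hn1 (h1 α hp))
        refine t.congr' ?_
        filter_upwards [eventually_alongCutoff_eq hp] with e e1
        rw [e1.1, one_mul]
  have hfin := tendsto_nhds_unique ((hL1.add hL2).congr' hid) hL3
  rwa [add_zero] at hfin

/-- The field is controlled on the strip only. Its extension by zero is measurable and bounded on
the plane and has the same limits from inside the strip. -/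
lemma IsStrip.integral_inner_grad (h : IsStrip ℓ w p) (hℓ : 0 < ℓ) {γ : ℂ → ℂ}
    (hK : 0 ≤ K) (hb : ∀ x ∈ stripRegion w p, ‖γ x‖ ≤ K) (hγ : ContDiffOn ℝ 1 γ (stripRegion w p))
    (hdiv : ∀ x ∈ stripRegion w p, divergence γ x = 0) {γ0 γ1 : ℝ → ℂ}
    (h0 : ∀ α, p α ≠ 0 → Tendsto γ (𝓝[stripRegion w p] (w α)) (𝓝 (γ0 α)))
    (h1 : ∀ α, p α ≠ 0 → Tendsto γ (𝓝[stripRegion w p] (strip w p 1 α)) (𝓝 (γ1 α)))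
    {φ : ℂ → ℝ} (hφ : ContDiff ℝ 1 φ) (hc : HasCompactSupport φ) :
    ∫ x in stripRegion w p, inner ℝ (γ x) (grad φ x) =
      ∫ α in (-(ℓ / 2))..(ℓ / 2), {α | p α ≠ 0}.indicator (fun α =>
        φ (w α) * inner ℝ (γ0 α) (Complex.I * deriv w α) -
        φ (strip w p 1 α) * inner ℝ (γ1 α) (Complex.I * deriv (strip w p 1) α)) α := by
  classical
  have hE := h.isOpen_stripRegion
  set Γ := (stripRegion w p).indicator γ with hΓ
  have heq : EqOn Γ γ (stripRegion w p) := fun x hx => indicator_of_mem hx γ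
  have hm : Measurable Γ := by
    have := hγ.continuousOn.measurable_piecewise (g := (0 : ℂ → ℂ)) continuousOn_const
      hE.measurableSet
    rwa [piecewise_eq_indicator] at this
  have hbΓ : ∀ x, ‖Γ x‖ ≤ K := fun x => by
    by_cases hx : x ∈ stripRegion w p
    · rw [heq hx]; exact hb x hx
    · rw [hΓ, indicator_of_notMem hx, norm_zero]; exact hK
  have ht : ∀ {y g : ℂ}, Tendsto γ (𝓝[stripRegion w p] y) (𝓝 g) →
      Tendsto Γ (𝓝[stripRegion w p] y) (𝓝 g) := fun hy =>
    hy.congr' (eventually_mem_nhdsWithin.mono fun x hx => (heq hx).symm)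
  have := h.integral_inner_grad_of_measurable hℓ hm hbΓ (hγ.congr heq) (fun x hx => by
      rw [divergence_congr (heq.eventuallyEq_of_mem (hE.mem_nhds hx)), hdiv x hx])
    (fun α hα => by rw [strip_zero]; exact ht (h0 α hα)) (fun α hα => ht (h1 α hα)) hφ hc
  rw [setIntegral_congr_fun (g := fun x => inner ℝ (Γ x) (grad φ x)) hE.measurableSet
    fun x hx => by simp only [heq hx], this]
  simp only [strip_zero, zero_smul, add_zero, deriv_strip h.loop h.loop_dir]

end StripFlux

/-! ### Density, velocity and their weak equations at a fixed time -/

section Fields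

variable {ℓ T : ℝ} {δ : ℝ≥0} {c : ℝ → ℝ} {z : ℝ → ℝ → ℂ}

lemma flux_add (ψ : ℂ → ℝ) {w u v : ℝ → ℂ} (hψ : Continuous ψ) (hw : IsLoop ℓ w)
    (hu : Continuous u) (hv : Continuous v) :
    flux ℓ ψ w (fun α => u α + v α) = flux ℓ ψ w u + flux ℓ ψ w v := by
  have hwc := hw.continuous; have hwd := hw.continuous_deriv
  unfold flux
  rw [← intervalIntegral.integral_add]
  · simp only [inner_add_left, mul_add]
  · exact (by fun_prop : Continuous _).intervalIntegrable _ _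
  · exact (by fun_prop : Continuous _).intervalIntegrable _ _

lemma flux_sub (ψ : ℂ → ℝ) {w u v : ℝ → ℂ} (hψ : Continuous ψ) (hw : IsLoop ℓ w)
    (hu : Continuous u) (hv : Continuous v) :
    flux ℓ ψ w (fun α => u α - v α) = flux ℓ ψ w u - flux ℓ ψ w v := by
  have hwc := hw.continuous; have hwd := hw.continuous_deriv
  unfold flux
  rw [← intervalIntegral.integral_sub]
  · simp only [inner_sub_left, mul_sub]
  · exact (by fun_prop : Continuous _).intervalIntegrable _ _
  · exact (by fun_prop : Continuous _).intervalIntegrable _ _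

lemma Admissible.ae_rhoBar_eq (h : Admissible ℓ δ T c z) (hℓ : 0 < ℓ) (hT : 0 < T) {t : ℝ}
    (ht : t ∈ Icc 0 T) : ∀ᵐ x : ℂ, rhoBar c z t x =
      -1 - wn ℓ (zLam c z 1 t) x - wn ℓ (zLam c z (-1) t) x := by
  filter_upwards [h.ae_notMem ht] with x hx using h.rhoBar_eq_wn hℓ hT ht hx.1 hx.2

lemma Admissible.measurable_rhoBar (h : Admissible ℓ δ T c z) (hℓ : 0 < ℓ) {t : ℝ}
    (ht : t ∈ Icc 0 T) : Measurable (rhoBar c z t) := by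
  obtain ⟨h1, h2, -⟩ := h.isOpen_zones hℓ ht
  exact (measurable_one.indicator h1.measurableSet).sub (measurable_one.indicator h2.measurableSet)

lemma Admissible.aestronglyMeasurable_vBar (h : Admissible ℓ δ T c z) (hℓ : 0 < ℓ) {t : ℝ}
    (ht : t ∈ Icc 0 T) : AEStronglyMeasurable (vBar ℓ c z t) volume := by
  have := (aestronglyMeasurable_vel hℓ (h.isLoop_zLam 1 ht)).add
    (aestronglyMeasurable_vel hℓ (h.isLoop_zLam (-1) ht))
  exact this.congr (Eventually.of_forall fun x => (vBar_eq ℓ c z t x).symm)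

lemma Admissible.exists_norm_vBar_le (h : Admissible ℓ δ T c z) (hℓ : 0 < ℓ) (hδ : 0 < δ)
    (hT : 0 < T) : ∃ V, 0 ≤ V ∧ ∀ t ∈ Icc 0 T, ∀ᵐ x : ℂ, ‖vBar ℓ c z t x‖ ≤ V := by
  obtain ⟨C, κ, hC, hκ0, hκ, hp⟩ := h.exists_closePair hℓ hδ hT
  set J := (2 * Real.pi)⁻¹ * ∫ β in (-(ℓ / 2))..(ℓ / 2), 4 * C * C ^ (1 - κ) * |β| ^ (κ - 1)
  have key : ∀ a ∈ Icc (-1 : ℝ) 1, ∀ t ∈ Icc 0 T, ∀ x ∉ range (zLam c z a t),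
      ‖loopVel ℓ (zLam c z a t) x‖ ≤ 1 + J := fun a ha t ht x hx =>
    (norm_vel_le (h.isLoop_zLam a ht) ((hp t ht a ha).2 a ha) hℓ hC hκ0 hκ hx).trans
      (add_le_add_left (h.wn_mem hℓ hT ha ht hx) _)
  refine ⟨|(1 + J) + (1 + J)|, abs_nonneg _, fun t ht => ?_⟩
  filter_upwards [h.ae_notMem ht] with x hx
  rw [vBar_eq]
  exact ((norm_add_le _ _).trans (add_le_add (key 1 one_mem_Icc t ht x hx.1)
    (key (-1) neg_one_mem_Icc t ht x hx.2))).trans (le_abs_self _)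

lemma Admissible.integral_rhoBar_mul (h : Admissible ℓ δ T c z) (hℓ : 0 < ℓ) (hT : 0 < T) {t : ℝ}
    (ht : t ∈ Icc 0 T) {ψ : ℂ → ℝ} (hψ : Continuous ψ) (hc : HasCompactSupport ψ) :
    ∫ x, rhoBar c z t x * ψ x = -(∫ x, ψ x) - (∫ x, ψ x * wn ℓ (zLam c z 1 t) x) -
      ∫ x, ψ x * wn ℓ (zLam c z (-1) t) x := by
  have i0 := (integrable_of_contDiff hψ hc).1
  have i1 := integrable_mul_wn (h.isLoop_zLam 1 ht) hℓ hψ hc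
  have i2 := integrable_mul_wn (h.isLoop_zLam (-1) ht) hℓ hψ hc
  have i01 : Integrable fun x => -ψ x - ψ x * wn ℓ (zLam c z 1 t) x := i0.neg.sub i1
  have i00 : Integrable fun x => -ψ x := i0.neg
  rw [← integral_neg, ← integral_sub i00 i1, ← integral_sub i01 i2]
  refine integral_congr_ae ?_
  filter_upwards [h.ae_rhoBar_eq hℓ hT ht] with x hx
  rw [hx]; ring

lemma Admissible.hasDerivWithinAt_integral_rhoBar (h : Admissible ℓ δ T c z) (hℓ : 0 < ℓ)
    (hT : 0 < T) {t : ℝ} (ht : t ∈ Icc 0 T) {ψ : ℂ → ℝ} (hψ : ContDiff ℝ 1 ψ)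
    (hc : HasCompactSupport ψ) :
    HasDerivWithinAt (fun s => ∫ x, rhoBar c z s x * ψ x)
      (flux ℓ ψ (zLam c z 1 t) (zVel T c z 1 t) + flux ℓ ψ (zLam c z (-1) t) (zVel T c z (-1) t))
      (Icc 0 T) t := by
  have d1 := (h.loopFamily hℓ 1).hasDerivWithinAt_integral_mul_wn hℓ hT.le hψ hc ht
  have d2 := (h.loopFamily hℓ (-1)).hasDerivWithinAt_integral_mul_wn hℓ hT.le hψ hc ht
  have d := ((hasDerivWithinAt_const t (Icc 0 T) (-∫ x, ψ x)).sub d1).sub d2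
  have e : flux ℓ ψ (zLam c z 1 t) (zVel T c z 1 t) +
      flux ℓ ψ (zLam c z (-1) t) (zVel T c z (-1) t) =
      0 - -flux ℓ ψ (zLam c z 1 t) (zVel T c z 1 t) -
        -flux ℓ ψ (zLam c z (-1) t) (zVel T c z (-1) t) := by ring
  rw [e]
  exact d.congr (fun s hs => h.integral_rhoBar_mul hℓ hT hs hψ.continuous hc)
    (h.integral_rhoBar_mul hℓ hT ht hψ.continuous hc)

lemma integrable_inner_loopVel {u : ℝ → ℂ} (hℓ : 0 < ℓ) (hu : IsLoop ℓ u) {f : ℂ → ℂ}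
    (hf : Continuous f) (hc : HasCompactSupport f) :
    Integrable fun x => inner ℝ (loopVel ℓ u x) (f x) :=
  (integrable_grad_mul_conj_vel hℓ hu hf hc).re.congr
    (Eventually.of_forall fun x => (inner_eq_re_mul_conj (loopVel ℓ u x) (f x)).symm)

lemma Admissible.integral_inner_vBar (h : Admissible ℓ δ T c z) (hℓ : 0 < ℓ) {t : ℝ}
    (ht : t ∈ Icc 0 T) {f : ℂ → ℂ} (hf : Continuous f) (hc : HasCompactSupport f) :
    ∫ x, inner ℝ (vBar ℓ c z t x) (f x) =
      (∫ x, inner ℝ (loopVel ℓ (zLam c z 1 t) x) (f x)) +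
        ∫ x, inner ℝ (loopVel ℓ (zLam c z (-1) t) x) (f x) := by
  rw [← integral_add (integrable_inner_loopVel hℓ (h.isLoop_zLam 1 ht) hf hc)
    (integrable_inner_loopVel hℓ (h.isLoop_zLam (-1) ht) hf hc)]
  simp only [vBar_eq, inner_add_left]

lemma hasCompactSupport_I_mul {f : ℂ → ℂ} (hc : HasCompactSupport f) :
    HasCompactSupport fun x => Complex.I * f x := hc.mul_left (f := fun _ => Complex.I)

lemma Admissible.integral_inner_vBar_grad (h : Admissible ℓ δ T c z) (hℓ : 0 < ℓ) {t : ℝ}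
    (ht : t ∈ Icc 0 T) {ψ : ℂ → ℝ} (hψ : ContDiff ℝ 1 ψ) (hc : HasCompactSupport ψ) :
    ∫ x, inner ℝ (vBar ℓ c z t x) (grad ψ x) = 0 := by
  rw [h.integral_inner_vBar hℓ ht (continuous_grad hψ) (hasCompactSupport_grad hc),
    (integral_inner_vel_grad hℓ (h.isLoop_zLam 1 ht) hψ hc).1,
    (integral_inner_vel_grad hℓ (h.isLoop_zLam (-1) ht) hψ hc).1, add_zero]

lemma integrable_wn_mul {w : ℝ → ℂ} (hℓ : 0 < ℓ) (hw : IsLoop ℓ w) {N : ℝ}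
    (hN : ∀ x ∉ range w, |wn ℓ w x| ≤ N) {E : Type*} [NormedAddCommGroup E] [NormedSpace ℝ E]
    {g : ℂ → E} (hg : Integrable g) : Integrable fun x => wn ℓ w x • g x := by
  refine hg.bdd_smul N (aestronglyMeasurable_wn hℓ hw) ?_
  filter_upwards [ae_notMem_range hw] with x hx using hN x hx

lemma Admissible.integral_rhoBar_mul_grad (h : Admissible ℓ δ T c z) (hℓ : 0 < ℓ) (hT : 0 < T)
    {t : ℝ} (ht : t ∈ Icc 0 T) {ψ : ℂ → ℝ} (hψ : ContDiff ℝ 1 ψ) (hc : HasCompactSupport ψ) :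
    ∫ x, rhoBar c z t x • grad ψ x =
      Complex.I * (∫ β in (-(ℓ / 2))..(ℓ / 2), deriv (zLam c z 1 t) β * ψ (zLam c z 1 t β)) +
      Complex.I * ∫ β in (-(ℓ / 2))..(ℓ / 2), deriv (zLam c z (-1) t) β * ψ (zLam c z (-1) t β) := by
  have hl1 := h.isLoop_zLam 1 ht
  have hl2 := h.isLoop_zLam (-1) ht
  have i0 := (integrable_of_contDiff (continuous_grad hψ) (hasCompactSupport_grad hc)).1
  have i1 := integrable_wn_mul hℓ hl1 (fun x hx => h.wn_mem hℓ hT one_mem_Icc ht hx) i0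
  have i2 := integrable_wn_mul hℓ hl2 (fun x hx => h.wn_mem hℓ hT neg_one_mem_Icc ht hx) i0
  have i00 : Integrable fun x => -grad ψ x := i0.neg
  have i01 : Integrable fun x => -grad ψ x - wn ℓ (zLam c z 1 t) x • grad ψ x := i00.sub i1
  have e1 := integral_wn_mul_grad hl1 hℓ hψ hc
  have e2 := integral_wn_mul_grad hl2 hℓ hψ hc
  simp only [← Complex.real_smul] at e1 e2
  have : ∫ x, rhoBar c z t x • grad ψ x = ∫ x, (-grad ψ x - wn ℓ (zLam c z 1 t) x • grad ψ x -
      wn ℓ (zLam c z (-1) t) x • grad ψ x) := by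
    refine integral_congr_ae ?_
    filter_upwards [h.ae_rhoBar_eq hℓ hT ht] with x hx
    rw [hx]; module
  rw [this, integral_sub i01 i2, integral_sub i00 i1, integral_neg, integral_grad_eq_zero hψ hc,
    e1, e2]
  ring

/-- By Green's theorem the density contributes the integrals of `-Im(∂_α z_a) ψ` along the two
curves, and the vorticity of the velocity contributes exactly the opposite. -/
lemma Admissible.integral_darcy (h : Admissible ℓ δ T c z) (hℓ : 0 < ℓ) (hT : 0 < T) {t : ℝ}
    (ht : t ∈ Icc 0 T) {ψ : ℂ → ℝ} (hψ : ContDiff ℝ 1 ψ) (hc : HasCompactSupport ψ) :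
    ∫ x, inner ℝ (vBar ℓ c z t x + (rhoBar c z t x : ℂ) * Complex.I) (Complex.I * grad ψ x) = 0 := by
  have hg := continuous_grad hψ
  have hgc := hasCompactSupport_grad hc
  have hIg : Continuous fun x => Complex.I * grad ψ x := by fun_prop
  have hIc := hasCompactSupport_I_mul hgc
  have hl1 := h.isLoop_zLam 1 ht
  have hl2 := h.isLoop_zLam (-1) ht
  have i1 : Integrable fun x => inner ℝ (vBar ℓ c z t x) (Complex.I * grad ψ x) := by
    simp only [vBar_eq, inner_add_left]
    exact (integrable_inner_loopVel hℓ hl1 hIg hIc).add (integrable_inner_loopVel hℓ hl2 hIg hIc)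
  have i2 : Integrable fun x => rhoBar c z t x • grad ψ x :=
    (integrable_of_contDiff hg hgc).1.bdd_smul 1
      (h.measurable_rhoBar hℓ ht).aestronglyMeasurable
      (Eventually.of_forall fun x => abs_le.2 (rhoBar_abs_le t x))
  have e : ∀ x, inner ℝ ((rhoBar c z t x : ℂ) * Complex.I) (Complex.I * grad ψ x) =
      (rhoBar c z t x • grad ψ x).re := fun x => by
    simp [mul_comm]
  have i2r : Integrable fun x => (rhoBar c z t x • grad ψ x).re := i2.re
  have hre : ∀ {w : ℝ → ℂ}, IsLoop ℓ w →
      (∫ β in (-(ℓ / 2))..(ℓ / 2), deriv w β * ψ (w β)).im =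
        ∫ β in (-(ℓ / 2))..(ℓ / 2), (deriv w β).im * ψ (w β) := fun {w} hw => by
    have hwc := hw.continuous; have hwd := hw.continuous_deriv; have := hψ.continuous
    have hi : IntervalIntegrable (fun β => deriv w β * ψ (w β)) volume (-(ℓ / 2)) (ℓ / 2) :=
      (by fun_prop : Continuous _).intervalIntegrable _ _
    refine (Complex.imCLM.intervalIntegral_comp_comm hi).symm.trans ?_
    refine intervalIntegral.integral_congr fun β _ => ?_
    simp
  simp only [inner_add_left, e]
  rw [integral_add i1 i2r, h.integral_inner_vBar hℓ ht hIg hIc,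
    (integral_inner_vel_grad hℓ hl1 hψ hc).2, (integral_inner_vel_grad hℓ hl2 hψ hc).2,
    show ∫ x, (rhoBar c z t x • grad ψ x).re = (∫ x, rhoBar c z t x • grad ψ x).re from
      integral_re (𝕜 := ℂ) i2,
    h.integral_rhoBar_mul_grad hℓ hT ht hψ hc]
  simp only [Complex.add_re, Complex.I_mul_re, hre hl1, hre hl2]
  ring

lemma Admissible.continuous_Bab (h : Admissible ℓ δ T c z) (hℓ : 0 < ℓ) (hδ : 0 < δ) (hT : 0 < T)
    {t : ℝ} (ht : t ∈ Icc 0 T) {a b : ℝ} (ha : a ∈ Icc (-1 : ℝ) 1) (hb : b ∈ Icc (-1 : ℝ) 1) :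
    Continuous (Bab ℓ c z a b t) := by
  obtain ⟨C, κ, hC, hκ0, hκ, hp⟩ := h.exists_closePair hℓ hδ hT
  exact continuous_muskat (h.isLoop_zLam a ht) (h.isLoop_zLam b ht) ((hp t ht a ha).2 b hb) hℓ hC
    hκ0 hκ

lemma Admissible.continuous_Ba (h : Admissible ℓ δ T c z) (hℓ : 0 < ℓ) (hδ : 0 < δ) (hT : 0 < T)
    {t : ℝ} (ht : t ∈ Icc 0 T) {a : ℝ} (ha : a ∈ Icc (-1 : ℝ) 1) :
    Continuous (Ba ℓ c z a t) :=
  (h.continuous_Bab hℓ hδ hT ht ha one_mem_Icc).add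
    (h.continuous_Bab hℓ hδ hT ht ha neg_one_mem_Icc)

lemma Admissible.integral_wn_mul_inner_vBar (h : Admissible ℓ δ T c z) (hℓ : 0 < ℓ) (hδ : 0 < δ)
    (hT : 0 < T) {t : ℝ} (ht : t ∈ Icc 0 T) {a : ℝ} (ha : a ∈ Icc (-1 : ℝ) 1) {ψ : ℂ → ℝ}
    (hψ : ContDiff ℝ 1 ψ) (hc : HasCompactSupport ψ) :
    Integrable (fun x => wn ℓ (zLam c z a t) x * inner ℝ (vBar ℓ c z t x) (grad ψ x)) ∧
    ∫ x, wn ℓ (zLam c z a t) x * inner ℝ (vBar ℓ c z t x) (grad ψ x) =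
      -flux ℓ ψ (zLam c z a t) (Ba ℓ c z a t) := by
  obtain ⟨C, κ, hC, hκ0, hκ, hp⟩ := h.exists_closePair hℓ hδ hT
  have hwn : ∀ x ∉ range (zLam c z a t), |wn ℓ (zLam c z a t) x| ≤ 1 := fun x hx =>
    h.wn_mem hℓ hT ha ht hx
  have hint : ∀ b, Integrable fun x => wn ℓ (zLam c z a t) x *
      inner ℝ (loopVel ℓ (zLam c z b t) x) (grad ψ x) := fun b =>
    integrable_wn_mul hℓ (h.isLoop_zLam a ht) hwn (integrable_inner_loopVel hℓ (h.isLoop_zLam b ht)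
      (continuous_grad hψ) (hasCompactSupport_grad hc))
  have hval : ∀ b ∈ Icc (-1 : ℝ) 1, ∫ x, wn ℓ (zLam c z a t) x *
      inner ℝ (loopVel ℓ (zLam c z b t) x) (grad ψ x) =
      -flux ℓ ψ (zLam c z a t) (Bab ℓ c z a b t) := fun b hb =>
    integral_wn_mul_inner_loopVel (h.isLoop_zLam a ht) (h.isLoop_zLam b ht)
      ((hp t ht a ha).2 b hb) hℓ hC hκ0 hκ hwn hψ hc
  simp only [vBar_eq, inner_add_left, mul_add]
  refine ⟨(hint 1).add (hint (-1)), ?_⟩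
  rw [integral_add (hint 1) (hint (-1)), hval 1 one_mem_Icc, hval (-1) neg_one_mem_Icc, ← neg_add,
    ← flux_add ψ hψ.continuous (h.isLoop_zLam a ht)
      (h.continuous_Bab hℓ hδ hT ht ha one_mem_Icc)
      (h.continuous_Bab hℓ hδ hT ht ha neg_one_mem_Icc)]
  rfl

/-- The constant part `-1` of the density contributes nothing, by incompressibility; each winding
number contributes the flux of the corresponding `B_a`. -/
lemma Admissible.integral_rhoBar_mul_vBar (h : Admissible ℓ δ T c z) (hℓ : 0 < ℓ) (hδ : 0 < δ)
    (hT : 0 < T) {t : ℝ} (ht : t ∈ Icc 0 T) {ψ : ℂ → ℝ} (hψ : ContDiff ℝ 1 ψ)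
    (hc : HasCompactSupport ψ) :
    ∫ x, inner ℝ ((rhoBar c z t x : ℂ) * vBar ℓ c z t x) (grad ψ x) =
      flux ℓ ψ (zLam c z 1 t) (Ba ℓ c z 1 t) + flux ℓ ψ (zLam c z (-1) t) (Ba ℓ c z (-1) t) := by
  obtain ⟨i1, e1⟩ := h.integral_wn_mul_inner_vBar hℓ hδ hT ht one_mem_Icc hψ hc
  obtain ⟨i2, e2⟩ := h.integral_wn_mul_inner_vBar hℓ hδ hT ht neg_one_mem_Icc hψ hc
  have i0 : Integrable fun x => -inner ℝ (vBar ℓ c z t x) (grad ψ x) := by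
    simp only [vBar_eq, inner_add_left]
    exact ((integrable_inner_loopVel hℓ (h.isLoop_zLam 1 ht) (continuous_grad hψ)
      (hasCompactSupport_grad hc)).add (integrable_inner_loopVel hℓ (h.isLoop_zLam (-1) ht)
      (continuous_grad hψ) (hasCompactSupport_grad hc))).neg
  have i01 : Integrable fun x => -inner ℝ (vBar ℓ c z t x) (grad ψ x) -
    wn ℓ (zLam c z 1 t) x * inner ℝ (vBar ℓ c z t x) (grad ψ x) := i0.sub i1
  have : ∫ x, inner ℝ ((rhoBar c z t x : ℂ) * vBar ℓ c z t x) (grad ψ x) =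
      ∫ x, (-inner ℝ (vBar ℓ c z t x) (grad ψ x) -
        wn ℓ (zLam c z 1 t) x * inner ℝ (vBar ℓ c z t x) (grad ψ x) -
        wn ℓ (zLam c z (-1) t) x * inner ℝ (vBar ℓ c z t x) (grad ψ x)) := by
    refine integral_congr_ae ?_
    filter_upwards [h.ae_rhoBar_eq hℓ hT ht] with x hx
    rw [← Complex.real_smul, real_inner_smul_left, hx]; ring
  rw [this, integral_sub i01 i2, integral_sub i0 i1, integral_neg,
    h.integral_inner_vBar_grad hℓ ht hψ hc, e1, e2]
  ring

end Fields

/-! ### Momentum balance at a fixed time -/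

section Mixing

variable {ℓ T : ℝ} {δ : ℝ≥0} {c : ℝ → ℝ} {z : ℝ → ℝ → ℂ} {γ : ℝ → ℂ → ℂ} {γb : ℝ → ℝ → ℝ → ℂ}

/-- The defect `B_a - ∂_t z_a + a i / 2` of the curve `z_a`. -/
def defect (ℓ T : ℝ) (c : ℝ → ℝ) (z : ℝ → ℝ → ℂ) (a t α : ℝ) : ℂ :=
  Ba ℓ c z a t α - zVel T c z a t α + a * (Complex.I / 2)

lemma GammaRegular.continuousOn_slice (hγ : GammaRegular T c z γ γb) {t : ℝ} (ht : t ∈ Icc 0 T) :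
    ContinuousOn (γ t) (OmegaMix c z t) :=
  hγ.continuousOn.comp (f := fun x => (t, x)) (by fun_prop) fun _ hx => ⟨ht, hx⟩

lemma Admissible.mBar_eq_of_notMem (h : Admissible ℓ δ T c z) (hℓ : 0 < ℓ) (hT : 0 < T) {t : ℝ}
    (ht : t ∈ Icc 0 T) : ∀ᵐ x : ℂ, mBar ℓ c z γ t x =
      (rhoBar c z t x : ℂ) * vBar ℓ c z t x -
        (OmegaMix c z t).indicator (fun x => γ t x + Complex.I / 2) x := by
  filter_upwards [h.ae_notMem ht] with x hx
  rw [mBar, h.one_sub_rhoBar_sq hℓ hT ht hx.1 hx.2]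
  by_cases hm : x ∈ OmegaMix c z t
  · simp [hm]
  · simp [hm]

lemma Admissible.aestronglyMeasurable_indicator (h : Admissible ℓ δ T c z) (hℓ : 0 < ℓ) {t : ℝ}
    (ht : t ∈ Icc 0 T) {f : ℂ → ℂ} (hf : ContinuousOn f (OmegaMix c z t)) :
    AEStronglyMeasurable ((OmegaMix c z t).indicator f) volume := by
  have hm := (h.isOpen_zones hℓ ht).2.2.measurableSet
  exact (aestronglyMeasurable_indicator_iff hm).2 (hf.aestronglyMeasurable hm)

lemma Admissible.aestronglyMeasurable_mBar (h : Admissible ℓ δ T c z) (hℓ : 0 < ℓ) (hT : 0 < T)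
    (hγ : GammaRegular T c z γ γb) {t : ℝ} (ht : t ∈ Icc 0 T) :
    AEStronglyMeasurable (mBar ℓ c z γ t) volume := by
  have h1 : AEStronglyMeasurable (fun x => (rhoBar c z t x : ℂ) * vBar ℓ c z t x) volume :=
    (Complex.continuous_ofReal.measurable.comp
      (h.measurable_rhoBar hℓ ht)).aestronglyMeasurable.mul (h.aestronglyMeasurable_vBar hℓ ht)
  have h2 := h.aestronglyMeasurable_indicator hℓ ht
    ((hγ.continuousOn_slice ht).add (continuousOn_const (c := Complex.I / 2)))
  exact (h1.sub h2).congr ((h.mBar_eq_of_notMem hℓ hT ht).mono fun x hx => hx.symm)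

lemma norm_add_I_div_two_le {g : ℂ} (hg : ‖g‖ ≤ 1 / 2) : ‖g + Complex.I / 2‖ ≤ 1 := by
  refine (norm_add_le _ _).trans ?_
  have : ‖Complex.I / 2‖ = 1 / 2 := by simp
  linarith

lemma Admissible.norm_mBar_le (h : Admissible ℓ δ T c z) (hℓ : 0 < ℓ) (hT : 0 < T) {t V : ℝ}
    (ht : t ∈ Icc 0 T) (hV : ∀ᵐ x : ℂ, ‖vBar ℓ c z t x‖ ≤ V)
    (hb : ∀ x ∈ OmegaMix c z t, ‖γ t x‖ ≤ 1 / 2) :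
    ∀ᵐ x : ℂ, ‖mBar ℓ c z γ t x‖ ≤ V + 1 := by
  filter_upwards [h.mBar_eq_of_notMem (γ := γ) hℓ hT ht, hV] with x hx hv
  rw [hx]
  refine (norm_sub_le _ _).trans (add_le_add ?_ ?_)
  · rw [norm_mul, Complex.norm_real]
    have : ‖rhoBar c z t x‖ ≤ 1 := abs_le.2 (rhoBar_abs_le t x)
    calc _ ≤ 1 * ‖vBar ℓ c z t x‖ := by gcongr
      _ ≤ V := by rwa [one_mul]
  · by_cases hm : x ∈ OmegaMix c z t
    · rw [indicator_of_mem hm]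
      exact norm_add_I_div_two_le (hb x hm)
    · rw [indicator_of_notMem hm, norm_zero]; exact zero_le_one

/-- The indicator of the mixing zone is a difference of winding numbers, so Green's theorem for the
field `ψ k` applies on each curve. With `k = i/2` this moves the constant part of the momentum into
the defects. -/
lemma Admissible.integral_mix_const (h : Admissible ℓ δ T c z) (hℓ : 0 < ℓ) {t : ℝ}
    (ht : t ∈ Icc 0 T) (k : ℂ) {ψ : ℂ → ℝ} (hψ : ContDiff ℝ 1 ψ) (hc : HasCompactSupport ψ) :
    ∫ x in OmegaMix c z t, inner ℝ k (grad ψ x) =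
      flux ℓ ψ (zLam c z (-1) t) (fun _ => k) - flux ℓ ψ (zLam c z 1 t) (fun _ => k) := by
  have hF : ContDiff ℝ 1 fun x => ψ x • k := hψ.smul contDiff_const
  have hFc : HasCompactSupport fun x => ψ x • k := hc.smul_right (f' := fun _ => k)
  have hdiv : ∀ x, divergence (fun x => ψ x • k) x = inner ℝ k (grad ψ x) := fun x => by
    rw [divergence_smul (γ := fun _ => k) (hψ.differentiable one_ne_zero x)
      (differentiableAt_const k)]
    simp [divergence]
  have hg : Continuous fun x => inner ℝ k (grad ψ x) := by
    have := continuous_grad hψ; fun_prop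
  have hgc : HasCompactSupport fun x => inner ℝ k (grad ψ x) :=
    (hasCompactSupport_grad hc).comp_left (g := fun y => inner ℝ k y) (inner_zero_right _)
  have i1 := integrable_mul_wn (h.isLoop_zLam 1 ht) hℓ hg hgc
  have i2 := integrable_mul_wn (h.isLoop_zLam (-1) ht) hℓ hg hgc
  have e1 := integral_wn_mul_divergence (h.isLoop_zLam 1 ht) hℓ hF hFc
  have e2 := integral_wn_mul_divergence (h.isLoop_zLam (-1) ht) hℓ hF hFc
  simp only [hdiv, real_inner_smul_left] at e1 e2
  rw [← integral_indicator (h.isOpen_zones hℓ ht).2.2.measurableSet]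
  have : ∫ x, (OmegaMix c z t).indicator (fun x => inner ℝ k (grad ψ x)) x =
      ∫ x, (inner ℝ k (grad ψ x) * wn ℓ (zLam c z 1 t) x -
        inner ℝ k (grad ψ x) * wn ℓ (zLam c z (-1) t) x) := by
    refine integral_congr_ae ?_
    filter_upwards [h.ae_notMem ht] with x hx
    rw [← mul_sub, h.wn_plus_sub_minus hℓ ht hx.1 hx.2]
    by_cases hm : x ∈ OmegaMix c z t
    · simp [hm]
    · simp [hm]
  rw [this, integral_sub i1 i2]
  simp only [mul_comm (inner ℝ k (grad ψ _))]
  rw [e1, e2]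
  unfold flux
  ring

lemma Admissible.integrableOn_inner_grad (h : Admissible ℓ δ T c z) (hℓ : 0 < ℓ) {t : ℝ}
    (ht : t ∈ Icc 0 T) {f : ℂ → ℂ} (hf : ContinuousOn f (OmegaMix c z t)) {K : ℝ}
    (hb : ∀ x ∈ OmegaMix c z t, ‖f x‖ ≤ K) {g : ℂ → ℂ} (hg : Integrable g) :
    IntegrableOn (fun x => inner ℝ (f x) (g x)) (OmegaMix c z t) := by
  have hm := (h.isOpen_zones hℓ ht).2.2.measurableSet
  refine (hg.integrableOn.norm.const_mul K).mono'
    ((hf.aestronglyMeasurable hm).inner hg.aestronglyMeasurable.restrict) ?_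
  refine (ae_restrict_iff' hm).2 (Eventually.of_forall fun x hx => ?_)
  exact (norm_inner_le_norm _ _).trans (mul_le_mul_of_nonneg_right (hb x hx) (norm_nonneg _))

lemma Admissible.continuous_zVel (h : Admissible ℓ δ T c z) (hℓ : 0 < ℓ) {t : ℝ}
    (ht : t ∈ Icc 0 T) (a : ℝ) : Continuous (zVel T c z a t) :=
  ((h.loopFamily hℓ a).vel t ht).continuous

lemma Admissible.continuous_defect (h : Admissible ℓ δ T c z) (hℓ : 0 < ℓ) (hδ : 0 < δ)
    (hT : 0 < T) {t : ℝ} (ht : t ∈ Icc 0 T) {a : ℝ} (ha : a ∈ Icc (-1 : ℝ) 1) :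
    Continuous (defect ℓ T c z a t) :=
  ((h.continuous_Ba hℓ hδ hT ht ha).sub (h.continuous_zVel hℓ ht a)).add continuous_const

lemma Admissible.flux_defect (h : Admissible ℓ δ T c z) (hℓ : 0 < ℓ) (hδ : 0 < δ)
    (hT : 0 < T) {t : ℝ} (ht : t ∈ Icc 0 T) {a : ℝ} (ha : a ∈ Icc (-1 : ℝ) 1) {ψ : ℂ → ℝ}
    (hψ : Continuous ψ) : flux ℓ ψ (zLam c z a t) (defect ℓ T c z a t) =
      flux ℓ ψ (zLam c z a t) (Ba ℓ c z a t) - flux ℓ ψ (zLam c z a t) (zVel T c z a t) +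
        a * flux ℓ ψ (zLam c z a t) (fun _ => Complex.I / 2) := by
  have hB := h.continuous_Ba hℓ hδ hT ht ha
  have hv := h.continuous_zVel hℓ ht a
  have hl := h.isLoop_zLam a ht
  have e : flux ℓ ψ (zLam c z a t) (fun _ => (a : ℂ) * (Complex.I / 2)) =
      a * flux ℓ ψ (zLam c z a t) (fun _ => Complex.I / 2) := by
    unfold flux
    rw [← intervalIntegral.integral_const_mul]
    refine intervalIntegral.integral_congr fun β _ => ?_
    simp only [← Complex.real_smul, real_inner_smul_left]; ring
  have hBv : Continuous fun α => Ba ℓ c z a t α - zVel T c z a t α := hB.sub hv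
  rw [← flux_sub ψ hψ hl hB hv, ← e, ← flux_add ψ hψ hl hBv continuous_const]
  rfl

/-- The momentum balance across the two curves at a fixed time. -/
lemma Admissible.integral_mBar_grad (h : Admissible ℓ δ T c z) (hℓ : 0 < ℓ) (hδ : 0 < δ)
    (hT : 0 < T) {t : ℝ} (ht : t ∈ Icc 0 T) (hf : ContinuousOn (γ t) (OmegaMix c z t))
    (hb : ∀ x ∈ OmegaMix c z t, ‖γ t x‖ ≤ 1 / 2) {ψ : ℂ → ℝ} (hψ : ContDiff ℝ 1 ψ)
    (hc : HasCompactSupport ψ) :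
    (∫ x, inner ℝ (mBar ℓ c z γ t x) (grad ψ x)) =
      flux ℓ ψ (zLam c z 1 t) (Ba ℓ c z 1 t) + flux ℓ ψ (zLam c z (-1) t) (Ba ℓ c z (-1) t) -
      ∫ x in OmegaMix c z t, inner ℝ (γ t x + Complex.I / 2) (grad ψ x) := by
  have hg := (integrable_of_contDiff (continuous_grad hψ) (hasCompactSupport_grad hc)).1
  have hm := (h.isOpen_zones hℓ ht).2.2.measurableSet
  obtain ⟨V, -, hV⟩ := h.exists_norm_vBar_le hℓ hδ hT
  have i1 : Integrable fun x => inner ℝ ((rhoBar c z t x : ℂ) * vBar ℓ c z t x) (grad ψ x) := by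
    refine (hg.norm.const_mul V).mono' (((Complex.continuous_ofReal.measurable.comp
      (h.measurable_rhoBar hℓ ht)).aestronglyMeasurable.mul
      (h.aestronglyMeasurable_vBar hℓ ht)).inner hg.aestronglyMeasurable) ?_
    filter_upwards [hV t ht] with x hx
    refine (norm_inner_le_norm _ _).trans (mul_le_mul_of_nonneg_right ?_ (norm_nonneg _))
    rw [norm_mul, Complex.norm_real]
    have : ‖rhoBar c z t x‖ ≤ 1 := abs_le.2 (rhoBar_abs_le t x)
    calc _ ≤ 1 * ‖vBar ℓ c z t x‖ := by gcongr
      _ ≤ V := by rwa [one_mul]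
  have i2 := (h.integrableOn_inner_grad (f := fun x => γ t x + Complex.I / 2) hℓ ht
    (hf.add continuousOn_const) (fun x hx => norm_add_I_div_two_le (hb x hx)) hg).integrable_indicator hm
  rw [← h.integral_rhoBar_mul_vBar hℓ hδ hT ht hψ hc, ← integral_indicator hm,
    ← integral_sub i1 i2]
  refine integral_congr_ae ?_
  filter_upwards [h.mBar_eq_of_notMem (γ := γ) hℓ hT ht] with x hx
  rw [hx, inner_sub_left]
  by_cases hxm : x ∈ OmegaMix c z t
  · simp only [indicator_of_mem hxm]
  · simp only [indicator_of_notMem hxm, inner_zero_left]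

/-- Both implications are read off from this identity: its left side vanishes for all `ψ` exactly
when mass is conserved at time `t`. Nothing about the divergence or the traces of `γ` enters yet. -/
lemma Admissible.integral_mBar_sub (h : Admissible ℓ δ T c z) (hℓ : 0 < ℓ) (hδ : 0 < δ)
    (hT : 0 < T) {t : ℝ} (ht : t ∈ Icc 0 T) (hf : ContinuousOn (γ t) (OmegaMix c z t))
    (hb : ∀ x ∈ OmegaMix c z t, ‖γ t x‖ ≤ 1 / 2) {ψ : ℂ → ℝ} (hψ : ContDiff ℝ 1 ψ)
    (hc : HasCompactSupport ψ) :
    (∫ x, inner ℝ (mBar ℓ c z γ t x) (grad ψ x)) -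
      (flux ℓ ψ (zLam c z 1 t) (zVel T c z 1 t) +
        flux ℓ ψ (zLam c z (-1) t) (zVel T c z (-1) t)) =
      flux ℓ ψ (zLam c z 1 t) (defect ℓ T c z 1 t) +
        flux ℓ ψ (zLam c z (-1) t) (defect ℓ T c z (-1) t) -
      ∫ x in OmegaMix c z t, inner ℝ (γ t x) (grad ψ x) := by
  have hg := (integrable_of_contDiff (continuous_grad hψ) (hasCompactSupport_grad hc)).1
  rw [h.integral_mBar_grad hℓ hδ hT ht hf hb hψ hc, h.flux_defect hℓ hδ hT ht one_mem_Icc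
    hψ.continuous, h.flux_defect hℓ hδ hT ht neg_one_mem_Icc hψ.continuous]
  simp only [inner_add_left]
  rw [integral_add (h.integrableOn_inner_grad hℓ ht hf hb hg)
    (h.integrableOn_inner_grad hℓ ht (continuousOn_const (c := Complex.I / 2)) (K := 1)
      (fun x _ => by norm_num) hg), h.integral_mix_const hℓ ht _ hψ hc]
  ring

/-- The flux of `γ` through the boundary of the mixing zone. -/
lemma Admissible.integral_mix_eq (h : Admissible ℓ δ T c z) (hℓ : 0 < ℓ)
    (hγ : GammaRegular T c z γ γb) {t : ℝ} (ht : t ∈ Ioc 0 T)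
    (hb : ∀ x ∈ OmegaMix c z t, ‖γ t x‖ ≤ 1 / 2)
    (hdiv : ∀ x ∈ OmegaMix c z t, divergence (γ t) x = 0) {ψ : ℂ → ℝ} (hψ : ContDiff ℝ 1 ψ)
    (hc : HasCompactSupport ψ) :
    ∫ x in OmegaMix c z t, inner ℝ (γ t x) (grad ψ x) =
      ∫ α in (-(ℓ / 2))..(ℓ / 2), {α | 0 < t * c α}.indicator (fun α =>
        ψ (zLam c z (-1) t α) * inner ℝ (γb (-1) t α) (Complex.I * deriv (zLam c z (-1) t) α) -
        ψ (zLam c z 1 t α) * inner ℝ (γb 1 t α) (Complex.I * deriv (zLam c z 1 t) α)) α := by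
  have ht' : t ∈ Icc 0 T := Ioc_subset_Icc_self ht
  have hs := h.isStrip hℓ ht'
  have hE := stripRegion_eq_omegaMix h ht'.1
  have h1 : strip (zLam c z (-1) t) (fun α => (-2 * t) • mixDir c z α) 1 = zLam c z 1 t := by
    rw [strip_zLam]; norm_num
  have hset : {α | (-2 * t) • mixDir c z α ≠ 0} = {α | 0 < t * c α} :=
    Set.ext fun α => h.mixDir_ne_zero ht'.1 α
  have hpos : ∀ α, (-2 * t) • mixDir c z α ≠ 0 → 0 < c α := fun α hα =>
    pos_of_mul_pos_right ((h.mixDir_ne_zero ht'.1 α).1 hα) ht'.1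
  have := hs.integral_inner_grad hℓ (γ := γ t) (K := 1 / 2) (by norm_num) (by rwa [hE])
    (by rw [hE]; exact hγ.contDiffOn t ht) (by rwa [hE]) (γ0 := γb (-1) t) (γ1 := γb 1 t)
    (fun α hα => by rw [hE]; exact hγ.tendsto (-1) (by simp) t ht α (hpos α hα))
    (fun α hα => by rw [hE, h1]; exact hγ.tendsto 1 (by simp) t ht α (hpos α hα)) hψ hc
  rwa [hE, h1, hset] at this

/-- A zero of `c ≥ 0` is a minimum, so `c' = 0` there as well. At a closed point all curves `z_λ`
therefore share position and tangent, and hence the value of `B_a`. -/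
lemma Admissible.deriv_mixDir_eq_zero (h : Admissible ℓ δ T c z) {α : ℝ} (hα : c α = 0) :
    deriv (mixDir c z) α = 0 := by
  have hd : DifferentiableAt ℝ c α := h.c_mem.2.1.differentiable one_ne_zero α
  have hmin : IsLocalMin c α := Eventually.of_forall fun β => by rw [hα]; exact h.c_nonneg β
  have hτ : DifferentiableAt ℝ (fun β => Complex.I * deriv (z 0) β) α :=
    (h.isLoop_tangent.contDiff.differentiable one_ne_zero α).const_mul _
  have := (hd.hasDerivAt.smul hτ.hasDerivAt).deriv
  rw [hmin.deriv_eq_zero, hα, zero_smul, zero_smul, add_zero] at this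
  exact this

lemma zLam_eq_of_mul_eq_zero {a t α : ℝ} (hα : t * c α = 0) : zLam c z a t α = z t α := by
  rw [zLam, mul_assoc, hα]; simp

lemma Admissible.deriv_zLam_of_mul_eq_zero (h : Admissible ℓ δ T c z) {a t α : ℝ}
    (ht : t ∈ Icc 0 T) (hα : t * c α = 0) : deriv (zLam c z a t) α = deriv (z t) α := by
  rw [h.deriv_zLam a ht]
  rcases mul_eq_zero.1 hα with h0 | h0
  · rw [h0, mul_zero, zero_smul, sub_zero]
  · rw [h.deriv_mixDir_eq_zero h0, smul_zero, sub_zero]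

lemma Admissible.Ba_eq_of_mul_eq_zero (h : Admissible ℓ δ T c z) {a t α : ℝ}
    (ht : t ∈ Icc 0 T) (hα : t * c α = 0) : Ba ℓ c z a t α = B ℓ c z t α := by
  have key : ∀ b, Ba ℓ c z b t α = Ba ℓ c z 0 t α := fun b => by
    simp only [Ba, Bab, zLam_eq_of_mul_eq_zero (z := z) (a := b) hα,
      zLam_eq_of_mul_eq_zero (z := z) (a := 0) hα, h.deriv_zLam_of_mul_eq_zero ht hα]
  rw [B, key a, key 1, key (-1)]
  module

/-- Under the boundary conditions the fluxes of momentum and density agree. -/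
lemma Admissible.integral_mBar_eq_flux (h : Admissible ℓ δ T c z) (hℓ : 0 < ℓ) (hδ : 0 < δ)
    (hT : 0 < T) (hγ : GammaRegular T c z γ γb) {t : ℝ} (ht : t ∈ Ioc 0 T)
    (hb : ∀ x ∈ OmegaMix c z t, ‖γ t x‖ ≤ 1 / 2)
    (hdiv : ∀ x ∈ OmegaMix c z t, divergence (γ t) x = 0)
    (h0 : ∀ α, t * c α = 0 →
      inner ℝ (timeDeriv T z t α - B ℓ c z t α) (Complex.I * deriv (z t) α) = 0)
    (h1 : ∀ a ∈ ({1, -1} : Set ℝ), ∀ α, 0 < t * c α →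
      inner ℝ (zVel T c z a t α - Ba ℓ c z a t α - (a : ℂ) * (γb a t α + Complex.I / 2))
        (Complex.I * deriv (zLam c z a t) α) = 0)
    {ψ : ℂ → ℝ} (hψ : ContDiff ℝ 1 ψ) (hc : HasCompactSupport ψ) :
    (∫ x, inner ℝ (mBar ℓ c z γ t x) (grad ψ x)) =
      flux ℓ ψ (zLam c z 1 t) (zVel T c z 1 t) +
        flux ℓ ψ (zLam c z (-1) t) (zVel T c z (-1) t) := by
  have ht' : t ∈ Icc 0 T := Ioc_subset_Icc_self ht
  rw [← sub_eq_zero, h.integral_mBar_sub hℓ hδ hT ht' (hγ.continuousOn_slice ht') hb hψ hc,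
    h.integral_mix_eq hℓ hγ ht hb hdiv hψ hc, sub_eq_zero]
  have hψc := hψ.continuous
  have hcont : ∀ a ∈ Icc (-1 : ℝ) 1, IntervalIntegrable (fun α => ψ (zLam c z a t α) *
      inner ℝ (defect ℓ T c z a t α) (Complex.I * deriv (zLam c z a t) α)) volume
      (-(ℓ / 2)) (ℓ / 2) := fun a ha => by
    have hl := h.isLoop_zLam a ht'
    have := hl.continuous; have := hl.continuous_deriv
    have := h.continuous_defect hℓ hδ hT ht' ha
    exact (by fun_prop : Continuous _).intervalIntegrable _ _
  rw [flux, flux, ← intervalIntegral.integral_add (hcont 1 one_mem_Icc)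
    (hcont (-1) neg_one_mem_Icc)]
  refine intervalIntegral.integral_congr fun α _ => ?_
  by_cases hα : 0 < t * c α
  · have hα' : α ∈ {α | 0 < t * c α} := hα
    have e1 := h1 1 (by simp) α hα
    have e2 := h1 (-1) (by simp) α hα
    simp only [indicator_of_mem hα', defect]
    simp only [inner_add_left, inner_sub_left, inner_neg_left, Complex.ofReal_one, one_mul,
      Complex.ofReal_neg, neg_mul] at e1 e2 ⊢
    linear_combination (-ψ (zLam c z 1 t α)) * e1 - ψ (zLam c z (-1) t α) * e2
  · have hα' : α ∉ {α | 0 < t * c α} := hα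
    have hz : t * c α = 0 := le_antisymm (not_lt.1 hα) (mul_nonneg ht'.1 (h.c_nonneg α))
    have hcz : c α = 0 := (mul_eq_zero.1 hz).resolve_left ht.1.ne'
    have e := h0 α hz
    -- At a closed point the terms `± i/2` of the two defects cancel, and the sum is twice `B - ∂_t
    -- z`.
    simp only [indicator_of_notMem hα', defect, zLam_eq_of_mul_eq_zero hz,
      h.deriv_zLam_of_mul_eq_zero ht' hz, h.Ba_eq_of_mul_eq_zero ht' hz,
      zVel_eq_timeDeriv_of_c_eq_zero hcz]
    simp only [inner_add_left, inner_sub_left, inner_neg_left, Complex.ofReal_one, one_mul,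
      Complex.ofReal_neg, neg_mul] at e ⊢
    linear_combination (-2 * ψ (z t α)) * e

end Mixing

/-! ### Weak-star continuity in time by dominated convergence -/

section WeakStar

/-- A uniform bound and continuity in time at almost every point suffice. The exceptional null set
may depend on the time, as it does for moving curves. -/
lemma weakStarContinuous_of_ae {E : Type} [NormedAddCommGroup E] [InnerProductSpace ℝ E] {T M : ℝ}
    {f : ℝ → ℂ → E} (hm : ∀ t ∈ Icc 0 T, AEStronglyMeasurable (f t) volume)
    (hb : ∀ t ∈ Icc 0 T, ∀ᵐ x, ‖f t x‖ ≤ M)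
    (hc : ∀ t ∈ Icc 0 T, ∀ᵐ x, ContinuousWithinAt (fun s => f s x) (Icc 0 T) t) :
    WeakStarContinuous T f := by
  refine ⟨fun t ht => memLp_top_of_bound (hm t ht) M (hb t ht), fun g hg t ht => ?_⟩
  refine tendsto_integral_filter_of_dominated_convergence (fun x => M * ‖g x‖) ?_ ?_
    (hg.norm.const_mul M) ?_
  · filter_upwards [self_mem_nhdsWithin] with s hs using (hm s hs).inner hg.aestronglyMeasurable
  · filter_upwards [self_mem_nhdsWithin] with s hs
    filter_upwards [hb s hs] with x hx
    exact (norm_inner_le_norm _ _).trans (mul_le_mul_of_nonneg_right hx (norm_nonneg _))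
  · filter_upwards [hc t ht] with x hx
    exact hx.inner tendsto_const_nhds

lemma exists_bound_snd {E : Type*} [NormedAddCommGroup E] {g : ℝ × ℂ → E} (hg : Continuous g)
    (hc : HasCompactSupport g) : ∃ N K, 0 ≤ N ∧ IsCompact K ∧ (∀ q, ‖g q‖ ≤ N) ∧
      ∀ s, ∀ x ∉ K, g (s, x) = 0 := by
  obtain ⟨N, hN⟩ := hc.exists_bound_of_continuous hg
  refine ⟨N, Prod.snd '' tsupport g, (norm_nonneg _).trans (hN 0), hc.isCompact.image continuous_snd,
    hN, fun s x hx => image_eq_zero_of_notMem_tsupport fun h => hx ⟨_, h, rfl⟩⟩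

lemma integrable_indicator_const {K : Set ℂ} (hK : IsCompact K) (N : ℝ) :
    Integrable (K.indicator fun _ => N) volume :=
  (integrable_indicator_iff hK.measurableSet).2 (integrableOn_const hK.measure_lt_top.ne)

lemma norm_le_indicator {E : Type*} [NormedAddCommGroup E] {g : ℂ → E} {K : Set ℂ} {N : ℝ}
    (hN : ∀ x, ‖g x‖ ≤ N) (h0 : ∀ x ∉ K, g x = 0) (x : ℂ) :
    ‖g x‖ ≤ K.indicator (fun _ => N) x := by
  by_cases hx : x ∈ K
  · rw [indicator_of_mem hx]; exact hN x
  · rw [indicator_of_notMem hx, h0 x hx, norm_zero]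

lemma continuousOn_integral_inner {E : Type*} [NormedAddCommGroup E] [InnerProductSpace ℝ E]
    {T M : ℝ} {f : ℝ → ℂ → E} {g : ℝ × ℂ → E}
    (hm : ∀ t ∈ Icc 0 T, AEStronglyMeasurable (f t) volume)
    (hb : ∀ t ∈ Icc 0 T, ∀ᵐ x, ‖f t x‖ ≤ M)
    (hc : ∀ t ∈ Icc 0 T, ∀ᵐ x, ContinuousWithinAt (fun s => f s x) (Icc 0 T) t)
    (hg : Continuous g) (hgc : HasCompactSupport g) :
    ContinuousOn (fun s => ∫ x, inner ℝ (f s x) (g (s, x))) (Icc 0 T) := by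
  obtain ⟨N, K, hN0, hK, hN, hKN⟩ := exists_bound_snd hg hgc
  intro t ht
  refine tendsto_integral_filter_of_dominated_convergence (fun x => M * K.indicator (fun _ => N) x)
    ?_ ?_ ((integrable_indicator_const hK N).const_mul M) ?_
  · filter_upwards [self_mem_nhdsWithin] with s hs
    exact (hm s hs).inner (by fun_prop : Continuous fun x => g (s, x)).aestronglyMeasurable
  · filter_upwards [self_mem_nhdsWithin] with s hs
    filter_upwards [hb s hs] with x hx
    refine (norm_inner_le_norm _ _).trans (mul_le_mul hx ?_ (norm_nonneg _)
      ((norm_nonneg _).trans hx))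
    exact norm_le_indicator (g := fun x => g (s, x)) (fun x => hN _) (fun x hx => hKN s x hx) x
  · filter_upwards [hc t ht] with x hx
    exact hx.inner ((by fun_prop : Continuous fun s => g (s, x)).continuousWithinAt)

end WeakStar

/-! ### Continuity in time at points off the curves -/

section TimeContinuity

variable {ℓ T : ℝ} {δ : ℝ≥0} {c : ℝ → ℝ} {z : ℝ → ℝ → ℂ} {γ : ℝ → ℂ → ℂ} {γb : ℝ → ℝ → ℝ → ℂ}

lemma tendsto_prodMk_Icc (t : ℝ) (x : ℂ) :
    Tendsto (fun s => (s, x)) (𝓝[Icc 0 T] t) (𝓝[Icc 0 T ×ˢ univ] (t, x)) := by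
  refine tendsto_nhdsWithin_iff.2 ⟨?_, ?_⟩
  · exact ((by fun_prop : Continuous fun s : ℝ => (s, x)).tendsto t).mono_left nhdsWithin_le_nhds
  · filter_upwards [self_mem_nhdsWithin] with s hs using ⟨hs, mem_univ _⟩

lemma continuousWithinAt_slice {E : Type*} [TopologicalSpace E] {F : ℝ × ℂ → E} {t : ℝ} {x : ℂ}
    (hF : ContinuousWithinAt F (Icc 0 T ×ˢ univ) (t, x)) :
    ContinuousWithinAt (fun s => F (s, x)) (Icc 0 T) t :=
  Tendsto.comp hF (tendsto_prodMk_Icc t x)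

lemma Admissible.eventually_notMem (h : Admissible ℓ δ T c z) (hℓ : 0 < ℓ) (a : ℝ) {t : ℝ}
    (ht : t ∈ Icc 0 T) {x : ℂ} (hx : x ∉ range (zLam c z a t)) :
    ∀ᶠ s in 𝓝[Icc 0 T] t, x ∉ range (zLam c z a s) := by
  have hf := h.loopFamily hℓ a
  obtain ⟨ε, hε, he⟩ := eventually_le_norm_sub hℓ hf.cont hf.loop ht hx
  filter_upwards [(tendsto_prodMk_Icc t x).eventually he] with s hs
  rintro ⟨β, rfl⟩
  have := hs β
  simp only [sub_self, norm_zero] at this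
  linarith

lemma Admissible.continuousWithinAt_vBar (h : Admissible ℓ δ T c z) (hℓ : 0 < ℓ) {t : ℝ}
    (ht : t ∈ Icc 0 T) {x : ℂ} (hx : x ∉ range (zLam c z 1 t))
    (hx' : x ∉ range (zLam c z (-1) t)) :
    ContinuousWithinAt (fun s => vBar ℓ c z s x) (Icc 0 T) t := by
  simp only [vBar_eq]
  have h1 := continuousWithinAt_slice ((h.loopFamily hℓ 1).continuousWithinAt_vel hℓ ht hx)
  have h2 := continuousWithinAt_slice ((h.loopFamily hℓ (-1)).continuousWithinAt_vel hℓ ht hx')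
  exact h1.add h2

lemma Admissible.continuousWithinAt_rhoBar (h : Admissible ℓ δ T c z) (hℓ : 0 < ℓ) (hT : 0 < T)
    {t : ℝ} (ht : t ∈ Icc 0 T) {x : ℂ} (hx : x ∉ range (zLam c z 1 t))
    (hx' : x ∉ range (zLam c z (-1) t)) :
    ContinuousWithinAt (fun s => rhoBar c z s x) (Icc 0 T) t := by
  have key : ContinuousWithinAt (fun s => -1 - wn ℓ (zLam c z 1 s) x - wn ℓ (zLam c z (-1) s) x)
      (Icc 0 T) t := by
    have h1 := continuousWithinAt_slice ((h.loopFamily hℓ 1).continuousWithinAt_wn hℓ ht hx)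
    have h2 := continuousWithinAt_slice ((h.loopFamily hℓ (-1)).continuousWithinAt_wn hℓ ht hx')
    exact (continuousWithinAt_const.sub h1).sub h2
  refine key.congr_of_eventuallyEq ?_ (h.rhoBar_eq_wn hℓ hT ht hx hx')
  filter_upwards [self_mem_nhdsWithin, h.eventually_notMem hℓ 1 ht hx,
    h.eventually_notMem hℓ (-1) ht hx'] with s hs h1 h2
  exact h.rhoBar_eq_wn hℓ hT hs h1 h2

/-- Off the curves `1 - ρ²` takes only the values `0` and `1` and is continuous in time, hence
locally constant. -/
lemma Admissible.eventually_mem_mix_iff (h : Admissible ℓ δ T c z) (hℓ : 0 < ℓ) (hT : 0 < T)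
    {t : ℝ} (ht : t ∈ Icc 0 T) {x : ℂ} (hx : x ∉ range (zLam c z 1 t))
    (hx' : x ∉ range (zLam c z (-1) t)) :
    ∀ᶠ s in 𝓝[Icc 0 T] t, (x ∈ OmegaMix c z s ↔ x ∈ OmegaMix c z t) := by
  have hρ : ContinuousWithinAt (fun s => 1 - rhoBar c z s x ^ 2) (Icc 0 T) t :=
    continuousWithinAt_const.sub ((h.continuousWithinAt_rhoBar hℓ hT ht hx hx').pow 2)
  have := Metric.tendsto_nhds.1 hρ 1 one_pos
  filter_upwards [this, self_mem_nhdsWithin, h.eventually_notMem hℓ 1 ht hx,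
    h.eventually_notMem hℓ (-1) ht hx'] with s hd hs h1 h2
  rw [h.one_sub_rhoBar_sq hℓ hT hs h1 h2, h.one_sub_rhoBar_sq hℓ hT ht hx hx'] at hd
  by_cases hms : x ∈ OmegaMix c z s <;> by_cases hmt : x ∈ OmegaMix c z t <;>
    simp_all

lemma Admissible.continuousWithinAt_mBar (h : Admissible ℓ δ T c z) (hℓ : 0 < ℓ) (hT : 0 < T)
    (hγ : GammaRegular T c z γ γb) {t : ℝ} (ht : t ∈ Icc 0 T) {x : ℂ}
    (hx : x ∉ range (zLam c z 1 t)) (hx' : x ∉ range (zLam c z (-1) t)) :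
    ContinuousWithinAt (fun s => mBar ℓ c z γ s x) (Icc 0 T) t := by
  have hρ := h.continuousWithinAt_rhoBar hℓ hT ht hx hx'
  have hρv : ContinuousWithinAt (fun s => (rhoBar c z s x : ℂ) * vBar ℓ c z s x) (Icc 0 T) t :=
    (Complex.continuous_ofReal.continuousAt.comp_continuousWithinAt hρ).mul
      (h.continuousWithinAt_vBar hℓ ht hx hx')
  by_cases hm : x ∈ OmegaMix c z t
  · have hg : ContinuousWithinAt (fun s => γ s x) (Icc 0 T) t := by
      refine Tendsto.comp (g := fun p : ℝ × ℂ => γ p.1 p.2) (f := fun s => (s, x))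
        (hγ.continuousOn (t, x) ⟨ht, hm⟩) (tendsto_nhdsWithin_iff.2 ⟨?_, ?_⟩)
      · exact ((by fun_prop : Continuous fun s : ℝ => (s, x)).tendsto t).mono_left
          nhdsWithin_le_nhds
      · filter_upwards [self_mem_nhdsWithin, h.eventually_mem_mix_iff hℓ hT ht hx hx'] with s hs hi
        exact ⟨hs, hi.2 hm⟩
    exact hρv.sub ((Complex.continuous_ofReal.continuousAt.comp_continuousWithinAt
      (continuousWithinAt_const.sub (hρ.pow 2))).mul (hg.add continuousWithinAt_const))
  · refine hρv.congr_of_eventuallyEq ?_ ?_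
    · filter_upwards [self_mem_nhdsWithin, h.eventually_notMem hℓ 1 ht hx,
        h.eventually_notMem hℓ (-1) ht hx', h.eventually_mem_mix_iff hℓ hT ht hx hx']
        with s hs h1 h2 hi
      rw [mBar, h.one_sub_rhoBar_sq hℓ hT hs h1 h2, indicator_of_notMem (fun hc => hm (hi.1 hc))]
      simp
    · rw [mBar, h.one_sub_rhoBar_sq hℓ hT ht hx hx', indicator_of_notMem hm]
      simp

end TimeContinuity

/-! ### Rate of change of the mass against a time-dependent test function -/

section Conservation

variable {ℓ T : ℝ} {δ : ℝ≥0} {c : ℝ → ℝ} {z : ℝ → ℝ → ℂ} {γ : ℝ → ℂ → ℂ} {γb : ℝ → ℝ → ℝ → ℂ}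
  {φ : ℝ × ℂ → ℝ}

lemma contDiff_slice (hφ : ContDiff ℝ 1 φ) (s : ℝ) : ContDiff ℝ 1 fun x => φ (s, x) :=
  hφ.comp (by fun_prop)

lemma hasCompactSupport_slice (hc : HasCompactSupport φ) (s : ℝ) :
    HasCompactSupport fun x => φ (s, x) :=
  HasCompactSupport.intro (hc.isCompact.image continuous_snd) fun _ hx =>
    image_eq_zero_of_notMem_tsupport fun h => hx ⟨_, h, rfl⟩

/-- The time derivative of a test function. -/
def timePartial (φ : ℝ × ℂ → ℝ) (q : ℝ × ℂ) : ℝ := fderiv ℝ φ q (1, 0)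

lemma hasDerivAt_time (hφ : ContDiff ℝ 1 φ) (s : ℝ) (x : ℂ) :
    HasDerivAt (fun r => φ (r, x)) (timePartial φ (s, x)) s := by
  have h1 := (hφ.differentiable one_ne_zero (s, x)).hasFDerivAt
  exact h1.comp_hasDerivAt s ((hasDerivAt_id s).prodMk (hasDerivAt_const s x))

lemma continuous_timePartial (hφ : ContDiff ℝ 1 φ) : Continuous (timePartial φ) :=
  (hφ.continuous_fderiv one_ne_zero).clm_apply continuous_const

lemma hasCompactSupport_timePartial (hc : HasCompactSupport φ) :
    HasCompactSupport (timePartial φ) :=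
  (hc.fderiv (𝕜 := ℝ)).comp_left (g := fun L : ℝ × ℂ →L[ℝ] ℝ => L (1, 0)) rfl

lemma Admissible.integrable_rhoBar_mul (h : Admissible ℓ δ T c z) (hℓ : 0 < ℓ) {t : ℝ}
    (ht : t ∈ Icc 0 T) {g : ℂ → ℝ} (hg : Integrable g) :
    Integrable fun x => rhoBar c z t x * g x :=
  hg.bdd_smul 1 (h.measurable_rhoBar hℓ ht).aestronglyMeasurable
      (Eventually.of_forall fun x => abs_le.2 (rhoBar_abs_le t x))

/-- The rate of change of the density against a time-dependent test function. -/
lemma Admissible.hasDerivWithinAt_integral_rhoBar_mul (h : Admissible ℓ δ T c z) (hℓ : 0 < ℓ)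
    (hT : 0 < T) {t : ℝ} (ht : t ∈ Icc 0 T) (hφ : ContDiff ℝ 1 φ) (hc : HasCompactSupport φ) :
    HasDerivWithinAt (fun s => ∫ x, rhoBar c z s x * φ (s, x))
      ((flux ℓ (fun x => φ (t, x)) (zLam c z 1 t) (zVel T c z 1 t) +
        flux ℓ (fun x => φ (t, x)) (zLam c z (-1) t) (zVel T c z (-1) t)) +
        ∫ x, rhoBar c z t x * timePartial φ (t, x)) (Icc 0 T) t := by
  obtain ⟨N, K, hN0, hK, hN, hKN⟩ := exists_bound_snd hφ.continuous hc
  obtain ⟨L, hL⟩ := hφ.lipschitzWith_of_hasCompactSupport hc one_ne_zero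
  have hint : ∀ s r, s ∈ Icc 0 T → Integrable fun x => rhoBar c z s x * φ (r, x) := fun s r hs =>
    h.integrable_rhoBar_mul hℓ hs (integrable_of_contDiff (contDiff_slice hφ r).continuous
      (hasCompactSupport_slice hc r)).1
  have d1 := h.hasDerivWithinAt_integral_rhoBar hℓ hT ht (contDiff_slice hφ t)
    (hasCompactSupport_slice hc t)
  -- The test function frozen at time `t` gives the fluxes. In the remainder the time differences
  -- fall on `φ` alone, whose quotients are bounded by a Lipschitz constant and supported in a fixed
  -- compact set.
  have d2 : HasDerivWithinAt (fun s => ∫ x, rhoBar c z s x * (φ (s, x) - φ (t, x)))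
      (∫ x, rhoBar c z t x * timePartial φ (t, x)) (Icc 0 T) t := by
    rw [hasDerivWithinAt_iff_tendsto_slope]
    have hs : slope (fun s => ∫ x, rhoBar c z s x * (φ (s, x) - φ (t, x))) t =
        fun s => ∫ x, rhoBar c z s x * ((s - t)⁻¹ * (φ (s, x) - φ (t, x))) := funext fun s => by
      simp only [slope, vsub_eq_sub, sub_self, mul_zero, integral_zero, sub_zero, smul_eq_mul]
      rw [← integral_const_mul]
      congr 1 with x; ring
    rw [hs]
    refine tendsto_integral_filter_of_dominated_convergence (K.indicator fun _ => (L : ℝ)) ?_ ?_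
      (integrable_indicator_const hK L) ?_
    · filter_upwards [self_mem_nhdsWithin] with s hs
      have := (contDiff_slice hφ s).continuous; have := (contDiff_slice hφ t).continuous
      exact (h.measurable_rhoBar hℓ hs.1).aestronglyMeasurable.mul
        (by fun_prop : Continuous fun x => (s - t)⁻¹ * (φ (s, x) - φ (t, x))).aestronglyMeasurable
    · filter_upwards [self_mem_nhdsWithin] with s hs
      refine Eventually.of_forall (norm_le_indicator (fun x => ?_) fun x hx => ?_)
      · have hst : 0 < |s - t| := abs_pos.2 (sub_ne_zero.2 hs.2)
        have hl := hL.dist_le_mul (s, x) (t, x)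
        rw [Prod.dist_eq, dist_self, max_eq_left dist_nonneg, Real.dist_eq, Real.dist_eq] at hl
        have hρ : |rhoBar c z s x| ≤ 1 := abs_le.2 (rhoBar_abs_le s x)
        rw [norm_mul, norm_mul, norm_inv, Real.norm_eq_abs, Real.norm_eq_abs, Real.norm_eq_abs]
        calc _ ≤ 1 * (|s - t|⁻¹ * (L * |s - t|)) := by gcongr
          _ = L := by field_simp
      · rw [hKN s x hx, hKN t x hx, sub_zero, mul_zero, mul_zero]
    · filter_upwards [h.ae_notMem ht] with x hx
      have c1 := (h.continuousWithinAt_rhoBar hℓ hT ht hx.1 hx.2).mono_left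
        (nhdsWithin_mono t (sdiff_subset (t := {t})))
      have c2 := (hasDerivAt_iff_tendsto_slope.1 (hasDerivAt_time hφ t x)).mono_left
        (nhdsWithin_mono t (fun s hs => hs.2 : Icc 0 T \ {t} ⊆ {t}ᶜ))
      exact c1.mul c2
  refine (d1.add d2).congr (fun s hs => ?_) ?_
  · rw [Pi.add_apply, ← integral_add (hint s t hs)]
    · congr 1 with x; ring
    · simp only [mul_sub]
      exact (hint s s hs).sub (hint s t hs)
  · simp

lemma Admissible.continuousOn_flux_slice (h : Admissible ℓ δ T c z) (hℓ : 0 < ℓ) (hT : 0 < T)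
    (a : ℝ) (hφ : Continuous φ) :
    ContinuousOn (fun s => flux ℓ (fun x => φ (s, x)) (zLam c z a s) (zVel T c z a s))
      (Icc 0 T) := by
  have hf := h.loopFamily hℓ a
  unfold flux
  refine continuousOn_integral hT.le (f := fun s β => φ (s, zLam c z a s β) *
    inner ℝ (zVel T c z a s β) (Complex.I * deriv (zLam c z a s) β)) ?_ _ _
  exact (hφ.comp_continuousOn (continuousOn_fst.prodMk hf.cont)).mul
    (hf.cont_vel.inner (𝕜 := ℝ) (continuousOn_const.mul hf.cont_deriv))

end Conservation

/-! ### From the boundary conditions to a subsolution -/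

section Sufficiency

variable {ℓ T : ℝ} {δ : ℝ≥0} {c : ℝ → ℝ} {z : ℝ → ℝ → ℂ} {γ : ℝ → ℂ → ℂ} {γb : ℝ → ℝ → ℝ → ℂ}

/-- The conservation law is the time integral of the derivative of the mass, in which the hypothesis
on the fluxes replaces the moving boundaries by the momentum. -/
lemma Admissible.conservation (h : Admissible ℓ δ T c z) (hℓ : 0 < ℓ) (hδ : 0 < δ) (hT : 0 < T)
    (hγ : GammaRegular T c z γ γb) (hb : ∀ t ∈ Icc 0 T, ∀ x ∈ OmegaMix c z t, ‖γ t x‖ ≤ 1 / 2)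
    (hflux : ∀ t ∈ Ioc 0 T, ∀ ψ : ℂ → ℝ, ContDiff ℝ 1 ψ → HasCompactSupport ψ →
      (∫ x, inner ℝ (mBar ℓ c z γ t x) (grad ψ x)) =
        flux ℓ ψ (zLam c z 1 t) (zVel T c z 1 t) +
          flux ℓ ψ (zLam c z (-1) t) (zVel T c z (-1) t))
    {φ : ℝ × ℂ → ℝ} (hφ : ContDiff ℝ 1 φ) (hc : HasCompactSupport φ) {t : ℝ} (ht : t ∈ Ioc 0 T) :
    (∫ s in (0 : ℝ)..t, ∫ x : ℂ, (rhoBar c z s x * deriv (fun r => φ (r, x)) s +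
      inner ℝ (mBar ℓ c z γ s x) (spaceGrad φ s x))) =
      (∫ x : ℂ, rhoBar c z t x * φ (t, x)) - ∫ x : ℂ, rhoInit (z 0) x * φ (0, x) := by
  obtain ⟨V, -, hV⟩ := h.exists_norm_vBar_le hℓ hδ hT
  set f : ℝ → ℝ := fun s => (flux ℓ (fun x => φ (s, x)) (zLam c z 1 s) (zVel T c z 1 s) +
    flux ℓ (fun x => φ (s, x)) (zLam c z (-1) s) (zVel T c z (-1) s)) +
    ∫ x, rhoBar c z s x * timePartial φ (s, x) with hf
  have hρt : ContinuousOn (fun s => ∫ x, rhoBar c z s x * timePartial φ (s, x)) (Icc 0 T) := by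
    have := continuousOn_integral_inner (T := T) (M := 1) (f := rhoBar c z) (g := timePartial φ)
      (fun t ht => (h.measurable_rhoBar hℓ ht).aestronglyMeasurable)
      (fun t _ => Eventually.of_forall fun x => abs_le.2 (rhoBar_abs_le t x))
      (fun t ht => (h.ae_notMem ht).mono fun x hx =>
        h.continuousWithinAt_rhoBar hℓ hT ht hx.1 hx.2)
      (continuous_timePartial hφ) (hasCompactSupport_timePartial hc)
    refine this.congr fun s _ => integral_congr_ae (Eventually.of_forall fun x => ?_)
    simp [mul_comm]
  have hfc : ContinuousOn f (Icc 0 T) :=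
    ((h.continuousOn_flux_slice hℓ hT 1 hφ.continuous).add
      (h.continuousOn_flux_slice hℓ hT (-1) hφ.continuous)).add hρt
  have hsub : Icc 0 t ⊆ Icc 0 T := Icc_subset_Icc le_rfl ht.2
  have hF : ∀ s ∈ Icc 0 T, HasDerivWithinAt (fun s => ∫ x, rhoBar c z s x * φ (s, x)) (f s)
      (Icc 0 T) s := fun s hs => h.hasDerivWithinAt_integral_rhoBar_mul hℓ hT hs hφ hc
  have hftc := intervalIntegral.integral_eq_sub_of_hasDerivAt_of_le ht.1.le
    (fun s hs => ((hF s (hsub hs)).mono hsub).continuousWithinAt)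
    (fun s hs => ((hF s (hsub (Ioo_subset_Icc_self hs))).mono hsub).hasDerivAt
      (Icc_mem_nhds hs.1 hs.2))
    ((hfc.mono hsub).intervalIntegrable_of_Icc ht.1.le)
  rw [rhoBar_zero] at hftc
  rw [← hftc]
  refine intervalIntegral.integral_congr_ae (Eventually.of_forall fun s hs => ?_)
  rw [uIoc_of_le ht.1.le] at hs
  have hs' : s ∈ Ioc 0 T := ⟨hs.1, hs.2.trans ht.2⟩
  have hsI := Ioc_subset_Icc_self hs'
  have hψ := contDiff_slice hφ s
  have hψc := hasCompactSupport_slice hc s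
  have i1 : Integrable fun x => rhoBar c z s x * deriv (fun r => φ (r, x)) s := by
    simp only [(hasDerivAt_time hφ s _).deriv]
    have hg := (continuous_timePartial hφ)
    refine h.integrable_rhoBar_mul hℓ hsI (integrable_of_contDiff (E := ℝ)
      (f := fun x => timePartial φ (s, x)) (by fun_prop) ?_).1
    exact hasCompactSupport_slice (hasCompactSupport_timePartial hc) s
  have i2 : Integrable fun x => inner ℝ (mBar ℓ c z γ s x) (spaceGrad φ s x) := by
    have hg := (integrable_of_contDiff (continuous_grad hψ) (hasCompactSupport_grad hψc)).1
    refine (hg.norm.const_mul (V + 1)).mono'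
      ((h.aestronglyMeasurable_mBar hℓ hT hγ hsI).inner hg.aestronglyMeasurable) ?_
    filter_upwards [h.norm_mBar_le hℓ hT hsI (hV s hsI) (hb s hsI)] with x hx
    exact (norm_inner_le_norm _ _).trans (mul_le_mul_of_nonneg_right hx (norm_nonneg _))
  rw [integral_add i1 i2]
  simp only [spaceGrad_eq_grad, (hasDerivAt_time hφ s _).deriv]
  rw [hflux s hs' _ hψ hψc, add_comm]

theorem Admissible.isSubsolution (h : Admissible ℓ δ T c z) (hℓ : 0 < ℓ) (hδ : 0 < δ) (hT : 0 < T)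
    (hγ : GammaRegular T c z γ γb)
    (h0 : ∀ t ∈ Icc 0 T, ∀ α, t * c α = 0 →
      inner ℝ (timeDeriv T z t α - B ℓ c z t α) (Complex.I * deriv (z t) α) = 0)
    (h1 : ∀ a ∈ ({1, -1} : Set ℝ), ∀ t ∈ Icc 0 T, ∀ α, 0 < t * c α →
      inner ℝ (timeDeriv T (zLam c z a) t α - Ba ℓ c z a t α -
        (a : ℂ) * (γb a t α + Complex.I / 2)) (Complex.I * deriv (zLam c z a t) α) = 0)
    (h2 : ∀ t ∈ Ioc 0 T, ∀ x ∈ OmegaMix c z t, divergence (γ t) x = 0 ∧ ‖γ t x‖ < 1 / 2) :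
    IsSubsolution T (rhoInit (z 0)) (rhoBar c z) (vBar ℓ c z) (mBar ℓ c z γ) (OmegaPlus c z)
      (OmegaMinus c z) (OmegaMix c z) := by
  obtain ⟨V, hV0, hV⟩ := h.exists_norm_vBar_le hℓ hδ hT
  have hb : ∀ t ∈ Icc 0 T, ∀ x ∈ OmegaMix c z t, ‖γ t x‖ ≤ 1 / 2 := fun t ht x hx => by
    rcases ht.1.eq_or_lt with rfl | h0
    · rw [omegaMix_zero] at hx; exact hx.elim
    · exact (h2 t ⟨h0, ht.2⟩ x hx).2.le
  have hIoc : ∀ t ∈ Ioc 0 T, t ∈ Icc 0 T := fun t ht => Ioc_subset_Icc_self ht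
  refine {
    weakStar_rho := weakStarContinuous_of_ae (M := 1)
      (fun t ht => (h.measurable_rhoBar hℓ ht).aestronglyMeasurable)
      (fun t _ => Eventually.of_forall fun x => abs_le.2 (rhoBar_abs_le t x))
      (fun t ht => (h.ae_notMem ht).mono fun x hx =>
        h.continuousWithinAt_rhoBar hℓ hT ht hx.1 hx.2)
    weakStar_v := weakStarContinuous_of_ae (fun t ht => h.aestronglyMeasurable_vBar hℓ ht) hV
      (fun t ht => (h.ae_notMem ht).mono fun x hx => h.continuousWithinAt_vBar hℓ ht hx.1 hx.2)
    weakStar_m := weakStarContinuous_of_ae (fun t ht => h.aestronglyMeasurable_mBar hℓ hT hγ ht)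
      (fun t ht => h.norm_mBar_le hℓ hT ht (hV t ht) (hb t ht))
      (fun t ht => (h.ae_notMem ht).mono fun x hx =>
        h.continuousWithinAt_mBar hℓ hT hγ ht hx.1 hx.2)
    rho_mem := fun t _ => Eventually.of_forall fun x => rhoBar_abs_le t x
    conservation := fun φ hφ hc t ht => h.conservation hℓ hδ hT hγ hb
      (fun s hs ψ hψ hψc => h.integral_mBar_eq_flux hℓ hδ hT hγ hs (hb s (hIoc s hs))
        (fun x hx => (h2 s hs x hx).1) (h0 s (hIoc s hs)) (fun a ha α hα => ?_) hψ hψc) hφ hc ht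
    incompressible := fun φ hφ hc t ht => ?_
    darcy := fun φ hφ hc t ht => ?_
    isOpen := fun t ht => h.isOpen_zones hℓ (hIoc t ht)
    disjoint := fun t ht => h.disjoint_zones hℓ hT (hIoc t ht)
    complementary := fun t ht => h.volume_compl_zones hℓ hT (hIoc t ht)
    plus := fun t ht x hx => ?_
    minus := fun t ht x hx => ?_
    hull := fun t ht x hx => ?_
    velocity_bdd := ?_ }
  · rw [← h.timeDeriv_zLam hℓ hT a (hIoc s hs)]
    exact h1 a ha s (hIoc s hs) α hα
  · refine (intervalIntegral.integral_congr_ae (g := fun _ => 0)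
      (Eventually.of_forall fun s hs => ?_)).trans intervalIntegral.integral_zero
    rw [uIoc_of_le ht.1.le] at hs
    exact h.integral_inner_vBar_grad hℓ ⟨hs.1.le, hs.2.trans ht.2⟩ (contDiff_slice hφ s)
      (hasCompactSupport_slice hc s)
  · refine (intervalIntegral.integral_congr_ae (g := fun _ => 0)
      (Eventually.of_forall fun s hs => ?_)).trans intervalIntegral.integral_zero
    rw [uIoc_of_le ht.1.le] at hs
    exact h.integral_darcy hℓ hT ⟨hs.1.le, hs.2.trans ht.2⟩ (contDiff_slice hφ s)
      (hasCompactSupport_slice hc s)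
  · have := h.rhoBar_plus hℓ hT (hIoc t ht) hx
    simp [mBar, this]
  · have := h.rhoBar_minus hℓ hT (hIoc t ht) hx
    simp [mBar, this]
  · have h3 := (h2 t ht x hx).2
    -- Here `ρ = 0`, so the constant `i/2` of the momentum is the centre of the hull, and the hull
    -- inequality is `|2γ| < 1`.
    have e : 2 * (mBar ℓ c z γ t x - (rhoBar c z t x : ℂ) * vBar ℓ c z t x) +
        ((1 - rhoBar c z t x ^ 2 : ℝ) : ℂ) * Complex.I = -(2 * γ t x) := by
      rw [mBar, h.rhoBar_mix hℓ hT (hIoc t ht) hx]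
      push_cast; ring
    rw [e, h.rhoBar_mix hℓ hT (hIoc t ht) hx, norm_neg, norm_mul, Complex.norm_ofNat]
    linarith
  · refine lt_of_le_of_lt (iSup₂_le fun t ht => ?_) (ENNReal.ofReal_lt_top (r := V))
    rw [eLpNorm_exponent_top]
    exact eLpNormEssSup_le_of_ae_bound (hV t ht)

end Sufficiency

/-! ### From a subsolution to the divergence condition and the integrated jump conditions -/

section Necessity

variable {ℓ T : ℝ} {δ : ℝ≥0} {c : ℝ → ℝ} {z : ℝ → ℝ → ℂ} {γ : ℝ → ℂ → ℂ} {γb : ℝ → ℝ → ℝ → ℂ}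

lemma IsSubsolution.norm_lt (h : Admissible ℓ δ T c z) (hℓ : 0 < ℓ) (hT : 0 < T)
    (hS : IsSubsolution T (rhoInit (z 0)) (rhoBar c z) (vBar ℓ c z) (mBar ℓ c z γ) (OmegaPlus c z)
      (OmegaMinus c z) (OmegaMix c z)) {t : ℝ} (ht : t ∈ Ioc 0 T) {x : ℂ}
    (hx : x ∈ OmegaMix c z t) : ‖γ t x‖ < 1 / 2 := by
  have h3 := hS.hull t ht x hx
  have e : 2 * (mBar ℓ c z γ t x - (rhoBar c z t x : ℂ) * vBar ℓ c z t x) +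
      ((1 - rhoBar c z t x ^ 2 : ℝ) : ℂ) * Complex.I = -(2 * γ t x) := by
    rw [mBar, h.rhoBar_mix hℓ hT (Ioc_subset_Icc_self ht) hx]
    push_cast; ring
  rw [e, h.rhoBar_mix hℓ hT (Ioc_subset_Icc_self ht) hx, norm_neg, norm_mul,
    Complex.norm_ofNat] at h3
  linarith

lemma IsSubsolution.norm_le (h : Admissible ℓ δ T c z) (hℓ : 0 < ℓ) (hT : 0 < T)
    (hS : IsSubsolution T (rhoInit (z 0)) (rhoBar c z) (vBar ℓ c z) (mBar ℓ c z γ) (OmegaPlus c z)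
      (OmegaMinus c z) (OmegaMix c z)) {t : ℝ} (ht : t ∈ Icc 0 T) :
    ∀ x ∈ OmegaMix c z t, ‖γ t x‖ ≤ 1 / 2 := fun x hx => by
  rcases ht.1.eq_or_lt with rfl | h0
  · rw [omegaMix_zero] at hx; exact hx.elim
  · exact (hS.norm_lt h hℓ hT ⟨h0, ht.2⟩ hx).le

/-- Conservation of mass, localized in time. -/
lemma IsSubsolution.integral_mBar_eq_flux (h : Admissible ℓ δ T c z) (hℓ : 0 < ℓ) (hT : 0 < T)
    (hS : IsSubsolution T (rhoInit (z 0)) (rhoBar c z) (vBar ℓ c z) (mBar ℓ c z γ) (OmegaPlus c z)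
      (OmegaMinus c z) (OmegaMix c z)) {t : ℝ} (ht : t ∈ Icc 0 T) {ψ : ℂ → ℝ}
    (hψ : ContDiff ℝ 1 ψ) (hc : HasCompactSupport ψ) :
    (∫ x, inner ℝ (mBar ℓ c z γ t x) (grad ψ x)) =
      flux ℓ ψ (zLam c z 1 t) (zVel T c z 1 t) +
        flux ℓ ψ (zLam c z (-1) t) (zVel T c z (-1) t) := by
  -- Test functions have compact support in time too. This factor is `1` on a neighbourhood of
  -- `[0,T]`, so it changes neither the values nor the time derivative there.
  set χ : ContDiffBump (T / 2) := ⟨T, 2 * T, hT, by linarith⟩ with hχ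
  have hχ1 : ∀ s ∈ Icc 0 T, χ =ᶠ[𝓝 s] fun _ => 1 := fun s hs => by
    filter_upwards [Metric.isOpen_ball.mem_nhds (show s ∈ Metric.ball (T / 2) T by
      rw [Metric.mem_ball, Real.dist_eq, abs_lt]; constructor <;> linarith [hs.1, hs.2])] with r hr
    exact χ.one_of_mem_closedBall (Metric.ball_subset_closedBall hr)
  set φ : ℝ × ℂ → ℝ := fun q => χ q.1 * ψ q.2 with hφd
  have hφ : ContDiff ℝ 1 φ := (χ.contDiff.comp contDiff_fst).mul (hψ.comp contDiff_snd)
  have hφc : HasCompactSupport φ := by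
    refine HasCompactSupport.intro (χ.hasCompactSupport.isCompact.prod hc.isCompact) fun q hq => ?_
    rw [mem_prod, not_and_or] at hq
    rcases hq with hq | hq
    · rw [hφd]; simp only [image_eq_zero_of_notMem_tsupport hq, zero_mul]
    · rw [hφd]; simp only [image_eq_zero_of_notMem_tsupport hq, mul_zero]
  -- Weak-star continuity of the momentum makes `G` continuous, so the integrated balance can be
  -- differentiated at every time, including the end points, and compared with the known derivative
  -- of the mass.
  set G : ℝ → ℝ := fun s => ∫ x, inner ℝ (mBar ℓ c z γ s x) (grad ψ x) with hG
  have hGc : ContinuousOn G (Icc 0 T) :=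
    hS.weakStar_m.2 _ (integrable_of_contDiff (continuous_grad hψ) (hasCompactSupport_grad hc)).1
  have hcons : ∀ s ∈ Icc 0 T, ∫ x, rhoBar c z s x * ψ x =
      (∫ x, rhoBar c z 0 x * ψ x) + ∫ r in (0 : ℝ)..s, G r := fun s hs => by
    rcases hs.1.eq_or_lt with rfl | h0
    · simp
    have := hS.conservation φ hφ hφc s ⟨h0, hs.2⟩
    rw [← rhoBar_zero] at this
    simp only [hφd, (hχ1 s hs).eq_of_nhds, (hχ1 0 (left_mem_Icc.2 hT.le)).eq_of_nhds, one_mul]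
      at this
    rw [← sub_eq_iff_eq_add', ← this]
    refine intervalIntegral.integral_congr_ae (Eventually.of_forall fun r hr => ?_)
    rw [uIoc_of_le h0.le] at hr
    have hr' := hχ1 r ⟨hr.1.le, hr.2.trans hs.2⟩
    refine integral_congr_ae (Eventually.of_forall fun x => ?_)
    have e1 : deriv (fun r => χ r * ψ x) r = 0 := by
      have : (fun r => χ r * ψ x) =ᶠ[𝓝 r] fun _ => ψ x := hr'.mono fun q hq => by simp [hq]
      rw [this.deriv_eq, deriv_const]
    have e2 : spaceGrad (fun q : ℝ × ℂ => χ q.1 * ψ q.2) r x = grad ψ x := by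
      rw [spaceGrad_eq_grad]
      simp only [hr'.eq_of_nhds, one_mul]
    simp only [e1, e2, mul_zero, zero_add]
  have d1 := h.hasDerivWithinAt_integral_rhoBar hℓ hT ht hψ hc
  have d2 : HasDerivWithinAt (fun s => ∫ x, rhoBar c z s x * ψ x) (G t) (Icc 0 T) t :=
    ((hasDerivWithinAt_primitive hT.le hGc ht).const_add _).congr hcons (hcons t ht)
  exact (uniqueDiffOn_Icc hT t ht).eq_deriv _ d2 d1

lemma contDiff_smul_of_tsupport_subset {Ω : Set ℂ} (hΩ : IsOpen Ω) {f : ℂ → ℂ}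
    (hf : ContDiffOn ℝ 1 f Ω) {ψ : ℂ → ℝ} (hψ : ContDiff ℝ 1 ψ) (hs : tsupport ψ ⊆ Ω) :
    ContDiff ℝ 1 fun x => ψ x • f x := by
  refine contDiff_iff_contDiffAt.2 fun x => ?_
  by_cases hx : x ∈ Ω
  · exact hψ.contDiffAt.smul (hf.contDiffAt (hΩ.mem_nhds hx))
  · have h0 : ψ =ᶠ[𝓝 x] 0 := notMem_tsupport_iff_eventuallyEq.1 fun h => hx (hs h)
    refine (contDiffAt_const (c := (0 : ℂ))).congr_of_eventuallyEq (h0.mono fun y hy => ?_)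
    simp [hy]

lemma grad_eq_zero {ψ : ℂ → ℝ} {x : ℂ} (h : ψ =ᶠ[𝓝 x] fun _ => 0) : grad ψ x = 0 := by
  simp [grad, h.fderiv_eq, Complex.ext_iff]

/-- The divergence of the compactly supported field `ψ f` has integral zero, so `div f` vanishes
against every such `ψ`, hence almost everywhere, and everywhere by continuity. -/
lemma divergence_eq_zero_of_integral {Ω : Set ℂ} (hΩ : IsOpen Ω) {f : ℂ → ℂ}
    (hf : ContDiffOn ℝ 1 f Ω)
    (hi : ∀ ψ : ℂ → ℝ, ContDiff ℝ 1 ψ → HasCompactSupport ψ → tsupport ψ ⊆ Ω →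
      ∫ x in Ω, inner ℝ (f x) (grad ψ x) = 0) : ∀ x ∈ Ω, divergence f x = 0 := by
  have hcont : ContinuousOn (divergence f) Ω := by
    have hd := hf.continuousOn_fderiv_of_isOpen hΩ le_rfl
    exact (Complex.continuous_re.comp_continuousOn (hd.clm_apply continuousOn_const)).add
      (Complex.continuous_im.comp_continuousOn (hd.clm_apply continuousOn_const))
  have hae : ∀ᵐ x ∂volume, x ∈ Ω → divergence f x = 0 := by
    refine hΩ.ae_eq_zero_of_integral_contDiff_smul_eq_zero
      (hcont.locallyIntegrableOn hΩ.measurableSet) fun ψ hψ hc hs => ?_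
    have hψ1 : ContDiff ℝ 1 ψ := hψ.of_le (by exact_mod_cast le_top)
    have hF := contDiff_smul_of_tsupport_subset hΩ hf hψ1 hs
    have hFc : HasCompactSupport fun x => ψ x • f x := hc.smul_right
    have hFd := integral_divergence_eq_zero hF hFc
    have hg0 : ∀ x ∉ tsupport ψ, grad ψ x = 0 := fun x hx =>
      grad_eq_zero (notMem_tsupport_iff_eventuallyEq.1 hx)
    have hψ0 : ∀ x ∉ tsupport ψ, ψ x = 0 := fun x hx => image_eq_zero_of_notMem_tsupport hx
    have hpt : ∀ x, divergence (fun x => ψ x • f x) x =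
        inner ℝ (f x) (grad ψ x) + ψ x • divergence f x := fun x => by
      by_cases hx : x ∈ Ω
      · exact divergence_smul (hψ1.differentiable one_ne_zero x)
          ((hf.contDiffAt (hΩ.mem_nhds hx)).differentiableAt one_ne_zero)
      · have h0 : (fun x => ψ x • f x) =ᶠ[𝓝 x] fun _ => 0 :=
          (notMem_tsupport_iff_eventuallyEq.1 fun h => hx (hs h)).mono fun y hy => by simp [hy]
        rw [divergence_congr h0, hg0 x fun h => hx (hs h), hψ0 x fun h => hx (hs h)]
        simp [divergence]
    have i1 : Integrable fun x => inner ℝ (f x) (grad ψ x) :=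
      (((hf.continuousOn.mono hs).inner (𝕜 := ℝ) (continuous_grad hψ1).continuousOn).integrableOn_compact
        hc).integrable_of_forall_notMem_eq_zero fun x hx => by rw [hg0 x hx, inner_zero_right]
    have i2 : Integrable fun x => ψ x • divergence f x :=
      ((hψ1.continuous.continuousOn.smul (hcont.mono hs)).integrableOn_compact
        hc).integrable_of_forall_notMem_eq_zero fun x hx => by
          rw [Pi.smul_apply', hψ0 x hx, zero_smul]
    simp only [hpt] at hFd
    rw [integral_add i1 i2, ← setIntegral_eq_integral_of_forall_compl_eq_zero (s := Ω)
      (fun x hx => by rw [hg0 x fun h => hx (hs h), inner_zero_right]), hi ψ hψ1 hc hs,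
      zero_add] at hFd
    exact hFd
  exact Measure.eqOn_open_of_ae_eq ((ae_restrict_iff' hΩ.measurableSet).2 hae) hΩ hcont
    continuousOn_const

/-- The balance of the normal velocities with the flux of `γ`. -/
lemma IsSubsolution.integral_mix_eq (h : Admissible ℓ δ T c z) (hℓ : 0 < ℓ) (hδ : 0 < δ)
    (hT : 0 < T) (hγ : GammaRegular T c z γ γb)
    (hS : IsSubsolution T (rhoInit (z 0)) (rhoBar c z) (vBar ℓ c z) (mBar ℓ c z γ) (OmegaPlus c z)
      (OmegaMinus c z) (OmegaMix c z)) {t : ℝ} (ht : t ∈ Icc 0 T) {ψ : ℂ → ℝ}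
    (hψ : ContDiff ℝ 1 ψ) (hc : HasCompactSupport ψ) :
    ∫ x in OmegaMix c z t, inner ℝ (γ t x) (grad ψ x) =
      flux ℓ ψ (zLam c z 1 t) (defect ℓ T c z 1 t) +
        flux ℓ ψ (zLam c z (-1) t) (defect ℓ T c z (-1) t) := by
  have := h.integral_mBar_sub hℓ hδ hT ht (hγ.continuousOn_slice ht) (hS.norm_le h hℓ hT ht) hψ hc
  rw [hS.integral_mBar_eq_flux h hℓ hT ht hψ hc, sub_self] at this
  linarith

lemma flux_eq_zero {ψ : ℂ → ℝ} {w v : ℝ → ℂ} (h0 : ∀ β, ψ (w β) = 0) : flux ℓ ψ w v = 0 := by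
  simp [flux, h0]

/-- A test function supported in the open mixing zone vanishes on both curves, so the fluxes drop
out of the balance. -/
lemma IsSubsolution.divergence_eq_zero (h : Admissible ℓ δ T c z) (hℓ : 0 < ℓ) (hδ : 0 < δ)
    (hT : 0 < T) (hγ : GammaRegular T c z γ γb)
    (hS : IsSubsolution T (rhoInit (z 0)) (rhoBar c z) (vBar ℓ c z) (mBar ℓ c z γ) (OmegaPlus c z)
      (OmegaMinus c z) (OmegaMix c z)) {t : ℝ} (ht : t ∈ Ioc 0 T) :
    ∀ x ∈ OmegaMix c z t, divergence (γ t) x = 0 := by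
  have ht' := Ioc_subset_Icc_self ht
  refine divergence_eq_zero_of_integral (h.isOpen_zones hℓ ht').2.2 (hγ.contDiffOn t ht)
    fun ψ hψ hc hs => ?_
  have h0 : ∀ x ∉ OmegaMix c z t, ψ x = 0 := fun x hx =>
    image_eq_zero_of_notMem_tsupport fun h => hx (hs h)
  rw [hS.integral_mix_eq h hℓ hδ hT hγ ht' hψ hc, flux_eq_zero, flux_eq_zero, add_zero]
  · exact fun β => h0 _ fun hm => (h.notMem_range_of_mem_mix hℓ ht' hm).2 ⟨β, rfl⟩
  · exact fun β => h0 _ fun hm => (h.notMem_range_of_mem_mix hℓ ht' hm).1 ⟨β, rfl⟩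

/-- The normal component of the jump condition on the curve `z_a`. -/
def normalJump (ℓ T : ℝ) (c : ℝ → ℝ) (z : ℝ → ℝ → ℂ) (γb : ℝ → ℝ → ℝ → ℂ) (a t α : ℝ) : ℝ :=
  inner ℝ (defect ℓ T c z a t α + {α | 0 < t * c α}.indicator (fun α => a • γb a t α) α)
    (Complex.I * deriv (zLam c z a t) α)

lemma zLam_mem_closure_mix {a t α : ℝ} (ha : a ∈ Icc (-1 : ℝ) 1) (hα : 0 < t * c α) :
    zLam c z a t α ∈ closure (OmegaMix c z t) := by
  have hcont : Continuous fun s => zLam c z s t α := by unfold zLam; fun_prop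
  refine map_mem_closure (f := fun s => zLam c z s t α) hcont (s := Ioo (-1) 1) ?_ fun s hs => ⟨α, s, hα, hs, rfl⟩
  rwa [closure_Ioo (by norm_num)]

lemma GammaRegular.norm_trace_le (hγ : GammaRegular T c z γ γb) {a : ℝ}
    (ha : a ∈ ({1, -1} : Set ℝ)) (ha' : a ∈ Icc (-1 : ℝ) 1) {t : ℝ} (ht : t ∈ Ioc 0 T)
    (hb : ∀ x ∈ OmegaMix c z t, ‖γ t x‖ ≤ 1 / 2) {α : ℝ} (hα : 0 < t * c α) :
    ‖γb a t α‖ ≤ 1 / 2 := by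
  have := mem_closure_iff_nhdsWithin_neBot.1 (zLam_mem_closure_mix (z := z) ha' hα)
  exact le_of_tendsto (hγ.tendsto a ha t ht α (pos_of_mul_pos_right hα ht.1.le)).norm
    (eventually_mem_nhdsWithin.mono hb)

/-- Periodicity of the trace is not assumed: the values at `α` and `α + ℓ` are limits of `γ` at the
same point of the plane, which lies in the closure of the mixing zone. -/
lemma GammaRegular.periodic_trace (hγ : GammaRegular T c z γ γb) (h : Admissible ℓ δ T c z) {a : ℝ}
    (ha : a ∈ ({1, -1} : Set ℝ)) (ha' : a ∈ Icc (-1 : ℝ) 1) {t : ℝ} (ht : t ∈ Ioc 0 T) {α : ℝ}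
    (hα : 0 < t * c α) : γb a t (α + ℓ) = γb a t α := by
  have := mem_closure_iff_nhdsWithin_neBot.1 (zLam_mem_closure_mix (z := z) ha' hα)
  have hcα := pos_of_mul_pos_right hα ht.1.le
  have h1 := hγ.tendsto a ha t ht α hcα
  have h2 := hγ.tendsto a ha t ht (α + ℓ) (by rwa [h.c_mem.1])
  rw [(h.isLoop_zLam a (Ioc_subset_Icc_self ht)).periodic] at h2
  exact tendsto_nhds_unique h2 h1

lemma Admissible.isOpen_pos (h : Admissible ℓ δ T c z) (t : ℝ) : IsOpen {α | 0 < t * c α} :=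
  isOpen_lt continuous_const (continuous_const.mul h.c_mem.2.1.continuous)

lemma Admissible.periodic_normalJump (h : Admissible ℓ δ T c z) (hℓ : 0 < ℓ) (hγ : GammaRegular T c z γ γb) {a : ℝ}
    (ha : a ∈ ({1, -1} : Set ℝ)) (ha' : a ∈ Icc (-1 : ℝ) 1) {t : ℝ} (ht : t ∈ Ioc 0 T) :
    Function.Periodic (normalJump ℓ T c z γb a t) ℓ := fun α => by
  have ht' := Ioc_subset_Icc_self ht
  have hl := h.isLoop_zLam a ht'
  have hind : {α | 0 < t * c α}.indicator (fun α => a • γb a t α) (α + ℓ) =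
      {α | 0 < t * c α}.indicator (fun α => a • γb a t α) α := by
    by_cases hα : 0 < t * c α
    · have hα' : 0 < t * c (α + ℓ) := by rwa [h.c_mem.1]
      rw [indicator_of_mem (show α ∈ {α | 0 < t * c α} from hα),
        indicator_of_mem (show α + ℓ ∈ {α | 0 < t * c α} from hα'),
        hγ.periodic_trace h ha ha' ht hα]
    · have hα' : ¬ 0 < t * c (α + ℓ) := by rwa [h.c_mem.1]
      rw [indicator_of_notMem (show α ∉ {α | 0 < t * c α} from hα),
        indicator_of_notMem (show α + ℓ ∉ {α | 0 < t * c α} from hα')]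
  simp only [normalJump, hind, defect, Ba, Bab, hl.periodic α, periodic_deriv hl.periodic α,
    ((h.loopFamily hℓ a).vel t ht').periodic α]

lemma Admissible.eventually_continuousAt_normalJump (h : Admissible ℓ δ T c z) (hℓ : 0 < ℓ)
    (hδ : 0 < δ) (hT : 0 < T) (hγ : GammaRegular T c z γ γb) {a : ℝ}
    (ha : a ∈ ({1, -1} : Set ℝ)) (ha' : a ∈ Icc (-1 : ℝ) 1) {t : ℝ} (ht : t ∈ Ioc 0 T) {α : ℝ}
    (hα : 0 < t * c α) : ∀ᶠ β in 𝓝 α, ContinuousAt (normalJump ℓ T c z γb a t) β := by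
  have ht' := Ioc_subset_Icc_self ht
  have hU := h.isOpen_pos t
  have hd := h.continuous_defect hℓ hδ hT ht' ha'
  have hl := (h.isLoop_zLam a ht').continuous_deriv
  have hγc : ContinuousOn (γb a t) {α | 0 < t * c α} := (hγ.continuousOn_trace a ha t ht).mono
    fun β hβ => pos_of_mul_pos_right hβ ht.1.le
  have hc : ContinuousOn (fun α => inner ℝ (defect ℓ T c z a t α + a • γb a t α)
      (Complex.I * deriv (zLam c z a t) α)) {α | 0 < t * c α} :=
    (hd.continuousOn.add (hγc.const_smul a)).inner (𝕜 := ℝ)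
      (continuous_const.mul hl).continuousOn
  filter_upwards [hU.mem_nhds hα] with β hβ
  refine (hc.continuousAt (hU.mem_nhds hβ)).congr ?_
  filter_upwards [hU.mem_nhds hβ] with x hx
  rw [normalJump, indicator_of_mem (show x ∈ {α | 0 < t * c α} from hx)]

/-- A test function that vanishes on the opposite curve isolates the contribution of one curve to
the balance. -/
lemma IsSubsolution.integral_normalJump (h : Admissible ℓ δ T c z) (hℓ : 0 < ℓ) (hδ : 0 < δ)
    (hT : 0 < T) (hγ : GammaRegular T c z γ γb)
    (hS : IsSubsolution T (rhoInit (z 0)) (rhoBar c z) (vBar ℓ c z) (mBar ℓ c z γ) (OmegaPlus c z)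
      (OmegaMinus c z) (OmegaMix c z)) {a : ℝ} (ha : a ∈ ({1, -1} : Set ℝ))
    (ha' : a ∈ Icc (-1 : ℝ) 1) {t : ℝ} (ht : t ∈ Ioc 0 T) {ψ : ℂ → ℝ} (hψ : ContDiff ℝ 1 ψ)
    (hc : HasCompactSupport ψ) (h0 : ∀ β, ψ (zLam c z (-a) t β) = 0) :
    ∫ α in (-(ℓ / 2))..(ℓ / 2), ψ (zLam c z a t α) * normalJump ℓ T c z γb a t α = 0 := by
  have ht' := Ioc_subset_Icc_self ht
  have hb := hS.norm_le h hℓ hT ht'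
  have E := hS.integral_mix_eq h hℓ hδ hT hγ ht' hψ hc
  rw [h.integral_mix_eq hℓ hγ ht hb (hS.divergence_eq_zero h hℓ hδ hT hγ ht) hψ hc] at E
  set F : ℝ → ℝ := {α | 0 < t * c α}.indicator fun α =>
    ψ (zLam c z a t α) * inner ℝ (a • γb a t α) (Complex.I * deriv (zLam c z a t) α) with hF
  have hU := h.isOpen_pos t
  have hl := h.isLoop_zLam a ht'
  have hlc := hl.continuous; have hld := hl.continuous_deriv; have hψc := hψ.continuous
  have hd := h.continuous_defect hℓ hδ hT ht' ha'
  -- The trace of `γ` on `z_a` enters the flux out of the strip with the sign `-a`, and `F` carries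
  -- the factor `a`.
  have key : flux ℓ ψ (zLam c z a t) (defect ℓ T c z a t) = -∫ α in (-(ℓ / 2))..(ℓ / 2), F α := by
    rw [← intervalIntegral.integral_neg]
    rcases ha with rfl | rfl
    · rw [flux_eq_zero (w := zLam c z (-1) t) h0, add_zero] at E
      rw [← E]
      refine intervalIntegral.integral_congr fun α _ => ?_
      by_cases hα : α ∈ {α | 0 < t * c α}
      · simp only [hF, indicator_of_mem hα, h0, real_inner_smul_left]; ring
      · simp only [hF, indicator_of_notMem hα, neg_zero]
    · rw [neg_neg] at h0
      rw [flux_eq_zero (w := zLam c z 1 t) h0, zero_add] at E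
      rw [← E]
      refine intervalIntegral.integral_congr fun α _ => ?_
      by_cases hα : α ∈ {α | 0 < t * c α}
      · simp only [hF, indicator_of_mem hα, h0, real_inner_smul_left]; ring
      · simp only [hF, indicator_of_notMem hα, neg_zero]
  obtain ⟨-, M, hM⟩ := integrable_of_contDiff hψc hc
  obtain ⟨D, hD⟩ := periodic_exists_bound (periodic_deriv hl.periodic) hℓ hld
  have hγc : ContinuousOn (γb a t) {α | 0 < t * c α} := (hγ.continuousOn_trace a ha t ht).mono
    fun β hβ => pos_of_mul_pos_right hβ ht.1.le
  have hFi : IntervalIntegrable F volume (-(ℓ / 2)) (ℓ / 2) := by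
    rw [intervalIntegrable_iff]
    have hM0 : 0 ≤ M := (norm_nonneg _).trans (hM 0)
    have hD0 : 0 ≤ D := (norm_nonneg _).trans (hD 0)
    refine IntegrableOn.of_bound (by simp) ?_ (M * (1 * (1 / 2) * D)) (Eventually.of_forall
      fun α => ?_)
    · have hco : ContinuousOn (fun α => ψ (zLam c z a t α) *
          inner ℝ (a • γb a t α) (Complex.I * deriv (zLam c z a t) α)) {α | 0 < t * c α} :=
        (hψc.comp hlc).continuousOn.mul ((hγc.const_smul a).inner (𝕜 := ℝ)
          (continuous_const.mul hld).continuousOn)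
      exact ((aestronglyMeasurable_indicator_iff hU.measurableSet).2
        (hco.aestronglyMeasurable hU.measurableSet)).restrict
    · by_cases hα : α ∈ {α | 0 < t * c α}
      · rw [hF, indicator_of_mem hα, norm_mul]
        refine mul_le_mul (hM _) ((norm_inner_le_norm _ _).trans ?_) (norm_nonneg _) hM0
        rw [norm_I_mul, norm_smul]
        have e1 := hγ.norm_trace_le ha ha' ht hb hα
        have e2 : ‖a‖ ≤ 1 := abs_le.2 ha'
        have e3 := hD α
        gcongr
      · rw [hF, indicator_of_notMem hα, norm_zero]; positivity
  have hG : IntervalIntegrable (fun α => ψ (zLam c z a t α) * inner ℝ (defect ℓ T c z a t α)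
      (Complex.I * deriv (zLam c z a t) α)) volume (-(ℓ / 2)) (ℓ / 2) :=
    (by fun_prop : Continuous _).intervalIntegrable _ _
  have : ∫ α in (-(ℓ / 2))..(ℓ / 2), ψ (zLam c z a t α) * normalJump ℓ T c z γb a t α =
      ∫ α in (-(ℓ / 2))..(ℓ / 2), (ψ (zLam c z a t α) * inner ℝ (defect ℓ T c z a t α)
      (Complex.I * deriv (zLam c z a t) α) + F α) := by
    refine intervalIntegral.integral_congr fun α _ => ?_
    simp only [normalJump, inner_add_left, mul_add, hF]
    congr 1
    by_cases hα : α ∈ {α | 0 < t * c α}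
    · simp only [indicator_of_mem hα]
    · simp only [indicator_of_notMem hα, inner_zero_left, mul_zero]
  rw [this, intervalIntegral.integral_add hG hFi]
  rw [flux] at key
  rw [key, neg_add_cancel]

end Necessity

/-! ### Test functions concentrated at a point of a curve -/

section Localization

variable {ℓ : ℝ} {w : ℝ → ℂ}

/-- Cut-off functions of discs, with gradients of the size of the inverse radius. -/
lemma exists_bump : ∃ M, 0 ≤ M ∧ ∀ (y : ℂ) (r : ℝ), 0 < r → ∃ ψ : ℂ → ℝ, ContDiff ℝ 1 ψ ∧
    HasCompactSupport ψ ∧ (∀ x, 0 ≤ ψ x) ∧ (∀ x, ‖x - y‖ ≤ r → ψ x = 1) ∧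
    (∀ x, 2 * r ≤ ‖x - y‖ → ψ x = 0) ∧
    ∀ x, ‖grad ψ x‖ ≤ M / r * (Metric.closedBall y (2 * r)).indicator 1 x := by
  set b : ContDiffBump (0 : ℂ) := ⟨1, 2, one_pos, one_lt_two⟩ with hb
  have hbd : ContDiff ℝ 1 b := b.contDiff
  obtain ⟨-, M, hM⟩ := integrable_of_contDiff (continuous_grad hbd)
    (hasCompactSupport_grad b.hasCompactSupport)
  refine ⟨M, (norm_nonneg _).trans (hM 0), fun y r hr => ?_⟩
  have hnorm : ∀ x, ‖r⁻¹ • (x - y)‖ = ‖x - y‖ / r := fun x => by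
    rw [norm_smul, norm_inv, Real.norm_of_nonneg hr.le, div_eq_inv_mul]
  have hA : ∀ x, HasFDerivAt (fun x : ℂ => r⁻¹ • (x - y)) (r⁻¹ • ContinuousLinearMap.id ℝ ℂ) x :=
    fun x => ((hasFDerivAt_id x).sub_const y).const_smul r⁻¹
  have h0 : ∀ x, 2 * r ≤ ‖x - y‖ → b (r⁻¹ • (x - y)) = 0 := fun x hx => by
    refine b.zero_of_le_dist ?_
    rw [dist_zero_right, hnorm, le_div_iff₀ hr]
    exact hx
  refine ⟨fun x => b (r⁻¹ • (x - y)), hbd.comp (by fun_prop), ?_, fun x => b.nonneg,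
    fun x hx => b.one_of_mem_closedBall ?_, h0, fun x => ?_⟩
  · refine HasCompactSupport.intro (isCompact_closedBall y (2 * r)) fun x hx => h0 x ?_
    rw [mem_closedBall_iff_norm, not_le] at hx
    exact hx.le
  · rw [mem_closedBall_zero_iff, hnorm]
    exact (div_le_one hr).2 hx
  · by_cases hx : x ∈ Metric.closedBall y (2 * r)
    · rw [indicator_of_mem hx, Pi.one_apply, mul_one]
      have hd := ((hbd.differentiable one_ne_zero _).hasFDerivAt.comp x (hA x)).fderiv
      have e : grad (fun x => b (r⁻¹ • (x - y))) x = r⁻¹ • grad b (r⁻¹ • (x - y)) := by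
        simp only [grad]
        rw [show fderiv ℝ (fun x => b (r⁻¹ • (x - y))) x = _ from hd]
        apply Complex.ext <;> simp
      rw [e, norm_smul, norm_inv, Real.norm_of_nonneg hr.le, div_eq_inv_mul]
      exact mul_le_mul_of_nonneg_left (hM _) (inv_nonneg.2 hr.le)
    · rw [indicator_of_notMem hx, mul_zero, norm_le_zero_iff]
      rw [mem_closedBall_iff_norm, not_le] at hx
      refine grad_eq_zero ?_
      filter_upwards [(isOpen_lt continuous_const (by fun_prop : Continuous fun x : ℂ =>
        ‖x - y‖)).mem_nhds hx] with x' hx' using h0 x' (le_of_lt hx')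

lemma intervalIntegral_centered {E : Type*} [NormedAddCommGroup E] [NormedSpace ℝ E] {f : ℝ → E}
    (hf : Function.Periodic f ℓ) (α : ℝ) :
    ∫ β in (-(ℓ / 2))..(ℓ / 2), f β = ∫ β in (α - ℓ / 2)..(α + ℓ / 2), f β := by
  have := hf.intervalIntegral_add_eq (-(ℓ / 2)) (α - ℓ / 2)
  rwa [show -(ℓ / 2) + ℓ = ℓ / 2 by ring, show α - ℓ / 2 + ℓ = α + ℓ / 2 by ring] at this

lemma abs_sub_le_of_chord {C α : ℝ}
    (hch : ∀ β ∈ Icc (-(ℓ / 2)) (ℓ / 2), |β| ≤ C * ‖w α - w (α - β)‖) {β : ℝ}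
    (hβ : β ∈ Ioc (α - ℓ / 2) (α + ℓ / 2)) : |β - α| ≤ C * ‖w β - w α‖ := by
  have := hch (α - β) ⟨by linarith [hβ.2], by linarith [hβ.1]⟩
  rwa [sub_sub_cancel, abs_sub_comm, norm_sub_rev] at this

/-- A lower bound for integrals along a curve localized near a point of the curve. -/
lemma exists_le_integral_bump (hw : IsLoop ℓ w) (hℓ : 0 < ℓ) {C α : ℝ} (hC : 0 < C)
    (hch : ∀ β ∈ Icc (-(ℓ / 2)) (ℓ / 2), |β| ≤ C * ‖w α - w (α - β)‖) {g : ℝ → ℝ}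
    (hgp : Function.Periodic g ℓ) (hg : ∀ᶠ β in 𝓝 α, ContinuousAt g β) (hpos : 0 < g α) :
    ∃ k, 0 < k ∧ ∀ᶠ r in 𝓝[>] 0, ∀ ψ : ℂ → ℝ, Continuous ψ → (∀ x, 0 ≤ ψ x) →
      (∀ x, ‖x - w α‖ ≤ r → ψ x = 1) → (∀ x, 2 * r ≤ ‖x - w α‖ → ψ x = 0) →
      k * r ≤ ∫ β in (-(ℓ / 2))..(ℓ / 2), ψ (w β) * g β := by
  obtain ⟨D, hD⟩ := periodic_exists_bound (periodic_deriv hw.periodic) hℓ hw.continuous_deriv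
  have hD0 : 0 ≤ D := (norm_nonneg _).trans (hD 0)
  have hlip : ∀ β, ‖w β - w α‖ ≤ (D + 1) * |β - α| := fun β =>
    (convex_univ.norm_image_sub_le_of_norm_hasDerivWithin_le
      (fun x _ => (hw.hasDerivAt x).hasDerivWithinAt) (fun x _ => (hD x).trans (by linarith))
      (mem_univ α) (mem_univ β))
  have hev : ∀ᶠ β in 𝓝 α, ContinuousAt g β ∧ g α / 2 < g β :=
    hg.and (hg.self_of_nhds.eventually (lt_mem_nhds (half_lt_self hpos)))
  obtain ⟨η', hη', hball⟩ := Metric.eventually_nhds_iff.1 hev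
  set η := min (η' / 2) (ℓ / 2) with hη
  have hη0 : 0 < η := lt_min (by linarith) (by linarith)
  have hnear : ∀ β ∈ Icc (α - η) (α + η), ContinuousAt g β ∧ g α / 2 < g β := fun β hβ => by
    refine hball ?_
    rw [Real.dist_eq]
    have h1 : |β - α| ≤ η := abs_le.2 ⟨by linarith [hβ.1], by linarith [hβ.2]⟩
    have h2 : η ≤ η' / 2 := min_le_left _ _
    linarith
  -- `D + 1` is a positive Lipschitz constant of the curve. For parameters within `r / (D + 1)` of
  -- `α` the cutoff is `1` and `g` exceeds `g α / 2`, and this interval has length `2 r / (D + 1)`.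
  refine ⟨g α / (D + 1), by positivity, ?_⟩
  -- By the chord-arc condition the first bound keeps the rest of the period outside the disc of
  -- radius `2 r`; the second makes the shorter interval fit into the window where `g` is positive.
  have hsmall : ∀ᶠ r : ℝ in 𝓝[>] 0, r < η / (2 * C) ∧ r < η * (D + 1) ∧ 0 < r := by
    have h1 : 0 < η / (2 * C) := by positivity
    have h2 : 0 < η * (D + 1) := by positivity
    filter_upwards [Ioo_mem_nhdsGT h1, Ioo_mem_nhdsGT h2] with r hr hr' using ⟨hr.2, hr'.2, hr.1⟩
  filter_upwards [hsmall] with r hr ψ hψ hψ0 hψ1 hψ2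
  obtain ⟨hr1, hr2, hr0⟩ := hr
  set f : ℝ → ℝ := fun β => ψ (w β) * g β with hf
  have hfp : Function.Periodic f ℓ := fun β => by simp only [hf, hw.periodic β, hgp β]
  rw [intervalIntegral_centered hfp α, intervalIntegral.integral_of_le (by linarith)]
  have hηℓ : η ≤ ℓ / 2 := min_le_right _ _
  have hsub : Ioc (α - η) (α + η) ⊆ Ioc (α - ℓ / 2) (α + ℓ / 2) :=
    Ioc_subset_Ioc (by linarith) (by linarith)
  rw [setIntegral_eq_of_subset_of_forall_sdiff_eq_zero measurableSet_Ioc hsub fun β hβ => ?_]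
  · have hfc : ContinuousOn f (Icc (α - η) (α + η)) :=
      (hψ.comp hw.continuous).continuousOn.mul fun β hβ => (hnear β hβ).1.continuousWithinAt
    have hfi : IntegrableOn f (Ioc (α - η) (α + η)) :=
      (hfc.integrableOn_compact isCompact_Icc).mono_set Ioc_subset_Icc_self
    set d := r / (D + 1) with hd
    have hdη : d ≤ η := by rw [hd, div_le_iff₀ (by positivity)]; exact hr2.le
    have hd0 : 0 < d := by positivity
    have hsub2 : Ioc (α - d) (α + d) ⊆ Ioc (α - η) (α + η) :=
      Ioc_subset_Ioc (by linarith) (by linarith)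
    have h1 : ∫ β in Ioc (α - d) (α + d), f β ≤ ∫ β in Ioc (α - η) (α + η), f β := by
      refine setIntegral_mono_set hfi ?_ hsub2.eventuallyLE
      refine (ae_restrict_iff' measurableSet_Ioc).2 (Eventually.of_forall fun β hβ => ?_)
      exact mul_nonneg (hψ0 _) (by linarith [(hnear β (Ioc_subset_Icc_self hβ)).2])
    have h2 : ∫ β in Ioc (α - d) (α + d), g α / 2 ≤ ∫ β in Ioc (α - d) (α + d), f β := by
      refine setIntegral_mono_on (integrableOn_const (by simp)) (hfi.mono_set hsub2)
        measurableSet_Ioc fun β hβ => ?_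
      have e1 : |β - α| ≤ d := abs_le.2 ⟨by linarith [hβ.1], by linarith [hβ.2]⟩
      have e2 : ‖w β - w α‖ ≤ r := (hlip β).trans (by
        calc (D + 1) * |β - α| ≤ (D + 1) * d := by gcongr
          _ = r := by rw [hd]; field_simp)
      rw [hf]
      simp only [hψ1 _ e2, one_mul]
      exact (hnear β (Ioc_subset_Icc_self (hsub2 hβ))).2.le
    refine le_trans (le_of_eq ?_) (h2.trans h1)
    rw [setIntegral_const, measureReal_def, Real.volume_Ioc, ENNReal.toReal_ofReal (by linarith),
      smul_eq_mul, hd]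
    field_simp
    ring
  · have h1 := abs_sub_le_of_chord hch hβ.1
    have h2 : η ≤ |β - α| := by
      by_contra hlt
      obtain ⟨h3, h4⟩ := abs_lt.1 (not_le.1 hlt)
      exact hβ.2 ⟨by linarith, by linarith⟩
    have h3 : 2 * r ≤ ‖w β - w α‖ := by
      rw [lt_div_iff₀ (by positivity)] at hr1
      have : C * (2 * r) ≤ C * ‖w β - w α‖ := by linarith
      exact le_of_mul_le_mul_left this hC
    show ψ (w β) * g β = 0
    rw [hψ2 _ h3, zero_mul]

/-- An upper bound for the length of a curve in a disc centred on the curve. -/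
lemma integral_indicator_closedBall_le (hw : IsLoop ℓ w) (hℓ : 0 < ℓ) {C α r : ℝ} (hC : 0 < C)
    (hr : 0 ≤ r) (hch : ∀ β ∈ Icc (-(ℓ / 2)) (ℓ / 2), |β| ≤ C * ‖w α - w (α - β)‖) :
    ∫ β in (-(ℓ / 2))..(ℓ / 2), (Metric.closedBall (w α) r).indicator (1 : ℂ → ℝ) (w β) ≤
      2 * (C * r) := by
  have hp : Function.Periodic (fun β => (Metric.closedBall (w α) r).indicator (1 : ℂ → ℝ) (w β)) ℓ :=
    fun β => by simp only [hw.periodic β]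
  have hCr : 0 ≤ C * r := by positivity
  rw [intervalIntegral_centered hp α, intervalIntegral.integral_of_le (by linarith)]
  have h1 : ∫ β in Ioc (α - ℓ / 2) (α + ℓ / 2),
      (Metric.closedBall (w α) r).indicator (1 : ℂ → ℝ) (w β) ≤
      ∫ β in Ioc (α - ℓ / 2) (α + ℓ / 2), (Icc (α - C * r) (α + C * r)).indicator 1 β := by
    refine integral_mono_of_nonneg (Eventually.of_forall fun β =>
      indicator_nonneg (fun _ _ => zero_le_one) _) ?_ ?_
    · exact ((integrable_indicator_iff measurableSet_Icc).2
        (integrableOn_const (by simp))).integrableOn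
    · refine (ae_restrict_iff' measurableSet_Ioc).2 (Eventually.of_forall fun β hβ => ?_)
      by_cases hb : w β ∈ Metric.closedBall (w α) r
      · have h2 := abs_sub_le_of_chord hch hβ
        rw [mem_closedBall_iff_norm] at hb
        obtain ⟨h3, h4⟩ := abs_le.1 (h2.trans (mul_le_mul_of_nonneg_left hb hC.le))
        have : β ∈ Icc (α - C * r) (α + C * r) := ⟨by linarith, by linarith⟩
        simp only [indicator_of_mem this]
        exact indicator_le_self' (fun _ _ => zero_le_one) _
      · simp only [indicator_of_notMem hb]
        exact indicator_nonneg (fun _ _ => zero_le_one) _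
  have h2 : ∫ β in Ioc (α - ℓ / 2) (α + ℓ / 2), (Icc (α - C * r) (α + C * r)).indicator
      (1 : ℝ → ℝ) β ≤ ∫ β, (Icc (α - C * r) (α + C * r)).indicator (1 : ℝ → ℝ) β :=
    setIntegral_le_integral ((integrable_indicator_iff measurableSet_Icc).2
        (integrableOn_const (by simp)))
      (Eventually.of_forall fun β => indicator_nonneg (fun _ _ => zero_le_one) _)
  refine (h1.trans h2).trans (le_of_eq ?_)
  rw [integral_indicator_one measurableSet_Icc, measureReal_def, Real.volume_Icc,
    ENNReal.toReal_ofReal (by linarith)]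
  ring

end Localization

/-! ### Pointwise boundary conditions of a subsolution -/

section BoundaryConditions

variable {ℓ T : ℝ} {δ : ℝ≥0} {c : ℝ → ℝ} {z : ℝ → ℝ → ℂ} {γ : ℝ → ℂ → ℂ} {γb : ℝ → ℝ → ℝ → ℂ}

/-- The mixing zone is thin near the points where it closes. -/
lemma Admissible.exists_area_mix_le (h : Admissible ℓ δ T c z) (hℓ : 0 < ℓ) (hδ : 0 < δ)
    (hT : 0 < T) {t : ℝ} (ht : t ∈ Icc 0 T) {α : ℝ} (hα : c α = 0) {ε : ℝ} (hε : 0 < ε) :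
    ∃ r₀, 0 < r₀ ∧ ∀ r, 0 < r → r < r₀ → ∫ x in OmegaMix c z t,
      (Metric.closedBall (z t α) r).indicator (1 : ℂ → ℝ) x ≤ ε * r ^ 2 := by
  obtain ⟨C, κ, hC, -, -, hp⟩ := h.exists_closePair hℓ hδ hT
  have htc : t * c α = 0 := by rw [hα, mul_zero]
  have hz : ∀ a, zLam c z a t α = z t α := fun a => zLam_eq_of_mul_eq_zero htc
  have h0m : (0 : ℝ) ∈ Icc (-1 : ℝ) 1 := by norm_num
  -- The area will be bounded by `K = 2 t ε' C² r`, for the Jacobian, times the length `2 C³ r` of a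
  -- parameter interval, that is by `4 t C⁵ ε' r²`.
  set ε' := ε / (4 * t * C ^ 5 + 1) with hε'
  have ht0 := ht.1
  have hε'0 : 0 < ε' := by positivity
  -- The zero of `c` is a minimum, so `c` vanishes to first order: `c(β) ≤ ε' |β - α|` near `α`.
  have hmin : IsLocalMin c α := Eventually.of_forall fun β => by rw [hα]; exact h.c_nonneg β
  have hder := (h.c_mem.2.1.differentiable one_ne_zero α).hasDerivAt
  rw [hmin.deriv_eq_zero, hasDerivAt_iff_isLittleO] at hder
  obtain ⟨η, hη, hsmall⟩ := Metric.eventually_nhds_iff.1 (hder.def hε'0)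
  simp only [hα, smul_zero, sub_zero, Real.norm_eq_abs, Real.dist_eq] at hsmall
  have hnear : ∀ β, ∀ a ∈ Icc (-1 : ℝ) 1, ∃ ξ, |ξ| ≤ C * ‖zLam c z a t β - z t α‖ ∧
      c β = c (α - ξ) ∧ zLam c z 0 t β = zLam c z 0 t (α - ξ) := fun β a ha => by
    obtain ⟨k, hk⟩ := exists_int_mem_Ioc hℓ (α - β)
    have e : α - (α - β + k * ℓ) = β + (-k : ℤ) * ℓ := by push_cast; ring
    refine ⟨α - β + k * ℓ, ?_, ?_, ?_⟩
    · have := ((hp t ht a ha).2 a ha).chord α _ (Ioc_subset_Icc_self hk)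
      rwa [e, periodic_int_mul (h.isLoop_zLam a ht).periodic, hz a, norm_sub_rev] at this
    · rw [e, periodic_int_mul h.c_mem.1]
    · rw [e, periodic_int_mul (h.isLoop_zLam 0 ht).periodic]
  have hlip : ∀ ξ, ‖zLam c z 0 t (α - ξ) - z t α‖ ≤ C * |ξ| := fun ξ => by
    have := convex_univ.norm_image_sub_le_of_norm_hasDerivWithin_le
      (fun x _ => ((h.isLoop_zLam 0 ht).hasDerivAt x).hasDerivWithinAt)
      (fun x _ => (hp t ht 0 h0m).1 x) (mem_univ α) (mem_univ (α - ξ))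
    rwa [hz, sub_sub_cancel_left, norm_neg] at this
  refine ⟨η / C, by positivity, fun r hr hr' => ?_⟩
  rw [lt_div_iff₀ hC] at hr'
  set K := 2 * t * (ε' * (C * r)) * C with hK
  have hK0 : 0 ≤ K := by positivity
  -- If some `z_λ(β)` is in the disc of radius `r`, then up to the period `β` is within `C r` of
  -- `α`, so `z_0(β)` is in the disc of radius `C² r`. This majorant no longer depends on `s`, and
  -- the area reduces to a length on the single curve `z_0`. The trailing factor `1` gives the
  -- product form required by `setIntegral_prod_mul`.
  have hpt : ∀ β, ∀ s ∈ Ioo (0 : ℝ) 1,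
      stripJac (zLam c z (-1) t) (fun α => (-2 * t) • mixDir c z α) β s •
        (Metric.closedBall (z t α) r).indicator (1 : ℂ → ℝ)
          (strip (zLam c z (-1) t) (fun α => (-2 * t) • mixDir c z α) s β) ≤
      K * (Metric.closedBall (z t α) (C * (C * r))).indicator (1 : ℂ → ℝ) (zLam c z 0 t β) *
        1 := fun β s hs => by
    rw [strip_zLam, h.stripJac_eq ht]
    have ha : 2 * s - 1 ∈ Icc (-1 : ℝ) 1 := ⟨by linarith [hs.1], by linarith [hs.2]⟩
    by_cases hb : zLam c z (2 * s - 1) t β ∈ Metric.closedBall (z t α) r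
    · obtain ⟨ξ, h1, h2, h3⟩ := hnear β _ ha
      rw [mem_closedBall_iff_norm] at hb
      have h4 : |ξ| ≤ C * r := h1.trans (mul_le_mul_of_nonneg_left hb hC.le)
      have h5 : c β ≤ ε' * (C * r) := by
        have := hsmall (y := α - ξ) (by
          rw [sub_sub_cancel_left, abs_neg]; linarith)
        rw [sub_sub_cancel_left, abs_neg] at this
        rw [h2]
        exact (le_abs_self _).trans (this.trans (mul_le_mul_of_nonneg_left h4 hε'0.le))
      have h6 : zLam c z 0 t β ∈ Metric.closedBall (z t α) (C * (C * r)) := by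
        rw [mem_closedBall_iff_norm, h3]
        exact (hlip ξ).trans (mul_le_mul_of_nonneg_left h4 hC.le)
      rw [indicator_of_mem (mem_closedBall_iff_norm.2 hb), indicator_of_mem h6]
      simp only [Pi.one_apply, smul_eq_mul, mul_one]
      have h7 : inner ℝ (deriv (zLam c z (2 * s - 1) t) β) (deriv (z 0) β) ≤ C := by
        refine (real_inner_le_norm _ _).trans ?_
        rw [h.z_init_arclength, mul_one]
        exact (hp t ht _ ha).1 β
      have h8 := (h.inner_deriv_pos ht ha β).le
      have h9 := h.c_nonneg β
      calc _ ≤ 2 * (t * (ε' * (C * r))) * C := by gcongr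
        _ = K := by rw [hK]; ring
    · rw [indicator_of_notMem hb, smul_zero, mul_one]
      exact mul_nonneg hK0 (indicator_nonneg (fun _ _ => zero_le_one) _)
  have hl0 := h.isLoop_zLam 0 ht
  have hmeas : Measurable fun β => (Metric.closedBall (z t α) (C * (C * r))).indicator (1 : ℂ → ℝ)
      (zLam c z 0 t β) :=
    (measurable_one.indicator Metric.isClosed_closedBall.measurableSet).comp
      hl0.continuous.measurable
  rw [← stripRegion_eq_omegaMix h ht.1, (h.isStrip hℓ ht).setIntegral_stripRegion hℓ]
  have hfin : volume (Ioc (-(ℓ / 2)) (ℓ / 2) ×ˢ Ioo (0 : ℝ) 1) ≠ ⊤ := by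
    rw [Measure.volume_eq_prod, Measure.prod_prod]
    exact ENNReal.mul_ne_top (by simp) (by simp)
  have hRm : MeasurableSet (Ioc (-(ℓ / 2)) (ℓ / 2) ×ˢ Ioo (0 : ℝ) 1) :=
    measurableSet_Ioc.prod measurableSet_Ioo
  have h1 : ∫ q in Ioc (-(ℓ / 2)) (ℓ / 2) ×ˢ Ioo (0 : ℝ) 1,
      stripJac (zLam c z (-1) t) (fun α => (-2 * t) • mixDir c z α) q.1 q.2 •
        (Metric.closedBall (z t α) r).indicator (1 : ℂ → ℝ)
          (strip (zLam c z (-1) t) (fun α => (-2 * t) • mixDir c z α) q.2 q.1) ≤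
      ∫ q in Ioc (-(ℓ / 2)) (ℓ / 2) ×ˢ Ioo (0 : ℝ) 1, K *
        (Metric.closedBall (z t α) (C * (C * r))).indicator (1 : ℂ → ℝ) (zLam c z 0 t q.1) * 1 := by
    refine integral_mono_of_nonneg ?_ ?_ ((ae_restrict_iff' hRm).2 (Eventually.of_forall
      fun q hq => hpt q.1 q.2 hq.2))
    · refine (ae_restrict_iff' hRm).2 (Eventually.of_forall fun q hq => ?_)
      have ha : 2 * q.2 - 1 ∈ Icc (-1 : ℝ) 1 := ⟨by linarith [hq.2.1], by linarith [hq.2.2]⟩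
      show (0 : ℝ) ≤ stripJac _ _ q.1 q.2 * _
      rw [h.stripJac_eq ht]
      exact mul_nonneg (mul_nonneg (mul_nonneg zero_le_two (mul_nonneg ht0 (h.c_nonneg _)))
        (h.inner_deriv_pos ht ha _).le) (indicator_nonneg (fun _ _ => zero_le_one) _)
    · refine IntegrableOn.of_bound hfin.lt_top (((hmeas.comp measurable_fst).const_mul
        K).mul_const 1).aestronglyMeasurable K (Eventually.of_forall fun q => ?_)
      rw [mul_one, norm_mul, Real.norm_of_nonneg hK0]
      refine mul_le_of_le_one_right hK0 ?_
      have h2 : 0 ≤ (Metric.closedBall (z t α) (C * (C * r))).indicator (1 : ℂ → ℝ)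
        (zLam c z 0 t q.1) := indicator_nonneg (fun _ _ => zero_le_one) _
      rw [Real.norm_of_nonneg h2]
      exact indicator_le_self' (fun _ _ => zero_le_one) _
  refine h1.trans ?_
  rw [Measure.volume_eq_prod, setIntegral_prod_mul (fun β => K *
    (Metric.closedBall (z t α) (C * (C * r))).indicator (1 : ℂ → ℝ) (zLam c z 0 t β)) fun _ => 1]
  have h2 := integral_indicator_closedBall_le hl0 hℓ (α := α) hC
    (by positivity : 0 ≤ C * (C * r)) (((hp t ht 0 h0m).2 0 h0m).chord α)
  rw [hz, intervalIntegral.integral_of_le (by linarith)] at h2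
  rw [integral_const_mul, setIntegral_const]
  simp only [measureReal_def, Real.volume_Ioo, sub_zero, ENNReal.ofReal_one, ENNReal.toReal_one,
    smul_eq_mul, mul_one]
  refine (mul_le_mul_of_nonneg_left h2 hK0).trans ?_
  have e : K * (2 * (C * (C * (C * r)))) = 4 * t * C ^ 5 * ε' * r ^ 2 := by rw [hK]; ring
  rw [e]
  refine mul_le_mul_of_nonneg_right ?_ (sq_nonneg r)
  have h3 : ε' * (4 * t * C ^ 5 + 1) = ε := by rw [hε']; field_simp
  linarith

lemma Admissible.periodic_vel_sub (h : Admissible ℓ δ T c z) (hℓ : 0 < ℓ) (a : ℝ) {t : ℝ}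
    (ht : t ∈ Icc 0 T) : Function.Periodic (fun α => inner ℝ (zVel T c z a t α - Ba ℓ c z a t α)
      (Complex.I * deriv (zLam c z a t) α)) ℓ := fun α => by
  have hl := h.isLoop_zLam a ht
  simp only [Ba, Bab, hl.periodic α, periodic_deriv hl.periodic α,
    ((h.loopFamily hℓ a).vel t ht).periodic α]

lemma Admissible.continuous_vel_sub (h : Admissible ℓ δ T c z) (hℓ : 0 < ℓ) (hδ : 0 < δ)
    (hT : 0 < T) {a : ℝ} (ha : a ∈ Icc (-1 : ℝ) 1) {t : ℝ} (ht : t ∈ Icc 0 T) :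
    Continuous fun α => inner ℝ (zVel T c z a t α - Ba ℓ c z a t α)
      (Complex.I * deriv (zLam c z a t) α) :=
  ((h.continuous_zVel hℓ ht a).sub (h.continuous_Ba hℓ hδ hT ht ha)).inner
    (continuous_const.mul (h.isLoop_zLam a ht).continuous_deriv)

/-- The momentum balance in terms of the normal velocities. -/
lemma IsSubsolution.flux_vel_sub (h : Admissible ℓ δ T c z) (hℓ : 0 < ℓ) (hδ : 0 < δ)
    (hT : 0 < T) (hγ : GammaRegular T c z γ γb)
    (hS : IsSubsolution T (rhoInit (z 0)) (rhoBar c z) (vBar ℓ c z) (mBar ℓ c z γ) (OmegaPlus c z)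
      (OmegaMinus c z) (OmegaMix c z)) {t : ℝ} (ht : t ∈ Icc 0 T) {ψ : ℂ → ℝ}
    (hψ : ContDiff ℝ 1 ψ) (hc : HasCompactSupport ψ) :
    flux ℓ ψ (zLam c z 1 t) (fun α => zVel T c z 1 t α - Ba ℓ c z 1 t α) +
      flux ℓ ψ (zLam c z (-1) t) (fun α => zVel T c z (-1) t α - Ba ℓ c z (-1) t α) =
      -∫ x in OmegaMix c z t, inner ℝ (γ t x + Complex.I / 2) (grad ψ x) := by
  have e1 := h.integral_mBar_grad hℓ hδ hT ht (hγ.continuousOn_slice ht) (hS.norm_le h hℓ hT ht)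
    hψ hc
  rw [hS.integral_mBar_eq_flux h hℓ hT ht hψ hc] at e1
  rw [flux_sub ψ hψ.continuous (h.isLoop_zLam 1 ht) (h.continuous_zVel hℓ ht 1)
    (h.continuous_Ba hℓ hδ hT ht one_mem_Icc),
    flux_sub ψ hψ.continuous (h.isLoop_zLam (-1) ht) (h.continuous_zVel hℓ ht (-1))
    (h.continuous_Ba hℓ hδ hT ht neg_one_mem_Icc)]
  linarith

lemma mul_flux (k : ℝ) (ψ : ℂ → ℝ) (w v : ℝ → ℂ) : k * flux ℓ ψ w v =
    ∫ β in (-(ℓ / 2))..(ℓ / 2), ψ (w β) * (k * inner ℝ (v β) (Complex.I * deriv w β)) := by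
  rw [flux, ← intervalIntegral.integral_const_mul]
  refine intervalIntegral.integral_congr fun β _ => ?_
  ring

/-- The boundary condition at the initial time. -/
lemma IsSubsolution.normal_velocity_init (h : Admissible ℓ δ T c z) (hℓ : 0 < ℓ) (hδ : 0 < δ)
    (hT : 0 < T) (hγ : GammaRegular T c z γ γb)
    (hS : IsSubsolution T (rhoInit (z 0)) (rhoBar c z) (vBar ℓ c z) (mBar ℓ c z γ) (OmegaPlus c z)
      (OmegaMinus c z) (OmegaMix c z)) (α : ℝ) :
    inner ℝ (timeDeriv T z 0 α - B ℓ c z 0 α) (Complex.I * deriv (z 0) α) = 0 := by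
  have ht : (0 : ℝ) ∈ Icc 0 T := left_mem_Icc.2 hT.le
  by_contra hκ
  set κ := inner ℝ (timeDeriv T z 0 α - B ℓ c z 0 α) (Complex.I * deriv (z 0) α) with hκd
  obtain ⟨C, hC, hch⟩ := h.chord
  obtain ⟨M, -, hM⟩ := exists_bump
  -- At the initial time both curves coincide and the mixing zone is empty, so only the sum of the
  -- two normal velocities is determined. In it the terms `± c τ^⊥` cancel, and the factor `κ` makes
  -- the value at `α` equal to `2 κ² > 0`.
  set g : ℝ → ℝ := fun α => κ * (inner ℝ (zVel T c z 1 0 α - Ba ℓ c z 1 0 α)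
      (Complex.I * deriv (zLam c z 1 0) α) + inner ℝ (zVel T c z (-1) 0 α - Ba ℓ c z (-1) 0 α)
      (Complex.I * deriv (zLam c z (-1) 0) α)) with hg
  have hgc : Continuous g := continuous_const.mul
    ((h.continuous_vel_sub hℓ hδ hT one_mem_Icc ht).add
      (h.continuous_vel_sub hℓ hδ hT neg_one_mem_Icc ht))
  have hgp : Function.Periodic g ℓ := fun β => by
    have e1 := h.periodic_vel_sub hℓ 1 ht β
    have e2 := h.periodic_vel_sub hℓ (-1) ht β
    simp only at e1 e2
    simp only [hg, e1, e2]
  have hpos : 0 < g α := by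
    have e : g α = κ * (2 * κ) := by
      have h0 : (0 : ℝ) * c α = 0 := zero_mul _
      rw [hg, hκd]
      simp only [zLam_zero, h.Ba_eq_of_mul_eq_zero ht h0, zVel, inner_sub_left,
        real_inner_smul_left]
      ring
    rw [e]
    have := mul_self_pos.2 hκ
    linarith
  have hl := h.isLoop_zLam 0 ht
  rw [zLam_zero] at hl
  obtain ⟨k, hk, hev⟩ := exists_le_integral_bump hl hℓ hC (fun β hβ => by
    have := (hch 0 ht 0 (by norm_num) 0 (by norm_num) α β hβ).1
    rwa [zLam_zero] at this) hgp (Eventually.of_forall fun β => hgc.continuousAt) hpos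
  obtain ⟨r, hr, hr0⟩ := (hev.and self_mem_nhdsWithin).exists
  have hr0' : 0 < r := hr0
  obtain ⟨ψ, hψ, hψc, h1, h2, h3, -⟩ := hM (z 0 α) r hr0
  have hle := hr ψ hψ.continuous h1 h2 h3
  have hE := congrArg (κ * ·) (hS.flux_vel_sub h hℓ hδ hT hγ ht hψ hψc)
  simp only [mul_add, mul_flux, omegaMix_zero, zLam_zero, Measure.restrict_empty,
    integral_zero_measure, neg_zero, mul_zero] at hE
  have hψ' := hψ.continuous.comp hl.continuous
  rw [← intervalIntegral.integral_add] at hE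
  · have e : ∫ β in (-(ℓ / 2))..(ℓ / 2), ψ (z 0 β) * g β = 0 := by
      refine Eq.trans ?_ hE
      refine intervalIntegral.integral_congr fun β _ => ?_
      simp only [hg, zLam_zero]; ring
    rw [e] at hle
    exact (mul_pos hk hr0').not_ge hle
  · have := h.continuous_vel_sub hℓ hδ hT one_mem_Icc ht
    simp only [zLam_zero] at this
    exact (hψ'.mul (continuous_const.mul this)).intervalIntegrable _ _
  · have := h.continuous_vel_sub hℓ hδ hT neg_one_mem_Icc ht
    simp only [zLam_zero] at this
    exact (hψ'.mul (continuous_const.mul this)).intervalIntegrable _ _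

/-- The boundary condition where the mixing zone is closed. -/
lemma IsSubsolution.normal_velocity_of_c_eq_zero (h : Admissible ℓ δ T c z) (hℓ : 0 < ℓ)
    (hδ : 0 < δ) (hT : 0 < T) (hγ : GammaRegular T c z γ γb)
    (hS : IsSubsolution T (rhoInit (z 0)) (rhoBar c z) (vBar ℓ c z) (mBar ℓ c z γ) (OmegaPlus c z)
      (OmegaMinus c z) (OmegaMix c z)) {t : ℝ} (ht : t ∈ Icc 0 T) {α : ℝ} (hα : c α = 0) :
    inner ℝ (timeDeriv T z t α - B ℓ c z t α) (Complex.I * deriv (z t) α) = 0 := by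
  by_contra hκ
  set κ := inner ℝ (timeDeriv T z t α - B ℓ c z t α) (Complex.I * deriv (z t) α) with hκd
  have htc : t * c α = 0 := by rw [hα, mul_zero]
  obtain ⟨C, hC, hch⟩ := h.chord
  obtain ⟨M, hM0, hM⟩ := exists_bump
  have hlow : ∀ a ∈ Icc (-1 : ℝ) 1, ∃ k, 0 < k ∧ ∀ᶠ r in 𝓝[>] 0, ∀ ψ : ℂ → ℝ, Continuous ψ →
      (∀ x, 0 ≤ ψ x) → (∀ x, ‖x - z t α‖ ≤ r → ψ x = 1) → (∀ x, 2 * r ≤ ‖x - z t α‖ → ψ x = 0) →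
      k * r ≤ κ * flux ℓ ψ (zLam c z a t) (fun α => zVel T c z a t α - Ba ℓ c z a t α) :=
    fun a ha => by
    have := exists_le_integral_bump (h.isLoop_zLam a ht) hℓ hC
      (fun β hβ => (hch t ht a ha a ha α β hβ).1)
      (g := fun α => κ * inner ℝ (zVel T c z a t α - Ba ℓ c z a t α)
        (Complex.I * deriv (zLam c z a t) α))
      (fun β => congrArg (κ * ·) (h.periodic_vel_sub hℓ a ht β))
      (Eventually.of_forall fun β =>
        (continuous_const.mul (h.continuous_vel_sub hℓ hδ hT ha ht)).continuousAt)
      (by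
        rw [h.Ba_eq_of_mul_eq_zero ht htc, h.deriv_zLam_of_mul_eq_zero ht htc,
          zVel_eq_timeDeriv_of_c_eq_zero hα]
        exact mul_self_pos.2 hκ)
    simpa only [zLam_eq_of_mul_eq_zero htc, mul_flux] using this
  obtain ⟨k, hk, hk'⟩ := hlow 1 one_mem_Icc
  obtain ⟨k2, hk2, hk2'⟩ := hlow (-1) neg_one_mem_Icc
  -- With this `ε` the mixing zone contributes at most `4 |κ| M ε r < k r`, less than the lower
  -- bound for the fluxes.
  set ε := k / (4 * |κ| * M + 1) with hε
  have hε0 : 0 < ε := by positivity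
  obtain ⟨r₀, hr₀, harea⟩ := h.exists_area_mix_le hℓ hδ hT ht hα hε0
  obtain ⟨r, ⟨hr, hr2⟩, hr0, hrr⟩ := ((hk'.and hk2').and
    (Ioo_mem_nhdsGT (half_pos hr₀))).exists
  obtain ⟨ψ, hψ, hψc, h1, h2, h3, h4⟩ := hM (z t α) r hr0
  have l1 := hr ψ hψ.continuous h1 h2 h3
  have l2 := hr2 ψ hψ.continuous h1 h2 h3
  have hE := hS.flux_vel_sub h hℓ hδ hT hγ ht hψ hψc
  have hb := hS.norm_le h hℓ hT ht
  have hm := (h.isOpen_zones hℓ ht).2.2.measurableSet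
  -- The gradient of the cutoff is at most `M / r` and lives in the disc of radius `2 r`, where the
  -- mixing zone has area at most `ε (2 r)²`.
  have hX : |∫ x in OmegaMix c z t, inner ℝ (γ t x + Complex.I / 2) (grad ψ x)| ≤
      M / r * (ε * (2 * r) ^ 2) := by
    refine le_trans ?_ (mul_le_mul_of_nonneg_left (harea (2 * r) (by linarith) (by linarith))
      (by positivity))
    rw [← integral_const_mul, ← Real.norm_eq_abs]
    refine norm_integral_le_of_norm_le ?_ ((ae_restrict_iff' hm).2 (Eventually.of_forall
      fun x hx => ?_))
    · exact (Integrable.const_mul (integrable_indicator_const (isCompact_closedBall (z t α) (2 * r))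
        1) (M / r)).integrableOn
    · refine (norm_inner_le_norm _ _).trans ?_
      calc _ ≤ 1 * ‖grad ψ x‖ := by gcongr; exact norm_add_I_div_two_le (hb x hx)
        _ ≤ _ := by rw [one_mul]; exact h4 x
  have hsum : (k + k2) * r ≤ |κ| * (M / r * (ε * (2 * r) ^ 2)) := by
    calc (k + k2) * r ≤ κ * -∫ x in OmegaMix c z t, inner ℝ (γ t x + Complex.I / 2) (grad ψ x) := by
          rw [← hE]; linarith
      _ ≤ |κ| * |∫ x in OmegaMix c z t, inner ℝ (γ t x + Complex.I / 2) (grad ψ x)| := by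
          rw [← abs_neg (∫ x in OmegaMix c z t, _), ← abs_mul]; exact le_abs_self _
      _ ≤ _ := by gcongr
  have e : |κ| * (M / r * (ε * (2 * r) ^ 2)) = 4 * |κ| * M * ε * r := by field_simp; ring
  have e2 : ε * (4 * |κ| * M + 1) = k := by rw [hε]; field_simp
  rw [e] at hsum
  have := le_of_mul_le_mul_right hsum hr0
  linarith

/-- The boundary condition where the mixing zone is open. -/
lemma IsSubsolution.normalJump_eq_zero (h : Admissible ℓ δ T c z) (hℓ : 0 < ℓ) (hδ : 0 < δ)
    (hT : 0 < T) (hγ : GammaRegular T c z γ γb)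
    (hS : IsSubsolution T (rhoInit (z 0)) (rhoBar c z) (vBar ℓ c z) (mBar ℓ c z γ) (OmegaPlus c z)
      (OmegaMinus c z) (OmegaMix c z)) {a : ℝ} (ha : a ∈ ({1, -1} : Set ℝ)) {t : ℝ}
    (ht : t ∈ Ioc 0 T) {α : ℝ} (hα : 0 < t * c α) : normalJump ℓ T c z γb a t α = 0 := by
  have ht' := Ioc_subset_Icc_self ht
  have ha' : a ∈ Icc (-1 : ℝ) 1 := by rcases ha with rfl | rfl <;> norm_num
  have hna' : -a ∈ Icc (-1 : ℝ) 1 := ⟨by linarith [ha'.2], by linarith [ha'.1]⟩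
  have ha2 : |a - -a| = 2 := by rcases ha with rfl | rfl <;> norm_num
  by_contra hκ
  set κ := normalJump ℓ T c z γb a t α with hκd
  obtain ⟨C, hC, hch⟩ := h.chord
  obtain ⟨M, -, hM⟩ := exists_bump
  obtain ⟨k, hk, hev⟩ := exists_le_integral_bump (h.isLoop_zLam a ht') hℓ hC
    (fun β hβ => (hch t ht' a ha' a ha' α β hβ).1) (g := fun β => κ * normalJump ℓ T c z γb a t β)
    (fun β => congrArg (κ * ·) (h.periodic_normalJump hℓ hγ ha ha' ht β))
    ((h.eventually_continuousAt_normalJump hℓ hδ hT hγ ha ha' ht hα).mono fun β hβ =>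
      continuousAt_const.mul hβ) (mul_self_pos.2 hκ)
  -- The chord-arc condition keeps the opposite curve at distance at least `2 t c(α) / C` from the
  -- point, so for `r` below half of this the cutoff, of support radius `2 r`, vanishes on it.
  have hd : 0 < t * c α / C := by positivity
  obtain ⟨r, hr, hr0, hrd⟩ := (hev.and (Ioo_mem_nhdsGT hd)).exists
  obtain ⟨ψ, hψ, hψc, h1, h2, h3, -⟩ := hM (zLam c z a t α) r hr0
  have hle := hr ψ hψ.continuous h1 h2 h3
  have hoff : ∀ β, ψ (zLam c z (-a) t β) = 0 := fun β => by
    obtain ⟨j, hj⟩ := exists_int_mem_Ioc hℓ (α - β)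
    have e : α - (α - β + j * ℓ) = β + (-j : ℤ) * ℓ := by push_cast; ring
    have := (hch t ht' a ha' (-a) hna' α _ (Ioc_subset_Icc_self hj)).2
    rw [e, periodic_int_mul (h.isLoop_zLam (-a) ht').periodic, mul_assoc, abs_mul, ha2,
      abs_of_pos hα, norm_sub_rev] at this
    refine h3 _ ?_
    rw [lt_div_iff₀ hC] at hrd
    have : C * (2 * r) ≤ C * ‖zLam c z (-a) t β - zLam c z a t α‖ := by linarith
    exact le_of_mul_le_mul_left this hC
  have hI := hS.integral_normalJump h hℓ hδ hT hγ ha ha' ht hψ hψc hoff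
  have e : ∫ β in (-(ℓ / 2))..(ℓ / 2), ψ (zLam c z a t β) * (κ * normalJump ℓ T c z γb a t β) =
      κ * ∫ β in (-(ℓ / 2))..(ℓ / 2), ψ (zLam c z a t β) * normalJump ℓ T c z γb a t β := by
    rw [← intervalIntegral.integral_const_mul]
    refine intervalIntegral.integral_congr fun β _ => ?_
    ring
  rw [e, hI, mul_zero] at hle
  exact (mul_pos hk hr0).not_ge hle

theorem IsSubsolution.normal_velocity (h : Admissible ℓ δ T c z) (hℓ : 0 < ℓ) (hδ : 0 < δ)
    (hT : 0 < T) (hγ : GammaRegular T c z γ γb)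
    (hS : IsSubsolution T (rhoInit (z 0)) (rhoBar c z) (vBar ℓ c z) (mBar ℓ c z γ) (OmegaPlus c z)
      (OmegaMinus c z) (OmegaMix c z)) {t : ℝ} (ht : t ∈ Icc 0 T) {α : ℝ} (hα : t * c α = 0) :
    inner ℝ (timeDeriv T z t α - B ℓ c z t α) (Complex.I * deriv (z t) α) = 0 := by
  rcases mul_eq_zero.1 hα with rfl | h0
  · exact hS.normal_velocity_init h hℓ hδ hT hγ α
  · exact hS.normal_velocity_of_c_eq_zero h hℓ hδ hT hγ ht h0

theorem IsSubsolution.normal_velocity_mix (h : Admissible ℓ δ T c z) (hℓ : 0 < ℓ) (hδ : 0 < δ)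
    (hT : 0 < T) (hγ : GammaRegular T c z γ γb)
    (hS : IsSubsolution T (rhoInit (z 0)) (rhoBar c z) (vBar ℓ c z) (mBar ℓ c z γ) (OmegaPlus c z)
      (OmegaMinus c z) (OmegaMix c z)) {a : ℝ} (ha : a ∈ ({1, -1} : Set ℝ)) {t : ℝ}
    (ht : t ∈ Icc 0 T) {α : ℝ} (hα : 0 < t * c α) :
    inner ℝ (timeDeriv T (zLam c z a) t α - Ba ℓ c z a t α -
      (a : ℂ) * (γb a t α + Complex.I / 2)) (Complex.I * deriv (zLam c z a t) α) = 0 := by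
  have ht0 : t ∈ Ioc 0 T := ⟨pos_of_mul_pos_left hα (h.c_nonneg α), ht.2⟩
  have := hS.normalJump_eq_zero h hℓ hδ hT hγ ha ht0 hα
  rw [normalJump, indicator_of_mem (show α ∈ {α | 0 < t * c α} from hα), defect,
    ← h.timeDeriv_zLam hℓ hT a ht] at this
  rw [← neg_eq_zero, ← inner_neg_left, ← this]
  congr 1
  rw [Complex.real_smul]
  ring

end BoundaryConditions

end IPM

end

theorem mainTheorem5 (ℓ : ℝ) (hℓ : 0 < ℓ) (δ : ℝ≥0) (hδ : 0 < δ) (T : ℝ) (hT : 0 < T)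
    (c : ℝ → ℝ) (z : ℝ → ℝ → ℂ) (hcz : IPM.Admissible ℓ δ T c z)
    (γ : ℝ → ℂ → ℂ) (γb : ℝ → ℝ → ℝ → ℂ) (hγ : IPM.GammaRegular T c z γ γb) :
    IPM.IsSubsolution T (IPM.rhoInit (z 0)) (IPM.rhoBar c z) (IPM.vBar ℓ c z)
        (IPM.mBar ℓ c z γ) (IPM.OmegaPlus c z) (IPM.OmegaMinus c z) (IPM.OmegaMix c z) ↔
      ((∀ t ∈ Icc 0 T, ∀ α : ℝ, t * c α = 0 →
          inner ℝ (IPM.timeDeriv T z t α - IPM.B ℓ c z t α)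
            (Complex.I * deriv (z t) α) = 0) ∧
        (∀ a ∈ ({1, -1} : Set ℝ), ∀ t ∈ Icc 0 T, ∀ α : ℝ, 0 < t * c α →
          inner ℝ (IPM.timeDeriv T (IPM.zLam c z a) t α - IPM.Ba ℓ c z a t α
              - (a : ℂ) * (γb a t α + Complex.I / 2))
            (Complex.I * deriv (IPM.zLam c z a t) α) = 0)) ∧
      (∀ t ∈ Ioc 0 T, ∀ x ∈ IPM.OmegaMix c z t,
        IPM.divergence (γ t) x = 0 ∧ ‖γ t x‖ < 1 / 2) := by
  constructor
  · intro hS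
    refine ⟨⟨fun t ht α hα => hS.normal_velocity hcz hℓ hδ hT hγ ht hα,
      fun a ha t ht α hα => hS.normal_velocity_mix hcz hℓ hδ hT hγ ha ht hα⟩,
      fun t ht x hx => ⟨hS.divergence_eq_zero hcz hℓ hδ hT hγ ht x hx,
        hS.norm_lt hcz hℓ hT ht hx⟩⟩
  · rintro ⟨⟨h0, h1⟩, h2⟩
    exact hcz.isSubsolution hℓ hδ hT hγ h0 h1 h2
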